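/- Let $q\ge 2$ and $n\ge 0$ be integers, and let $H=S_q^n\rtimes S_n$ be the wreath product, acting on words in $[q]^n$ (letters permuted in each position, positions permuted), hence on codes $C\subseteq[q]^n$, on $[q]^n\times[q]^n$, on $\mathbb R^X$ for each of these $H$-sets $X$ by $(g\cdot f)(x)=f(g^{-1}\cdot x)$, and on $(\mathbb R^{q\times q})^{\otimes n}\cong\mathbb R^{([q]^n)^2}$ (where $(A_1\otimes\cdots\otimes A_n)(\alpha,\beta)=\prod_i (A_i)_{\alpha_i,\beta_i}$). **Representative sets.** Let a finite group $G$ act linearly on a finite-dimensional real space $V$ with isotypical components $V_1,\dots,V_k$. A representative set for this action consists of ordered lists $U_i=[u_{i,1},\dots,u_{i,m_i}]$, $i=1,\dots,k$, such that for some decompositions $V_i=V_{i,1}\oplus\cdots\oplus V_{i,m_i}$ into irreducible $G$-modules we have $0\ne u_{i,j}\in V_{i,j}$, and for all $j,j'$ some $G$-isomorphism $V_{i,j}\to V_{i,j'}$ maps $u_{i,j}$ to $u_{i,j'}$. **The matrices $B_i$.** Put $(m_1,m_2,m_3,m_4)=(2,3,1,1)$ if $q\ge4$, $(2,3,1,0)$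 if $q=3$, and $(2,2,0,0)$ if $q=2$. With $I$ the identity matrix, $J$ the all-one matrix, $\mathbf 1$ the all-one vector, $E_{a,b}=e_ae_b^{\mathsf T}$ and $N=(e_1-e_2)\mathbf 1^{\mathsf T}$, let $B_i(1),\dots,B_i(m_i)$ be the first $m_i$ members of $B_1=(I,\,J-I)$, $B_2=(E_{1,1}-E_{2,2},\,N-N^{\mathsf T},\,N+N^{\mathsf T}-2(E_{1,1}-E_{2,2}))$, $B_3=(E_{1,2}+E_{2,3}+E_{3,1}-E_{2,1}-E_{3,2}-E_{1,3})$, $B_4=(E_{1,3}-E_{3,2}+E_{2,4}-E_{4,1}+E_{3,1}-E_{2,3}+E_{4,2}-E_{1,4})$. **The vectors $v_{\boldsymbol\tau}$.** For a partition $\lambda$ let $T_{\lambda,m}$ be the set of semistandard tableaux of shape $\lambda$ with entries in $[m]$, let $Y(\lambda)$ be the Young shape, ordered by concatenating its rows, and let $R_\lambda$ and $C_\lambda$ be its row and column group. For $\tau\in T_{\lambda,m_i}$ let $$u_{\tau,B_i}=\sum_{\tau'\in\tau R_\lambda}\ \sum_{c\in C_\lambda}\operatorname{sgn}(c)\bigotimes_{y\in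 Y(\lambda)}B_i(\tau'(c(y))).$$ Let $\mathbf N$ be the set of $\mathbf n=(n_1,\dots,n_4)$ of nonnegative integers with sum $n$, let $\boldsymbol\lambda\vdash\mathbf n$ mean $\lambda_i\vdash n_i$ for all $i$, put $W_{\boldsymbol\lambda}=\prod_{i=1}^4T_{\lambda_i,m_i}$, and $v_{\boldsymbol\tau}=\bigotimes_{i=1}^4u_{\tau_i,B_i}\in(\mathbb R^{q\times q})^{\otimes n}$ for $\boldsymbol\tau\in W_{\boldsymbol\lambda}$. Let $W'_{\boldsymbol\lambda}$ be the set of $\boldsymbol\tau\in W_{\boldsymbol\lambda}$ with $|\tau_2^{-1}(2)|+|\tau_3^{-1}(1)|$ even, and for an integer $d\ge0$ let $W''_{\boldsymbol\lambda}$ be the set of $\boldsymbol\tau\in W'_{\boldsymbol\lambda}$ with $n-|\tau_1^{-1}(1)|-|\tau_2^{-1}(1)|\in\{0,d,d+1,\dots,n\}$. **Codes.** Let $\mathcal C_k$ be the set of codes $C\subseteq[q]^n$ with $|C|\le k$, and $\mathcal C_2^d$ the set of those $C\in\mathcal C_2$ whose distinct words have Hamming distance at least $d$. For $v\in\mathbb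 R^{([q]^n)^2}$ let $(Fv)_C=\sum_{(\gamma,\delta):\{\gamma,\delta\}=C}v_{(\gamma,\delta)}$ for each nonempty $C\in\mathcal C_2$, and $(Fv)_\emptyset=0$. In the following sets $\mathbf n$ ranges over $\mathbf N$ and $\boldsymbol\lambda$ over the $\boldsymbol\lambda\vdash\mathbf n$; lists without members are omitted. 1. $\{[v_{\boldsymbol\tau}\mid\boldsymbol\tau\in W_{\boldsymbol\lambda}]\}$ is representative for the action of $H$ on $(\mathbb R^{q\times q})^{\otimes n}$. 2. For each $\boldsymbol\tau\in W'_{\boldsymbol\lambda}$ the vector $v_{\boldsymbol\tau}$ is invariant under $(\alpha,\beta)\mapsto(\beta,\alpha)$, and $\{[v_{\boldsymbol\tau}\mid\boldsymbol\tau\in W'_{\boldsymbol\lambda}]\}$ is representative for the action of $H$ on $(\mathbb R^{([q]^n)^2})^{S_2}$, the space of functions with this invariance; $\{[Fv_{\boldsymbol\tau}\mid\boldsymbol\tau\in W'_{\boldsymbol\lambda}]\}$ is representative for the action of $H$ on $\mathbb R^{\mathcal C_2\setminus\{\emptyset\}}$. 3. For each $d\ge0$ and $\boldsymbol\tau\in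 W''_{\boldsymbol\lambda}$ the vector $Fv_{\boldsymbol\tau}$ is zero outside $\mathcal C_2^d$, and $\{[Fv_{\boldsymbol\tau}\mid\boldsymbol\tau\in W''_{\boldsymbol\lambda}]\}$ is representative for the action of $H$ on $\mathbb R^{\mathcal C_2^d\setminus\{\emptyset\}}$. 4. For each $d\ge0$, adding the unit vector $e_\emptyset$ as a column to the list indexed by $\boldsymbol\lambda=((n),(),(),())$ in the set of part 3 gives a set that is representative for the action of $H$ on $\mathbb R^{\mathcal C_2^d}$. Let $U_{\boldsymbol\lambda}$ denote its matrices. 5. For each $d\ge0$ the map $A\mapsto(U_{\boldsymbol\lambda}^{\mathsf T}AU_{\boldsymbol\lambda})_{\boldsymbol\lambda}$, from the $H$-invariant real $\mathcal C_2^d\times\mathcal C_2^d$ matrices to the tuples of real matrices of the corresponding orders, is bijective, and such an $A$ is positive semidefinite if and only if all $U_{\boldsymbol\lambda}^{\mathsf T}AU_{\boldsymbol\lambda}$ are. Moreover, for each $H$-invariant $x:\mathcal C_4\to\mathbb R$ with $x(C)=0$ whenever $C$ has two distinct words at distance less than $d$, the $\mathcal C_2\times\mathcal C_2$ matrix $M(x)=(x(C\cup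 C'))_{C,C'}$ is positive semidefinite if and only if all $U_{\boldsymbol\lambda}^{\mathsf T}M^d(x)U_{\boldsymbol\lambda}$ are, where $M^d(x)$ is the $\mathcal C_2^d\times\mathcal C_2^d$ submatrix of $M(x)$. (For $d=0$ there is no condition on the zeros of $x$, and $\mathcal C_2^d=\mathcal C_2$.) 6. There is a polynomial $p$, independent of $q$, $n$ and $d$, such that the number of (nonempty) lists in part 1 and in part 4, and the number of columns of each of them, are at most $p(n)$. -/

import Mathlib

open scoped Pointwise TensorProduct

noncomputable section

namespace WreathCodes

/-! ### Representative families of vectors -/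

/-- `u i j` (`i : ι`, `j : J i`) is the family of columns of a representative matrix set for `ρ`:
there are a bijective enumeration `C : ι → _` of the isotypical components of `V`, for each `i` a
decomposition of `C i` as internal direct sum of irreducible submodules `D i j`, and `u i j` is a
nonzero element of `D i j` such that for all `j, j'` some `G`-isomorphism `D i j → D i j'` brings
`u i j` to `u i j'`. -/
def IsRepresentative {G V : Type*} [Group G] [AddCommGroup V] [Module ℝ V]
    (ρ : Representation ℝ G V) {ι : Type*} {J : ι → Type*} (u : ∀ i, J i → V) : Prop :=
  ∃ (C : ι → Submodule (MonoidAlgebra ℝ G) ρ.asModule)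
    (D : ∀ i, J i → Submodule (MonoidAlgebra ℝ G) ρ.asModule),
    Function.Injective C ∧
    Set.range C = isotypicComponents (MonoidAlgebra ℝ G) ρ.asModule ∧
    (∀ i, iSupIndep (D i) ∧ ⨆ j, D i j = C i) ∧
    (∀ i j, IsSimpleModule (MonoidAlgebra ℝ G) (D i j)) ∧
    (∀ i j, u i j ≠ 0) ∧
    ∃ h : ∀ i j, ρ.asModuleEquiv.symm (u i j) ∈ D i j,
      ∀ i j j', ∃ e : D i j ≃ₗ[MonoidAlgebra ℝ G] D i j',
        e ⟨ρ.asModuleEquiv.symm (u i j), h i j⟩ = ⟨ρ.asModuleEquiv.symm (u i j'), h i j'⟩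

/-- The representation of `G` on `ℝ^X` induced by an action of `G` on `X`:
`(g • f) x = f (g⁻¹ • x)`. -/
def permRep (G X : Type*) [Group G] [MulAction G X] : Representation ℝ G (X → ℝ) where
  toFun g :=
    { toFun := fun f x => f (g⁻¹ • x)
      map_add' := fun _ _ => rfl
      map_smul' := fun _ _ => rfl }
  map_one' := by ext; simp
  map_mul' g h := by
    refine LinearMap.ext fun f => funext fun x => ?_
    simp [mul_smul]

/-- A matrix is invariant under the simultaneous action of `G` on rows and columns. -/
def IsInvariantMatrix (G : Type*) {X : Type*} [Group G] [MulAction G X]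
    (A : Matrix X X ℝ) : Prop :=
  ∀ (g : G) (x y : X), A (g • x) (g • y) = A x y

/-- The tuple of blocks `Uᵢᵀ A Uᵢ`. -/
def blocks {X ι : Type*} [Fintype X] {J : ι → Type*} (U : ∀ i, Matrix X (J i) ℝ)
    (A : Matrix X X ℝ) : ∀ i, Matrix (J i) (J i) ℝ :=
  fun i => (U i).transpose * A * U i

/-! ### Young shapes, tableaux and symmetrized tensors

In a cell `(a, b)` of a `YoungDiagram`, `a` is the row and `b` is the column. -/

/-- The permutations of the shape that preserve each row. -/
def rowGroup (μ : YoungDiagram) : Subgroup (Equiv.Perm μ.cells) where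
  carrier := {π | ∀ y, (π y).1.1 = y.1.1}
  one_mem' := fun _ => rfl
  mul_mem' := fun {a b} ha hb y => (ha (b y)).trans (hb y)
  inv_mem' := fun {a} ha y => by simpa using (ha (a⁻¹ y)).symm

/-- The permutations of the shape that preserve each column. -/
def colGroup (μ : YoungDiagram) : Subgroup (Equiv.Perm μ.cells) where
  carrier := {π | ∀ y, (π y).1.2 = y.1.2}
  one_mem' := fun _ => rfl
  mul_mem' := fun {a b} ha hb y => (ha (b y)).trans (hb y)
  inv_mem' := fun {a} ha y => by simpa using (ha (a⁻¹ y)).symm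

/-- Tableaux of shape `μ` with `m` possible entries. The entry `j` of the standard notation
`1, …, m` is the element `j - 1` of `Fin m`. -/
abbrev Tableau (μ : YoungDiagram) (m : ℕ) := μ.cells → Fin m

/-- Entries are nondecreasing in rows and increasing in columns. -/
def IsSemistandard {μ : YoungDiagram} {m : ℕ} (τ : Tableau μ m) : Prop :=
  (∀ y z : μ.cells, y.1.1 = z.1.1 → y.1.2 ≤ z.1.2 → τ y ≤ τ z) ∧
  (∀ y z : μ.cells, y.1.2 = z.1.2 → y.1.1 < z.1.1 → τ y < τ z)

/-- The set of semistandard tableaux of shape `μ` with `m` possible entries. -/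
abbrev SST (μ : YoungDiagram) (m : ℕ) := {τ : Tableau μ m // IsSemistandard τ}

/-- `τ' ∼ τ`: the tableau `τ'` arises from `τ` by permuting entries within rows. -/
def RowEquiv {μ : YoungDiagram} {m : ℕ} (τ' τ : Tableau μ m) : Prop :=
  ∃ r ∈ rowGroup μ, τ' = τ ∘ r

/-- The number of cells whose entry is the `j`-th one, counting from `0`. -/
def entryCount {μ : YoungDiagram} {m : ℕ} (τ : Tableau μ m) (j : ℕ) : ℕ :=
  (Finset.univ.filter fun y : μ.cells => (τ y : ℕ) = j).card

open Classical in
/-- `u_{τ,B} = ∑_{τ' ∼ τ} ∑_{c ∈ C_μ} sgn(c) ⨂_{y ∈ Y(μ)} B(τ'(c(y)))`. -/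
def youngTensor {V : Type*} [AddCommGroup V] [Module ℝ V] {μ : YoungDiagram} {m : ℕ}
    (B : Fin m → V) (τ : Tableau μ m) : ⨂[ℝ] _ : μ.cells, V :=
  ∑ τ' : {τ' : Tableau μ m // RowEquiv τ' τ}, ∑ c : colGroup μ,
    ((Equiv.Perm.sign c.1 : ℤ) : ℝ) • PiTensorProduct.tprod ℝ fun y => B (τ'.1 (c.1 y))

/-- The order of the cells of a Young shape by concatenating its rows. -/
def rowOrder (μ : YoungDiagram) : μ.cells ≃ Fin μ.card :=
  (toLex.subtypeEquiv fun c => by simp :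
      μ.cells ≃ (μ.cells.map toLex.toEmbedding : Finset (ℕ ×ₗ ℕ))).trans
    ((μ.cells.map toLex.toEmbedding : Finset (ℕ ×ₗ ℕ)).orderIsoOfFin
      (Finset.card_map _)).symm.toEquiv

/-! ### The wreath product and its actions -/

/-- Words of length `n` over an alphabet with `q` letters. -/
abbrev Word (q n : ℕ) := Fin n → Fin q

/-- The wreath product `S_q^n ⋊ S_n`; a permutation `π` acts on `S_q^n` by
`(π • g) i = g (π⁻¹ i)`. -/
abbrev Wreath (q n : ℕ) :=
  (Fin n → Equiv.Perm (Fin q)) ⋊[mulAutArrow (G := Equiv.Perm (Fin n))] Equiv.Perm (Fin n)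

instance instMulActionWord (q n : ℕ) : MulAction (Wreath q n) (Word q n) where
  smul g w := fun i => g.left i (w (g.right⁻¹ i))
  one_smul w := by
    funext i
    change (1 : Wreath q n).left i (w ((1 : Wreath q n).right⁻¹ i)) = w i
    simp
  mul_smul g h w := by
    funext i
    change (g * h).left i (w ((g * h).right⁻¹ i)) =
      g.left i (h.left (g.right⁻¹ i) (w (h.right⁻¹ (g.right⁻¹ i))))
    simp only [SemidirectProduct.mul_left, SemidirectProduct.mul_right, mul_inv_rev]
    rfl

theorem smul_word_apply {q n : ℕ} (g : Wreath q n) (w : Word q n) (i : Fin n) :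
    (g • w) i = g.left i (w (g.right⁻¹ i)) := rfl

/-- The action of `S_q` on `ℝ^{q × q}` by simultaneous row and column permutations. -/
def matrixRep (q : ℕ) :
    Representation ℝ (Equiv.Perm (Fin q)) (Matrix (Fin q) (Fin q) ℝ) where
  toFun s :=
    { toFun := fun A => A.submatrix ⇑s⁻¹ ⇑s⁻¹
      map_add' := fun _ _ => rfl
      map_smul' := fun _ _ => rfl }
  map_one' := by ext; simp
  map_mul' g h := by
    refine LinearMap.ext fun f => ?_
    ext i j
    simp

/-- `(ℝ^{q × q})^{⊗ n}`. -/
abbrev TensorSpace (q n : ℕ) := ⨂[ℝ] _ : Fin n, Matrix (Fin q) (Fin q) ℝ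

/-- The action of the wreath product on `(ℝ^{q × q})^{⊗ n}`: the group `S_q^n` acts factorwise, and
`S_n` permutes the factors. -/
def tensorRep (q n : ℕ) : Representation ℝ (Wreath q n) (TensorSpace q n) where
  toFun g :=
    (PiTensorProduct.map fun i => matrixRep q (g.left i)) ∘ₗ
      (PiTensorProduct.reindex ℝ (fun _ => Matrix (Fin q) (Fin q) ℝ) g.right).toLinearMap
  map_one' := by
    refine PiTensorProduct.ext (MultilinearMap.ext fun A => ?_)
    simp
    rfl
  map_mul' g h := by
    refine PiTensorProduct.ext (MultilinearMap.ext fun A => ?_)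
    simp
    rfl

/-- The identification `(ℝ^{q × q})^{⊗ n} ≅ ℝ^{([q]^n)²}`: the tensor `A₁ ⊗ ⋯ ⊗ A_n` is the
function `(α, β) ↦ ∏ i, (A i) (α i) (β i)`. -/
def toPairs (q n : ℕ) : TensorSpace q n →ₗ[ℝ] (Word q n × Word q n → ℝ) :=
  PiTensorProduct.lift (MultilinearMap.pi fun p =>
    (MultilinearMap.mkPiAlgebra ℝ (Fin n) ℝ).compLinearMap fun i =>
      Matrix.entryLinearMap ℝ ℝ (p.1 i) (p.2 i))

/-- The invariants of transposition in `ℝ^{([q]^n)²}`, as a representation of the wreath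
product. -/
def symmetricPairs (q n : ℕ) :
    Subrepresentation (permRep (Wreath q n) (Word q n × Word q n)) where
  toSubmodule :=
    { carrier := {f | ∀ a b, f (b, a) = f (a, b)}
      add_mem' := fun hf hg a b => congrArg₂ (· + ·) (hf a b) (hg a b)
      zero_mem' := fun _ _ => rfl
      smul_mem' := fun c _ hf a b => congrArg (c * ·) (hf a b) }
  apply_mem_toSubmodule g _ hf a b := hf (g⁻¹ • a) (g⁻¹ • b)

/-! ### Codes -/

/-- The minimum distance of `C` is at least `d`; this holds if `C` has at most one element. -/
def MinDistGE {q n : ℕ} (d : ℕ) (C : Finset (Word q n)) : Prop :=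
  ∀ v ∈ C, ∀ w ∈ C, v ≠ w → d ≤ hammingDist v w

theorem hammingDist_smul {q n : ℕ} (g : Wreath q n) (v w : Word q n) :
    hammingDist (g • v) (g • w) = hammingDist v w := by
  unfold hammingDist
  refine Finset.card_equiv g.right⁻¹ fun i => ?_
  simp [smul_word_apply]

theorem MinDistGE.smul {q n d : ℕ} {C : Finset (Word q n)} (h : MinDistGE d C)
    (g : Wreath q n) : MinDistGE d (g • C) := by
  intro v hv w hw hvw
  obtain ⟨v', hv', rfl⟩ := Finset.mem_smul_finset.1 hv
  obtain ⟨w', hw', rfl⟩ := Finset.mem_smul_finset.1 hw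
  rw [hammingDist_smul]
  exact h v' hv' w' hw' fun e => hvw (by rw [e])

/-- `𝒞_k`: the codes with at most `k` elements. -/
def codes (q n k : ℕ) : SubMulAction (Wreath q n) (Finset (Word q n)) where
  carrier := {C | C.card ≤ k}
  smul_mem' g C hC := by simpa using hC

/-- `𝒞₂ ∖ {∅}`. -/
def pairs (q n : ℕ) : SubMulAction (Wreath q n) (Finset (Word q n)) where
  carrier := {C | C.card ≤ 2 ∧ C ≠ ∅}
  smul_mem' g C hC := by simpa using hC

/-- `𝒞₂^d`: the codes with at most two elements and minimum distance at least `d`. -/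
def codesD (q n d : ℕ) : SubMulAction (Wreath q n) (Finset (Word q n)) where
  carrier := {C | C.card ≤ 2 ∧ MinDistGE d C}
  smul_mem' g C hC := ⟨by simpa using hC.1, hC.2.smul g⟩

/-- `𝒞₂^d ∖ {∅}`. -/
def pairsD (q n d : ℕ) : SubMulAction (Wreath q n) (Finset (Word q n)) where
  carrier := {C | C.card ≤ 2 ∧ MinDistGE d C ∧ C ≠ ∅}
  smul_mem' g C hC := ⟨by simpa using hC.1, hC.2.1.smul g, by simpa using hC.2.2⟩

instance instFintypeSub (q n : ℕ) (S : SubMulAction (Wreath q n) (Finset (Word q n))) :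
    Fintype S :=
  Fintype.ofFinite S

/-- The rows, indexed by a collection `S` of codes, of the `0,1` matrix `F` with
`F_{C,(γ,δ)} = 1` if and only if `C = {γ, δ}`. -/
def pairMatrix {q n : ℕ} (S : SubMulAction (Wreath q n) (Finset (Word q n))) :
    Matrix S (Word q n × Word q n) ℝ :=
  Matrix.of fun C p => if C.1 = {p.1, p.2} then 1 else 0

/-- The matrix `M(x)` with rows and columns indexed by `𝒞₂` and entries `x(C ∪ C')`. -/
def momentMatrix {q n : ℕ} (x : codes q n 4 → ℝ) : Matrix (codes q n 2) (codes q n 2) ℝ :=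
  Matrix.of fun C C' =>
    x ⟨C.1 ∪ C'.1, (Finset.card_union_le _ _).trans (Nat.add_le_add C.2 C'.2)⟩

/-- The `𝒞₂^d × 𝒞₂^d` submatrix of `M(x)`. -/
def momentMatrixD {q n : ℕ} (d : ℕ) (x : codes q n 4 → ℝ) :
    Matrix (codesD q n d) (codesD q n d) ℝ :=
  (momentMatrix x).submatrix (fun C => ⟨C.1, C.2.1⟩) (fun C => ⟨C.1, C.2.1⟩)

/-! ### The matrices `B₁, …, B₄` -/

/-- The unit vector `e_a` of `ℝ^q`, with coordinates counted from `1`. -/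
def unitVec (q a : ℕ) : Fin q → ℝ := fun i => if (i : ℕ) + 1 = a then 1 else 0

/-- The matrix `E_{a,b} = e_a e_bᵀ`. -/
def unitMat (q a b : ℕ) : Matrix (Fin q) (Fin q) ℝ :=
  Matrix.vecMulVec (unitVec q a) (unitVec q b)

/-- `J`, the all-one matrix. -/
def allOne (q : ℕ) : Matrix (Fin q) (Fin q) ℝ := Matrix.of fun _ _ => 1

/-- `N = (e₁ - e₂) 1ᵀ`. -/
def diffMat (q : ℕ) : Matrix (Fin q) (Fin q) ℝ :=
  Matrix.vecMulVec (unitVec q 1 - unitVec q 2) 1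

/-- The number `m_i` of columns of `B_i`: `(2,3,1,1)` if `q ≥ 4`, `(2,3,1,0)` if `q = 3` and
`(2,2,0,0)` if `q = 2`. Deleting `B_i` amounts to `m_i = 0`: then the only shape of the `i`-th
tableau that admits a semistandard filling is the empty one. -/
def numCols (q : ℕ) : Fin 4 → ℕ :=
  ![2, if q ≤ 2 then 2 else 3, if q ≤ 2 then 0 else 1, if q ≤ 3 then 0 else 1]

/-- The columns of `B₁, …, B₄`, both indices counted from `0`. -/
def basisMat (q : ℕ) : Fin 4 → ℕ → Matrix (Fin q) (Fin q) ℝ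
  | 0, 0 => 1
  | 0, 1 => allOne q - 1
  | 1, 0 => unitMat q 1 1 - unitMat q 2 2
  | 1, 1 => diffMat q - (diffMat q).transpose
  | 1, 2 => diffMat q + (diffMat q).transpose - (2 : ℝ) • (unitMat q 1 1 - unitMat q 2 2)
  | 2, 0 => unitMat q 1 2 + unitMat q 2 3 + unitMat q 3 1
      - unitMat q 2 1 - unitMat q 3 2 - unitMat q 1 3
  | 3, 0 => unitMat q 1 3 - unitMat q 3 2 + unitMat q 2 4 - unitMat q 4 1
      + unitMat q 3 1 - unitMat q 2 3 + unitMat q 4 2 - unitMat q 1 4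
  | _, _ => 0

/-- `B_i` as an ordered list of `m_i` columns. -/
def colFamily (q : ℕ) (i : Fin 4) (j : Fin (numCols q i)) : Matrix (Fin q) (Fin q) ℝ :=
  basisMat q i j

/-! ### The vectors `v_τ` -/

/-- A tuple `𝛌 = (λ₁, …, λ₄)` of Young shapes with `n` cells in total. Such a tuple is the same as
a pair of `𝐧 = (n₁, …, n₄)` with sum `n` and `𝛌 ⊢ 𝐧`, where `n_i` is the size of `λ_i`. -/
structure MultiShape (n : ℕ) where
  shape : Fin 4 → YoungDiagram
  sum_card : ∑ i, (shape i).card = n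

/-- The Young shape `(n)` with a single row of `n` cells. -/
def rowShape (n : ℕ) : YoungDiagram where
  cells := {0} ×ˢ Finset.range n
  isLowerSet := by
    rintro ⟨a, b⟩ ⟨c, d⟩ h hab
    obtain ⟨h1, h2⟩ := Prod.mk_le_mk.1 h
    simp only [Finset.coe_product, Finset.coe_singleton, Set.mem_prod, Set.mem_singleton_iff,
      Finset.coe_range, Set.mem_Iio] at hab ⊢
    omega

/-- `((n), (), (), ())`. -/
def trivialShape (n : ℕ) : MultiShape n where
  shape := ![rowShape n, ⊥, ⊥, ⊥]
  sum_card := by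
    simp [Fin.sum_univ_four, rowShape, YoungDiagram.card]

/-- All cells of `λ₁, …, λ₄`, as a disjoint union. -/
abbrev MultiShape.Cells {n : ℕ} (lam : MultiShape n) :=
  (lam.shape 0).cells ⊕ (lam.shape 1).cells ⊕ (lam.shape 2).cells ⊕ (lam.shape 3).cells

/-- The order of the cells: first those of `λ₁`, then those of `λ₂`, and so on, where each shape is
ordered by concatenating its rows. -/
def MultiShape.cellOrder {n : ℕ} (lam : MultiShape n) : lam.Cells ≃ Fin n :=
  ((rowOrder (lam.shape 0)).sumCongr <|
    ((rowOrder (lam.shape 1)).sumCongr <|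
      ((rowOrder (lam.shape 2)).sumCongr (rowOrder (lam.shape 3))).trans finSumFinEquiv).trans
    finSumFinEquiv).trans <| finSumFinEquiv.trans <| finCongr (by
      have h := lam.sum_card
      rw [Fin.sum_univ_four] at h
      omega)

/-- `W_𝛌 = T_{λ₁,m₁} × ⋯ × T_{λ₄,m₄}`. -/
abbrev W (q : ℕ) {n : ℕ} (lam : MultiShape n) := ∀ i : Fin 4, SST (lam.shape i) (numCols q i)

/-- The number of entries `2` in `τ₂` plus the number of entries `1` in `τ₃`. -/
def skewCount {q n : ℕ} {lam : MultiShape n} (τ : W q lam) : ℕ :=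
  entryCount (τ 1).1 1 + entryCount (τ 2).1 0

/-- `n` minus the number of entries `1` in `τ₁` and minus the number of entries `1` in `τ₂`. -/
def distCount {q n : ℕ} {lam : MultiShape n} (τ : W q lam) : ℕ :=
  n - entryCount (τ 0).1 0 - entryCount (τ 1).1 0

/-- `W'_𝛌`. -/
abbrev W' (q : ℕ) {n : ℕ} (lam : MultiShape n) := {τ : W q lam // Even (skewCount τ)}

/-- `W''_𝛌`. -/
abbrev W'' (q d : ℕ) {n : ℕ} (lam : MultiShape n) :=
  {τ : W' q lam // distCount τ.1 = 0 ∨ d ≤ distCount τ.1 ∧ distCount τ.1 ≤ n}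

/-- `v_𝛕 = u_{τ₁,B₁} ⊗ ⋯ ⊗ u_{τ₄,B₄}`. -/
def tableauVec {q n : ℕ} {lam : MultiShape n} (τ : W q lam) : TensorSpace q n :=
  PiTensorProduct.reindex ℝ (fun _ => Matrix (Fin q) (Fin q) ℝ) lam.cellOrder <|
    PiTensorProduct.tmulEquiv ℝ _ <| youngTensor (colFamily q 0) (τ 0).1 ⊗ₜ[ℝ] (
      PiTensorProduct.tmulEquiv ℝ _ <| youngTensor (colFamily q 1) (τ 1).1 ⊗ₜ[ℝ] (
        PiTensorProduct.tmulEquiv ℝ _ <| youngTensor (colFamily q 2) (τ 2).1 ⊗ₜ[ℝ]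
          youngTensor (colFamily q 3) (τ 3).1))

/-- `v_𝛕` as an element of `ℝ^{([q]^n)²}`. -/
def pairVec {q n : ℕ} {lam : MultiShape n} (τ : W q lam) : Word q n × Word q n → ℝ :=
  toPairs q n (tableauVec τ)

/-- The indices of the columns of the `𝛌`-th block for `ℝ^{𝒞₂^d}`: the set `W''_𝛌`, together with
one more index if `𝛌 = ((n), (), (), ())`. -/
abbrev FullCols (q d : ℕ) {n : ℕ} (lam : MultiShape n) :=
  W'' q d lam ⊕ {_u : Unit // lam = trivialShape n}

open Classical in
/-- The columns of the `𝛌`-th block for `ℝ^{𝒞₂^d}`: the vectors `F v_𝛕`, and the unit vector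
`e_∅` at the additional index. -/
def fullVec {q d n : ℕ} {lam : MultiShape n} :
    FullCols q d lam → codesD q n d → ℝ
  | .inl τ => (pairMatrix (codesD q n d)).mulVec (pairVec τ.1.1)
  | .inr _ => fun C => if C.1 = ∅ then 1 else 0

/-- The `𝛌`-th matrix of the representative set for `ℝ^{𝒞₂^d}`. -/
def fullMatrix (q d : ℕ) {n : ℕ} (lam : MultiShape n) :
    Matrix (codesD q n d) (FullCols q d lam) ℝ :=
  Matrix.of fun C c => fullVec c C

end WreathCodes

end

open WreathCodes

set_option linter.unusedSectionVars false
set_option linter.unusedSimpArgs false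

noncomputable section

/-! Everything rests on elements `e i` of the real group algebra that behave like primitive
idempotents, up to normalization, in pairwise inequivalent matrix blocks. On the module, `e i * x *
e i` is a real multiple of `e i` for every `x`, `e i * x * e j` vanishes for `i ≠ j`, and every
nonzero vector is moved by some `x` to a vector that some `e i` does not kill (`IsControlled`,
`Controls`). These three properties replace the theory of characters and of semisimple algebras. A
nonzero vector `e i • v` generates a simple module, because any nonzero element of that module can
be compressed back to a multiple of `e i • v`. Two nonzero vectors in the range of the same `e i`
have the same annihilator, which gives the isomorphism that carries one to the other. Different `i`
give different isotypical components. Hence any real basis of the range of `e i` is a list of a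
representative set (`Controls.isRepresentative`), and all claims about representative sets become
claims about bases of ranges.

The elements for the wreath product are assembled from two levels. On letters, `S_q` acts on `ℝ^{q ×
q}`, and four elements have the spans of the columns of `B₁, …, B₄` as ranges: the group sum, a
compressed sum over the stabilizer of a letter, and the signed stabilizers of the cyclic and of the
quadrangle matrix (`controls_letterElt`). On positions, the symmetric group contributes `b a b`,
where `a` is the row sum and `b` the signed column sum of a Young shape; unlike `b a` this is fixed
by inversion. Its compressions are scalar, and conjugation averages of such elements form a basis of
the class functions, so that the unit is a combination of them (`exists_one_eq_sum_youngElt`). For a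
tuple of shapes, the tensor product over the four types of (Young element) times (tensor power of
the letter matrix) inherits the three properties: a permutation that mixes types creates a factor `f
i * s * f j = 0`, and otherwise the product is computed type by type (`controls_shapeElt`).

The range of this operator is spanned by Young symmetrizations of tensors of columns. Garnir
relations reduce the spanning set to semistandard tableaux (`symAlt_mem_span`), and a triangularity
argument shows independence (`linearIndependent_symAlt_single`). So the vectors of the tableaux are
a basis, which is part 1.

Each column of each `B_i` is symmetric or skew, and is supported on the diagonal or off it.
Therefore `v_τ` has a definite parity under transposition and lives on pairs at one Hamming distance
(`pairVec_swap`, `hammingDist_of_pairVec_ne_zero`). The equivariant maps to symmetric functions and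
to functions on codes kill exactly the excluded tableaux and are injective on the span of the
others, which gives parts 2 and 3. The unit vector of the empty code is invariant; on invariants an
element acts by its coefficient sum, which is nonzero only for the one-row tuple of shapes, and part
4 follows.

For part 5 the elements are fixed by inversion, hence act symmetrically: blocks are orthogonal, an
invariant matrix with zero blocks is zero, and averaging over the group produces an invariant matrix
with prescribed blocks, positive semidefinite if they are (`BlockData`). Part 6 holds because at
most three rows and three entry values occur, so that boundedly many numbers up to `n` determine a
shape or a tableau. -/

namespace WreathCodes

/-! ### A criterion for representative families -/

section Controlled

variable {R M ι : Type*} [Ring R] [Algebra ℝ R] [AddCommGroup M] [Module R M] [Module ℝ M]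
  [IsScalarTower ℝ R M]

/-- The elements `e i` of `R` act on `M` like pairwise non-isomorphic quasi-idempotents with
one-dimensional corner algebras, and every nonzero submodule is detected by one of them. -/
structure IsControlled (M : Type*) [AddCommGroup M] [Module R M] [Module ℝ M] (e : ι → R) :
    Prop where
  scal : ∀ i (x : R), ∃ c : ℝ, ∀ m : M, e i • x • e i • m = c • e i • m
  orth : ∀ i j, i ≠ j → ∀ (x : R) (m : M), e i • x • e j • m = 0
  complete : ∀ m : M, m ≠ 0 → ∃ i, ∃ x : R, e i • x • m ≠ 0

namespace IsControlled

variable {e : ι → R} (h : IsControlled M e)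
include h

/-- Completeness provides some index that detects `n`. Since `n` is a multiple of `e i • v`,
orthogonality rules out every index other than `i`. -/
theorem exists_smul_ne_zero {i : ι} {v n : M} (hn : n ∈ Submodule.span R {e i • v})
    (hn0 : n ≠ 0) : ∃ x : R, e i • x • n ≠ 0 := by
  obtain ⟨i', x, hx⟩ := h.complete n hn0
  by_cases hi : i' = i
  · subst hi; exact ⟨x, hx⟩
  · obtain ⟨z, rfl⟩ := Submodule.mem_span_singleton.1 hn
    rw [← mul_smul x z, h.orth _ _ hi] at hx
    exact absurd rfl hx

/-- Write `n = z • e i • v`. Then `e i • x • n` is the compression of `x * z`, a scalar times `e i •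
v`, and the scalar is nonzero if `x` detects `n`. Dividing by it recovers the generator; this is the
source of simplicity. -/
theorem mem_span_singleton_of_ne_zero {i : ι} {v n : M} (hn : n ∈ Submodule.span R {e i • v})
    (hn0 : n ≠ 0) : e i • v ∈ Submodule.span R {n} := by
  obtain ⟨x, hx⟩ := h.exists_smul_ne_zero hn hn0
  obtain ⟨z, rfl⟩ := Submodule.mem_span_singleton.1 hn
  obtain ⟨c, hc⟩ := h.scal i (x * z)
  have h1 : e i • x • z • e i • v = c • e i • v := by rw [← mul_smul x z, hc]
  have hc0 : c ≠ 0 := by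
    rintro rfl
    exact hx (by rw [h1, zero_smul])
  have h2 : e i • v = (algebraMap ℝ R c⁻¹ * e i * x) • z • e i • v := by
    rw [mul_smul, mul_smul, h1, algebraMap_smul, smul_smul, inv_mul_cancel₀ hc0, one_smul]
  exact Submodule.mem_span_singleton.2 ⟨_, h2.symm⟩

theorem isSimpleModule_span {i : ι} {v : M} (hv : e i • v ≠ 0) :
    IsSimpleModule R (Submodule.span R {e i • v}) := by
  rw [isSimpleModule_iff_isAtom]
  refine ⟨fun hb => hv (Submodule.span_singleton_eq_bot.1 hb), fun N hN => ?_⟩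
  by_contra hN0
  obtain ⟨n, hnN, hn0⟩ := N.ne_bot_iff.1 hN0
  have := h.mem_span_singleton_of_ne_zero (hN.le hnN) hn0
  refine hN.not_ge ((Submodule.span_singleton_le_iff_mem _ _).2 ?_)
  exact (Submodule.span_singleton_le_iff_mem _ _).2 hnN this

/-- The scalar by which `z * x` is compressed does not depend on the vector. If `x` kills `e i • v`,
this scalar is zero for every `z`, so no `z` can detect `x • e i • w`. -/
theorem smul_eq_zero_of_smul_eq_zero {i : ι} {v w : M} (hv : e i • v ≠ 0) {x : R}
    (hx : x • e i • v = 0) : x • e i • w = 0 := by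
  by_contra hxw
  obtain ⟨z, hz⟩ := h.exists_smul_ne_zero (i := i) (v := w)
    (Submodule.smul_mem _ _ (Submodule.mem_span_singleton_self _)) hxw
  obtain ⟨c, hc⟩ := h.scal i (z * x)
  have h1 := hc v
  rw [mul_smul, hx, smul_zero, smul_zero] at h1
  have hc0 : c = 0 := by
    by_contra hc0
    exact (smul_ne_zero hc0 hv) h1.symm
  have h2 := hc w
  rw [mul_smul, hc0, zero_smul] at h2
  exact hz h2

/-- The annihilators of the two generators coincide, so both modules are the quotient of `R` by the
same left ideal, with the class of `1` as generator. -/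
theorem exists_equiv {i : ι} {v w : M} (hv : e i • v ≠ 0) (hw : e i • w ≠ 0) :
    ∃ f : Submodule.span R {e i • v} ≃ₗ[R] Submodule.span R {e i • w},
      f ⟨e i • v, Submodule.mem_span_singleton_self _⟩ =
        ⟨e i • w, Submodule.mem_span_singleton_self _⟩ := by
  have hker : LinearMap.ker (LinearMap.toSpanSingleton R M (e i • v)) =
      LinearMap.ker (LinearMap.toSpanSingleton R M (e i • w)) := by
    ext x
    simp only [LinearMap.mem_ker, LinearMap.toSpanSingleton_apply]
    exact ⟨h.smul_eq_zero_of_smul_eq_zero hv, h.smul_eq_zero_of_smul_eq_zero hw⟩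
  let f := (LinearMap.quotKerEquivRange (LinearMap.toSpanSingleton R M (e i • v))).symm.trans
    ((Submodule.quotEquivOfEq _ _ hker).trans
      (LinearMap.quotKerEquivRange (LinearMap.toSpanSingleton R M (e i • w))))
  have hf : ∀ hm, f ⟨e i • v, hm⟩ = ⟨e i • w, by
      exact ⟨1, by simp [LinearMap.toSpanSingleton_apply]⟩⟩ := by
    intro hm
    have h1 : (⟨e i • v, hm⟩ : LinearMap.range (LinearMap.toSpanSingleton R M (e i • v))) =
        LinearMap.quotKerEquivRange (LinearMap.toSpanSingleton R M (e i • v))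
          (Submodule.Quotient.mk 1) := by
      ext
      simp [LinearMap.quotKerEquivRange_apply_mk, LinearMap.toSpanSingleton_apply]
    rw [h1]
    ext
    simp [f, LinearMap.toSpanSingleton_apply]
  refine ⟨(LinearEquiv.ofEq _ _ (LinearMap.span_singleton_eq_range R M _)).trans
    (f.trans (LinearEquiv.ofEq _ _ (LinearMap.span_singleton_eq_range R M _).symm)), ?_⟩
  ext
  have := hf (by exact ⟨1, by simp [LinearMap.toSpanSingleton_apply]⟩)
  simp only [LinearEquiv.trans_apply, LinearEquiv.coe_ofEq_apply]
  exact congrArg Subtype.val this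

variable {J : ι → Type*} {u : ∀ i, J i → M}

/-- Compression by `e i` acts as a scalar on each `u i j`. It therefore takes the `R`-module
generated by a subfamily into its real span, which turns independence of modules into linear
independence over `ℝ`. -/
theorem smul_mem_span (hu : ∀ i, (Submodule.span ℝ (Set.range (u i)) : Set M) =
    Set.range fun m => e i • m) {i : ι} {s : Set (J i)} {n : M}
    (hn : n ∈ Submodule.span R (u i '' s)) (z : R) :
    e i • z • n ∈ Submodule.span ℝ (u i '' s) := by
  induction hn using Submodule.span_induction generalizing z with
  | mem x hx =>
    have hx' : x ∈ (Submodule.span ℝ (Set.range (u i)) : Set M) :=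
      Submodule.subset_span (Set.image_subset_range _ _ hx)
    rw [hu i] at hx'
    obtain ⟨m, hm⟩ := hx'
    obtain ⟨c, hc⟩ := h.scal i z
    have h1 : e i • z • x = c • x := by rw [← hm]; exact hc m
    rw [h1]
    exact Submodule.smul_mem _ _ (Submodule.subset_span hx)
  | zero => simp
  | add x y _ _ hx hy =>
    rw [smul_add, smul_add]
    exact Submodule.add_mem _ (hx z) (hy z)
  | smul a x _ hx =>
    rw [← mul_smul z a]
    exact hx _

/-- A nonzero common element of one cyclic module and the sum of the others would generate `u i j`
inside that sum. After compression, `u i j` would be a real combination of the other vectors. -/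
theorem iSupIndep_span (hu : ∀ i, (Submodule.span ℝ (Set.range (u i)) : Set M) =
    Set.range fun m => e i • m) (hli : ∀ i, LinearIndependent ℝ (u i)) (i : ι) :
    iSupIndep fun j => Submodule.span R {u i j} := by
  intro j
  rw [Submodule.disjoint_def]
  intro n hn1 hn2
  by_contra hn0
  have hn3 : n ∈ Submodule.span R (u i '' {k | k ≠ j}) := by
    rw [Submodule.span_eq_iSup_of_singleton_spans, iSup_image]
    exact hn2
  have hmem : u i j ∈ Set.range fun m => e i • m := by
    rw [← hu i]
    exact Submodule.subset_span ⟨j, rfl⟩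
  obtain ⟨v, hv⟩ := hmem
  change n ∈ Submodule.span R {u i j} at hn1
  rw [← hv] at hn1
  obtain ⟨a, ha⟩ := Submodule.mem_span_singleton.1 (h.mem_span_singleton_of_ne_zero hn1 hn0)
  have h3 : u i j ∈ Submodule.span R (u i '' {k | k ≠ j}) := by
    rw [← hv]
    simp only at ha ⊢
    rw [← ha]
    exact Submodule.smul_mem _ _ hn3
  obtain ⟨x, hx⟩ := h.exists_smul_ne_zero (i := i) (v := v)
    (Submodule.mem_span_singleton_self _) (by
      simp only at hv
      rw [hv]; exact (hli i).ne_zero j)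
  obtain ⟨c, hc⟩ := h.scal i x
  have hc0 : c ≠ 0 := by
    rintro rfl
    exact hx (by rw [hc, zero_smul])
  have h4 := h.smul_mem_span hu h3 x
  rw [← hv] at h4
  simp only [hc] at h4
  have h5 := Submodule.smul_mem _ c⁻¹ h4
  simp only at hv
  rw [smul_smul, inv_mul_cancel₀ hc0, one_smul, hv] at h5
  exact (hli i).notMem_span_image (s := {k | k ≠ j}) (by simp) h5

/-- A copy `N` of the simple module contains a nonzero vector of the form `e i • m`, which generates
`N` and lies in the real span of the `u i j`. The other inclusion is `exists_equiv`. -/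
theorem isotypicComponent_eq_iSup (hu : ∀ i, (Submodule.span ℝ (Set.range (u i)) : Set M) =
    Set.range fun m => e i • m) {i : ι} {v : M} (hv : e i • v ≠ 0) :
    isotypicComponent R M (Submodule.span R {e i • v}) = ⨆ j, Submodule.span R {u i j} := by
  have key : ∀ N : Submodule R M, ∀ m ∈ N, e i • m ∈ ⨆ j, Submodule.span R {u i j} := by
    intro N m _
    have h1 : e i • m ∈ (Submodule.span ℝ (Set.range (u i)) : Set M) := by
      rw [hu i]; exact ⟨m, rfl⟩
    have h2 : Submodule.span ℝ (Set.range (u i)) ≤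
        (⨆ j, Submodule.span R {u i j}).restrictScalars ℝ := by
      rw [Submodule.span_le]
      rintro _ ⟨j, rfl⟩
      exact (le_iSup (fun j => Submodule.span R {u i j}) j)
        (Submodule.mem_span_singleton_self _)
    exact h2 h1
  apply le_antisymm
  · refine sSup_le ?_
    rintro N ⟨f⟩
    obtain ⟨x, hx⟩ := h.exists_smul_ne_zero (i := i) (v := v)
      (Submodule.mem_span_singleton_self _) hv
    obtain ⟨g, hg⟩ : ∃ n : N, f n = ⟨e i • v, Submodule.mem_span_singleton_self _⟩ :=
      f.surjective _
    have hne : e i • x • g ≠ 0 := by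
      intro h0
      have := congrArg f h0
      rw [map_smul, map_smul, hg, map_zero] at this
      exact hx (congrArg Subtype.val this)
    have hne' : e i • x • (g : M) ≠ 0 := fun h0 => hne (Subtype.ext h0)
    have : IsSimpleModule R N :=
      haveI := h.isSimpleModule_span hv
      IsSimpleModule.congr f
    have hat : IsAtom N := isSimpleModule_iff_isAtom.1 this
    have hle : Submodule.span R {e i • x • (g : M)} ≤ N := by
      rw [Submodule.span_singleton_le_iff_mem]
      exact N.smul_mem _ (N.smul_mem _ g.2)
    have heq : Submodule.span R {e i • x • (g : M)} = N :=
      (hat.le_iff_eq (fun hb => hne' (Submodule.span_singleton_eq_bot.1 hb))).1 hle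
    rw [← heq, Submodule.span_singleton_le_iff_mem]
    exact key N _ (N.smul_mem _ g.2)
  · refine iSup_le fun j => ?_
    by_cases h0 : u i j = 0
    · simp [h0]
    obtain ⟨w, hw⟩ : u i j ∈ Set.range fun m => e i • m := by
      rw [← hu i]
      exact Submodule.subset_span ⟨j, rfl⟩
    simp only at hw
    rw [← hw] at h0 ⊢
    obtain ⟨f, -⟩ := h.exists_equiv h0 hv
    exact le_sSup ⟨f⟩

/-- By orthogonality, `e i • x` kills the whole component of `i'`, whereas for suitable `x` it does
not kill `u i j`. -/
theorem iSup_ne (hu : ∀ i, (Submodule.span ℝ (Set.range (u i)) : Set M) =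
    Set.range fun m => e i • m) {i i' : ι} (hi : i ≠ i') (j : J i) (hj : u i j ≠ 0) :
    (⨆ j, Submodule.span R {u i j}) ≠ ⨆ j, Submodule.span R {u i' j} := by
  intro heq
  obtain ⟨v, hv⟩ : u i j ∈ Set.range fun m => e i • m := by
    rw [← hu i]
    exact Submodule.subset_span ⟨j, rfl⟩
  simp only at hv
  obtain ⟨x, hx⟩ := h.exists_smul_ne_zero (i := i) (v := v)
      (Submodule.mem_span_singleton_self _) (by rwa [hv])
  have hmem : u i j ∈ ⨆ j, Submodule.span R {u i' j} := by
    rw [← heq]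
    exact (le_iSup (fun j => Submodule.span R {u i j}) j)
        (Submodule.mem_span_singleton_self _)
  rw [hv] at hx
  refine hx ?_
  rw [← Submodule.span_range_eq_iSup] at hmem
  clear hx hv hj heq
  generalize u i j = y at hmem
  induction hmem using Submodule.span_induction generalizing x with
  | mem y hy =>
    have hy' : y ∈ (Submodule.span ℝ (Set.range (u i')) : Set M) := Submodule.subset_span hy
    rw [hu i'] at hy'
    obtain ⟨m, rfl⟩ := hy'
    exact h.orth _ _ hi _ _
  | zero => simp
  | add y z _ _ hy hz => rw [smul_add, smul_add, hy, hz, add_zero]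
  | smul a y _ hy => rw [← mul_smul x a]; exact hy _

/-- The representative criterion in module form. -/
theorem exists_decomposition (hu : ∀ i, (Submodule.span ℝ (Set.range (u i)) : Set M) =
    Set.range fun m => e i • m) (hli : ∀ i, LinearIndependent ℝ (u i))
    {p : ι → Prop} (hp : ∀ i, p i ↔ Nonempty (J i)) :
    ∃ (C : {i // p i} → Submodule R M) (D : ∀ i : {i // p i}, J i.1 → Submodule R M),
      Function.Injective C ∧
      Set.range C = isotypicComponents R M ∧
      (∀ i, iSupIndep (D i) ∧ ⨆ j, D i j = C i) ∧
      (∀ i j, IsSimpleModule R (D i j)) ∧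
      ∃ hD : ∀ (i : {i // p i}) (j : J i.1), u i.1 j ∈ D i j,
        ∀ i j j', ∃ f : D i j ≃ₗ[R] D i j', f ⟨u i.1 j, hD i j⟩ = ⟨u i.1 j', hD i j'⟩ := by
  have hpre : ∀ i (j : J i), ∃ v, e i • v = u i j := by
    intro i j
    have : u i j ∈ Set.range fun m => e i • m := by
      rw [← hu i]
      exact Submodule.subset_span ⟨j, rfl⟩
    exact this
  refine ⟨fun i => ⨆ j, Submodule.span R {u i.1 j}, fun i j => Submodule.span R {u i.1 j},
    ?_, ?_, fun i => ⟨h.iSupIndep_span hu hli i.1, rfl⟩, ?_,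
    fun i j => Submodule.mem_span_singleton_self _, ?_⟩
  · intro i i' hii
    by_contra hne
    obtain ⟨j⟩ := (hp _).1 i.2
    exact h.iSup_ne hu (fun h' => hne (Subtype.ext h')) j ((hli _).ne_zero j) hii
  · ext N
    constructor
    · rintro ⟨i, rfl⟩
      obtain ⟨j⟩ := (hp _).1 i.2
      obtain ⟨v, hv⟩ := hpre i.1 j
      have hv0 : e i.1 • v ≠ 0 := by rw [hv]; exact (hli _).ne_zero j
      exact ⟨_, h.isSimpleModule_span hv0, (h.isotypicComponent_eq_iSup hu hv0).symm⟩
    -- A simple `S` is detected by some `e i`, so it is generated by a vector in the range of `e i`.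
    -- This range is then nonzero, which forces `J i` to be nonempty.
    · rintro ⟨S, hS, rfl⟩
      have hat : IsAtom S := isSimpleModule_iff_isAtom.1 hS
      obtain ⟨s, hsS, hs0⟩ := S.ne_bot_iff.1 hat.1
      obtain ⟨i, x, hx⟩ := h.complete s hs0
      have hle : Submodule.span R {e i • x • s} ≤ S := by
        rw [Submodule.span_singleton_le_iff_mem]
        exact S.smul_mem _ (S.smul_mem _ hsS)
      have heq : Submodule.span R {e i • x • s} = S :=
        (hat.le_iff_eq (fun hb => hx (Submodule.span_singleton_eq_bot.1 hb))).1 hle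
      have hJ : Nonempty (J i) := by
        by_contra hJ
        rw [not_nonempty_iff] at hJ
        have : e i • x • s ∈ (Submodule.span ℝ (Set.range (u i)) : Set M) := by
          rw [hu i]; exact ⟨_, rfl⟩
        rw [Set.range_eq_empty, Submodule.span_empty] at this
        exact hx this
      refine ⟨⟨i, (hp i).2 hJ⟩, ?_⟩
      rw [← heq, h.isotypicComponent_eq_iSup hu hx]
  · intro i j
    obtain ⟨v, hv⟩ := hpre i.1 j
    have hv0 : e i.1 • v ≠ 0 := by rw [hv]; exact (hli _).ne_zero j
    have := h.isSimpleModule_span hv0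
    rw [hv] at this
    exact this
  · intro i j j'
    obtain ⟨v, hv⟩ := hpre i.1 j
    have hv0 : e i.1 • v ≠ 0 := by rw [hv]; exact (hli _).ne_zero j
    obtain ⟨w, hw⟩ := hpre i.1 j'
    have hw0 : e i.1 • w ≠ 0 := by rw [hw]; exact (hli _).ne_zero j'
    have key : ∀ a b, e i.1 • v = a → e i.1 • w = b →
        ∀ (ha : a ∈ Submodule.span R {a}) (hb : b ∈ Submodule.span R {b}),
        ∃ f : Submodule.span R {a} ≃ₗ[R] Submodule.span R {b}, f ⟨a, ha⟩ = ⟨b, hb⟩ := by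
      rintro _ _ rfl rfl _ _
      exact h.exists_equiv hv0 hw0
    exact key _ _ hv hw _ _

end IsControlled

end Controlled

/-! ### Controlled representations -/

section Controls

variable {G V ι : Type*} [Group G] [AddCommGroup V] [Module ℝ V]

/-- `IsControlled` for a representation, in terms of the action of the group algebra. -/
structure Controls (ρ : Representation ℝ G V) (e : ι → MonoidAlgebra ℝ G) : Prop where
  scal : ∀ i (x : MonoidAlgebra ℝ G), ∃ c : ℝ, ∀ v : V,
    ρ.asAlgebraHom (e i) (ρ.asAlgebraHom x (ρ.asAlgebraHom (e i) v)) =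
      c • ρ.asAlgebraHom (e i) v
  orth : ∀ i j, i ≠ j → ∀ (x : MonoidAlgebra ℝ G) (v : V),
    ρ.asAlgebraHom (e i) (ρ.asAlgebraHom x (ρ.asAlgebraHom (e j) v)) = 0
  complete : ∀ v : V, v ≠ 0 → ∃ i, ∃ x : MonoidAlgebra ℝ G,
    ρ.asAlgebraHom (e i) (ρ.asAlgebraHom x v) ≠ 0

theorem Controls.isControlled {ρ : Representation ℝ G V} {e : ι → MonoidAlgebra ℝ G}
    (h : Controls ρ e) : IsControlled ρ.asModule e :=
  ⟨h.scal, h.orth, h.complete⟩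

theorem Controls.isRepresentative {ρ : Representation ℝ G V} {e : ι → MonoidAlgebra ℝ G}
    (h : Controls ρ e) {J : ι → Type*} {u : ∀ i, J i → V}
    (hu : ∀ i, Submodule.span ℝ (Set.range (u i)) = LinearMap.range (ρ.asAlgebraHom (e i)))
    (hli : ∀ i, LinearIndependent ℝ (u i))
    {p : ι → Prop} (hp : ∀ i, p i ↔ Nonempty (J i)) :
    IsRepresentative ρ (fun (i : {i // p i}) (j : J i.1) => u i.1 j) := by
  obtain ⟨C, D, h1, h2, h3, h4, h5, h6⟩ :=
    h.isControlled.exists_decomposition (u := fun i j => ρ.asModuleEquiv.symm (u i j))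
      (fun i => congrArg (fun N : Submodule ℝ V => (N : Set V)) (hu i)) hli hp
  exact ⟨C, D, h1, h2, h3, h4, fun i j => (hli i.1).ne_zero j, h5, h6⟩

theorem asAlgebraHom_eq_sum [Fintype G] (ρ : Representation ℝ G V) (x : MonoidAlgebra ℝ G)
    (v : V) : ρ.asAlgebraHom x v = ∑ g, x.coeff g • ρ g v := by
  rw [Representation.asAlgebraHom_def, MonoidAlgebra.lift_apply]
  rw [Finsupp.sum_fintype _ _ (by simp)]
  simp

/-- It suffices to test the first two conditions on group elements. -/
theorem Controls.of_group [Fintype G] {ρ : Representation ℝ G V} {e : ι → MonoidAlgebra ℝ G}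
    (scal : ∀ i (g : G), ∃ c : ℝ, ∀ v : V,
      ρ.asAlgebraHom (e i) (ρ g (ρ.asAlgebraHom (e i) v)) = c • ρ.asAlgebraHom (e i) v)
    (orth : ∀ i j, i ≠ j → ∀ (g : G) (v : V),
      ρ.asAlgebraHom (e i) (ρ g (ρ.asAlgebraHom (e j) v)) = 0)
    (complete : ∀ v : V, v ≠ 0 → ∃ i, ∃ g : G, ρ.asAlgebraHom (e i) (ρ g v) ≠ 0) :
    Controls ρ e where
  scal i x := by
    choose c hc using scal i
    refine ⟨∑ g, x.coeff g * c g, fun v => ?_⟩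
    rw [asAlgebraHom_eq_sum ρ x, map_sum, Finset.sum_smul]
    refine Finset.sum_congr rfl fun g _ => ?_
    rw [map_smul, hc, smul_smul]
  orth i j hij x v := by
    rw [asAlgebraHom_eq_sum ρ x, map_sum]
    refine Finset.sum_eq_zero fun g _ => ?_
    rw [map_smul, orth i j hij, smul_zero]
  complete v hv := by
    obtain ⟨i, g, hg⟩ := complete v hv
    exact ⟨i, MonoidAlgebra.of ℝ G g, by rwa [Representation.asAlgebraHom_of]⟩

variable {V' : Type*} [AddCommGroup V'] [Module ℝ V']

theorem asAlgebraHom_intertwine {ρ : Representation ℝ G V} {ρ' : Representation ℝ G V'}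
    (Φ : V →ₗ[ℝ] V') (hΦ : ∀ g v, Φ (ρ g v) = ρ' g (Φ v)) (x : MonoidAlgebra ℝ G) (v : V) :
    Φ (ρ.asAlgebraHom x v) = ρ'.asAlgebraHom x (Φ v) := by
  induction x using MonoidAlgebra.induction_on with
  | of g => rw [Representation.asAlgebraHom_of, Representation.asAlgebraHom_of, hΦ]
  | add x y hx hy => simp only [map_add, LinearMap.add_apply, hx, hy]
  | smul r x hx => simp only [map_smul, LinearMap.smul_apply, hx]

/-- Controlledness passes to a representation that is separated by intertwiners to a controlled
one. -/
theorem Controls.of_separating {ρ : Representation ℝ G V} {ρ' : Representation ℝ G V'}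
    {e : ι → MonoidAlgebra ℝ G} (h : Controls ρ e) {κ : Type*} (Ψ : κ → V' →ₗ[ℝ] V)
    (hΨ : ∀ k g v, Ψ k (ρ' g v) = ρ g (Ψ k v)) (hsep : ∀ v, (∀ k, Ψ k v = 0) → v = 0) :
    Controls ρ' e where
  scal i x := by
    obtain ⟨c, hc⟩ := h.scal i x
    refine ⟨c, fun v => sub_eq_zero.1 (hsep _ fun k => ?_)⟩
    simp only [map_sub, map_smul, asAlgebraHom_intertwine (Ψ k) (hΨ k), hc, sub_self]
  orth i j hij x v := by
    refine hsep _ fun k => ?_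
    simp only [asAlgebraHom_intertwine (Ψ k) (hΨ k), h.orth i j hij]
  complete v hv := by
    obtain ⟨k, hk⟩ : ∃ k, Ψ k v ≠ 0 := by
      by_contra! hk
      exact hv (hsep v hk)
    obtain ⟨i, x, hx⟩ := h.complete _ hk
    refine ⟨i, x, fun h0 => hx ?_⟩
    rw [← asAlgebraHom_intertwine (Ψ k) (hΨ k), ← asAlgebraHom_intertwine (Ψ k) (hΨ k), h0,
      map_zero]

theorem range_asAlgebraHom_of_surjective {ρ : Representation ℝ G V}
    {ρ' : Representation ℝ G V'} (Φ : V →ₗ[ℝ] V') (hΦ : ∀ g v, Φ (ρ g v) = ρ' g (Φ v))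
    (hs : Function.Surjective Φ) (x : MonoidAlgebra ℝ G) :
    LinearMap.range (ρ'.asAlgebraHom x) = (LinearMap.range (ρ.asAlgebraHom x)).map Φ := by
  ext w
  simp only [LinearMap.mem_range, Submodule.mem_map]
  constructor
  · rintro ⟨v', rfl⟩
    obtain ⟨v, rfl⟩ := hs v'
    exact ⟨_, ⟨v, rfl⟩, asAlgebraHom_intertwine Φ hΦ x v⟩
  · rintro ⟨_, ⟨v, rfl⟩, rfl⟩
    exact ⟨Φ v, (asAlgebraHom_intertwine Φ hΦ x v).symm⟩

end Controls

/-! ### Block diagonalization of invariant matrices -/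

theorem permRep_apply {G X : Type*} [Group G] [MulAction G X] (g : G) (f : X → ℝ) (x : X) :
    permRep G X g f x = f (g⁻¹ • x) := rfl

section Blocks

open Matrix

variable {G X ι : Type*} [Group G] [Fintype G] [MulAction G X] [Fintype X]

theorem dotProduct_permRep (g : G) (f f' : X → ℝ) :
    permRep G X g f ⬝ᵥ f' = f ⬝ᵥ permRep G X g⁻¹ f' := by
  simp only [dotProduct, permRep_apply, inv_inv]
  exact Fintype.sum_equiv (MulAction.toPerm g⁻¹) _ _ fun x => by simp

/-- An element of the group algebra that is fixed by inversion acts symmetrically. -/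
theorem dotProduct_asAlgebraHom_permRep {x : MonoidAlgebra ℝ G}
    (hx : ∀ g, x.coeff g⁻¹ = x.coeff g) (f f' : X → ℝ) :
    (permRep G X).asAlgebraHom x f ⬝ᵥ f' = f ⬝ᵥ (permRep G X).asAlgebraHom x f' := by
  rw [asAlgebraHom_eq_sum, asAlgebraHom_eq_sum, sum_dotProduct, dotProduct_sum]
  refine Fintype.sum_equiv (Equiv.inv G) _ _ fun g => ?_
  simp only [Equiv.inv_apply, smul_dotProduct, dotProduct_smul, dotProduct_permRep, hx]

theorem mulVec_permRep {A : Matrix X X ℝ} (hA : IsInvariantMatrix G A) (g : G) (f : X → ℝ) :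
    A *ᵥ permRep G X g f = permRep G X g (A *ᵥ f) := by
  funext x
  simp only [mulVec, dotProduct, permRep_apply]
  refine Fintype.sum_equiv (MulAction.toPerm g⁻¹) _ _ fun y => ?_
  simp [hA g⁻¹ x y]

theorem mulVec_asAlgebraHom {A : Matrix X X ℝ} (hA : IsInvariantMatrix G A)
    (x : MonoidAlgebra ℝ G) (f : X → ℝ) :
    A *ᵥ (permRep G X).asAlgebraHom x f = (permRep G X).asAlgebraHom x (A *ᵥ f) :=
  asAlgebraHom_intertwine A.mulVecLin (fun g v => mulVec_permRep hA g v) x f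

variable {e : ι → MonoidAlgebra ℝ G} {J : ι → Type*} {U : ∀ i, Matrix X (J i) ℝ}

/-- The data used for block diagonalization. -/
structure BlockData (e : ι → MonoidAlgebra ℝ G) (U : ∀ i, Matrix X (J i) ℝ) : Prop where
  controls : Controls (permRep G X) e
  symm : ∀ i g, (e i).coeff g⁻¹ = (e i).coeff g
  span : ∀ i, Submodule.span ℝ (Set.range fun j x => U i x j) =
    LinearMap.range ((permRep G X).asAlgebraHom (e i))
  li : ∀ i, LinearIndependent ℝ fun j x => U i x j

namespace BlockData

variable (h : BlockData e U)
include h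

theorem exists_eq (i : ι) (j : J i) :
    ∃ v, (permRep G X).asAlgebraHom (e i) v = fun x => U i x j := by
  have : (fun x => U i x j) ∈ LinearMap.range ((permRep G X).asAlgebraHom (e i)) := by
    rw [← h.span]
    exact Submodule.subset_span ⟨j, rfl⟩
  exact this

theorem dotProduct_eq_zero {i i' : ι} (hi : i ≠ i') (j : J i) (j' : J i') (g : G) :
    (fun x => U i x j) ⬝ᵥ permRep G X g (fun x => U i' x j') = 0 := by
  obtain ⟨v, hv⟩ := h.exists_eq i j
  obtain ⟨w, hw⟩ := h.exists_eq i' j'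
  rw [← hv, ← hw, dotProduct_asAlgebraHom_permRep (h.symm i)]
  have := h.controls.orth i i' hi (MonoidAlgebra.of ℝ G g) w
  rw [Representation.asAlgebraHom_of] at this
  rw [this, dotProduct_zero]

/-- The ratio by which a group element scales the Gram matrix of a block. -/
theorem exists_ratio (i : ι) : ∃ γ : G → ℝ, γ 1 = 1 ∧ ∀ g (j j' : J i),
    (fun x => U i x j) ⬝ᵥ permRep G X g (fun x => U i x j') =
      γ g * ((fun x => U i x j) ⬝ᵥ (fun x => U i x j')) := by
  choose c hc using fun g => h.controls.scal i (MonoidAlgebra.of ℝ G g)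
  simp only [Representation.asAlgebraHom_of] at hc
  by_cases hJ : IsEmpty (J i)
  · exact ⟨fun _ => 1, rfl, fun g j => hJ.elim j⟩
  rw [not_isEmpty_iff] at hJ
  obtain ⟨j₀⟩ := hJ
  have key : ∀ g (j j' : J i), c 1 *
      ((fun x => U i x j) ⬝ᵥ permRep G X g (fun x => U i x j')) =
      c g * ((fun x => U i x j) ⬝ᵥ (fun x => U i x j')) := by
    intro g j j'
    obtain ⟨v, hv⟩ := h.exists_eq i j
    obtain ⟨w, hw⟩ := h.exists_eq i j'
    have h1 := hc 1 w
    rw [map_one, Module.End.one_apply] at h1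
    rw [← hv, ← hw, dotProduct_asAlgebraHom_permRep (h.symm i), hc g,
      dotProduct_asAlgebraHom_permRep (h.symm i), h1, dotProduct_smul, dotProduct_smul]
    simp only [smul_eq_mul]
    ring
  -- The elements are only quasi-idempotent, with `e i * e i` acting as `c 1 • e i`. By symmetry, `c
  -- 1 = 0` would make the squared length of a column zero.
  have hc1 : c 1 ≠ 0 := by
    intro h0
    obtain ⟨v, hv⟩ := h.exists_eq i j₀
    have h1 := hc 1 v
    rw [h0, zero_smul, map_one, Module.End.one_apply] at h1
    have h2 := dotProduct_asAlgebraHom_permRep (h.symm i) v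
      ((permRep G X).asAlgebraHom (e i) v)
    rw [h1, dotProduct_zero, dotProduct_self_eq_zero, hv] at h2
    exact (h.li i).ne_zero j₀ h2
  refine ⟨fun g => c g / c 1, div_self hc1, fun g j j' => ?_⟩
  have := key g j j'
  field_simp
  linarith

/-- A nonzero `B` is nonzero on some column `u` of some `U i`, by completeness and equivariance.
Since `B` commutes with `e i`, the vector `B u` lies again in the span of the columns of `U i`. The
vanishing block says that `B u` is orthogonal to this span, hence to itself. -/
theorem eq_zero_of_blocks_eq_zero {B : Matrix X X ℝ} (hB : IsInvariantMatrix G B)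
    (h0 : ∀ i, Nonempty (J i) → (U i).transpose * B * U i = 0) : B = 0 := by
  by_contra hne
  obtain ⟨f, hf⟩ : ∃ f, B *ᵥ f ≠ 0 := by
    by_contra! hz
    classical
    exact hne (ext_of_mulVec_single fun i => by rw [hz, zero_mulVec])
  obtain ⟨i, x, hx⟩ := h.controls.complete _ hf
  rw [← mulVec_asAlgebraHom hB, ← mulVec_asAlgebraHom hB] at hx
  have hmem : (permRep G X).asAlgebraHom (e i) ((permRep G X).asAlgebraHom x f) ∈
      Submodule.span ℝ (Set.range fun j x => U i x j) := by
    rw [h.span]; exact ⟨_, rfl⟩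
  have hj : ∃ j, B *ᵥ (fun x => U i x j) ≠ 0 := by
    by_contra! hz
    refine hx ?_
    have : Submodule.span ℝ (Set.range fun j x => U i x j) ≤ LinearMap.ker B.mulVecLin := by
      rw [Submodule.span_le]
      rintro _ ⟨j, rfl⟩
      exact hz j
    exact this hmem
  obtain ⟨j, hj⟩ := hj
  obtain ⟨v, hv⟩ := h.exists_eq i j
  obtain ⟨i', y, hy⟩ := h.controls.complete _ hj
  rw [← hv, ← mulVec_asAlgebraHom hB, ← mulVec_asAlgebraHom hB] at hy
  by_cases hi : i' = i
  swap
  · rw [h.controls.orth _ _ hi, mulVec_zero] at hy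
    exact hy rfl
  subst hi
  obtain ⟨c, hc⟩ := h.controls.scal i' y
  rw [hc, mulVec_smul] at hy
  obtain ⟨d, hd⟩ := h.controls.scal i' 1
  simp only [map_one, Module.End.one_apply] at hd
  have hB1 : (permRep G X).asAlgebraHom (e i') (B *ᵥ (permRep G X).asAlgebraHom (e i') v) =
      d • (B *ᵥ (permRep G X).asAlgebraHom (e i') v) := by
    rw [← mulVec_asAlgebraHom hB, hd, mulVec_smul]
  have hd0 : d ≠ 0 := by
    rintro rfl
    have h1 := hd v
    rw [zero_smul] at h1
    have h2 := dotProduct_asAlgebraHom_permRep (h.symm i') v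
      ((permRep G X).asAlgebraHom (e i') v)
    rw [h1, dotProduct_zero, dotProduct_self_eq_zero, hv] at h2
    exact (h.li i').ne_zero j h2
  have hmem2 : B *ᵥ (fun x => U i' x j) ∈ Submodule.span ℝ (Set.range fun j x => U i' x j) := by
    rw [h.span, ← hv]
    refine ⟨d⁻¹ • (B *ᵥ (permRep G X).asAlgebraHom (e i') v), ?_⟩
    rw [map_smul, hB1, smul_smul, inv_mul_cancel₀ hd0, one_smul]
  have horth : ∀ w ∈ Submodule.span ℝ (Set.range fun j x => U i' x j),
      w ⬝ᵥ (B *ᵥ (fun x => U i' x j)) = 0 := by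
    intro w hw
    induction hw using Submodule.span_induction with
    | mem w hw =>
      obtain ⟨j', rfl⟩ := hw
      have := congrFun (congrFun (h0 i' ⟨j⟩) j') j
      rw [Matrix.mul_assoc] at this
      simpa [Matrix.mul_apply, dotProduct, mulVec, transpose_apply] using this
    | zero => simp
    | add w w' _ _ hw hw' => rw [add_dotProduct, hw, hw', add_zero]
    | smul a w _ hw => rw [smul_dotProduct, hw, smul_zero]
  exact hj (dotProduct_self_eq_zero.1 (horth _ hmem2))

/-- A preimage of a tuple of blocks, positive semidefinite if the tuple is. -/
theorem exists_preimage {p : ι → Prop} [Finite {i // p i}] [∀ i, Finite (J i)]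
    (N : ∀ i : {i // p i}, Matrix (J i.1) (J i.1) ℝ) :
    ∃ A : Matrix X X ℝ, IsInvariantMatrix G A ∧ blocks (fun i : {i // p i} => U i.1) A = N ∧
      ((∀ i, (N i).PosSemidef) → A.PosSemidef) := by
  classical
  have := Fintype.ofFinite {i // p i}
  have := fun i => Fintype.ofFinite (J i)
  choose γ hγ1 hγ using h.exists_ratio
  -- In the average below, the translate by `g` contributes `γ(g)²` times `Gm * K * Gm` to the
  -- block, since the ratio enters once from each side. The matrix `K` undoes the total factor `s`
  -- and the two Gram matrices.
  let s : ι → ℝ := fun i => ∑ g, γ i g * γ i g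
  have hs : ∀ i, 0 < s i := fun i => by
    refine Finset.sum_pos' (fun g _ => mul_self_nonneg _) ⟨1, Finset.mem_univ _, ?_⟩
    rw [hγ1]; norm_num
  let Gm : ∀ i, Matrix (J i) (J i) ℝ := fun i => (U i).transpose * U i
  have hGm : ∀ i, IsUnit (Gm i).det := by
    intro i
    have hpd : (Gm i).PosDef := by
      have := PosDef.conjTranspose_mul_self (U i) (by
        rw [mulVec_injective_iff]
        exact h.li i)
      rwa [conjTranspose_eq_transpose_of_trivial] at this
    exact (isUnit_iff_isUnit_det _).1 hpd.isUnit
  have hGmsymm : ∀ i, (Gm i).transpose = Gm i := fun i => by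
    simp [Gm, transpose_mul]
  let K : ∀ i : {i // p i}, Matrix (J i.1) (J i.1) ℝ := fun i =>
    (s i.1)⁻¹ • ((Gm i.1)⁻¹ * N i * (Gm i.1)⁻¹)
  let P : ∀ i, G → Matrix X (J i) ℝ := fun i g => of fun x j => U i (g⁻¹ • x) j
  have hP : ∀ i g, (U i).transpose * P i g = γ i g • Gm i := by
    intro i g
    ext j j'
    have := hγ i g j j'
    simpa [Matrix.mul_apply, dotProduct, permRep_apply, P, Gm] using this
  have hP' : ∀ i i' g, i ≠ i' → (U i).transpose * P i' g = 0 := by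
    intro i i' g hi
    ext j j'
    have := h.dotProduct_eq_zero hi j j' g
    simpa [Matrix.mul_apply, dotProduct, permRep_apply, P] using this
  refine ⟨∑ i : {i // p i}, ∑ g, P i.1 g * K i * (P i.1 g).transpose, ?_, ?_, ?_⟩
  · intro g x y
    simp only [Matrix.sum_apply]
    refine Finset.sum_congr rfl fun i _ => ?_
    refine Fintype.sum_equiv (Equiv.mulLeft g⁻¹) _ _ fun g' => ?_
    simp [Matrix.mul_apply, P, mul_smul]
  · funext i
    simp only [blocks, Matrix.mul_sum, Matrix.sum_mul]
    rw [Finset.sum_eq_single i]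
    · have : ∀ g, (U i.1).transpose * (P i.1 g * K i * (P i.1 g).transpose) * U i.1 =
          (γ i.1 g * γ i.1 g) • ((s i.1)⁻¹ • N i) := by
        intro g
        have h1 : (P i.1 g).transpose * U i.1 = γ i.1 g • Gm i.1 := by
          rw [← transpose_transpose ((P i.1 g).transpose * U i.1), transpose_mul,
            transpose_transpose, hP, transpose_smul, hGmsymm]
        calc _ = ((U i.1).transpose * P i.1 g) * K i * ((P i.1 g).transpose * U i.1) := by
              simp only [Matrix.mul_assoc]
          _ = (γ i.1 g * γ i.1 g) • ((s i.1)⁻¹ • (Gm i.1 * (Gm i.1)⁻¹ * N i *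
              ((Gm i.1)⁻¹ * Gm i.1))) := by
            rw [hP, h1]
            simp only [K, Matrix.smul_mul, Matrix.mul_smul, smul_smul, Matrix.mul_assoc]
            congr 1
            ring
          _ = _ := by
            rw [mul_nonsing_inv _ (hGm _), nonsing_inv_mul _ (hGm _), one_mul, mul_one]
      rw [Finset.sum_congr rfl fun g _ => this g, ← Finset.sum_smul, smul_smul,
        mul_inv_cancel₀ (hs i.1).ne', one_smul]
    · intro i' _ hi'
      refine Finset.sum_eq_zero fun g _ => ?_
      rw [← Matrix.mul_assoc, ← Matrix.mul_assoc, hP' _ _ _ fun h' => hi' (Subtype.ext h'.symm)]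
      simp
    · simp
  · intro hN
    refine posSemidef_sum _ fun i _ => posSemidef_sum _ fun g _ => ?_
    have hK : (K i).PosSemidef := by
      refine PosSemidef.smul ?_ (inv_nonneg.2 (hs _).le)
      have := (hN i).mul_mul_conjTranspose_same (Gm i.1)⁻¹
      rwa [conjTranspose_eq_transpose_of_trivial, transpose_nonsing_inv, hGmsymm] at this
    have := hK.mul_mul_conjTranspose_same (P i.1 g)
    rwa [conjTranspose_eq_transpose_of_trivial] at this

theorem injective_blocks {p : ι → Prop} (hp : ∀ i, p i ↔ Nonempty (J i))
    {A A' : Matrix X X ℝ} (hA : IsInvariantMatrix G A) (hA' : IsInvariantMatrix G A')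
    (hAA' : blocks (fun i : {i // p i} => U i.1) A = blocks (fun i : {i // p i} => U i.1) A') :
    A = A' := by
  refine sub_eq_zero.1 (h.eq_zero_of_blocks_eq_zero (fun g x y => ?_) fun i hi => ?_)
  · simp [hA g x y, hA' g x y]
  · have := congrFun hAA' ⟨i, (hp i).2 hi⟩
    simp only [blocks] at this
    rw [Matrix.mul_sub, Matrix.sub_mul, this, sub_self]

theorem bijective_blocks {p : ι → Prop} (hp : ∀ i, p i ↔ Nonempty (J i))
    [Finite {i // p i}] [∀ i, Finite (J i)] :
    Function.Bijective (fun A : {A : Matrix X X ℝ // IsInvariantMatrix G A} =>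
      blocks (fun i : {i // p i} => U i.1) A.1) := by
  refine ⟨fun A A' hAA' => Subtype.ext (h.injective_blocks hp A.2 A'.2 hAA'), fun N => ?_⟩
  obtain ⟨A, hA, hN, -⟩ := h.exists_preimage N
  exact ⟨⟨A, hA⟩, hN⟩

theorem posSemidef_iff {p : ι → Prop} (hp : ∀ i, p i ↔ Nonempty (J i))
    [Finite {i // p i}] [∀ i, Finite (J i)] {A : Matrix X X ℝ} (hA : IsInvariantMatrix G A) :
    A.PosSemidef ↔ ∀ i : {i // p i}, ((U i.1).transpose * A * U i.1).PosSemidef := by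
  constructor
  · intro hpsd i
    have := Fintype.ofFinite (J i.1)
    have := hpsd.conjTranspose_mul_mul_same (U i.1)
    rwa [conjTranspose_eq_transpose_of_trivial] at this
  · intro hpsd
    -- Blocks determine an invariant matrix, so `A` is the averaged preimage, whose positive
    -- semidefiniteness is visible from its construction.
    obtain ⟨A', hA', hN, hA'psd⟩ := h.exists_preimage (blocks (fun i : {i // p i} => U i.1) A)
    rw [← h.injective_blocks hp hA' hA hN]
    exact hA'psd hpsd

end BlockData

end Blocks

/-! ### Sorting by an extremal principle -/

section Sorting

variable {K : Type*} [Fintype K] [DecidableEq K]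

theorem sum_mul_swap (a b : K → ℤ) {y z : K} (hyz : y ≠ z) :
    ∑ x, a x * b (Equiv.swap y z x) = ∑ x, a x * b x + (a z - a y) * (b y - b z) := by
  rw [← sub_eq_iff_eq_add', ← Finset.sum_sub_distrib, Fintype.sum_eq_add y z hyz]
  · simp only [Equiv.swap_apply_left, Equiv.swap_apply_right]
    ring
  · intro x hx
    rw [Equiv.swap_apply_of_ne_of_ne hx.1 hx.2, sub_self]

/-- A rearrangement of `b` in a subgroup with maximal correlation with `a` is sorted along `a`. -/
theorem sorted_of_isMax {H : Subgroup (Equiv.Perm K)} {a b : K → ℕ} {c : Equiv.Perm K}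
    (hc : c ∈ H) (hmax : ∀ c' ∈ H, ∑ x, a x * b (c' x) ≤ ∑ x, a x * b (c x)) {y z : K}
    (hyz : Equiv.swap y z ∈ H) (hlt : a y < a z) : b (c y) ≤ b (c z) := by
  have hne : y ≠ z := by rintro rfl; exact lt_irrefl _ hlt
  have h1 := hmax (c * Equiv.swap y z) (mul_mem hc hyz)
  have h2 := sum_mul_swap (fun x => (a x : ℤ)) (fun x => (b (c x) : ℤ)) hne
  zify at h1
  simp only [Function.comp_apply] at h1
  rw [h2] at h1
  by_contra! hlt'
  have h3 : (0 : ℤ) < a z - a y := by omega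
  have h4 : (0 : ℤ) < b (c y) - b (c z) := by omega
  have := mul_pos h3 h4
  linarith

theorem exists_isMax (H : Subgroup (Equiv.Perm K)) (a b : K → ℕ) :
    ∃ c ∈ H, ∀ c' ∈ H, ∑ x, a x * b (c' x) ≤ ∑ x, a x * b (c x) := by
  obtain ⟨c, hc⟩ := Finite.exists_max fun c : H => ∑ x, a x * b (c.1 x)
  exact ⟨c.1, c.2, fun c' hc' => hc ⟨c', hc'⟩⟩

end Sorting

/-! ### Row and column weights of Young shapes -/

theorem swap_mem_colGroup {μ : YoungDiagram} {y z : μ.cells} (h : y.1.2 = z.1.2) :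
    Equiv.swap y z ∈ colGroup μ := by
  intro x
  by_cases hy : x = y
  · subst hy; simp [h]
  by_cases hz : x = z
  · subst hz; simp [h]
  rw [Equiv.swap_apply_of_ne_of_ne hy hz]

theorem swap_mem_rowGroup {μ : YoungDiagram} {y z : μ.cells} (h : y.1.1 = z.1.1) :
    Equiv.swap y z ∈ rowGroup μ := by
  intro x
  by_cases hy : x = y
  · subst hy; simp [h]
  by_cases hz : x = z
  · subst hz; simp [h]
  rw [Equiv.swap_apply_of_ne_of_ne hy hz]

/-- The sum of the row indices of the cells. -/
def rowWeight (μ : YoungDiagram) : ℕ := ∑ y : μ.cells, y.1.1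

theorem row_le_of_strict {μ : YoungDiagram} {f : μ.cells → ℕ}
    (hf : ∀ y z : μ.cells, y.1.2 = z.1.2 → y.1.1 < z.1.1 → f y < f z) (y : μ.cells) :
    y.1.1 ≤ f y := by
  suffices hle : ∀ (i : ℕ) (y : μ.cells), y.1.1 = i → i ≤ f y from hle _ y rfl
  intro i
  induction i with
  | zero => intro y _; exact Nat.zero_le _
  | succ i ih =>
    intro y hy
    have hmem : (i, y.1.2) ∈ μ.cells := by
      refine μ.up_left_mem (i2 := y.1.1) (j2 := y.1.2) (by omega) le_rfl ?_
      exact y.2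
    have h1 := ih ⟨_, hmem⟩ rfl
    have h2 := hf ⟨_, hmem⟩ y rfl (by simp only; omega)
    omega

/-- A filling with distinct entries in each column has sum at least the row weight; in case of
equality it is a column rearrangement of the filling by row indices. -/
theorem rowWeight_le_sum {μ : YoungDiagram} {f : μ.cells → ℕ}
    (hf : ∀ y z : μ.cells, y.1.2 = z.1.2 → f y = f z → y = z) :
    rowWeight μ ≤ ∑ y, f y ∧
      (rowWeight μ = ∑ y, f y → ∃ c ∈ colGroup μ, ∀ y, f (c y) = y.1.1) := by
  -- The maximizer sorts every column. Distinct entries make the sorted columns strictly increasing,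
  -- so that each entry is at least its row index.
  obtain ⟨c, hc, hmax⟩ := exists_isMax (colGroup μ) (fun y => y.1.1) f
  have hle : ∀ y, y.1.1 ≤ f (c y) := row_le_of_strict fun y z hcol hlt => by
    refine lt_of_le_of_ne (sorted_of_isMax hc hmax (swap_mem_colGroup hcol) hlt) fun h => ?_
    have h4 := c.injective (hf _ _ (((hc y).trans hcol).trans (hc z).symm) h)
    rw [h4] at hlt
    exact lt_irrefl _ hlt
  have hsum : ∑ y, f (c y) = ∑ y, f y := Equiv.sum_comp c f
  rw [← hsum]
  refine ⟨Finset.sum_le_sum fun y _ => hle y, fun h => ⟨c, hc, fun y => ?_⟩⟩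
  exact ((Finset.sum_eq_sum_iff_of_le fun y _ => hle y).1 h y (Finset.mem_univ _)).symm

theorem rowLen_eq_card_filter (μ : YoungDiagram) (i : ℕ) :
    μ.rowLen i = (Finset.univ.filter fun y : μ.cells => y.1.1 = i).card := by
  rw [μ.rowLen_eq_card, YoungDiagram.row]
  rw [← Finset.card_map (Function.Embedding.subtype _)]
  congr 1
  ext x
  simp only [Finset.mem_map, Finset.mem_filter, Finset.mem_univ,
    true_and, Function.Embedding.subtype_apply, Subtype.exists]
  constructor
  · rintro ⟨h1, h2⟩; exact ⟨x, h1, h2, rfl⟩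
  · rintro ⟨y, h1, h2, rfl⟩; exact ⟨h1, h2⟩

theorem youngDiagram_ext_rowLen {μ ν : YoungDiagram} (h : ∀ i, μ.rowLen i = ν.rowLen i) :
    μ = ν := by
  ext ⟨i, j⟩
  rw [YoungDiagram.mem_cells, YoungDiagram.mem_cells, YoungDiagram.mem_iff_lt_rowLen,
    YoungDiagram.mem_iff_lt_rowLen, h]

/-! ### The reversal of a group algebra -/

section Reversal

variable {G : Type*} [Group G]

/-- The antiautomorphism of the group algebra induced by inversion. -/
def rev : MonoidAlgebra ℝ G →ₗ[ℝ] MonoidAlgebra ℝ G :=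
  (MulOpposite.opLinearEquiv ℝ).symm.toLinearMap ∘ₗ
    (MonoidAlgebra.lift ℝ (MonoidAlgebra ℝ G)ᵐᵒᵖ G
      { toFun := fun g => MulOpposite.op (MonoidAlgebra.of ℝ G g⁻¹)
        map_one' := by simp; rfl
        map_mul' := fun g h => by rw [mul_inv_rev, map_mul, MulOpposite.op_mul] }).toLinearMap

theorem rev_single (g : G) (r : ℝ) :
    rev (MonoidAlgebra.single g r) = MonoidAlgebra.single g⁻¹ r := by
  simp [rev, MonoidAlgebra.lift_single]

theorem rev_mul (x y : MonoidAlgebra ℝ G) : rev (x * y) = rev y * rev x := by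
  simp [rev]

theorem rev_rev (x : MonoidAlgebra ℝ G) : rev (rev x) = x := by
  induction x using MonoidAlgebra.induction_on with
  | of g => rw [MonoidAlgebra.of_apply, rev_single, rev_single, inv_inv]
  | add x y hx hy => rw [map_add, map_add, hx, hy]
  | smul r x hx => rw [map_smul, map_smul, hx]

theorem coeff_rev (x : MonoidAlgebra ℝ G) (g : G) : (rev x).coeff g = x.coeff g⁻¹ := by
  classical
  induction x using MonoidAlgebra.induction_on with
  | of h =>
    rw [MonoidAlgebra.of_apply, rev_single, MonoidAlgebra.coeff_single, MonoidAlgebra.coeff_single,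
      Finsupp.single_apply, Finsupp.single_apply]
    simp [inv_eq_iff_eq_inv]
  | add x y hx hy => simp [map_add, hx, hy]
  | smul r x hx => simp [hx]

theorem coeff_one_rev_mul_self [Fintype G] (x : MonoidAlgebra ℝ G) :
    (rev x * x).coeff 1 = ∑ g, x.coeff g * x.coeff g := by
  classical
  rw [MonoidAlgebra.coeff_mul_antidiag (s := Finset.univ.image fun g : G => (g⁻¹, g))]
  · rw [Finset.sum_image (by simp [Set.InjOn])]
    simp [coeff_rev]
  · rintro ⟨a, b⟩
    simp only [Finset.mem_image, Finset.mem_univ, true_and, Prod.mk.injEq]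
    constructor
    · rintro ⟨g, rfl, rfl⟩; simp
    · intro hab; exact ⟨b, (eq_inv_of_mul_eq_one_left hab).symm, rfl⟩

/-- The coefficient of `rev x * x` at the identity is the sum of the squares of the coefficients of
`x`. This positivity is the substitute for semisimplicity in the nonvanishing arguments about Young
elements. -/
theorem rev_mul_self_ne_zero [Finite G] {x : MonoidAlgebra ℝ G} (hx : x ≠ 0) :
    rev x * x ≠ 0 := by
  have := Fintype.ofFinite G
  intro h
  have h1 := coeff_one_rev_mul_self x
  rw [h] at h1
  refine hx ?_
  ext g
  have h2 := (Finset.sum_eq_zero_iff_of_nonneg (fun g _ => mul_self_nonneg (x.coeff g))).1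
    h1.symm g (Finset.mem_univ _)
  simpa using h2

end Reversal

/-! ### Young symmetrizers -/

section Young

open MonoidAlgebra Classical

variable {K : Type*} [Fintype K] [DecidableEq K] {μ ν : YoungDiagram}

/-- The sum of the row group of a numbering `T` of the cells. -/
def rowSym (T : μ.cells ≃ K) : MonoidAlgebra ℝ (Equiv.Perm K) :=
  ∑ r : rowGroup μ, single (T.permCongr r.1) 1

/-- The signed sum of the column group of a numbering `T` of the cells. -/
def colAlt (T : μ.cells ≃ K) : MonoidAlgebra ℝ (Equiv.Perm K) :=
  ∑ c : colGroup μ, single (T.permCongr c.1) ((Equiv.Perm.sign c.1 : ℤ) : ℝ)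

theorem permCongr_mul (T : μ.cells ≃ K) (a b : Equiv.Perm μ.cells) :
    T.permCongr (a * b) = T.permCongr a * T.permCongr b := by
  ext x; simp [Equiv.permCongr_apply]

theorem permCongr_inv (T : μ.cells ≃ K) (a : Equiv.Perm μ.cells) :
    T.permCongr a⁻¹ = (T.permCongr a)⁻¹ := by
  rw [eq_inv_iff_mul_eq_one, ← permCongr_mul, inv_mul_cancel]
  ext x; simp [Equiv.permCongr_apply]

theorem rowSym_mul_single (T : μ.cells ≃ K) {r : Equiv.Perm μ.cells} (hr : r ∈ rowGroup μ) :
    rowSym T * single (T.permCongr r) 1 = rowSym T := by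
  rw [rowSym, Finset.sum_mul]
  refine Fintype.sum_equiv (Equiv.mulRight (⟨r, hr⟩ : rowGroup μ)) _ _ fun x => ?_
  rw [single_mul_single, one_mul, ← permCongr_mul]
  rfl

theorem sign_mul_self' (c : Equiv.Perm μ.cells) :
    ((Equiv.Perm.sign c : ℤ) : ℝ) * ((Equiv.Perm.sign c : ℤ) : ℝ) = 1 := by
  rw [← Int.cast_mul, ← Units.val_mul, Int.units_mul_self]; simp

theorem single_mul_colAlt (T : μ.cells ≃ K) {c : Equiv.Perm μ.cells} (hc : c ∈ colGroup μ) :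
    single (T.permCongr c) 1 * colAlt T = ((Equiv.Perm.sign c : ℤ) : ℝ) • colAlt T := by
  rw [colAlt, Finset.mul_sum, Finset.smul_sum]
  refine Fintype.sum_equiv (Equiv.mulLeft (⟨c, hc⟩ : colGroup μ)) _ _ fun x => ?_
  rw [single_mul_single, one_mul, ← permCongr_mul, smul_single, Equiv.coe_mulLeft,
    Subgroup.coe_mul, Equiv.Perm.sign_mul]
  congr 1
  push_cast
  rw [smul_eq_mul, ← mul_assoc, sign_mul_self', one_mul]

theorem rev_rowSym (T : μ.cells ≃ K) : rev (rowSym T) = rowSym T := by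
  rw [rowSym, map_sum]
  refine Fintype.sum_equiv (Equiv.inv _) _ _ fun x => ?_
  rw [rev_single, Equiv.inv_apply, Subgroup.coe_inv, permCongr_inv]

theorem rev_colAlt (T : μ.cells ≃ K) : rev (colAlt T) = colAlt T := by
  rw [colAlt, map_sum]
  refine Fintype.sum_equiv (Equiv.inv _) _ _ fun x => ?_
  rw [rev_single, Equiv.inv_apply, Subgroup.coe_inv, permCongr_inv, Equiv.Perm.sign_inv]

theorem single_mul_rowSym (T : μ.cells ≃ K) {r : Equiv.Perm μ.cells} (hr : r ∈ rowGroup μ) :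
    single (T.permCongr r) 1 * rowSym T = rowSym T := by
  have := congrArg rev (rowSym_mul_single T (inv_mem hr))
  rwa [rev_mul, rev_rowSym, rev_single, permCongr_inv, inv_inv] at this

theorem single_mul_colAlt_trans (T : μ.cells ≃ K) (g : Equiv.Perm K) :
    single g 1 * colAlt T = colAlt (T.trans g) * single g 1 := by
  rw [colAlt, colAlt, Finset.mul_sum, Finset.sum_mul]
  refine Finset.sum_congr rfl fun c _ => ?_
  rw [single_mul_single, single_mul_single, one_mul, mul_one]
  congr 1
  ext x; simp [Equiv.permCongr_apply]

theorem single_mul_rowSym_trans (T : μ.cells ≃ K) (g : Equiv.Perm K) :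
    single g 1 * rowSym T = rowSym (T.trans g) * single g 1 := by
  rw [rowSym, rowSym, Finset.mul_sum, Finset.sum_mul]
  refine Finset.sum_congr rfl fun c _ => ?_
  rw [single_mul_single, single_mul_single, one_mul]
  congr 1
  ext x; simp [Equiv.permCongr_apply]

/-- The transposition of the two common elements is absorbed by the row sum with sign `1` and by the
column sum with sign `-1`. -/
theorem rowSym_mul_colAlt_eq_zero (T : μ.cells ≃ K) (S : ν.cells ≃ K) {y z : ν.cells}
    (hyz : y ≠ z) (hcol : y.1.2 = z.1.2)
    (hrow : (T.symm (S y)).1.1 = (T.symm (S z)).1.1) : rowSym T * colAlt S = 0 := by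
  have h1 : rowSym T * single (Equiv.swap (S y) (S z)) 1 = rowSym T := by
    have := rowSym_mul_single T (swap_mem_rowGroup hrow)
    rwa [Equiv.permCongr_def, Equiv.symm_trans_swap_trans, Equiv.apply_symm_apply,
      Equiv.apply_symm_apply] at this
  have h2 : single (Equiv.swap (S y) (S z)) 1 * colAlt S = -colAlt S := by
    have := single_mul_colAlt S (swap_mem_colGroup hcol)
    rw [Equiv.permCongr_def, Equiv.symm_trans_swap_trans, Equiv.Perm.sign_swap hyz] at this
    simpa using this
  have h3 : rowSym T * colAlt S = -(rowSym T * colAlt S) := by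
    conv_lhs => rw [← h1, mul_assoc, h2, mul_neg]
  have h4 : (2 : ℝ) • (rowSym T * colAlt S) = 0 := by
    rw [two_smul]
    nth_rewrite 1 [h3]
    exact neg_add_cancel _
  exact (smul_eq_zero.1 h4).resolve_left two_ne_zero

/-- If the product is nonzero, cells in one column of `S` lie in different rows of `T`. So the row
indices in `T`, read along `S`, fill `ν` with distinct entries in each column, and
`rowWeight_le_sum` applies. The numerical weight takes the place of the dominance order. -/
theorem rowSym_mul_colAlt_ne_zero {T : μ.cells ≃ K} {S : ν.cells ≃ K}
    (h : rowSym T * colAlt S ≠ 0) :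
    rowWeight ν ≤ rowWeight μ ∧ (rowWeight ν = rowWeight μ →
      ∃ c ∈ colGroup ν, ∀ y, (T.symm (S (c y))).1.1 = y.1.1) := by
  have := rowWeight_le_sum (f := fun y : ν.cells => (T.symm (S y)).1.1)
    (fun y z hcol hrow => by
      by_contra hyz
      exact h (rowSym_mul_colAlt_eq_zero T S hyz hcol hrow))
  have hs : ∑ y : ν.cells, (T.symm (S y)).1.1 = rowWeight μ :=
    Equiv.sum_comp (S.trans T.symm) fun y : μ.cells => y.1.1
  rwa [hs] at this

theorem eq_of_rowSym_mul_colAlt_ne_zero {T : μ.cells ≃ K} {S : ν.cells ≃ K}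
    (h : rowSym T * colAlt S ≠ 0) (hw : rowWeight ν = rowWeight μ) : ν = μ := by
  obtain ⟨c, -, hc⟩ := (rowSym_mul_colAlt_ne_zero h).2 hw
  refine youngDiagram_ext_rowLen fun i => ?_
  rw [rowLen_eq_card_filter, rowLen_eq_card_filter]
  refine Finset.card_equiv (c.trans (S.trans T.symm)) fun y => ?_
  simp [← hc y]

theorem rowSym_mul_mul_colAlt_eq_zero (T : μ.cells ≃ K) (S : ν.cells ≃ K)
    (h : ν ≠ μ) (hw : rowWeight μ ≤ rowWeight ν) (x : MonoidAlgebra ℝ (Equiv.Perm K)) :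
    rowSym T * x * colAlt S = 0 := by
  induction x using MonoidAlgebra.induction_on with
  | of g =>
    rw [MonoidAlgebra.of_apply, mul_assoc, single_mul_colAlt_trans, ← mul_assoc]
    suffices rowSym T * colAlt (S.trans g) = 0 by rw [this, zero_mul]
    by_contra hne
    have h1 := (rowSym_mul_colAlt_ne_zero hne).1
    exact h (eq_of_rowSym_mul_colAlt_ne_zero hne (le_antisymm h1 hw))
  | add x y hx hy => rw [mul_add, add_mul, hx, hy, add_zero]
  | smul r x hx => rw [mul_smul_comm, smul_mul_assoc, hx, smul_zero]

/-- For a single permutation `g` with nonzero product, the equality case of the weight estimate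
writes `g` as a row permutation times a column permutation. The two sums absorb these factors,
leaving a sign. -/
theorem exists_rowSym_mul_mul_colAlt (T : μ.cells ≃ K) (x : MonoidAlgebra ℝ (Equiv.Perm K)) :
    ∃ c : ℝ, rowSym T * x * colAlt T = c • (rowSym T * colAlt T) := by
  induction x using MonoidAlgebra.induction_on with
  | of g =>
    by_cases h0 : rowSym T * colAlt (T.trans g) = 0
    · refine ⟨0, ?_⟩
      rw [MonoidAlgebra.of_apply, mul_assoc, single_mul_colAlt_trans, ← mul_assoc, h0, zero_mul,
        zero_smul]
    · obtain ⟨c, hc, hcr⟩ := (rowSym_mul_colAlt_ne_zero h0).2 rfl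
      refine ⟨((Equiv.Perm.sign c : ℤ) : ℝ), ?_⟩
      have hr : T.permCongr.symm g * c ∈ rowGroup μ := hcr
      have hg : g = T.permCongr (T.permCongr.symm g * c) * T.permCongr c⁻¹ := by
        rw [← permCongr_mul, mul_inv_cancel_right, Equiv.apply_symm_apply]
      rw [MonoidAlgebra.of_apply]
      conv_lhs => rw [hg]
      have : (single (T.permCongr (T.permCongr.symm g * c) * T.permCongr c⁻¹) (1 : ℝ)) =
          single (T.permCongr (T.permCongr.symm g * c)) 1 * single (T.permCongr c⁻¹) 1 := by
        rw [single_mul_single, one_mul]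
      rw [this, ← mul_assoc, rowSym_mul_single T hr, mul_assoc, single_mul_colAlt T (inv_mem hc),
        Equiv.Perm.sign_inv, mul_smul_comm]
  | add x y hx hy =>
    obtain ⟨a, ha⟩ := hx
    obtain ⟨b, hb⟩ := hy
    exact ⟨a + b, by rw [mul_add, add_mul, ha, hb, add_smul]⟩
  | smul r x hx =>
    obtain ⟨a, ha⟩ := hx
    exact ⟨r * a, by rw [mul_smul_comm, smul_mul_assoc, ha, smul_smul]⟩

theorem rowSym_mul_rowSym (T : μ.cells ≃ K) :
    rowSym T * rowSym T = (Fintype.card (rowGroup μ) : ℝ) • rowSym T := by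
  have h : ∀ r : rowGroup μ, single (T.permCongr r.1) (1 : ℝ) * rowSym T = rowSym T :=
    fun r => single_mul_rowSym T r.2
  nth_rewrite 1 [rowSym]
  rw [Finset.sum_mul, Finset.sum_congr rfl fun r _ => h r]
  simp [← Nat.cast_smul_eq_nsmul ℝ]

theorem colAlt_mul_colAlt (T : μ.cells ≃ K) :
    colAlt T * colAlt T = (Fintype.card (colGroup μ) : ℝ) • colAlt T := by
  have h : ∀ c : colGroup μ,
      single (T.permCongr c.1) ((Equiv.Perm.sign c.1 : ℤ) : ℝ) * colAlt T = colAlt T := by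
    intro r
    have : (single (T.permCongr r.1) ((Equiv.Perm.sign r.1 : ℤ) : ℝ)) =
        ((Equiv.Perm.sign r.1 : ℤ) : ℝ) • single (T.permCongr r.1) (1 : ℝ) := by
      rw [smul_single, smul_eq_mul, mul_one]
    rw [this, smul_mul_assoc, single_mul_colAlt T r.2, smul_smul, sign_mul_self', one_smul]
  nth_rewrite 1 [colAlt]
  rw [Finset.sum_mul, Finset.sum_congr rfl fun r _ => h r]
  simp [← Nat.cast_smul_eq_nsmul ℝ]

/-- The self-adjoint version `b a b` of the Young symmetrizer `b a`. -/
def youngElt (T : μ.cells ≃ K) : MonoidAlgebra ℝ (Equiv.Perm K) :=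
  colAlt T * rowSym T * colAlt T

theorem rev_youngElt (T : μ.cells ≃ K) : rev (youngElt T) = youngElt T := by
  rw [youngElt, rev_mul, rev_mul, rev_rowSym, rev_colAlt, mul_assoc]

/-- The product contains both a factor `a_T … b_S` and a factor `b_T … a_S`. The comparison of the
row weights decides which of them vanishes; the second is the reversal of a factor of the first
kind. -/
theorem youngElt_mul_mul_youngElt_eq_zero (T : μ.cells ≃ K) (S : ν.cells ≃ K) (h : μ ≠ ν)
    (x : MonoidAlgebra ℝ (Equiv.Perm K)) : youngElt T * x * youngElt S = 0 := by
  rcases le_total (rowWeight μ) (rowWeight ν) with hw | hw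
  · have := rowSym_mul_mul_colAlt_eq_zero T S h.symm hw (colAlt T * x)
    calc _ = colAlt T * (rowSym T * (colAlt T * x) * colAlt S) * (rowSym S * colAlt S) := by
          simp only [youngElt, mul_assoc]
      _ = 0 := by rw [this, mul_zero, zero_mul]
  · have := congrArg rev (rowSym_mul_mul_colAlt_eq_zero S T h hw (rev (x * colAlt S)))
    rw [rev_mul, rev_mul, rev_rev, rev_rowSym, rev_colAlt, map_zero] at this
    calc _ = colAlt T * rowSym T * (colAlt T * ((x * colAlt S) * rowSym S)) * colAlt S := by
          simp only [youngElt, mul_assoc]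
      _ = 0 := by rw [this, mul_zero, zero_mul]

theorem exists_youngElt_mul_mul_youngElt (T : μ.cells ≃ K)
    (x : MonoidAlgebra ℝ (Equiv.Perm K)) :
    ∃ c : ℝ, youngElt T * x * youngElt T = c • youngElt T := by
  obtain ⟨c, hc⟩ := exists_rowSym_mul_mul_colAlt T (colAlt T * x * colAlt T * rowSym T)
  refine ⟨c, ?_⟩
  calc _ = colAlt T * (rowSym T * (colAlt T * x * colAlt T * rowSym T) * colAlt T) := by
        simp only [youngElt, mul_assoc]
    _ = _ := by rw [hc, mul_smul_comm, youngElt, mul_assoc]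

/-- A permutation that preserves both rows and columns is trivial, so that only the pair of
identities contributes. -/
theorem coeff_one_rowSym_mul_colAlt (T : μ.cells ≃ K) : (rowSym T * colAlt T).coeff 1 = 1 := by
  have h1 : ∀ (r : rowGroup μ) (c : colGroup μ), T.permCongr r.1 * T.permCongr c.1 = 1 →
      r = 1 ∧ c = 1 := by
    intro r c h
    rw [← permCongr_mul] at h
    have h' : r.1 * c.1 = 1 := by
      apply T.permCongr.injective
      rw [h]; ext x; simp [Equiv.permCongr_apply]
    have hc : c.1 = 1 := by
      ext1 y
      apply Subtype.ext
      have h2 : r.1 (c.1 y) = y := congrFun (congrArg DFunLike.coe h') y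
      have h3 := r.2 (c.1 y)
      rw [h2] at h3
      exact Prod.ext h3.symm (c.2 y)
    have hr : r.1 = 1 := by rwa [hc, mul_one] at h'
    exact ⟨Subtype.ext hr, Subtype.ext hc⟩
  rw [rowSym, colAlt, Finset.sum_mul_sum]
  simp only [single_mul_single, one_mul, coeff_sum, Finsupp.finsetSum_apply, coeff_single]
  rw [Finset.sum_eq_single 1, Finset.sum_eq_single 1]
  · have : T.permCongr (1 : rowGroup μ).1 * T.permCongr (1 : colGroup μ).1 = 1 := by
      ext x; simp [Equiv.permCongr_apply]
    rw [this]
    simp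
  · intro c _ hc
    rw [Finsupp.single_apply, if_neg fun h => hc (h1 _ _ h).2]
  · simp
  · intro r _ hr
    refine Finset.sum_eq_zero fun c _ => ?_
    rw [Finsupp.single_apply, if_neg fun h => hr (h1 _ _ h).1]
  · simp

theorem rowSym_mul_colAlt_self_ne_zero (T : μ.cells ≃ K) : rowSym T * colAlt T ≠ 0 := by
  intro h
  have := coeff_one_rowSym_mul_colAlt T
  rw [h] at this
  simp at this

/-- With `x = a b`, the element `rev x * x = b a a b` is the order of the row group times `b a b`,
and positivity applies. -/
theorem youngElt_ne_zero (T : μ.cells ≃ K) : youngElt T ≠ 0 := by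
  intro h
  have h1 := rev_mul_self_ne_zero (rowSym_mul_colAlt_self_ne_zero T)
  rw [rev_mul, rev_rowSym, rev_colAlt] at h1
  refine h1 ?_
  calc colAlt T * rowSym T * (rowSym T * colAlt T) =
        colAlt T * (rowSym T * rowSym T) * colAlt T := by simp only [mul_assoc]
    _ = (Fintype.card (rowGroup μ) : ℝ) • youngElt T := by
      rw [rowSym_mul_rowSym, mul_smul_comm, smul_mul_assoc, youngElt]
    _ = 0 := by rw [h, smul_zero]

theorem exists_youngElt_mul_youngElt (T : μ.cells ≃ K) :
    ∃ c : ℝ, c ≠ 0 ∧ youngElt T * youngElt T = c • youngElt T := by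
  obtain ⟨c, hc⟩ := exists_youngElt_mul_mul_youngElt T 1
  rw [mul_one] at hc
  refine ⟨c, ?_, hc⟩
  rintro rfl
  have := rev_mul_self_ne_zero (youngElt_ne_zero T)
  rw [rev_youngElt, hc, zero_smul] at this
  exact this rfl

/-- `b a b a` is a nonzero multiple of `b a`. -/
theorem exists_youngElt_mul_rowSym (T : μ.cells ≃ K) :
    ∃ c : ℝ, c ≠ 0 ∧ youngElt T * rowSym T = c • (colAlt T * rowSym T) := by
  obtain ⟨c, hc⟩ := exists_rowSym_mul_mul_colAlt T (colAlt T * rowSym T)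
  have h := congrArg rev hc
  simp only [map_smul, rev_mul, rev_rowSym, rev_colAlt] at h
  have h' : youngElt T * rowSym T = c • (colAlt T * rowSym T) := by
    rw [← h]; simp only [youngElt, mul_assoc]
  refine ⟨c, ?_, h'⟩
  rintro rfl
  obtain ⟨d, hd0, hd⟩ := exists_youngElt_mul_youngElt T
  -- Since `b b` is a multiple of `b`, the square of `b a b` is a multiple of `(b a b a) b`, so it
  -- would vanish together with `b a b a`.
  have h1 : youngElt T * youngElt T = 0 := by
    have h2 : youngElt T * (colAlt T * rowSym T * colAlt T) =
        (Fintype.card (colGroup μ) : ℝ) • (youngElt T * rowSym T * colAlt T) := by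
      calc _ = colAlt T * rowSym T * (colAlt T * colAlt T) * rowSym T * colAlt T := by
            simp only [youngElt, mul_assoc]
        _ = _ := by
          rw [colAlt_mul_colAlt]
          simp only [youngElt, mul_smul_comm, smul_mul_assoc]
    rw [h', zero_smul, zero_mul, smul_zero] at h2
    exact h2
  rw [h1] at hd
  exact smul_ne_zero hd0 (youngElt_ne_zero T) hd.symm

theorem single_mul_youngElt_trans (T : μ.cells ≃ K) (g : Equiv.Perm K) :
    single g 1 * youngElt T = youngElt (T.trans g) * single g 1 := by
  rw [youngElt, youngElt, ← mul_assoc, ← mul_assoc, single_mul_colAlt_trans,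
    mul_assoc (colAlt _) (single g 1), single_mul_rowSym_trans, ← mul_assoc,
    mul_assoc _ (single g 1), single_mul_colAlt_trans]
  simp only [mul_assoc]

end Young

/-! ### Completeness of the Young symmetrizers -/

theorem card_cellsOfRowLens (w : List ℕ) : (YoungDiagram.cellsOfRowLens w).card = w.sum := by
  induction w with
  | nil => rfl
  | cons a w ih =>
    rw [YoungDiagram.cellsOfRowLens, Finset.card_union_of_disjoint, Finset.card_map, ih]
    · simp
    · rw [Finset.disjoint_left]
      rintro ⟨i, j⟩ h1 h2
      simp only [Finset.mem_product, Finset.mem_singleton, Finset.mem_map] at h1 h2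
      obtain ⟨x, -, hx⟩ := h2
      have := congrArg Prod.fst hx
      simp only [Function.Embedding.prodMap, Function.Embedding.coeFn_mk, Prod.map_fst] at this
      omega

section

variable {K : Type*} [Fintype K] [DecidableEq K]

/-- The Young shape of the cycle type of a permutation. -/
def cycleShape (π : Equiv.Perm K) : YoungDiagram :=
  YoungDiagram.ofRowLens (π.partition.parts.sort (· ≥ ·))
    (Multiset.pairwise_sort _ _).sortedGE

theorem card_cycleShape (π : Equiv.Perm K) : (cycleShape π).card = Fintype.card K := by
  change (YoungDiagram.cellsOfRowLens _).card = _
  rw [card_cellsOfRowLens, ← Multiset.sum_coe, Multiset.sort_eq, π.partition.parts_sum]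

/-- The row lengths of the shape return the sorted cycle type. Thus there are at least as many
shapes as conjugacy classes, which is all that the dimension count below requires. -/
theorem cycleShape_eq_iff (π ρ : Equiv.Perm K) : cycleShape π = cycleShape ρ ↔ IsConj π ρ := by
  rw [Equiv.Perm.partition_eq_of_isConj]
  constructor
  · intro h
    have h1 := congrArg YoungDiagram.rowLens h
    have hpos : ∀ σ : Equiv.Perm K, ∀ x ∈ σ.partition.parts.sort (· ≥ ·), 0 < x :=
      fun σ x hx => σ.partition.parts_pos ((Multiset.mem_sort _).1 hx)
    rw [cycleShape, cycleShape, YoungDiagram.rowLens_ofRowLens_eq_self (hpos π),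
      YoungDiagram.rowLens_ofRowLens_eq_self (hpos ρ)] at h1
    have h2 := congrArg (fun l : List ℕ => (l : Multiset ℕ)) h1
    simp only [Multiset.sort_eq] at h2
    exact Nat.Partition.ext h2
  · intro h
    simp only [cycleShape, h]

open MonoidAlgebra

theorem coeff_conj_of_commute {G : Type*} [Group G] {x : MonoidAlgebra ℝ G}
    (hx : ∀ g, single g 1 * x = x * single g 1) (g h : G) :
    x.coeff (g * h * g⁻¹) = x.coeff h := by
  have h1 : (single g 1 * x).coeff (g * h) = (x * single g 1).coeff (g * h) := by rw [hx g]
  rw [coeff_single_mul_apply, coeff_mul_single_apply, one_mul, mul_one, inv_mul_cancel_left] at h1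
  exact h1.symm

/-- The unit of the group algebra of a symmetric group is a combination of Young
symmetrizers. -/
theorem exists_one_eq_sum_youngElt.{u} (K : Type u) [Fintype K] [DecidableEq K] :
    ∃ (ι : Type u) (_ : Fintype ι) (c : ι → ℝ) (μ : ι → YoungDiagram)
      (T : ∀ i, (μ i).cells ≃ K),
      (1 : MonoidAlgebra ℝ (Equiv.Perm K)) = ∑ i, c i • youngElt (T i) := by
  classical
  let r : ConjClasses (Equiv.Perm K) → Equiv.Perm K := Quotient.out
  have hr : ∀ κ, ConjClasses.mk (r κ) = κ := fun κ => Quotient.out_eq κ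
  let sh : ConjClasses (Equiv.Perm K) → YoungDiagram := fun κ => cycleShape (r κ)
  have hsh : Function.Injective sh := fun κ κ' h => by
    rw [← hr κ, ← hr κ', ConjClasses.mk_eq_mk_iff_isConj]
    exact (cycleShape_eq_iff _ _).1 h
  have hT : ∀ κ, Nonempty ((sh κ).cells ≃ K) := fun κ =>
    ⟨Fintype.equivOfCardEq (by rw [Fintype.card_coe]; exact card_cycleShape _)⟩
  let T : ∀ κ, (sh κ).cells ≃ K := fun κ => (hT κ).some
  -- Summing over all renumberings amounts to averaging over conjugates, so that these elements are
  -- central.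
  let z : ConjClasses (Equiv.Perm K) → MonoidAlgebra ℝ (Equiv.Perm K) := fun κ =>
    ∑ g : Equiv.Perm K, youngElt ((T κ).trans g)
  have hz' : ∀ κ, z κ = ∑ g : Equiv.Perm K, single g 1 * youngElt (T κ) * single g⁻¹ 1 := by
    intro κ
    refine Finset.sum_congr rfl fun g _ => ?_
    rw [single_mul_youngElt_trans, mul_assoc, single_mul_single, mul_inv_cancel, one_mul,
      ← one_def, mul_one]
  have hcomm : ∀ κ (g : Equiv.Perm K), single g 1 * z κ = z κ * single g 1 := by
    intro κ g
    simp only [z]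
    rw [Finset.mul_sum, Finset.sum_mul]
    refine Fintype.sum_equiv (Equiv.mulLeft g) _ _ fun h => ?_
    rw [single_mul_youngElt_trans]
    rfl
  have hzero : ∀ x : MonoidAlgebra ℝ (Equiv.Perm K),
      (∀ g, single g 1 * x = x * single g 1) → (∀ κ, x.coeff (r κ) = 0) → x = 0 := by
    intro x hx h0
    ext g
    obtain ⟨h, hh⟩ := isConj_iff.1 (ConjClasses.mk_eq_mk_iff_isConj.1 (hr (ConjClasses.mk g)))
    rw [← hh, coeff_conj_of_commute hx, h0]
    rfl
  have hcommsum : ∀ (c : ConjClasses (Equiv.Perm K) → ℝ) (g : Equiv.Perm K),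
      single g 1 * (∑ κ, c κ • z κ) = (∑ κ, c κ • z κ) * single g 1 := by
    intro c g
    rw [Finset.mul_sum, Finset.sum_mul]
    refine Finset.sum_congr rfl fun κ _ => ?_
    rw [mul_smul_comm, smul_mul_assoc, hcomm]
  -- Compression by the Young element of `κ` kills every other term. In its own term it leaves the
  -- coefficient `∑ γ(g)²`, positive because `γ 1 ≠ 0`.
  have hli : ∀ c : ConjClasses (Equiv.Perm K) → ℝ, ∑ κ, c κ • z κ = 0 → ∀ κ, c κ = 0 := by
    intro c hc κ
    choose γ hγ using fun g : Equiv.Perm K =>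
      exists_youngElt_mul_mul_youngElt (T κ) (single g 1)
    have hγinv : ∀ g, γ g⁻¹ = γ g := by
      intro g
      have h1 := congrArg rev (hγ g)
      simp only [rev_mul, rev_youngElt, rev_single, map_smul] at h1
      rw [← mul_assoc, hγ g⁻¹] at h1
      have h2 : (γ g⁻¹ - γ g) • youngElt (T κ) = 0 := by rw [sub_smul, h1, sub_self]
      exact sub_eq_zero.1 ((smul_eq_zero.1 h2).resolve_right (youngElt_ne_zero _))
    have hγ1 : γ 1 ≠ 0 := by
      intro h0
      obtain ⟨d, hd0, hd⟩ := exists_youngElt_mul_youngElt (T κ)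
      have h1 := hγ 1
      rw [h0, zero_smul, ← one_def, mul_one, hd] at h1
      exact smul_ne_zero hd0 (youngElt_ne_zero _) h1
    have h1 : ∀ κ', youngElt (T κ) * z κ' * youngElt (T κ) =
        if κ' = κ then (∑ g, γ g * γ g) • youngElt (T κ) else 0 := by
      intro κ'
      split_ifs with h
      · subst h
        rw [hz', Finset.mul_sum, Finset.sum_mul, Finset.sum_smul]
        refine Finset.sum_congr rfl fun g _ => ?_
        calc _ = (youngElt (T κ') * single g 1 * youngElt (T κ')) *
              single g⁻¹ 1 * youngElt (T κ') := by simp only [mul_assoc]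
          _ = _ := by
            rw [hγ, smul_mul_assoc, smul_mul_assoc, hγ, smul_smul, hγinv]
      · rw [hz', Finset.mul_sum, Finset.sum_mul]
        refine Finset.sum_eq_zero fun g _ => ?_
        rw [← mul_assoc, ← mul_assoc, youngElt_mul_mul_youngElt_eq_zero (T κ) (T κ')
          fun h' => h (hsh h'.symm), zero_mul, zero_mul]
    have h2 : youngElt (T κ) * (∑ κ', c κ' • z κ') * youngElt (T κ) =
        (c κ * ∑ g, γ g * γ g) • youngElt (T κ) := by
      rw [Finset.mul_sum, Finset.sum_mul, Finset.sum_eq_single κ]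
      · rw [mul_smul_comm, smul_mul_assoc, h1, if_pos rfl, smul_smul]
      · intro κ' _ hκ'
        rw [mul_smul_comm, smul_mul_assoc, h1, if_neg hκ', smul_zero]
      · simp
    rw [hc, mul_zero, zero_mul] at h2
    have h3 := (smul_eq_zero.1 h2.symm).resolve_right (youngElt_ne_zero _)
    have h4 : 0 < ∑ g, γ g * γ g := by
      refine Finset.sum_pos' (fun g _ => mul_self_nonneg _) ⟨1, Finset.mem_univ _, ?_⟩
      exact mul_self_pos.2 hγ1
    exact (mul_eq_zero.1 h3).resolve_right h4.ne'
  -- A central element is determined by its coefficients at class representatives. The elements `z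
  -- κ` are independent and as numerous as the classes, so their coefficient vectors span, and in
  -- particular yield the unit.
  let ev : ConjClasses (Equiv.Perm K) → ConjClasses (Equiv.Perm K) → ℝ := fun κ κ' =>
    (z κ).coeff (r κ')
  have hev : LinearIndependent ℝ ev := by
    rw [Fintype.linearIndependent_iff]
    intro c hc
    refine hli c (hzero _ (hcommsum c) fun κ' => ?_)
    have := congrFun hc κ'
    simpa [ev, coeff_sum, Finsupp.finsetSum_apply] using this
  have hspan := hev.span_eq_top_of_card_eq_finrank' (by simp)
  have hone : (fun κ' => (1 : MonoidAlgebra ℝ (Equiv.Perm K)).coeff (r κ')) ∈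
      Submodule.span ℝ (Set.range ev) := by rw [hspan]; trivial
  obtain ⟨c, hc⟩ := (Submodule.mem_span_range_iff_exists_fun ℝ).1 hone
  refine ⟨ConjClasses (Equiv.Perm K) × Equiv.Perm K, inferInstance, fun i => c i.1,
    fun i => sh i.1, fun i => (T i.1).trans i.2, ?_⟩
  rw [Fintype.sum_prod_type]
  have h1 : (1 : MonoidAlgebra ℝ (Equiv.Perm K)) = ∑ κ, c κ • z κ := by
    refine sub_eq_zero.1 (hzero _ (fun g => ?_) fun κ' => ?_)
    · rw [mul_sub, sub_mul, hcommsum, mul_one, one_mul]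
    · have := congrFun hc κ'
      simp only [ev, Finset.sum_apply, Pi.smul_apply] at this
      simp [coeff_sum, ← this]
  rw [h1]
  exact Finset.sum_congr rfl fun κ _ => by simp only [z, Finset.smul_sum]

end

/-! ### Row-equivalent and semistandard tableaux -/

section Tableaux

variable {μ : YoungDiagram} {m : ℕ}

theorem rowEquiv_refl (τ : Tableau μ m) : RowEquiv τ τ := ⟨1, one_mem _, rfl⟩

theorem rowEquiv_iff_card {τ' τ : Tableau μ m} :
    RowEquiv τ' τ ↔ ∀ (i : ℕ) (a : Fin m),
      (Finset.univ.filter fun x : μ.cells => x.1.1 = i ∧ τ' x = a).card =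
        (Finset.univ.filter fun x : μ.cells => x.1.1 = i ∧ τ x = a).card := by
  constructor
  · rintro ⟨r, hr, rfl⟩ i a
    refine Finset.card_equiv r fun x => ?_
    simp [hr x]
  · intro h
    let f : μ.cells → ℕ × Fin m := fun x => (x.1.1, τ' x)
    let g : μ.cells → ℕ × Fin m := fun x => (x.1.1, τ x)
    have e : ∀ c, Nonempty ({x // f x = c} ≃ {x // g x = c}) := by
      rintro ⟨i, a⟩
      refine ⟨Fintype.equivOfCardEq ?_⟩
      rw [Fintype.card_subtype, Fintype.card_subtype]
      simpa [f, g, Prod.ext_iff] using h i a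
    let r : Equiv.Perm μ.cells := Equiv.ofFiberEquiv fun c => (e c).some
    have hr : ∀ x, g (r x) = f x := fun x => Equiv.ofFiberEquiv_map _ x
    exact ⟨r, fun x => show (r x).1.1 = x.1.1 from (Prod.ext_iff.1 (hr x)).1, funext fun x => ((Prod.ext_iff.1 (hr x)).2).symm⟩

/-- Entries are nondecreasing in rows. -/
def RowWeak (τ : Tableau μ m) : Prop :=
  ∀ y z : μ.cells, y.1.1 = z.1.1 → y.1.2 ≤ z.1.2 → τ y ≤ τ z

theorem rowWeak_of_isMax {τ : Tableau μ m} {r : Equiv.Perm μ.cells} (hr : r ∈ rowGroup μ)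
    (hmax : ∀ r' ∈ rowGroup μ, ∑ x : μ.cells, x.1.2 * (τ (r' x) : ℕ) ≤
      ∑ x : μ.cells, x.1.2 * (τ (r x) : ℕ)) : RowWeak (τ ∘ r) := by
  intro y z hrow hcol
  rcases hcol.eq_or_lt with h | h
  · have : y = z := Subtype.ext (Prod.ext hrow h)
    rw [this]
  · exact sorted_of_isMax (a := fun x : μ.cells => x.1.2) (b := fun x => (τ x : ℕ)) hr hmax
      (swap_mem_rowGroup hrow) h

theorem exists_rowWeak (τ : Tableau μ m) : ∃ r ∈ rowGroup μ, RowWeak (τ ∘ r) := by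
  obtain ⟨r, hr, hmax⟩ := exists_isMax (rowGroup μ) (fun x => x.1.2) (fun x => (τ x : ℕ))
  exact ⟨r, hr, rowWeak_of_isMax hr hmax⟩

/-- In a nondecreasing row the entries at most `a` occupy an initial segment. Hence the numbers of
such entries recover the row, and a row-weak tableau is unique in its class of row equivalence. -/
theorem RowWeak.le_iff {τ : Tableau μ m} (h : RowWeak τ) (y : μ.cells) (a : Fin m) :
    τ y ≤ a ↔
      y.1.2 < (Finset.univ.filter fun x : μ.cells => x.1.1 = y.1.1 ∧ τ x ≤ a).card := by
  have hcard : ∀ k, k ≤ μ.rowLen y.1.1 →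
      (Finset.univ.filter fun x : μ.cells => x.1.1 = y.1.1 ∧ x.1.2 < k).card = k := by
    intro k hk
    rw [← Finset.card_range k]
    refine Finset.card_bij (fun x _ => x.1.2) ?_ ?_ ?_
    · intro x hx; simpa using (Finset.mem_filter.1 hx).2.2
    · intro x hx z hz hxz
      exact Subtype.ext (Prod.ext ((Finset.mem_filter.1 hx).2.1.trans
        (Finset.mem_filter.1 hz).2.1.symm) hxz)
    · intro j hj
      have hj' := Finset.mem_range.1 hj
      exact ⟨⟨(y.1.1, j), YoungDiagram.mem_iff_lt_rowLen.2 (hj'.trans_le hk)⟩,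
        by simpa using hj', rfl⟩
  have hy : y.1.2 < μ.rowLen y.1.1 := YoungDiagram.mem_iff_lt_rowLen.1 y.2
  constructor
  · intro hya
    rw [Nat.lt_iff_add_one_le, ← hcard (y.1.2 + 1) hy]
    refine Finset.card_le_card fun x hx => ?_
    simp only [Finset.mem_filter, Finset.mem_univ, true_and] at hx ⊢
    exact ⟨hx.1, (h x y hx.1 (by omega)).trans hya⟩
  · intro hlt
    by_contra hya
    refine absurd hlt (not_lt.2 ?_)
    conv_rhs => rw [← hcard y.1.2 hy.le]
    refine Finset.card_le_card fun x hx => ?_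
    simp only [Finset.mem_filter, Finset.mem_univ, true_and] at hx ⊢
    refine ⟨hx.1, ?_⟩
    by_contra hle
    exact hya ((h y x hx.1.symm (not_lt.1 hle)).trans hx.2)

theorem RowWeak.eq_of_rowEquiv {τ τ' : Tableau μ m} (h : RowWeak τ) (h' : RowWeak τ')
    (hE : RowEquiv τ' τ) : τ' = τ := by
  obtain ⟨r, hr, hE⟩ := hE
  have hcard : ∀ i a, (Finset.univ.filter fun x : μ.cells => x.1.1 = i ∧ τ' x ≤ a).card =
      (Finset.univ.filter fun x : μ.cells => x.1.1 = i ∧ τ x ≤ a).card := by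
    intro i a
    refine Finset.card_equiv r fun x => ?_
    simp [hr x, hE]
  funext y
  apply le_antisymm
  · rw [h'.le_iff, hcard, ← h.le_iff]
  · rw [h.le_iff, ← hcard, ← h'.le_iff]

/-- Any rearrangement within rows that maximizes the column statistic is row-weak, and by uniqueness
it is `τ` itself. -/
theorem RowWeak.sum_comp_le {τ : Tableau μ m} (h : RowWeak τ) {r : Equiv.Perm μ.cells}
    (hr : r ∈ rowGroup μ) :
    ∑ x : μ.cells, x.1.2 * (τ (r x) : ℕ) ≤ ∑ x : μ.cells, x.1.2 * (τ x : ℕ) ∧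
      (∑ x : μ.cells, x.1.2 * (τ (r x) : ℕ) = ∑ x : μ.cells, x.1.2 * (τ x : ℕ) → τ ∘ r = τ) := by
  obtain ⟨r₀, hr₀, hmax⟩ := exists_isMax (rowGroup μ) (fun x => x.1.2) (fun x => (τ x : ℕ))
  have h0 : τ ∘ r₀ = τ := h.eq_of_rowEquiv (rowWeak_of_isMax hr₀ hmax) ⟨r₀, hr₀, rfl⟩
  have h1 : ∑ x : μ.cells, x.1.2 * (τ (r₀ x) : ℕ) = ∑ x : μ.cells, x.1.2 * (τ x : ℕ) :=
    Finset.sum_congr rfl fun x _ => by rw [← congrFun h0 x]; rfl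
  rw [h1] at hmax
  refine ⟨hmax r hr, fun heq => ?_⟩
  rw [← heq] at hmax
  exact h.eq_of_rowEquiv (rowWeak_of_isMax hr hmax) ⟨r, hr, rfl⟩

/-- Both fillings increase down the columns, so `c` preserves the order within each column. This
gives `row ≤ row ∘ c`, and the equality of the sums forces equality everywhere. -/
theorem eq_one_of_strict {τ : Tableau μ m} {c : Equiv.Perm μ.cells} (hc : c ∈ colGroup μ)
    (h : ∀ y z : μ.cells, y.1.2 = z.1.2 → y.1.1 < z.1.1 → τ y < τ z)
    (h' : ∀ y z : μ.cells, y.1.2 = z.1.2 → y.1.1 < z.1.1 → τ (c y) < τ (c z)) : c = 1 := by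
  have hle : ∀ y, y.1.1 ≤ (c y).1.1 := row_le_of_strict fun y z hcol hlt => by
    by_contra! hge
    have hcol' : (c z).1.2 = (c y).1.2 := (hc z).trans (hcol.symm.trans (hc y).symm)
    rcases hge.eq_or_lt with he | hl
    · have : c z = c y := Subtype.ext (Prod.ext he hcol')
      rw [c.injective this] at hlt
      exact lt_irrefl _ hlt
    · exact lt_asymm (h' y z hcol hlt) (h _ _ hcol' hl)
  have hsum : ∑ y : μ.cells, y.1.1 = ∑ y, (c y).1.1 :=
    (Equiv.sum_comp c fun y : μ.cells => y.1.1).symm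
  ext1 y
  exact Subtype.ext (Prod.ext ((Finset.sum_eq_sum_iff_of_le fun y _ => hle y).1 hsum y
    (Finset.mem_univ _)).symm (hc y))

/-- The sum of column index times entry does not change under column permutations, and among row
rearrangements it is maximal exactly at the nondecreasing one. So it orders the semistandard
tableaux in a way that makes symmetrization triangular. -/
theorem semistandard_triangular {σ τ : Tableau μ m} (hσ : IsSemistandard σ)
    (hτ : IsSemistandard τ) {r c : Equiv.Perm μ.cells} (hr : r ∈ rowGroup μ)
    (hc : c ∈ colGroup μ) (h : τ ∘ r ∘ c = σ) :
    ∑ x : μ.cells, x.1.2 * (σ x : ℕ) ≤ ∑ x : μ.cells, x.1.2 * (τ x : ℕ) ∧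
      (∑ x : μ.cells, x.1.2 * (σ x : ℕ) = ∑ x : μ.cells, x.1.2 * (τ x : ℕ) →
        τ ∘ r = τ ∧ c = 1 ∧ σ = τ) := by
  have h1 : ∑ x : μ.cells, x.1.2 * (σ x : ℕ) = ∑ x : μ.cells, x.1.2 * (τ (r x) : ℕ) := by
    rw [← Equiv.sum_comp c fun x : μ.cells => x.1.2 * (τ (r x) : ℕ)]
    refine Finset.sum_congr rfl fun x _ => ?_
    rw [hc x, ← congrFun h x]
    rfl
  have h2 := RowWeak.sum_comp_le hτ.1 hr
  rw [h1]
  refine ⟨h2.1, fun heq => ?_⟩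
  have h3 := h2.2 heq
  have h4 : τ ∘ c = σ := by rw [← h, ← Function.comp_assoc, h3]
  have h5 : c = 1 := eq_one_of_strict hc hτ.2 fun y z hcol hlt => by
    have := hσ.2 y z hcol hlt
    rwa [← h4] at this
  refine ⟨h3, h5, ?_⟩
  rw [← h4, h5]
  rfl

/-! ### Straightening -/

open Classical in
/-- The Young symmetrization of a family of vectors indexed by tableaux. -/
def symAlt {N : Type*} [AddCommGroup N] [Module ℝ N] (t : Tableau μ m → N) (τ : Tableau μ m) : N :=
  ∑ r : rowGroup μ, ∑ c : colGroup μ, ((Equiv.Perm.sign c.1 : ℤ) : ℝ) • t (τ ∘ r.1 ∘ c.1)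

open Classical in
/-- The normalization of `symAlt` that runs over row-equivalent tableaux. -/
def symAltRow {N : Type*} [AddCommGroup N] [Module ℝ N] (t : Tableau μ m → N)
    (τ : Tableau μ m) : N :=
  ∑ τ' : {τ' : Tableau μ m // RowEquiv τ' τ}, ∑ c : colGroup μ,
    ((Equiv.Perm.sign c.1 : ℤ) : ℝ) • t (τ'.1 ∘ c.1)

variable {N : Type*} [AddCommGroup N] [Module ℝ N]

/-- The factor is the order of the stabilizer of `τ` in the row group, since each row-equivalent
tableau arises that many times. It depends on `τ` only, not on the vectors. -/
theorem exists_symAlt_eq_smul (τ : Tableau μ m) : ∃ k : ℝ, k ≠ 0 ∧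
    ∀ {N : Type*} [AddCommGroup N] [Module ℝ N] (t : Tableau μ m → N),
      symAlt t τ = k • symAltRow t τ := by
  classical
  let S : Finset (rowGroup μ) := Finset.univ.filter fun r => τ ∘ r.1 = τ
  have hS : S.Nonempty := ⟨1, by simp [S]⟩
  refine ⟨S.card, by exact_mod_cast hS.card_pos.ne', ?_⟩
  intro N _ _ t
  let F : Tableau μ m → N := fun τ' =>
    ∑ c : colGroup μ, ((Equiv.Perm.sign c.1 : ℤ) : ℝ) • t (τ' ∘ c.1)
  let p : rowGroup μ → {τ' : Tableau μ m // RowEquiv τ' τ} := fun r =>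
    ⟨τ ∘ r.1, r.1, r.2, rfl⟩
  change ∑ r : rowGroup μ, F (p r).1 = (S.card : ℝ) • ∑ τ' : {τ' // RowEquiv τ' τ}, F τ'.1
  rw [← Finset.sum_fiberwise (s := Finset.univ) (g := p), Finset.smul_sum]
  refine Finset.sum_congr rfl fun τ' _ => ?_
  rw [Finset.sum_congr rfl (g := fun _ => F τ'.1)
    (fun r hr => by rw [(Finset.mem_filter.1 hr).2]), Finset.sum_const, Nat.cast_smul_eq_nsmul]
  congr 1
  obtain ⟨τ', r₀, hr₀, rfl⟩ := τ'
  refine Finset.card_equiv (Equiv.mulRight (⟨r₀, hr₀⟩ : rowGroup μ)⁻¹) fun r => ?_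
  simp only [Finset.mem_filter, Finset.mem_univ, true_and, S]
  constructor
  · intro h
    funext x
    have := congrFun (congrArg Subtype.val h) (r₀⁻¹ x)
    simpa [p] using this
  · intro h
    refine Subtype.ext (funext fun x => ?_)
    have := congrFun h (r₀ x)
    simpa [p] using this

theorem symAlt_comp_row (t : Tableau μ m → N) (τ : Tableau μ m) {r : Equiv.Perm μ.cells}
    (hr : r ∈ rowGroup μ) : symAlt t (τ ∘ r) = symAlt t τ := by
  classical
  rw [symAlt, symAlt]
  exact Fintype.sum_equiv (Equiv.mulLeft (⟨r, hr⟩ : rowGroup μ)) _ _ fun r' => rfl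

theorem symAlt_eq_of_rowEquiv (t : Tableau μ m → N) {τ τ' : Tableau μ m}
    (h : RowEquiv τ' τ) : symAlt t τ' = symAlt t τ := by
  obtain ⟨r, hr, rfl⟩ := h
  exact symAlt_comp_row t τ hr

/-- The permutations that move only cells in `D`. -/
def supportedIn (D : Finset μ.cells) : Subgroup (Equiv.Perm μ.cells) where
  carrier := {π | ∀ x ∉ D, π x = x}
  one_mem' := fun _ _ => rfl
  mul_mem' := fun {a b} ha hb x hx => by
    rw [Equiv.Perm.mul_apply, hb x hx, ha x hx]
  inv_mem' := fun {a} ha x hx => by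
    rw [Equiv.Perm.inv_eq_iff_eq, ha x hx]

theorem apply_mem_of_mem_supportedIn {D : Finset μ.cells} {π : Equiv.Perm μ.cells}
    (h : π ∈ supportedIn D) {x : μ.cells} (hx : x ∈ D) : π x ∈ D := by
  by_contra hD
  have := h _ hD
  rw [π.injective this] at hD
  exact hD hx

open Classical in
/-- The Garnir relation. -/
theorem sum_symAlt_eq_zero (t : Tableau μ m → N) (τ : Tableau μ m) (D : Finset μ.cells)
    (hD : ∀ r ∈ rowGroup μ, ∃ y ∈ D, ∃ z ∈ D, y ≠ z ∧ (r y).1.2 = (r z).1.2) :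
    ∑ σ : supportedIn D, symAlt t (τ ∘ σ.1) = 0 := by
  simp only [symAlt]
  rw [Finset.sum_comm]
  refine Finset.sum_eq_zero fun r _ => ?_
  obtain ⟨y, hy, z, hz, hyz, hcol⟩ := hD r.1⁻¹ (inv_mem r.2)
  let s : supportedIn D := ⟨Equiv.swap y z, fun x hx => Equiv.swap_apply_of_ne_of_ne
    (fun h => hx (h ▸ hy)) (fun h => hx (h ▸ hz))⟩
  let s' : colGroup μ := ⟨Equiv.swap (r.1⁻¹ y) (r.1⁻¹ z), swap_mem_colGroup hcol⟩
  have hs' : Equiv.Perm.sign s'.1 = -1 :=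
    Equiv.Perm.sign_swap fun h => hyz (r.1⁻¹.injective h)
  have hcomm : s.1 * r.1 = r.1 * s'.1 := by
    change Equiv.swap y z * r.1 = r.1 * Equiv.swap (r.1⁻¹ y) (r.1⁻¹ z)
    rw [Equiv.mul_swap_eq_swap_mul]
    simp
  set S := ∑ σ : supportedIn D, ∑ c : colGroup μ,
    ((Equiv.Perm.sign c.1 : ℤ) : ℝ) • t ((τ ∘ σ.1) ∘ r.1 ∘ c.1) with hS
  -- The swap inside `D`, multiplied into `σ`, and the corresponding swap of two cells of one
  -- column, multiplied into `c`, leave the tableau unchanged but reverse the sign.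
  have h1 : S = -S := by
    conv_rhs => rw [hS, ← Equiv.sum_comp (Equiv.mulRight s)]
    rw [hS, ← Finset.sum_neg_distrib]
    refine Finset.sum_congr rfl fun σ _ => ?_
    rw [← Equiv.sum_comp (Equiv.mulLeft s'), ← Finset.sum_neg_distrib]
    refine Finset.sum_congr rfl fun c _ => ?_
    rw [Equiv.coe_mulLeft, Equiv.coe_mulRight, Subgroup.coe_mul, Subgroup.coe_mul,
      Equiv.Perm.sign_mul, hs', ← neg_smul]
    congr 1
    · push_cast; ring
    · congr 1
      funext x
      have := congrArg (fun π : Equiv.Perm μ.cells => τ (σ.1 (π (c.1 x)))) hcomm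
      exact this.symm
  have h2 : (2 : ℝ) • S = 0 := by
    rw [two_smul]
    nth_rewrite 1 [h1]
    exact neg_add_cancel _
  exact (smul_eq_zero.1 h2).resolve_left two_ne_zero

/-- A rearrangement that moves large entries to lower rows increases the row statistic, strictly
unless it is a row equivalence. -/
theorem le_sum_row_of_threshold {τ : Tableau μ m} {σ : Equiv.Perm μ.cells} (t : Fin m)
    (h : ∀ x, 0 ≤ ((x.1.1 : ℤ) - (σ x).1.1) * (((τ (σ x) : ℕ) : ℤ) - (t : ℕ))) :
    ∑ x : μ.cells, x.1.1 * (τ x : ℕ) ≤ ∑ x : μ.cells, x.1.1 * (τ (σ x) : ℕ) ∧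
      (∑ x : μ.cells, x.1.1 * (τ x : ℕ) = ∑ x : μ.cells, x.1.1 * (τ (σ x) : ℕ) →
        RowEquiv (τ ∘ σ) τ) := by
  -- The threshold drops out since `σ` preserves the sum of the row indices. What remains is the
  -- change of the statistic, written as a sum of nonnegative terms.
  have h1 : ∑ x : μ.cells, ((x.1.1 : ℤ) - (σ x).1.1) * (((τ (σ x) : ℕ) : ℤ) - (t : ℕ)) =
      ((∑ x : μ.cells, x.1.1 * (τ (σ x) : ℕ) : ℕ) : ℤ) -
        ((∑ x : μ.cells, x.1.1 * (τ x : ℕ) : ℕ) : ℤ) := by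
    have e1 : ∑ x : μ.cells, ((σ x).1.1 : ℤ) = ∑ x : μ.cells, (x.1.1 : ℤ) :=
      Equiv.sum_comp σ fun x : μ.cells => (x.1.1 : ℤ)
    have e2 : ∑ x : μ.cells, ((σ x).1.1 : ℤ) * ((τ (σ x) : ℕ) : ℤ) =
        ∑ x : μ.cells, (x.1.1 : ℤ) * ((τ x : ℕ) : ℤ) :=
      Equiv.sum_comp σ fun x : μ.cells => (x.1.1 : ℤ) * ((τ x : ℕ) : ℤ)
    push_cast
    rw [← e2]
    have : ∀ x : μ.cells, ((x.1.1 : ℤ) - (σ x).1.1) * (((τ (σ x) : ℕ) : ℤ) - (t : ℕ)) =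
        (x.1.1 : ℤ) * ((τ (σ x) : ℕ) : ℤ) - ((σ x).1.1 : ℤ) * ((τ (σ x) : ℕ) : ℤ) -
          ((x.1.1 : ℤ) - (σ x).1.1) * (t : ℕ) := fun x => by ring
    rw [Finset.sum_congr rfl fun x _ => this x, Finset.sum_sub_distrib, Finset.sum_sub_distrib,
      ← Finset.sum_mul, Finset.sum_sub_distrib, e1]
    ring
  have h2 := Finset.sum_nonneg fun x (_ : x ∈ Finset.univ) => h x
  rw [h1] at h2
  refine ⟨by omega, fun heq => ?_⟩
  have h3 : ∑ x : μ.cells, ((x.1.1 : ℤ) - (σ x).1.1) * (((τ (σ x) : ℕ) : ℤ) - (t : ℕ)) = 0 := by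
    rw [h1]; omega
  have h4 : ∀ x, x.1.1 = (σ x).1.1 ∨ τ (σ x) = t := by
    intro x
    have := (Finset.sum_eq_zero_iff_of_nonneg fun x _ => h x).1 h3 x (Finset.mem_univ _)
    rcases mul_eq_zero.1 this with h5 | h5
    · left; omega
    · right; ext; omega
  -- In the case of equality only entries equal to `t` change rows. The content of each row is then
  -- preserved for the other values, and for `t` by taking complements.
  have key : ∀ (i : ℕ) (p : Fin m → Prop) [DecidablePred p], (∀ a, p a → a ≠ t) →
      (Finset.univ.filter fun x : μ.cells => x.1.1 = i ∧ p (τ (σ x))).card =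
        (Finset.univ.filter fun x : μ.cells => x.1.1 = i ∧ p (τ x)).card := by
    intro i p _ hp
    refine Finset.card_equiv σ fun x => ?_
    simp only [Finset.mem_filter, Finset.mem_univ, true_and]
    refine and_congr_left fun hpx => ?_
    rw [(h4 x).resolve_right (hp _ hpx)]
  rw [rowEquiv_iff_card]
  intro i a
  by_cases ha : a = t
  · subst ha
    have hk := key i (fun b => b ≠ a) fun b hb => hb
    have hsplit : ∀ f : Tableau μ m,
        (Finset.univ.filter fun x : μ.cells => x.1.1 = i ∧ f x = a).card +
          (Finset.univ.filter fun x : μ.cells => x.1.1 = i ∧ f x ≠ a).card =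
        (Finset.univ.filter fun x : μ.cells => x.1.1 = i).card := by
      intro f
      rw [← Finset.card_filter_add_card_filter_not (s := Finset.univ.filter
        fun x : μ.cells => x.1.1 = i) (p := fun x => f x = a), Finset.filter_filter,
        Finset.filter_filter]
    have s1 := hsplit (τ ∘ σ)
    have s2 := hsplit τ
    simp only [Function.comp_apply] at s1 ⊢
    omega
  · exact key i (fun b => b = a) fun b hb => hb ▸ ha

theorem exists_adjacent_of_not_semistandard {τ : Tableau μ m} (hw : RowWeak τ)
    (h : ¬ IsSemistandard τ) :
    ∃ y z : μ.cells, y.1.2 = z.1.2 ∧ z.1.1 = y.1.1 + 1 ∧ τ z ≤ τ y := by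
  by_contra! hadj
  refine h ⟨hw, fun y z hcol hlt => ?_⟩
  suffices H : ∀ (k : ℕ) (z : μ.cells), y.1.2 = z.1.2 → z.1.1 = y.1.1 + k + 1 → τ y < τ z from
    H (z.1.1 - y.1.1 - 1) z hcol (by omega)
  intro k
  induction k with
  | zero => intro z hz1 hz2; exact hadj y z hz1 hz2
  | succ k ih =>
    intro z hz1 hz2
    have hmem : (y.1.1 + k + 1, z.1.2) ∈ μ.cells := by
      refine μ.up_left_mem (i2 := z.1.1) (j2 := z.1.2) (by omega) le_rfl ?_
      exact z.2
    exact (ih ⟨_, hmem⟩ hz1 rfl).trans (hadj ⟨_, hmem⟩ z rfl hz2)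

/-- Straightening: the symmetrizations of the semistandard tableaux span all symmetrizations. -/
theorem symAlt_mem_span (t : Tableau μ m → N) (τ : Tableau μ m) :
    symAlt t τ ∈ Submodule.span ℝ (Set.range fun σ : SST μ m => symAlt t σ.1) := by
  classical
  -- A bound for the statistic row index times entry, which straightening increases; the induction
  -- runs over the distance to this bound.
  let B : ℕ := ∑ x : μ.cells, x.1.1 * m
  have hB : ∀ τ : Tableau μ m, ∑ x : μ.cells, x.1.1 * (τ x : ℕ) ≤ B := fun τ =>
    Finset.sum_le_sum fun x _ => Nat.mul_le_mul_left _ (τ x).2.le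
  suffices H : ∀ (k : ℕ) (τ : Tableau μ m), B - ∑ x : μ.cells, x.1.1 * (τ x : ℕ) = k →
      symAlt t τ ∈ Submodule.span ℝ (Set.range fun σ : SST μ m => symAlt t σ.1) from H _ τ rfl
  intro k
  induction k using Nat.strong_induction_on with
  | _ k ih =>
  intro τ hk
  obtain ⟨r, hr, hw⟩ := exists_rowWeak τ
  rw [← symAlt_comp_row t τ hr]
  have hk' : B - ∑ x : μ.cells, x.1.1 * ((τ ∘ r) x : ℕ) = k := by
    rw [← hk]
    congr 1
    rw [← Equiv.sum_comp r fun x : μ.cells => x.1.1 * (τ x : ℕ)]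
    exact Finset.sum_congr rfl fun x _ => by rw [hr x]; rfl
  generalize τ ∘ r = τ at hw hk'
  by_cases hs : IsSemistandard τ
  · exact Submodule.subset_span ⟨⟨τ, hs⟩, rfl⟩
  obtain ⟨y, z, hcol, hrow, hle⟩ := exists_adjacent_of_not_semistandard hw hs
  -- The Garnir set of the violation at `y` above `z`: the end of the upper row from `y` on, and the
  -- beginning of the lower row up to `z`. It has more cells than the upper row has columns, so that
  -- after any row permutation two of its cells share a column.
  let A : Finset μ.cells := Finset.univ.filter fun x => x.1.1 = y.1.1 ∧ y.1.2 ≤ x.1.2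
  let A' : Finset μ.cells := Finset.univ.filter fun x => x.1.1 = z.1.1 ∧ x.1.2 ≤ z.1.2
  have hdisj : Disjoint A A' := by
    rw [Finset.disjoint_left]
    intro x hx hx'
    have h1 := (Finset.mem_filter.1 hx).2.1
    have h2 := (Finset.mem_filter.1 hx').2.1
    omega
  let D := A ∪ A'
  have hy : y.1.2 < μ.rowLen y.1.1 := YoungDiagram.mem_iff_lt_rowLen.1 y.2
  have hz : z.1.2 < μ.rowLen z.1.1 := YoungDiagram.mem_iff_lt_rowLen.1 z.2
  have hanti : μ.rowLen z.1.1 ≤ μ.rowLen y.1.1 := μ.rowLen_anti _ _ (by omega)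
  have hA : μ.rowLen y.1.1 - y.1.2 ≤ A.card := by
    rw [← Nat.card_Ico]
    refine Finset.card_le_card_of_surjOn (fun x => x.1.2) fun j hj => ?_
    have hj' := Finset.mem_Ico.1 hj
    exact ⟨⟨(y.1.1, j), YoungDiagram.mem_iff_lt_rowLen.2 hj'.2⟩, by simp [A, hj'.1], rfl⟩
  have hA' : z.1.2 + 1 ≤ A'.card := by
    conv_lhs => rw [← Finset.card_range (z.1.2 + 1)]
    refine Finset.card_le_card_of_surjOn (fun x => x.1.2) fun j hj => ?_
    have hj' := Finset.mem_range.1 hj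
    exact ⟨⟨(z.1.1, j), YoungDiagram.mem_iff_lt_rowLen.2 (by omega)⟩,
      by simp only [A', Finset.coe_filter, Finset.mem_univ, true_and, Set.mem_ofPred_eq]; omega, rfl⟩
  have hDcard : μ.rowLen y.1.1 < D.card := by
    rw [Finset.card_union_of_disjoint hdisj]
    omega
  have hDrow : ∀ x ∈ D, x.1.1 = y.1.1 ∨ x.1.1 = z.1.1 := by
    intro x hx
    rcases Finset.mem_union.1 hx with h | h
    · exact Or.inl (Finset.mem_filter.1 h).2.1
    · exact Or.inr (Finset.mem_filter.1 h).2.1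
  have hgarnir := sum_symAlt_eq_zero t τ D fun r hr => by
    have hmaps : ∀ x ∈ D, (r x).1.2 ∈ Finset.range (μ.rowLen y.1.1) := by
      intro x hx
      have h1 : (r x).1.2 < μ.rowLen (r x).1.1 := YoungDiagram.mem_iff_lt_rowLen.1 (r x).2
      rw [hr x] at h1
      rw [Finset.mem_range]
      rcases hDrow x hx with h | h
      · rwa [h] at h1
      · rw [h] at h1; exact h1.trans_le hanti
    obtain ⟨a, ha, b, hb, hab, h⟩ := Finset.exists_ne_map_eq_of_card_lt_of_maps_to
      (by rwa [Finset.card_range]) hmaps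
    exact ⟨a, ha, b, hb, hab, h⟩
  have hlarge : ∀ x ∈ D, x.1.1 = y.1.1 → τ y ≤ τ x := by
    intro x hx hxr
    rcases Finset.mem_union.1 hx with h | h
    · exact hw y x hxr.symm (Finset.mem_filter.1 h).2.2
    · have := (Finset.mem_filter.1 h).2.1; omega
  have hsmall : ∀ x ∈ D, x.1.1 = z.1.1 → τ x ≤ τ y := by
    intro x hx hxr
    rcases Finset.mem_union.1 hx with h | h
    · have := (Finset.mem_filter.1 h).2.1; omega
    · exact (hw x z hxr (Finset.mem_filter.1 h).2.2).trans hle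
  -- Entries of `D` in the upper row are at least `τ y` and those in the lower row are at most `τ
  -- y`. So an exchange between the rows moves the larger entries downwards.
  have hthr : ∀ σ ∈ supportedIn D, ∀ x,
      0 ≤ ((x.1.1 : ℤ) - (σ x).1.1) * (((τ (σ x) : ℕ) : ℤ) - (τ y : ℕ)) := by
    intro σ hσ x
    by_cases hx : x ∈ D
    swap
    · rw [hσ x hx, sub_self, zero_mul]
    have hσx := apply_mem_of_mem_supportedIn hσ hx
    rcases hDrow x hx with h1 | h1 <;> rcases hDrow _ hσx with h2 | h2
    · rw [h1, h2, sub_self, zero_mul]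
    · have h3 : (τ (σ x) : ℕ) ≤ τ y := hsmall _ hσx h2
      refine mul_nonneg_of_nonpos_of_nonpos ?_ ?_ <;> omega
    · have h3 : (τ y : ℕ) ≤ τ (σ x) := hlarge _ hσx h2
      refine mul_nonneg ?_ ?_ <;> omega
    · rw [h1, h2, sub_self, zero_mul]
  -- In the Garnir relation the terms row-equivalent to `τ` add up to a positive multiple of the
  -- symmetrization of `τ`, because the identity is among them. All other terms have a larger
  -- statistic.
  let E : Finset (supportedIn D) := Finset.univ.filter fun σ => RowEquiv (τ ∘ σ.1) τ
  rw [← Finset.sum_filter_add_sum_filter_not _ (fun σ : supportedIn D => RowEquiv (τ ∘ σ.1) τ),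
    Finset.sum_congr rfl (fun σ hσ => symAlt_eq_of_rowEquiv t (Finset.mem_filter.1 hσ).2),
    Finset.sum_const] at hgarnir
  have hE : 0 < E.card := Finset.card_pos.2 ⟨1, by simpa [E] using rowEquiv_refl τ⟩
  have hrest : ∑ σ : supportedIn D with ¬ RowEquiv (τ ∘ σ.1) τ, symAlt t (τ ∘ σ.1) ∈
      Submodule.span ℝ (Set.range fun σ : SST μ m => symAlt t σ.1) := by
    refine Submodule.sum_mem _ fun σ hσ => ?_
    have hne := (Finset.mem_filter.1 hσ).2
    have h1 := le_sum_row_of_threshold (τ y) (hthr σ.1 σ.2)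
    have h2 : ∑ x : μ.cells, x.1.1 * (τ x : ℕ) ≠ ∑ x : μ.cells, x.1.1 * (τ (σ.1 x) : ℕ) :=
      fun h => hne (h1.2 h)
    have h3 := hB (τ ∘ σ.1)
    refine ih _ ?_ (τ ∘ σ.1) rfl
    simp only [Function.comp_apply] at h3 ⊢
    have := h1.1
    omega
  have hfin : (E.card : ℝ) • symAlt t τ ∈
      Submodule.span ℝ (Set.range fun σ : SST μ m => symAlt t σ.1) := by
    rw [Nat.cast_smul_eq_nsmul, eq_neg_of_add_eq_zero_left hgarnir]
    exact neg_mem hrest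
  have := Submodule.smul_mem _ (E.card : ℝ)⁻¹ hfin
  rwa [smul_smul, inv_mul_cancel₀ (by exact_mod_cast hE.ne'), one_smul] at this

theorem span_symAltRow (t : Tableau μ m → N) :
    Submodule.span ℝ (Set.range fun σ : SST μ m => symAltRow t σ.1) =
      Submodule.span ℝ (Set.range (symAlt t)) := by
  apply le_antisymm <;> rw [Submodule.span_le]
  · rintro _ ⟨σ, rfl⟩
    obtain ⟨k, hk, h⟩ := exists_symAlt_eq_smul σ.1
    have : symAltRow t σ.1 = k⁻¹ • symAlt t σ.1 := by
      rw [h, smul_smul, inv_mul_cancel₀ hk, one_smul]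
    simp only [this]
    exact Submodule.smul_mem _ _ (Submodule.subset_span ⟨_, rfl⟩)
  · rintro _ ⟨τ, rfl⟩
    have h1 := symAlt_mem_span t τ
    refine Submodule.span_le.2 ?_ h1
    rintro _ ⟨σ, rfl⟩
    obtain ⟨k, hk, h⟩ := exists_symAlt_eq_smul σ.1
    change symAlt t σ.1 ∈ _
    rw [show symAlt t σ.1 = k • symAltRow t σ.1 from h t]
    exact Submodule.smul_mem _ _ (Submodule.subset_span ⟨σ, rfl⟩)

/-! ### Independence -/

-- In a linear relation, choose a tableau `σ` with nonzero coefficient and maximal column statistic,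
-- and evaluate at `σ`. By triangularity only the term of `σ` contributes, with the order of its row
-- stabilizer as value.
open Classical in
theorem linearIndependent_symAlt_single :
    LinearIndependent ℝ fun σ : SST μ m =>
      symAlt (fun τ => (Pi.single τ 1 : Tableau μ m → ℝ)) σ.1 := by
  rw [Fintype.linearIndependent_iff]
  intro a ha
  by_contra! hne
  obtain ⟨σ₀, hσ₀⟩ := hne
  obtain ⟨σ, hσ, hmax⟩ := Finset.exists_max_image
    (Finset.univ.filter fun σ : SST μ m => a σ ≠ 0)
    (fun σ => ∑ x : μ.cells, x.1.2 * (σ.1 x : ℕ)) ⟨σ₀, by simpa using hσ₀⟩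
  have haσ := (Finset.mem_filter.1 hσ).2
  have hev : ∀ τ : SST μ m, symAlt (fun τ => (Pi.single τ 1 : Tableau μ m → ℝ)) τ.1 σ.1 =
      ∑ r : rowGroup μ, ∑ c : colGroup μ, ((Equiv.Perm.sign c.1 : ℤ) : ℝ) *
        (if τ.1 ∘ r.1 ∘ c.1 = σ.1 then 1 else 0) := by
    intro τ
    simp only [symAlt, Finset.sum_apply, Pi.smul_apply, smul_eq_mul, Pi.single_apply, eq_comm]
  have h1 := congrFun ha σ.1
  rw [Finset.sum_apply, Finset.sum_eq_single σ] at h1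
  · simp only [Pi.smul_apply, smul_eq_mul, Pi.zero_apply, hev] at h1
    have h2 : ∀ r : rowGroup μ, ∑ c : colGroup μ, ((Equiv.Perm.sign c.1 : ℤ) : ℝ) *
        (if σ.1 ∘ r.1 ∘ c.1 = σ.1 then 1 else 0) = if σ.1 ∘ r.1 = σ.1 then 1 else 0 := by
      intro r
      rw [Finset.sum_eq_single 1]
      · simp
      · intro c _ hc
        rw [if_neg fun h => hc (Subtype.ext
          ((semistandard_triangular σ.2 σ.2 r.2 c.2 h).2 rfl).2.1), mul_zero]
      · simp
    rw [Finset.sum_congr rfl fun r _ => h2 r] at h1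
    have h3 : (0 : ℝ) < ∑ r : rowGroup μ, if σ.1 ∘ r.1 = σ.1 then 1 else 0 := by
      refine Finset.sum_pos' (fun r _ => by split_ifs <;> norm_num) ⟨1, Finset.mem_univ _, ?_⟩
      simp
    exact (mul_ne_zero haσ h3.ne') h1
  · intro τ _ hτ
    simp only [Pi.smul_apply, smul_eq_mul, hev]
    by_cases haτ : a τ = 0
    · rw [haτ, zero_mul]
    have h2 := hmax τ (by simpa using haτ)
    rw [Finset.sum_eq_zero, mul_zero]
    intro r _
    refine Finset.sum_eq_zero fun c _ => ?_
    rw [if_neg, mul_zero]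
    intro h
    have h3 := semistandard_triangular σ.2 τ.2 r.2 c.2 h
    exact hτ (Subtype.ext (h3.2 (le_antisymm h3.1 h2)).2.2.symm)
  · simp

theorem linearIndependent_symAltRow_single [DecidableEq (Tableau μ m)] :
    LinearIndependent ℝ fun σ : SST μ m =>
      symAltRow (fun τ => (Pi.single τ 1 : Tableau μ m → ℝ)) σ.1 := by
  have h := linearIndependent_symAlt_single (μ := μ) (m := m)
  choose k hk hk' using fun σ : SST μ m => exists_symAlt_eq_smul σ.1
  have := h.units_smul fun σ => (Units.mk0 (k σ) (hk σ))⁻¹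
  convert this using 2 with σ
  rw [Pi.smul_apply', hk' σ, Units.smul_def, smul_smul]
  simp only [Units.val_inv_eq_inv_val, Units.val_mk0]
  rw [inv_mul_cancel₀ (hk σ), one_smul]
  congr!

theorem map_symAltRow {N' : Type*} [AddCommGroup N'] [Module ℝ N'] (L : N →ₗ[ℝ] N')
    (t : Tableau μ m → N) (τ : Tableau μ m) :
    L (symAltRow t τ) = symAltRow (fun σ => L (t σ)) τ := by
  simp only [symAltRow, map_sum, map_smul]

end Tableaux

/-! ### The signed stabilizer of a function -/

section SignedStabilizer

open Matrix

variable {G X Y : Type*} [Group G] [Fintype G] [MulAction G X] [MulAction G Y]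

theorem permRep_single [DecidableEq X] (g : G) (x : X) (c : ℝ) :
    permRep G X g (Pi.single x c) = Pi.single (g • x) c := by
  funext y
  simp only [permRep_apply, Pi.single_apply, inv_smul_eq_iff]

theorem asAlgebraHom_single {V : Type*} [AddCommGroup V] [Module ℝ V] (ρ : Representation ℝ G V)
    (g : G) (v : V) : ρ.asAlgebraHom (MonoidAlgebra.single g 1) v = ρ g v := by
  rw [Representation.asAlgebraHom_single, one_smul]

theorem permRep_inv_eq {g : G} {f f' : X → ℝ} (h : permRep G X g f = f') :
    permRep G X g⁻¹ f' = f := by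
  rw [← h, ← Module.End.mul_apply, ← map_mul, inv_mul_cancel, map_one, Module.End.one_apply]

open Classical in
/-- The sign by which a group element acts on a function, or zero. -/
def stabSign (B : X → ℝ) (g : G) : ℝ :=
  (if permRep G X g B = B then 1 else 0) - (if permRep G X g B = -B then 1 else 0)

/-- The signed sum of the group elements that fix a function up to sign. -/
def signedStab (G : Type*) {X : Type*} [Group G] [Fintype G] [MulAction G X] (B : X → ℝ) :
    MonoidAlgebra ℝ G :=
  ∑ g, MonoidAlgebra.single g (stabSign B g)

theorem coeff_signedStab (B : X → ℝ) (g : G) : (signedStab G B).coeff g = stabSign B g := by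
  classical
  simp [signedStab, MonoidAlgebra.coeff_sum, Finsupp.single_apply]

theorem stabSign_inv (B : X → ℝ) (g : G) : stabSign B g⁻¹ = stabSign B g := by
  have h1 : permRep G X g⁻¹ B = B ↔ permRep G X g B = B :=
    ⟨fun h => by simpa using permRep_inv_eq h, permRep_inv_eq⟩
  have h2 : permRep G X g⁻¹ B = -B ↔ permRep G X g B = -B := by
    constructor <;> intro h
    · have := permRep_inv_eq h
      rw [inv_inv, map_neg] at this
      rw [← this, neg_neg, this]
    · have := permRep_inv_eq h
      rw [map_neg] at this
      rw [← this, neg_neg, this]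
  classical
  exact congrArg₂ (· - ·) (if_congr h1 rfl rfl) (if_congr h2 rfl rfl)

theorem stabSign_mul {B : X → ℝ} {g : G} (hg : permRep G X g B = -B) (g' : G) :
    stabSign B (g' * g) = -stabSign B g' := by
  have h1 : permRep G X (g' * g) B = - permRep G X g' B := by
    rw [map_mul, Module.End.mul_apply, hg, map_neg]
  have h2 : -permRep G X g' B = B ↔ permRep G X g' B = -B := neg_eq_iff_eq_neg
  have h3 : -permRep G X g' B = -B ↔ permRep G X g' B = B := neg_inj
  rw [stabSign, stabSign, h1, neg_sub]
  classical
  exact congrArg₂ (· - ·) (if_congr h2 rfl rfl) (if_congr h3 rfl rfl)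

theorem stabSign_mul' {B : X → ℝ} {g : G} (hg : permRep G X g B = B) (g' : G) :
    stabSign B (g' * g) = stabSign B g' := by
  rw [stabSign, stabSign, map_mul, Module.End.mul_apply, hg]

theorem stabSign_zero (g : G) : stabSign (0 : X → ℝ) g = 0 := by
  simp [stabSign]

theorem asAlgebraHom_signedStab_zero {V : Type*} [AddCommGroup V] [Module ℝ V]
    (ρ : Representation ℝ G V) (v : V) : ρ.asAlgebraHom (signedStab G (0 : X → ℝ)) v = 0 := by
  simp only [asAlgebraHom_eq_sum, coeff_signedStab, stabSign_zero, zero_smul,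
    Finset.sum_const_zero]

theorem apply_asAlgebraHom_signedStab {V : Type*} [AddCommGroup V] [Module ℝ V]
    (ρ : Representation ℝ G V) {B : X → ℝ} {g : G} (hg : permRep G X g B = -B) (v : V) :
    ρ g (ρ.asAlgebraHom (signedStab G B) v) = -ρ.asAlgebraHom (signedStab G B) v := by
  have hg' : permRep G X g⁻¹ B = -B := by
    have := permRep_inv_eq hg
    rw [map_neg] at this
    rw [← this, neg_neg, this]
  simp only [asAlgebraHom_eq_sum, coeff_signedStab]
  rw [map_sum, ← Finset.sum_neg_distrib]
  refine Fintype.sum_equiv (Equiv.mulLeft g) _ _ fun g' => ?_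
  rw [Equiv.coe_mulLeft, ← stabSign_inv, ← stabSign_inv B (g * g'), _root_.mul_inv_rev,
    stabSign_mul hg', map_mul, Module.End.mul_apply, map_smul, neg_smul, neg_neg]

theorem apply_asAlgebraHom_signedStab' {V : Type*} [AddCommGroup V] [Module ℝ V]
    (ρ : Representation ℝ G V) {B : X → ℝ} {g : G} (hg : permRep G X g B = B) (v : V) :
    ρ g (ρ.asAlgebraHom (signedStab G B) v) = ρ.asAlgebraHom (signedStab G B) v := by
  simp only [asAlgebraHom_eq_sum, coeff_signedStab]
  rw [map_sum]
  refine Fintype.sum_equiv (Equiv.mulLeft g) _ _ fun g' => ?_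
  rw [Equiv.coe_mulLeft, ← stabSign_inv, ← stabSign_inv B (g * g'), _root_.mul_inv_rev,
    stabSign_mul' (permRep_inv_eq hg), map_mul, Module.End.mul_apply, map_smul]

theorem signedStab_smul_eq_neg {B : X → ℝ} {g : G} (hg : permRep G X g B = -B)
    (v : Y → ℝ) (y : Y) :
    (permRep G Y).asAlgebraHom (signedStab G B) v (g • y) =
      -(permRep G Y).asAlgebraHom (signedStab G B) v y := by
  have := congrFun (apply_asAlgebraHom_signedStab (permRep G Y) hg v) (g • y)
  rw [permRep_apply, inv_smul_smul] at this
  rw [this, Pi.neg_apply, neg_neg]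

theorem signedStab_smul_eq {B : X → ℝ} {g : G} (hg : permRep G X g B = B)
    (v : Y → ℝ) (y : Y) :
    (permRep G Y).asAlgebraHom (signedStab G B) v (g • y) =
      (permRep G Y).asAlgebraHom (signedStab G B) v y := by
  have := congrFun (apply_asAlgebraHom_signedStab' (permRep G Y) hg v) (g • y)
  rw [permRep_apply, inv_smul_smul] at this
  exact this.symm

/-- Each group element that maps `B` to `± B` contributes `+B`, its sign being counted twice. The
factor is thus the number of these elements. -/
theorem asAlgebraHom_signedStab_self {B : X → ℝ} (hB : B ≠ 0) :
    ∃ k : ℝ, k ≠ 0 ∧ (permRep G X).asAlgebraHom (signedStab G B) B = k • B := by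
  have hne : B ≠ -B := fun h => hB (self_eq_neg.1 h)
  refine ⟨∑ g : G, |stabSign B g|, ?_, ?_⟩
  · refine (Finset.sum_pos' (fun g _ => abs_nonneg _) ⟨1, Finset.mem_univ _, ?_⟩).ne'
    simp [stabSign, hne]
  · rw [asAlgebraHom_eq_sum, Finset.sum_smul]
    refine Finset.sum_congr rfl fun g _ => ?_
    rw [coeff_signedStab]
    by_cases h1 : permRep G X g B = B
    · rw [h1]; simp [stabSign, h1, hne]
    · by_cases h2 : permRep G X g B = -B
      · rw [h2]; simp [stabSign, h1, h2, hne.symm]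
      · simp [stabSign, h1, h2]

theorem range_asAlgebraHom_signedStab {B : X → ℝ} (hB : B ≠ 0)
    (h : ∀ v, ∃ c : ℝ, (permRep G X).asAlgebraHom (signedStab G B) v = c • B) :
    LinearMap.range ((permRep G X).asAlgebraHom (signedStab G B)) = Submodule.span ℝ {B} := by
  apply le_antisymm
  · rintro _ ⟨v, rfl⟩
    obtain ⟨c, hc⟩ := h v
    exact Submodule.mem_span_singleton.2 ⟨c, hc.symm⟩
  · rw [Submodule.span_singleton_le_iff_mem]
    obtain ⟨k, hk, hkB⟩ := asAlgebraHom_signedStab_self (G := G) hB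
    exact ⟨k⁻¹ • B, by rw [map_smul, hkB, smul_smul, inv_mul_cancel₀ hk, one_smul]⟩

/-- If the range is one-dimensional, the compressions of group elements are scalar. -/
theorem exists_scal_of_range_le {V : Type*} [AddCommGroup V] [Module ℝ V]
    {ρ : Representation ℝ G V} {x : MonoidAlgebra ℝ G} {B : V}
    (h : ∀ v, ∃ c : ℝ, ρ.asAlgebraHom x v = c • B) (g : G) : ∃ c : ℝ, ∀ v,
      ρ.asAlgebraHom x (ρ g (ρ.asAlgebraHom x v)) = c • ρ.asAlgebraHom x v := by
  obtain ⟨c, hc⟩ := h (ρ g B)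
  refine ⟨c, fun v => ?_⟩
  obtain ⟨c', hc'⟩ := h v
  rw [hc', map_smul, map_smul, hc, smul_comm]

/-- Both elements act symmetrically, so the squared length of the vector in question is an inner
product containing `x … y` applied to some vector. -/
theorem orth_symm [Fintype X] {x y : MonoidAlgebra ℝ G} (hx : ∀ g, x.coeff g⁻¹ = x.coeff g)
    (hy : ∀ g, y.coeff g⁻¹ = y.coeff g)
    (h : ∀ g v, (permRep G X).asAlgebraHom x (permRep G X g ((permRep G X).asAlgebraHom y v)) = 0)
    (g : G) (v : X → ℝ) :
    (permRep G X).asAlgebraHom y (permRep G X g ((permRep G X).asAlgebraHom x v)) = 0 := by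
  rw [← dotProduct_self_eq_zero, dotProduct_asAlgebraHom_permRep hy, dotProduct_permRep,
    dotProduct_asAlgebraHom_permRep hx, h, dotProduct_zero]

end SignedStabilizer

/-! ### The symmetric group acting on pairs of letters -/

section Letters

open Matrix Equiv

variable {q : ℕ}

theorem exists_perm_pair {α : Type*} [DecidableEq α] {a b a' b' : α} (h : a ≠ b) (h' : a' ≠ b') :
    ∃ s : Perm α, s a = a' ∧ s b = b' ∧
      ∀ c, c ≠ a → c ≠ b → c ≠ a' → c ≠ b' → s c = c := by
  refine ⟨swap b' (swap a a' b) * swap a a', ?_, ?_, ?_⟩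
  · rw [Perm.mul_apply, swap_apply_left, swap_apply_of_ne_of_ne h']
    intro h1
    apply h
    rw [← (swap a a').injective.eq_iff, swap_apply_left]
    exact h1
  · rw [Perm.mul_apply, swap_apply_right]
  · intro c h1 h2 h3 h4
    have h5 : swap a a' c = c := swap_apply_of_ne_of_ne h1 h3
    rw [Perm.mul_apply, h5, swap_apply_of_ne_of_ne h4]
    intro h6
    rw [← h5, (swap a a').injective.eq_iff] at h6
    exact h2 h6

/-- The function `p ↦ 1` at `(a, b)`. -/
def pairUnit (a b : Fin q) : Fin q × Fin q → ℝ := Pi.single (a, b) 1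

theorem pairUnit_apply (a b x y : Fin q) :
    pairUnit a b (x, y) = if x = a ∧ y = b then 1 else 0 := by
  simp [pairUnit, Pi.single_apply]

theorem permRep_pairUnit (s : (Perm (Fin q))) (a b : Fin q) :
    permRep (Perm (Fin q)) (Fin q × Fin q) s (pairUnit a b) = pairUnit (s a) (s b) := by
  classical
  rw [pairUnit, permRep_single]
  rfl

theorem dotProduct_pairUnit (v : Fin q × Fin q → ℝ) (a b : Fin q) :
    v ⬝ᵥ pairUnit a b = v (a, b) := by
  rw [pairUnit, dotProduct_single_one]

/-- The skew-symmetric matrix of a cyclic triple. -/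
def cycFun (a b c : Fin q) : Fin q × Fin q → ℝ :=
  pairUnit a b + pairUnit b c + pairUnit c a - pairUnit b a - pairUnit c b - pairUnit a c

/-- The symmetric matrix of an alternating quadrangle. -/
def quadFun (a b c d : Fin q) : Fin q × Fin q → ℝ :=
  pairUnit a c - pairUnit c b + pairUnit b d - pairUnit d a + pairUnit c a - pairUnit b c +
    pairUnit d b - pairUnit a d

theorem permRep_cycFun (s : (Perm (Fin q))) (a b c : Fin q) :
    permRep (Perm (Fin q)) (Fin q × Fin q) s (cycFun a b c) = cycFun (s a) (s b) (s c) := by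
  simp only [cycFun, map_add, map_sub, permRep_pairUnit]

theorem permRep_quadFun (s : (Perm (Fin q))) (a b c d : Fin q) :
    permRep (Perm (Fin q)) (Fin q × Fin q) s (quadFun a b c d) = quadFun (s a) (s b) (s c) (s d) := by
  simp only [quadFun, map_add, map_sub, permRep_pairUnit]

theorem cycFun_swap (a b c : Fin q) : cycFun b a c = -cycFun a b c := by
  simp only [cycFun]; abel

theorem cycFun_rotate (a b c : Fin q) : cycFun b c a = cycFun a b c := by
  simp only [cycFun]; abel

theorem quadFun_swap (a b c d : Fin q) : quadFun b a c d = -quadFun a b c d := by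
  simp only [quadFun]; abel

theorem quadFun_comm (a b c d : Fin q) : quadFun c d a b = quadFun a b c d := by
  simp only [quadFun]; abel

theorem permRep_swap_cycFun {a b c : Fin q} (hac : a ≠ c) (hbc : b ≠ c) :
    permRep (Perm (Fin q)) (Fin q × Fin q) (swap a b) (cycFun a b c) = -cycFun a b c := by
  rw [permRep_cycFun, swap_apply_left, swap_apply_right,
    swap_apply_of_ne_of_ne hac.symm hbc.symm, cycFun_swap]

theorem permRep_swap_quadFun {a b c d : Fin q} (hac : a ≠ c) (hbc : b ≠ c) (had : a ≠ d)
    (hbd : b ≠ d) : permRep (Perm (Fin q)) (Fin q × Fin q) (swap a b) (quadFun a b c d) = -quadFun a b c d := by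
  rw [permRep_quadFun, swap_apply_left, swap_apply_right,
    swap_apply_of_ne_of_ne hac.symm hbc.symm, swap_apply_of_ne_of_ne had.symm hbd.symm,
    quadFun_swap]

theorem permRep_swap_quadFun' {a b c d : Fin q} (hac : a ≠ c) (hbc : b ≠ c) (had : a ≠ d)
    (hbd : b ≠ d) : permRep (Perm (Fin q)) (Fin q × Fin q) (swap c d) (quadFun a b c d) = -quadFun a b c d := by
  rw [← quadFun_comm, permRep_swap_quadFun hac.symm had.symm hbc.symm hbd.symm]

/-- The image changes sign under each of the three transpositions of `a, b, c`. An entry whose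
position is fixed by one of them vanishes, and the six others agree up to sign. -/
theorem signedStab_cycFun_eq {a b c : Fin q} (hab : a ≠ b) (hac : a ≠ c) (hbc : b ≠ c)
    (v : Fin q × Fin q → ℝ) : ∃ k : ℝ,
      (permRep (Perm (Fin q)) (Fin q × Fin q)).asAlgebraHom (signedStab (Perm (Fin q)) (cycFun a b c)) v =
        k • cycFun a b c := by
  set w := (permRep (Perm (Fin q)) (Fin q × Fin q)).asAlgebraHom (signedStab (Perm (Fin q)) (cycFun a b c)) v with hw
  have h1 : ∀ x y, w (swap a b x, swap a b y) = -w (x, y) := fun x y =>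
    signedStab_smul_eq_neg (permRep_swap_cycFun hac hbc) v (x, y)
  have h2 : ∀ x y, w (swap b c x, swap b c y) = -w (x, y) := fun x y =>
    signedStab_smul_eq_neg (by
      rw [← cycFun_rotate]; exact permRep_swap_cycFun hab.symm hac.symm) v (x, y)
  have h3 : ∀ x y, w (swap a c x, swap a c y) = -w (x, y) := fun x y =>
    signedStab_smul_eq_neg (by
      rw [cycFun_rotate c a b, Equiv.swap_comm]
      exact permRep_swap_cycFun hbc.symm hab) v (x, y)
  refine ⟨w (a, b), funext ?_⟩
  rintro ⟨x, y⟩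
  have e1 := h1 x y
  have e2 := h2 x y
  have e3 := h3 x y
  have f1 := h1 a b
  have f2 := h2 a b
  have f3 := h3 a b
  have f4 := h1 a c
  have f5 := h1 c a
  simp only [swap_apply_left, swap_apply_right, swap_apply_of_ne_of_ne, ne_eq, hab, hac, hbc,
    hab.symm, hac.symm, hbc.symm, not_false_eq_true] at f1 f2 f3 f4 f5
  simp only [Pi.smul_apply, cycFun, Pi.add_apply, Pi.sub_apply, pairUnit_apply, smul_eq_mul]
  rcases eq_or_ne x a with rfl | hxa
  · rcases eq_or_ne y x with rfl | hya
    · simp [swap_apply_of_ne_of_ne, hab, hac, hbc] at e2 ⊢; linarith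
    rcases eq_or_ne y b with rfl | hyb
    · simp [hab, hac, hbc, hab.symm, hac.symm, hbc.symm]
    rcases eq_or_ne y c with rfl | hyc
    · simp [hab, hac, hbc, hab.symm, hac.symm, hbc.symm]; linarith
    · simp [swap_apply_of_ne_of_ne, *] at e2 ⊢; linarith
  rcases eq_or_ne x b with rfl | hxb
  · rcases eq_or_ne y a with rfl | hya
    · simp [hab, hac, hbc, hab.symm, hac.symm, hbc.symm]; linarith
    rcases eq_or_ne y x with rfl | hyb
    · simp [swap_apply_of_ne_of_ne, hab.symm, hac, hbc] at e3 ⊢; linarith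
    rcases eq_or_ne y c with rfl | hyc
    · simp [hab, hac, hbc, hab.symm, hac.symm, hbc.symm]; linarith
    · simp [swap_apply_of_ne_of_ne, *] at e3 ⊢; linarith
  rcases eq_or_ne x c with rfl | hxc
  · rcases eq_or_ne y a with rfl | hya
    · simp [hab, hac, hbc, hab.symm, hac.symm, hbc.symm]; linarith
    rcases eq_or_ne y b with rfl | hyb
    · simp [hab, hac, hbc, hab.symm, hac.symm, hbc.symm]; linarith
    · rcases eq_or_ne y x with rfl | hyc
      · simp [swap_apply_of_ne_of_ne, *] at e1 ⊢; linarith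
      · simp [swap_apply_of_ne_of_ne, *] at e1 ⊢; linarith
  · simp only [hxa, hxb, hxc, false_and, if_false]
    rcases eq_or_ne y a with rfl | hya
    · simp [swap_apply_of_ne_of_ne, *] at e2 ⊢; linarith
    · rcases eq_or_ne y b with rfl | hyb
      · simp [swap_apply_of_ne_of_ne, *] at e3 ⊢; linarith
      · simp [swap_apply_of_ne_of_ne, *] at e1 ⊢; linarith

/-- The image changes sign under `(a b)` and under `(c d)`, which kills all entries except those
with one index in `{a, b}` and the other in `{c, d}`. These form two orbits of four entries, joined
by the permutation `(a c)(b d)`, which fixes the matrix. -/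
theorem signedStab_quadFun_eq {a b c d : Fin q} (hab : a ≠ b) (hac : a ≠ c) (had : a ≠ d)
    (hbc : b ≠ c) (hbd : b ≠ d) (hcd : c ≠ d) (v : Fin q × Fin q → ℝ) : ∃ k : ℝ,
      (permRep (Perm (Fin q)) (Fin q × Fin q)).asAlgebraHom (signedStab (Perm (Fin q)) (quadFun a b c d)) v =
        k • quadFun a b c d := by
  set w := (permRep (Perm (Fin q)) (Fin q × Fin q)).asAlgebraHom (signedStab (Perm (Fin q)) (quadFun a b c d)) v with hw
  have h1 : ∀ x y, w (swap a b x, swap a b y) = -w (x, y) := fun x y =>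
    signedStab_smul_eq_neg (permRep_swap_quadFun hac hbc had hbd) v (x, y)
  have h2 : ∀ x y, w (swap c d x, swap c d y) = -w (x, y) := fun x y =>
    signedStab_smul_eq_neg (permRep_swap_quadFun' hac hbc had hbd) v (x, y)
  have h3 : w (c, a) = w (a, c) := by
    have := signedStab_smul_eq (g := swap a c * swap b d) (B := quadFun a b c d) (by
      rw [permRep_quadFun]
      simp only [Perm.mul_apply, swap_apply_left, swap_apply_right, swap_apply_of_ne_of_ne, ne_eq,
        hab, hac, had, hbc, hbd, hcd, hab.symm, hac.symm, had.symm, hbc.symm, hbd.symm, hcd.symm,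
        not_false_eq_true, quadFun_comm]) v (a, c)
    rw [Prod.smul_mk] at this
    simpa [hab, hac, had, hbc, hbd, hcd, hab.symm, hac.symm, had.symm, hbc.symm, hbd.symm,
      hcd.symm, swap_apply_of_ne_of_ne] using this
  have hz1 : ∀ x y, x ≠ a → x ≠ b → y ≠ a → y ≠ b → w (x, y) = 0 := by
    intro x y hxa hxb hya hyb
    have := h1 x y
    rw [swap_apply_of_ne_of_ne hxa hxb, swap_apply_of_ne_of_ne hya hyb] at this
    linarith
  have hz2 : ∀ x y, x ≠ c → x ≠ d → y ≠ c → y ≠ d → w (x, y) = 0 := by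
    intro x y hxa hxb hya hyb
    have := h2 x y
    rw [swap_apply_of_ne_of_ne hxa hxb, swap_apply_of_ne_of_ne hya hyb] at this
    linarith
  have f1 := h1 a c
  have f2 := h2 a c
  have f3 := h1 a d
  have g1 := h1 c a
  have g2 := h2 c a
  have g3 := h1 d a
  simp only [swap_apply_left, swap_apply_right, swap_apply_of_ne_of_ne, ne_eq, hab, hac, hbc,
    hab.symm, hac.symm, hbc.symm, had, hbd, hcd, had.symm, hbd.symm, hcd.symm,
    not_false_eq_true] at f1 f2 f3 g1 g2 g3
  refine ⟨w (a, c), funext ?_⟩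
  rintro ⟨x, y⟩
  simp only [Pi.smul_apply, quadFun, Pi.add_apply, Pi.sub_apply, pairUnit_apply, smul_eq_mul]
  by_cases hx : x = a ∨ x = b
  · by_cases hy : y = c ∨ y = d
    · rcases hx with rfl | rfl <;> rcases hy with rfl | rfl <;>
        simp [hab, hac, had, hbc, hbd, hcd, hab.symm, hac.symm, had.symm, hbc.symm, hbd.symm,
          hcd.symm] <;> linarith
    · push Not at hy
      rw [hz2 x y (by rcases hx with rfl | rfl <;> assumption)
        (by rcases hx with rfl | rfl <;> assumption) hy.1 hy.2]
      rcases hx with rfl | rfl <;> simp [*]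
  · push Not at hx
    by_cases hx' : x = c ∨ x = d
    · by_cases hy : y = a ∨ y = b
      · rcases hx' with rfl | rfl <;> rcases hy with rfl | rfl <;>
          simp [hab, hac, had, hbc, hbd, hcd, hab.symm, hac.symm, had.symm, hbc.symm, hbd.symm,
            hcd.symm] <;> linarith
      · push Not at hy
        rw [hz1 x y hx.1 hx.2 hy.1 hy.2]
        simp [hx.1, hx.2, hy.1, hy.2]
    · push Not at hx'
      have : w (x, y) = 0 := by
        by_cases hy : y = a ∨ y = b
        · exact hz2 x y hx'.1 hx'.2 (by rcases hy with rfl | rfl <;> assumption)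
            (by rcases hy with rfl | rfl <;> assumption)
        · push Not at hy
          exact hz1 x y hx.1 hx.2 hy.1 hy.2
      rw [this]
      simp [hx.1, hx.2, hx'.1, hx'.2]

end Letters

/-! ### The standard representation, invariants, and completeness for pairs of letters -/

section Standard

open Matrix Equiv

variable {q : ℕ}

/-- The sum of the permutations that fix a letter. -/
def fixSum (a : Fin q) : MonoidAlgebra ℝ (Perm (Fin q)) :=
  ∑ s : MulAction.stabilizer (Perm (Fin q)) a, MonoidAlgebra.single s.1 1

/-- The element `(1 - (a b)) (∑ s, s) (1 - (a b))`, where `s` runs over the permutations that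
fix `a`. -/
def standardElt (a b : Fin q) : MonoidAlgebra ℝ (Perm (Fin q)) :=
  (1 - MonoidAlgebra.single (swap a b) 1) * fixSum a * (1 - MonoidAlgebra.single (swap a b) 1)

theorem rev_one {G : Type*} [Group G] : rev (1 : MonoidAlgebra ℝ G) = 1 := by
  rw [MonoidAlgebra.one_def, rev_single, inv_one]

theorem rev_fixSum (a : Fin q) : rev (fixSum a) = fixSum a := by
  simp only [fixSum, map_sum, rev_single]
  exact Fintype.sum_equiv (Equiv.inv _) _ _ fun s => rfl

theorem rev_standardElt (a b : Fin q) : rev (standardElt a b) = standardElt a b := by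
  have h : rev (1 - MonoidAlgebra.single (swap a b) (1 : ℝ)) =
      1 - MonoidAlgebra.single (swap a b) 1 := by
    rw [map_sub, rev_one, rev_single, swap_inv]
  rw [standardElt, rev_mul, rev_mul, rev_fixSum, h, mul_assoc]

variable {V : Type*} [AddCommGroup V] [Module ℝ V] (ρ : Representation ℝ (Perm (Fin q)) V)

theorem asAlgebraHom_fixSum (a : Fin q) (v : V) :
    ρ.asAlgebraHom (fixSum a) v = ∑ s : MulAction.stabilizer (Perm (Fin q)) a, ρ s.1 v := by
  simp only [fixSum, map_sum, LinearMap.sum_apply, asAlgebraHom_single]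

theorem apply_asAlgebraHom_fixSum {a : Fin q} {s : Perm (Fin q)} (hs : s a = a) (v : V) :
    ρ s (ρ.asAlgebraHom (fixSum a) v) = ρ.asAlgebraHom (fixSum a) v := by
  rw [asAlgebraHom_fixSum, map_sum]
  refine Fintype.sum_equiv (Equiv.mulLeft (⟨s, hs⟩ : MulAction.stabilizer (Perm (Fin q)) a)) _ _ fun s' => ?_
  rw [Equiv.coe_mulLeft, Subgroup.coe_mul, map_mul, Module.End.mul_apply]

theorem asAlgebraHom_standardElt (a b : Fin q) (v : V) :
    ∃ u : V, (∀ s : (Perm (Fin q)), s a = a → ρ s u = u) ∧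
      ρ.asAlgebraHom (standardElt a b) v = u - ρ (swap a b) u := by
  refine ⟨_, fun s hs => apply_asAlgebraHom_fixSum ρ hs
    (ρ.asAlgebraHom (1 - MonoidAlgebra.single (swap a b) 1) v), ?_⟩
  simp only [standardElt, map_mul, Module.End.mul_apply, map_sub, map_one, LinearMap.sub_apply,
    Module.End.one_apply, asAlgebraHom_single]
  abel

/-- The difference of two unit vectors. -/
def diffVec (a b : Fin q) : Fin q → ℝ := Pi.single a 1 - Pi.single b 1

theorem permRep_diffVec (s : (Perm (Fin q))) (a b : Fin q) :
    permRep (Perm (Fin q)) (Fin q) s (diffVec a b) = diffVec (s a) (s b) := by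
  rw [diffVec, map_sub, permRep_single, permRep_single]
  rfl

/-- A function fixed by the stabilizer of `a` is constant away from `a`; subtracting its image under
`(a b)` leaves only the entries at `a` and `b`. -/
theorem asAlgebraHom_standardElt_letters {a b : Fin q} (hab : a ≠ b) (v : Fin q → ℝ) :
    ∃ c : ℝ, (permRep (Perm (Fin q)) (Fin q)).asAlgebraHom (standardElt a b) v = c • diffVec a b := by
  obtain ⟨u, hu, h⟩ := asAlgebraHom_standardElt (permRep (Perm (Fin q)) (Fin q)) a b v
  have hu' : ∀ x, x ≠ a → u x = u b := by
    intro x hx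
    have := congrFun (hu (swap b x) (swap_apply_of_ne_of_ne hab hx.symm)) x
    rw [permRep_apply, swap_inv, Perm.smul_def, swap_apply_right] at this
    exact this.symm
  refine ⟨u a - u b, funext fun x => ?_⟩
  rw [h]
  simp only [Pi.sub_apply, Pi.smul_apply, permRep_apply, swap_inv, Perm.smul_def, smul_eq_mul,
    diffVec, Pi.single_apply]
  rcases eq_or_ne x a with rfl | hxa
  · simp [hab]
  rcases eq_or_ne x b with rfl | hxb
  · simp [hab.symm]
  · rw [swap_apply_of_ne_of_ne hxa hxb]; simp [hxa, hxb]

theorem asAlgebraHom_standardElt_diffVec {a b : Fin q} (hab : a ≠ b) :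
    ∃ κ : ℝ, κ ≠ 0 ∧
      (permRep (Perm (Fin q)) (Fin q)).asAlgebraHom (standardElt a b) (diffVec a b) = κ • diffVec a b := by
  obtain ⟨κ, hκ⟩ := asAlgebraHom_standardElt_letters hab (diffVec a b)
  refine ⟨κ, ?_, hκ⟩
  rintro rfl
  rw [zero_smul] at hκ
  have h1 : (permRep (Perm (Fin q)) (Fin q)).asAlgebraHom (1 - MonoidAlgebra.single (swap a b) 1)
      (diffVec a b) = (2 : ℝ) • diffVec a b := by
    rw [map_sub, map_one, LinearMap.sub_apply, Module.End.one_apply, asAlgebraHom_single,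
      permRep_diffVec, swap_apply_left, swap_apply_right, two_smul]
    simp only [diffVec]
    abel
  have h2 := congrFun hκ a
  rw [standardElt, map_mul, Module.End.mul_apply, h1, map_smul, map_mul, Module.End.mul_apply,
    map_sub, map_one, LinearMap.sub_apply, Module.End.one_apply, asAlgebraHom_single,
    asAlgebraHom_fixSum] at h2
  simp only [map_smul, Pi.smul_apply, Pi.sub_apply, Finset.sum_apply, smul_eq_mul, Pi.zero_apply,
    permRep_apply, swap_inv, Perm.smul_def, swap_apply_left] at h2
  -- A permutation that fixes `a` never sends `b` to `a`. So each summand is `1` minus a number that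
  -- is `0` or `-1`.
  have h3 : (0 : ℝ) < ∑ s : MulAction.stabilizer (Perm (Fin q)) a,
      (diffVec a b (s.1⁻¹ a) - diffVec a b (s.1⁻¹ b)) := by
    refine Finset.sum_pos (fun s _ => ?_) ⟨1, Finset.mem_univ _⟩
    have hs : s.1⁻¹ a = a := by
      rw [Perm.inv_eq_iff_eq]; exact s.2.symm
    have hsb : s.1⁻¹ b ≠ a := fun h => hab (s.1⁻¹.injective (hs.trans h.symm))
    rw [hs]
    simp only [diffVec, Pi.sub_apply, Pi.single_apply, hsb, hab, if_true, if_false]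
    split_ifs <;> norm_num
  rw [Finset.sum_sub_distrib] at h3
  linarith

/-- Three equivariant maps from functions on letters to functions on pairs of letters. -/
def letterMap (q : ℕ) : Fin 3 → (Fin q → ℝ) →ₗ[ℝ] (Fin q × Fin q → ℝ) :=
  ![{ toFun := fun v p => if p.1 = p.2 then v p.1 else 0
      map_add' := fun v w => by funext p; simp only [Pi.add_apply]; split_ifs <;> simp
      map_smul' := fun c v => by funext p; simp },
    { toFun := fun v p => v p.1
      map_add' := fun _ _ => rfl
      map_smul' := fun _ _ => rfl },
    { toFun := fun v p => v p.2
      map_add' := fun _ _ => rfl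
      map_smul' := fun _ _ => rfl }]

theorem letterMap_zero_apply (v : Fin q → ℝ) (x y : Fin q) :
    letterMap q 0 v (x, y) = if x = y then v x else 0 := rfl

theorem letterMap_one_apply (v : Fin q → ℝ) (x y : Fin q) : letterMap q 1 v (x, y) = v x := rfl

theorem letterMap_two_apply (v : Fin q → ℝ) (x y : Fin q) : letterMap q 2 v (x, y) = v y := rfl

theorem letterMap_equivariant (k : Fin 3) (s : (Perm (Fin q))) (v : Fin q → ℝ) :
    letterMap q k (permRep (Perm (Fin q)) (Fin q) s v) = permRep (Perm (Fin q)) (Fin q × Fin q) s (letterMap q k v) := by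
  funext ⟨x, y⟩
  fin_cases k
  · simp [permRep_apply, letterMap_zero_apply]
  · rfl
  · rfl

theorem asAlgebraHom_standardElt_pairs {a b : Fin q} (hab : a ≠ b) (v : Fin q × Fin q → ℝ) :
    (permRep (Perm (Fin q)) (Fin q × Fin q)).asAlgebraHom (standardElt a b) v ∈
      Submodule.span ℝ (Set.range fun k => letterMap q k (diffVec a b)) := by
  obtain ⟨u, hu, h⟩ := asAlgebraHom_standardElt (permRep (Perm (Fin q)) (Fin q × Fin q)) a b v
  have hu' : ∀ (s : (Perm (Fin q))), s a = a → ∀ x y, u (s x, s y) = u (x, y) := by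
    intro s hs x y
    have := congrFun (hu s hs) (s • (x, y))
    rw [permRep_apply, inv_smul_smul] at this
    exact this.symm
  have h1 : ∀ y, y ≠ a → u (a, y) = u (a, b) := by
    intro y hy
    have := hu' (swap b y) (swap_apply_of_ne_of_ne hab hy.symm) a b
    rwa [swap_apply_left, swap_apply_of_ne_of_ne hab hy.symm] at this
  have h2 : ∀ y, y ≠ a → u (y, a) = u (b, a) := by
    intro y hy
    have := hu' (swap b y) (swap_apply_of_ne_of_ne hab hy.symm) b a
    rwa [swap_apply_left, swap_apply_of_ne_of_ne hab hy.symm] at this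
  have h3 : ∀ y, y ≠ a → u (y, y) = u (b, b) := by
    intro y hy
    have := hu' (swap b y) (swap_apply_of_ne_of_ne hab hy.symm) b b
    rwa [swap_apply_left] at this
  obtain ⟨z, hz⟩ : ∃ z : ℝ, ∀ x y, x ≠ a → y ≠ a → x ≠ y → u (x, y) = z := by
    by_cases hc : ∃ c, c ≠ a ∧ c ≠ b
    · obtain ⟨c, hca, hcb⟩ := hc
      refine ⟨u (b, c), fun x y hx hy hxy => ?_⟩
      obtain ⟨s, hs1, hs2, hs3⟩ := exists_perm_pair hcb.symm hxy
      have := hu' s (hs3 a hab hca.symm hx.symm hy.symm) b c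
      rwa [hs1, hs2] at this
    · push Not at hc
      refine ⟨0, fun x y hx hy hxy => absurd ((hc x hx).trans (hc y hy).symm) hxy⟩
  -- The last two coefficients are the entries at `(a, y)` and `(y, a)` for a third letter `y`, if
  -- there is one. The first makes up the remainder of the entry at `(a, a)`.
  have h5 : (permRep (Perm (Fin q)) (Fin q × Fin q)).asAlgebraHom (standardElt a b) v =
      (u (a, a) - u (b, b) - (u (a, b) - z) - (u (b, a) - z)) • letterMap q 0 (diffVec a b) +
      (u (a, b) - z) • letterMap q 1 (diffVec a b) +
      (u (b, a) - z) • letterMap q 2 (diffVec a b) := by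
    rw [h]
    funext ⟨x, y⟩
    simp only [Pi.sub_apply, Pi.smul_apply, Pi.add_apply, permRep_apply, swap_inv, Perm.smul_def,
      smul_eq_mul, letterMap_zero_apply, letterMap_one_apply, letterMap_two_apply, diffVec,
      Pi.single_apply, Prod.smul_mk]
    rcases eq_or_ne x a with rfl | hxa
    · rcases eq_or_ne y x with rfl | hya
      · simp [hab]; ring
      rcases eq_or_ne y b with rfl | hyb
      · simp [hab, hab.symm]
      · rw [swap_apply_left, swap_apply_of_ne_of_ne hya hyb, h1 y hya, hz b y hab.symm hya hyb.symm]
        simp [hab, hya, hyb, hya.symm]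
    rcases eq_or_ne x b with rfl | hxb
    · rcases eq_or_ne y a with rfl | hya
      · simp [hab, hab.symm]
      rcases eq_or_ne y x with rfl | hyb
      · simp [hab.symm]; ring
      · rw [swap_apply_right, swap_apply_of_ne_of_ne hya hyb, h1 y hya,
          hz x y hab.symm hya hyb.symm]
        simp [hab.symm, hya, hyb, hyb.symm]
    · rw [swap_apply_of_ne_of_ne hxa hxb]
      rcases eq_or_ne y a with rfl | hya
      · rw [swap_apply_left, h2 x hxa, hz x b hxa hab.symm hxb]
        simp [hab, hxa, hxb]
      rcases eq_or_ne y b with rfl | hyb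
      · rw [swap_apply_right, h2 x hxa, hz x y hxa hya hxb]
        simp [hab.symm, hxa, hxb]
      · rw [swap_apply_of_ne_of_ne hya hyb]
        simp [hxa, hxb, hya, hyb]
  rw [h5]
  refine add_mem (add_mem ?_ ?_) ?_ <;>
    exact Submodule.smul_mem _ _ (Submodule.subset_span ⟨_, rfl⟩)

theorem range_standardElt {a b : Fin q} (hab : a ≠ b) :
    LinearMap.range ((permRep (Perm (Fin q)) (Fin q × Fin q)).asAlgebraHom (standardElt a b)) =
      Submodule.span ℝ (Set.range fun k => letterMap q k (diffVec a b)) := by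
  apply le_antisymm
  · rintro _ ⟨v, rfl⟩
    exact asAlgebraHom_standardElt_pairs hab v
  · rw [Submodule.span_le]
    rintro _ ⟨k, rfl⟩
    obtain ⟨κ, hκ, h⟩ := asAlgebraHom_standardElt_diffVec hab
    refine ⟨κ⁻¹ • letterMap q k (diffVec a b), ?_⟩
    rw [map_smul, ← asAlgebraHom_intertwine _ (letterMap_equivariant k), h, map_smul, smul_smul,
      inv_mul_cancel₀ hκ, one_smul]

/-- The range consists of combinations of equivariant images of the single vector `diffVec a b`.
Hence the scalar found on functions of one letter serves for all three copies. -/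
theorem standardElt_scal {a b : Fin q} (hab : a ≠ b) (s : (Perm (Fin q))) : ∃ c : ℝ, ∀ v,
    (permRep (Perm (Fin q)) (Fin q × Fin q)).asAlgebraHom (standardElt a b)
      (permRep (Perm (Fin q)) (Fin q × Fin q) s
        ((permRep (Perm (Fin q)) (Fin q × Fin q)).asAlgebraHom (standardElt a b) v)) =
      c • (permRep (Perm (Fin q)) (Fin q × Fin q)).asAlgebraHom (standardElt a b) v := by
  obtain ⟨c, hc⟩ := asAlgebraHom_standardElt_letters hab (permRep (Perm (Fin q)) (Fin q) s (diffVec a b))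
  refine ⟨c, fun v => ?_⟩
  have hv := asAlgebraHom_standardElt_pairs hab v
  generalize (permRep (Perm (Fin q)) (Fin q × Fin q)).asAlgebraHom (standardElt a b) v = w at hv ⊢
  induction hv using Submodule.span_induction with
  | mem w hw =>
    obtain ⟨k, rfl⟩ := hw
    simp only
    rw [← letterMap_equivariant, ← asAlgebraHom_intertwine _ (letterMap_equivariant k), hc,
      map_smul]
  | zero => simp
  | add w w' _ _ hw hw' => simp only [map_add, hw, hw', smul_add]
  | smul r w _ hw => simp only [map_smul, hw, smul_comm c r]

/-- Each letter is fixed by a permutation that negates `B`, so the signed stabilizer annihilates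
every function on letters. The range of the standard element is built from such functions by
equivariant maps. -/
theorem signedStab_standardElt {a b : Fin q} (hab : a ≠ b) {B : Fin q × Fin q → ℝ}
    (hB : ∀ x : Fin q, ∃ s : (Perm (Fin q)), s x = x ∧ permRep (Perm (Fin q)) (Fin q × Fin q) s B = -B) (s : (Perm (Fin q)))
    (v : Fin q × Fin q → ℝ) :
    (permRep (Perm (Fin q)) (Fin q × Fin q)).asAlgebraHom (signedStab (Perm (Fin q)) B)
      (permRep (Perm (Fin q)) (Fin q × Fin q) s
        ((permRep (Perm (Fin q)) (Fin q × Fin q)).asAlgebraHom (standardElt a b) v)) = 0 := by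
  have h0 : ∀ w : Fin q → ℝ, (permRep (Perm (Fin q)) (Fin q)).asAlgebraHom (signedStab (Perm (Fin q)) B) w = 0 := by
    intro w
    funext x
    obtain ⟨s, hs, hsB⟩ := hB x
    have := signedStab_smul_eq_neg hsB w x
    rw [Perm.smul_def, hs] at this
    rw [Pi.zero_apply]
    linarith
  have hv := asAlgebraHom_standardElt_pairs hab v
  generalize (permRep (Perm (Fin q)) (Fin q × Fin q)).asAlgebraHom (standardElt a b) v = w at hv ⊢
  induction hv using Submodule.span_induction with
  | mem w hw =>
    obtain ⟨k, rfl⟩ := hw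
    simp only
    rw [← letterMap_equivariant, ← asAlgebraHom_intertwine _ (letterMap_equivariant k), h0,
      map_zero]
  | zero => simp
  | add w w' _ _ hw hw' => simp only [map_add, hw, hw', add_zero]
  | smul r w _ hw => simp only [map_smul, hw, smul_zero]

/-- The sum of all group elements. -/
def groupSum (G : Type*) [Group G] [Fintype G] : MonoidAlgebra ℝ G :=
  ∑ g, MonoidAlgebra.single g 1

theorem rev_groupSum {G : Type*} [Group G] [Fintype G] : rev (groupSum G) = groupSum G := by
  simp only [groupSum, map_sum, rev_single]
  exact Fintype.sum_equiv (Equiv.inv _) _ _ fun s => rfl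

section

variable {G : Type*} [Group G] [Fintype G] (σ : Representation ℝ G V)

theorem asAlgebraHom_groupSum (v : V) : σ.asAlgebraHom (groupSum G) v = ∑ g, σ g v := by
  simp only [groupSum, map_sum, LinearMap.sum_apply, asAlgebraHom_single]

theorem apply_groupSum (g : G) (v : V) :
    σ g (σ.asAlgebraHom (groupSum G) v) = σ.asAlgebraHom (groupSum G) v := by
  rw [asAlgebraHom_groupSum, map_sum]
  refine Fintype.sum_equiv (Equiv.mulLeft g) _ _ fun s' => ?_
  rw [Equiv.coe_mulLeft, map_mul, Module.End.mul_apply]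

theorem groupSum_apply (g : G) (v : V) :
    σ.asAlgebraHom (groupSum G) (σ g v) = σ.asAlgebraHom (groupSum G) v := by
  rw [asAlgebraHom_groupSum, asAlgebraHom_groupSum]
  refine Fintype.sum_equiv (Equiv.mulRight g) _ _ fun s' => ?_
  rw [Equiv.coe_mulRight, map_mul, Module.End.mul_apply]

theorem groupSum_of_invariant {v : V} (h : ∀ g, σ g v = v) :
    σ.asAlgebraHom (groupSum G) v = (Fintype.card G : ℝ) • v := by
  rw [asAlgebraHom_groupSum, Finset.sum_congr rfl fun g _ => h g, Finset.sum_const,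
    Finset.card_univ, Nat.cast_smul_eq_nsmul]

theorem groupSum_eq_zero {v : V} {g : G} (h : σ g v = -v) :
    σ.asAlgebraHom (groupSum G) v = 0 := by
  have h1 := groupSum_apply σ g v
  rw [h, map_neg] at h1
  have h2 : (2 : ℝ) • σ.asAlgebraHom (groupSum G) v = 0 := by
    rw [two_smul]
    nth_rewrite 1 [← h1]
    exact neg_add_cancel _
  exact (smul_eq_zero.1 h2).resolve_left two_ne_zero

end

theorem apply_standardElt (a b : Fin q) (v : V) :
    ρ (swap a b) (ρ.asAlgebraHom (standardElt a b) v) = -ρ.asAlgebraHom (standardElt a b) v := by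
  obtain ⟨u, -, h⟩ := asAlgebraHom_standardElt ρ a b v
  rw [h, map_sub, ← Module.End.mul_apply, ← map_mul, Equiv.swap_mul_self, map_one, Module.End.one_apply,
    neg_sub]

/-- The identity matrix and the matrix `J - I`, as functions. -/
def orbitFun (q : ℕ) : Fin 2 → Fin q × Fin q → ℝ :=
  ![fun p => if p.1 = p.2 then 1 else 0, fun p => if p.1 = p.2 then 0 else 1]

theorem permRep_orbitFun (k : Fin 2) (s : (Perm (Fin q))) :
    permRep (Perm (Fin q)) (Fin q × Fin q) s (orbitFun q k) = orbitFun q k := by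
  funext ⟨x, y⟩
  fin_cases k <;> simp [permRep_apply, orbitFun]

theorem range_groupSum {a b : Fin q} (hab : a ≠ b) :
    LinearMap.range ((permRep (Perm (Fin q)) (Fin q × Fin q)).asAlgebraHom (groupSum (Perm (Fin q)))) =
      Submodule.span ℝ (Set.range (orbitFun q)) := by
  apply le_antisymm
  · rintro _ ⟨v, rfl⟩
    set w := (permRep (Perm (Fin q)) (Fin q × Fin q)).asAlgebraHom (groupSum (Perm (Fin q))) v with hw
    have h : ∀ (s : (Perm (Fin q))) x y, w (s x, s y) = w (x, y) := by
      intro s x y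
      have := congrFun (apply_groupSum (permRep (Perm (Fin q)) (Fin q × Fin q)) s v) (s • (x, y))
      rw [permRep_apply, inv_smul_smul] at this
      exact this.symm
    have : w = w (a, a) • orbitFun q 0 + w (a, b) • orbitFun q 1 := by
      funext ⟨x, y⟩
      rcases eq_or_ne x y with rfl | hxy
      · have := h (swap a x) a a
        rw [swap_apply_left] at this
        simp [orbitFun, this]
      · obtain ⟨s, hs1, hs2, -⟩ := exists_perm_pair hab hxy
        have := h s a b
        rw [hs1, hs2] at this
        simp [orbitFun, this, hxy]
    rw [this]
    refine add_mem ?_ ?_ <;> exact Submodule.smul_mem _ _ (Submodule.subset_span ⟨_, rfl⟩)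
  · rw [Submodule.span_le]
    rintro _ ⟨k, rfl⟩
    refine ⟨(Fintype.card (Perm (Fin q)) : ℝ)⁻¹ • orbitFun q k, ?_⟩
    rw [map_smul, groupSum_of_invariant _ (permRep_orbitFun k), smul_smul, inv_mul_cancel₀,
      one_smul]
    exact_mod_cast Fintype.card_ne_zero

/-- A function on pairs of letters that is orthogonal to all translates of the standard
generators vanishes. -/
theorem eq_zero_of_orthogonal (v : Fin q × Fin q → ℝ)
    (h0 : ∀ k, v ⬝ᵥ orbitFun q k = 0)
    (h1 : ∀ k (a b : Fin q), a ≠ b → v ⬝ᵥ letterMap q k (diffVec a b) = 0)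
    (h2 : ∀ a b c : Fin q, a ≠ b → a ≠ c → b ≠ c → v ⬝ᵥ cycFun a b c = 0)
    (h3 : ∀ a b c d : Fin q, a ≠ b → a ≠ c → a ≠ d → b ≠ c → b ≠ d → c ≠ d →
      v ⬝ᵥ quadFun a b c d = 0) : v = 0 := by
  by_cases hq : q = 0
  · subst hq; funext p; exact p.1.elim0
  have hq' : (q : ℝ) ≠ 0 := by exact_mod_cast hq
  have hd0 : ∑ x, v (x, x) = 0 := by
    have := h0 0
    simp only [dotProduct, Fintype.sum_prod_type, orbitFun, Matrix.cons_val_zero, mul_ite, mul_one,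
      mul_zero, Finset.sum_ite_eq, Finset.mem_univ, if_true] at this
    exact this
  have hd1 : ∀ a b, a ≠ b → v (a, a) = v (b, b) := by
    intro a b hab
    have := h1 0 a b hab
    simp only [dotProduct, Fintype.sum_prod_type, letterMap_zero_apply, mul_ite,
      mul_zero, Finset.sum_ite_eq, Finset.mem_univ, if_true, diffVec, Pi.sub_apply,
      Pi.single_apply, mul_sub, Finset.sum_sub_distrib, mul_one, Finset.sum_ite_eq'] at this
    linarith
  have hd : ∀ a, v (a, a) = 0 := by
    intro a
    have : ∑ x, v (x, x) = q * v (a, a) := by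
      rw [Finset.sum_congr rfl fun x _ => show v (x, x) = v (a, a) from ?_]
      · simp
      · rcases eq_or_ne x a with rfl | hx
        · rfl
        · exact hd1 x a hx
    rw [hd0] at this
    exact (mul_eq_zero.1 this.symm).resolve_left hq'
  have ht : ∑ x, ∑ y, v (x, y) = 0 := by
    have e0 := h0 0
    have e1 := h0 1
    have : ∑ x, ∑ y, v (x, y) = v ⬝ᵥ orbitFun q 0 + v ⬝ᵥ orbitFun q 1 := by
      rw [← dotProduct_add, dotProduct, Fintype.sum_prod_type]
      refine Finset.sum_congr rfl fun x _ => Finset.sum_congr rfl fun y _ => ?_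
      by_cases hxy : x = y <;> simp [orbitFun, hxy]
    rw [this, e0, e1, add_zero]
  have hr1 : ∀ a b, a ≠ b → ∑ y, v (a, y) = ∑ y, v (b, y) := by
    intro a b hab
    have := h1 1 a b hab
    simp only [dotProduct, Fintype.sum_prod_type, letterMap_one_apply, diffVec, Pi.sub_apply,
      Pi.single_apply, mul_sub, Finset.sum_sub_distrib, mul_ite, mul_one, mul_zero] at this
    rw [Finset.sum_comm, Finset.sum_comm (f := fun x y => if x = b then v (x, y) else 0)] at this
    simp only [Finset.sum_ite_eq', Finset.mem_univ, if_true] at this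
    linarith
  have hr : ∀ a, ∑ y, v (a, y) = 0 := by
    intro a
    have : ∑ x, ∑ y, v (x, y) = q * ∑ y, v (a, y) := by
      rw [Finset.sum_congr rfl fun x _ => show ∑ y, v (x, y) = ∑ y, v (a, y) from ?_]
      · simp
      · rcases eq_or_ne x a with rfl | hx
        · rfl
        · exact hr1 x a hx
    rw [ht] at this
    exact (mul_eq_zero.1 this.symm).resolve_left hq'
  have hc1 : ∀ a b, a ≠ b → ∑ x, v (x, a) = ∑ x, v (x, b) := by
    intro a b hab
    have := h1 2 a b hab
    simp only [dotProduct, Fintype.sum_prod_type, letterMap_two_apply, diffVec, Pi.sub_apply,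
      Pi.single_apply, mul_sub, Finset.sum_sub_distrib, mul_ite, mul_one, mul_zero,
      Finset.sum_ite_eq', Finset.mem_univ, if_true] at this
    linarith
  have hc : ∀ a, ∑ x, v (x, a) = 0 := by
    intro a
    have : ∑ x, ∑ y, v (x, y) = q * ∑ x, v (x, a) := by
      rw [Finset.sum_comm, Finset.sum_congr rfl fun y _ =>
        show ∑ x, v (x, y) = ∑ x, v (x, a) from ?_]
      · simp
      · rcases eq_or_ne y a with rfl | hx
        · rfl
        · exact hc1 y a hx
    rw [ht] at this
    exact (mul_eq_zero.1 this.symm).resolve_left hq'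
  -- The relation for the cyclic triple is summed over the third letter `c`. As all row and column
  -- sums vanish, only `q` times the antisymmetric part at `(a, b)` remains.
  have hs : ∀ a b, v (a, b) = v (b, a) := by
    intro a b
    have hcyc : ∀ c, (v (a, b) - v (b, a)) + (v (b, c) - v (c, b)) + (v (c, a) - v (a, c)) = 0 := by
      intro c
      rcases eq_or_ne a b with rfl | hab
      · ring
      rcases eq_or_ne a c with rfl | hac
      · ring
      rcases eq_or_ne b c with rfl | hbc
      · ring
      have := h2 a b c hab hac hbc
      simp only [cycFun, dotProduct_add, dotProduct_sub, dotProduct_pairUnit] at this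
      linarith
    have hsum := Finset.sum_eq_zero fun c (_ : c ∈ Finset.univ) => hcyc c
    simp only [Finset.sum_add_distrib, Finset.sum_sub_distrib, hr, hc, Finset.sum_const,
      Finset.card_univ, Fintype.card_fin, nsmul_eq_mul] at hsum
    have : (q : ℝ) * (v (a, b) - v (b, a)) = 0 := by linarith
    exact sub_eq_zero.1 ((mul_eq_zero.1 this).resolve_left hq')
  -- By the quadrangle relations, the difference of rows `a` and `b` is constant outside the columns
  -- `a` and `b`. In these two columns its entries cancel by symmetry and the vanishing diagonal, so
  -- that the zero row sums give `q - 2` times the constant.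
  have heq : ∀ a b c, a ≠ c → b ≠ c → v (a, c) = v (b, c) := by
    intro a b c hac hbc
    rcases eq_or_ne a b with rfl | hab
    · rfl
    have hquad : ∀ d, d ≠ a → d ≠ b → v (a, c) - v (b, c) = v (a, d) - v (b, d) := by
      intro d hda hdb
      rcases eq_or_ne c d with rfl | hcd
      · rfl
      have := h3 a b c d hab hac hda.symm hbc hdb.symm hcd
      simp only [quadFun, dotProduct_add, dotProduct_sub, dotProduct_pairUnit] at this
      rw [hs c b, hs d a, hs c a, hs d b] at this
      linarith
    have hsum : ∑ d, (v (a, d) - v (b, d) -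
        (if d = a then -v (b, a) else if d = b then v (a, b) else v (a, c) - v (b, c))) = 0 := by
      refine Finset.sum_eq_zero fun d _ => ?_
      split_ifs with hda hdb
      · rw [hda, hd]; ring
      · rw [hdb, hd]; ring
      · rw [hquad d hda hdb, sub_self]
    have hsum2 : ∑ d : Fin q, (if d = a then -v (b, a) else if d = b then v (a, b) else
        v (a, c) - v (b, c)) = (q - 2) * (v (a, c) - v (b, c)) := by
      have : ∀ d : Fin q, (if d = a then -v (b, a) else if d = b then v (a, b) else
          v (a, c) - v (b, c)) = (v (a, c) - v (b, c)) +
          (if d = a then -v (b, a) - (v (a, c) - v (b, c)) else 0) +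
          (if d = b then v (a, b) - (v (a, c) - v (b, c)) else 0) := by
        intro d
        by_cases hda : d = a
        · simp [hda, hab]
        · by_cases hdb : d = b <;> simp [hda, hdb, hab.symm]
      rw [Finset.sum_congr rfl fun d _ => this d, Finset.sum_add_distrib, Finset.sum_add_distrib]
      simp only [Finset.sum_ite_eq', Finset.mem_univ, if_true, Finset.sum_const,
        Finset.card_univ, Fintype.card_fin, nsmul_eq_mul]
      rw [hs a b]
      ring
    rw [Finset.sum_sub_distrib, Finset.sum_sub_distrib, hr, hr, hsum2] at hsum
    have hq3 : (q : ℝ) - 2 ≠ 0 := by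
      have : 3 ≤ q := by
        have := Finset.card_le_univ ({a, b, c} : Finset (Fin q))
        rwa [Finset.card_eq_three.2 ⟨a, b, c, hab, hac, hbc, rfl⟩, Fintype.card_fin] at this
      have : (3 : ℝ) ≤ q := by exact_mod_cast this
      linarith
    have : ((q : ℝ) - 2) * (v (a, c) - v (b, c)) = 0 := by linarith
    exact sub_eq_zero.1 ((mul_eq_zero.1 this).resolve_left hq3)
  funext ⟨a, c⟩
  rcases eq_or_ne a c with rfl | hac
  · exact hd a
  -- Column `c` is constant off the diagonal and has sum zero, so `q - 1` times the constant
  -- vanishes.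
  have hsum : ∑ x, (v (x, c) - (if x = c then 0 else v (a, c))) = 0 := by
    refine Finset.sum_eq_zero fun x _ => ?_
    split_ifs with hxc
    · rw [hxc, hd, sub_zero]
    · rw [heq x a c hxc hac, sub_self]
  rw [Finset.sum_sub_distrib, hc, zero_sub, neg_eq_zero] at hsum
  have hpos : ∑ x : Fin q, (if x = c then 0 else v (a, c)) = (q - 1) * v (a, c) := by
    have : ∀ x : Fin q, (if x = c then 0 else v (a, c)) =
        v (a, c) - (if x = c then v (a, c) else 0) := by
      intro x; split_ifs <;> simp
    rw [Finset.sum_congr rfl fun x _ => this x, Finset.sum_sub_distrib]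
    simp
    ring
  rw [hpos] at hsum
  have hq2 : (q : ℝ) - 1 ≠ 0 := by
    have : 2 ≤ q := by
      have := Finset.card_le_univ ({a, c} : Finset (Fin q))
      rwa [Finset.card_pair hac, Fintype.card_fin] at this
    have : (2 : ℝ) ≤ q := by exact_mod_cast this
    linarith
  exact (mul_eq_zero.1 hsum).resolve_left hq2

end Standard

/-! ### The four blocks of the matrix representation of `S_q` -/

section LetterBlocks

open Matrix Equiv

theorem exists_perm_extending {α : Type*} {k : ℕ} {f g : Fin k → α}
    (hf : Function.Injective f) (hg : Function.Injective g) :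
    ∃ s : Perm α, ∀ i, s (f i) = g i := by
  have := Equiv.Perm.isMultiplyPretransitive α k
  obtain ⟨s, hs⟩ := MulAction.exists_smul_eq (Perm α) (⟨f, hf⟩ : Fin k ↪ α) ⟨g, hg⟩
  exact ⟨s, fun i => DFunLike.congr_fun hs i⟩

variable {q : ℕ}

/-- The columns of `B₁, …, B₄`, as functions on pairs of letters. -/
def colFun (q : ℕ) (i : Fin 4) (j : ℕ) : Fin q × Fin q → ℝ := fun p => basisMat q i j p.1 p.2

theorem unitMat_apply {a b : ℕ} (ha : a < q) (hb : b < q) (x y : Fin q) :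
    unitMat q (a + 1) (b + 1) x y = pairUnit ⟨a, ha⟩ ⟨b, hb⟩ (x, y) := by
  simp only [unitMat, vecMulVec_apply, unitVec, pairUnit_apply, Fin.ext_iff, Nat.add_right_cancel_iff]
  split_ifs <;> simp_all

theorem colFun_zero (k : Fin 2) : colFun q 0 k = orbitFun q k := by
  funext ⟨x, y⟩
  fin_cases k
  · simp [colFun, basisMat, orbitFun, Matrix.one_apply]
  · simp only [colFun, basisMat, orbitFun, Matrix.sub_apply, allOne, Matrix.one_apply, of_apply]
    split_ifs <;> simp_all

theorem diffMat_apply (h0 : 0 < q) (h1 : 1 < q) (x y : Fin q) :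
    diffMat q x y = diffVec ⟨0, h0⟩ ⟨1, h1⟩ x := by
  simp [diffMat, vecMulVec_apply, unitVec, diffVec, Pi.single_apply, Fin.ext_iff]

theorem unitMat_sub_apply (h0 : 0 < q) (h1 : 1 < q) (x y : Fin q) :
    unitMat q 1 1 x y - unitMat q 2 2 x y = letterMap q 0 (diffVec ⟨0, h0⟩ ⟨1, h1⟩) (x, y) := by
  rw [unitMat_apply h0 h0, unitMat_apply h1 h1]
  simp only [letterMap_zero_apply, diffVec, pairUnit_apply, Pi.sub_apply, Pi.single_apply,
    Fin.ext_iff]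
  split_ifs <;> first | omega | simp

theorem colFun_one_zero (h0 : 0 < q) (h1 : 1 < q) :
    colFun q 1 0 = letterMap q 0 (diffVec ⟨0, h0⟩ ⟨1, h1⟩) := by
  funext ⟨x, y⟩
  exact unitMat_sub_apply h0 h1 x y

theorem colFun_one_one (h0 : 0 < q) (h1 : 1 < q) :
    colFun q 1 1 = letterMap q 1 (diffVec ⟨0, h0⟩ ⟨1, h1⟩) -
      letterMap q 2 (diffVec ⟨0, h0⟩ ⟨1, h1⟩) := by
  funext ⟨x, y⟩
  simp [colFun, basisMat, diffMat_apply h0 h1, letterMap_one_apply, letterMap_two_apply]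

theorem colFun_one_two (h0 : 0 < q) (h1 : 1 < q) :
    colFun q 1 2 = letterMap q 1 (diffVec ⟨0, h0⟩ ⟨1, h1⟩) +
      letterMap q 2 (diffVec ⟨0, h0⟩ ⟨1, h1⟩) -
      (2 : ℝ) • letterMap q 0 (diffVec ⟨0, h0⟩ ⟨1, h1⟩) := by
  funext ⟨x, y⟩
  simp [colFun, basisMat, diffMat_apply h0 h1, letterMap_one_apply, letterMap_two_apply,
    unitMat_sub_apply h0 h1]

theorem colFun_two_zero (h0 : 0 < q) (h1 : 1 < q) (h2 : 2 < q) :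
    colFun q 2 0 = cycFun ⟨0, h0⟩ ⟨1, h1⟩ ⟨2, h2⟩ := by
  funext ⟨x, y⟩
  simp only [colFun, basisMat, Matrix.add_apply, Matrix.sub_apply, cycFun, Pi.add_apply,
    Pi.sub_apply]
  rw [unitMat_apply h0 h1, unitMat_apply h1 h2, unitMat_apply h2 h0, unitMat_apply h1 h0,
    unitMat_apply h2 h1, unitMat_apply h0 h2]

theorem colFun_three_zero (h0 : 0 < q) (h1 : 1 < q) (h2 : 2 < q) (h3 : 3 < q) :
    colFun q 3 0 = quadFun ⟨0, h0⟩ ⟨1, h1⟩ ⟨2, h2⟩ ⟨3, h3⟩ := by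
  funext ⟨x, y⟩
  simp only [colFun, basisMat, Matrix.add_apply, Matrix.sub_apply, quadFun, Pi.add_apply,
    Pi.sub_apply]
  rw [unitMat_apply h0 h2, unitMat_apply h2 h1, unitMat_apply h1 h3, unitMat_apply h3 h0,
    unitMat_apply h2 h0, unitMat_apply h1 h2, unitMat_apply h3 h1, unitMat_apply h0 h3]

theorem li_colFun_zero (hq : 2 ≤ q) {m : ℕ} (hm : m = 2) :
    LinearIndependent ℝ fun j : Fin m => colFun q 0 j := by
  subst hm
  simp only [colFun_zero]
  rw [Fintype.linearIndependent_iff]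
  intro g hg
  have e0 := congrFun hg (⟨0, by omega⟩, ⟨0, by omega⟩)
  have e1 := congrFun hg (⟨0, by omega⟩, ⟨1, by omega⟩)
  simp [Fin.sum_univ_two, orbitFun] at e0 e1
  intro i
  fin_cases i <;> assumption

theorem span_colFun_zero {m : ℕ} (hm : m = 2) :
    Submodule.span ℝ (Set.range fun j : Fin m => colFun q 0 j) =
      Submodule.span ℝ (Set.range (orbitFun q)) := by
  subst hm
  simp only [colFun_zero]

theorem li_colFun_one (hq : 2 ≤ q) {m : ℕ} (hm : m = if q ≤ 2 then 2 else 3) :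
    LinearIndependent ℝ fun j : Fin m => colFun q 1 j := by
  have h0 : 0 < q := by omega
  have h1 : 1 < q := by omega
  by_cases h2 : q ≤ 2
  · rw [if_pos h2] at hm
    subst hm
    rw [Fintype.linearIndependent_iff]
    intro g hg
    rw [Fin.sum_univ_two] at hg
    simp only [Fin.val_zero, Fin.val_one, colFun_one_zero h0 h1, colFun_one_one h0 h1] at hg
    have e0 := congrFun hg (⟨0, h0⟩, ⟨0, h0⟩)
    have e1 := congrFun hg (⟨0, h0⟩, ⟨1, h1⟩)
    simp [letterMap_zero_apply, letterMap_one_apply, letterMap_two_apply, diffVec] at e0 e1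
    intro i
    fin_cases i
    · simpa using e0
    · simpa using (by linarith : g 1 = 0)
  · rw [if_neg h2] at hm
    subst hm
    rw [Fintype.linearIndependent_iff]
    intro g hg
    rw [Fin.sum_univ_three] at hg
    simp only [Fin.val_zero, Fin.val_one, Fin.val_two, colFun_one_zero h0 h1,
      colFun_one_one h0 h1, colFun_one_two h0 h1] at hg
    have e0 := congrFun hg (⟨0, h0⟩, ⟨0, h0⟩)
    have e1 := congrFun hg (⟨0, h0⟩, ⟨1, h1⟩)
    have e2 := congrFun hg (⟨0, h0⟩, ⟨2, by omega⟩)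
    simp [letterMap_zero_apply, letterMap_one_apply, letterMap_two_apply, diffVec,
      Pi.single_apply, Fin.ext_iff] at e0 e1 e2
    have f0 : g 0 = 0 := by linarith
    have f1 : g 1 = 0 := by linarith
    have f2 : g 2 = 0 := by linarith
    intro i
    fin_cases i <;> assumption

theorem span_colFun_one (h0 : 0 < q) (h1 : 1 < q) {m : ℕ} (hm : m = if q ≤ 2 then 2 else 3) :
    Submodule.span ℝ (Set.range fun j : Fin m => colFun q 1 j) =
      Submodule.span ℝ (Set.range fun k => letterMap q k (diffVec ⟨0, h0⟩ ⟨1, h1⟩)) := by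
  have hmem : ∀ k, letterMap q k (diffVec ⟨0, h0⟩ ⟨1, h1⟩) ∈
      Submodule.span ℝ (Set.range fun k => letterMap q k (diffVec ⟨0, h0⟩ ⟨1, h1⟩)) := fun k =>
    Submodule.subset_span ⟨k, rfl⟩
  have hm2 : 2 ≤ m := by rw [hm]; split_ifs <;> omega
  apply le_antisymm <;> rw [Submodule.span_le]
  · rintro _ ⟨⟨j, hj⟩, rfl⟩
    have hj3 : j < 3 := by split_ifs at hm <;> omega
    change colFun q 1 j ∈ _
    interval_cases j
    · rw [colFun_one_zero h0 h1]; exact hmem 0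
    · rw [colFun_one_one h0 h1]; exact sub_mem (hmem 1) (hmem 2)
    · rw [colFun_one_two h0 h1]
      exact sub_mem (add_mem (hmem 1) (hmem 2)) (Submodule.smul_mem _ _ (hmem 0))
  · have hcol : ∀ j, j < 3 → colFun q 1 j ∈
        Submodule.span ℝ (Set.range fun j : Fin m => colFun q 1 j) := by
      intro j hj
      by_cases hjm : j < m
      · exact Submodule.subset_span ⟨⟨j, hjm⟩, rfl⟩
      · have hj2 : j = 2 := by omega
        have hq2 : q = 2 := by
          by_contra hq
          rw [if_neg (by omega)] at hm
          omega
        subst hj2 hq2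
        -- For two letters, `N + Nᵀ` equals `2 (E₁₁ - E₂₂)`, so the third column may be dropped
        -- without changing the span.
        have : colFun 2 1 2 = 0 := by
          rw [colFun_one_two h0 h1]
          funext ⟨x, y⟩
          fin_cases x <;> fin_cases y <;>
            simp [letterMap_zero_apply, letterMap_one_apply, letterMap_two_apply, diffVec,
              Pi.single_apply, Fin.ext_iff] <;> norm_num
        rw [this]
        exact zero_mem _
    rintro _ ⟨k, rfl⟩
    change letterMap q k (diffVec ⟨0, h0⟩ ⟨1, h1⟩) ∈ _
    have c0 := hcol 0 (by omega)
    have c1 := hcol 1 (by omega)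
    have c2 := hcol 2 (by omega)
    fin_cases k
    · rwa [colFun_one_zero h0 h1] at c0
    · have : letterMap q 1 (diffVec ⟨0, h0⟩ ⟨1, h1⟩) =
          (2⁻¹ : ℝ) • (colFun q 1 1 + colFun q 1 2 + (2 : ℝ) • colFun q 1 0) := by
        rw [colFun_one_zero h0 h1, colFun_one_one h0 h1, colFun_one_two h0 h1]
        module
      exact this ▸ Submodule.smul_mem _ _ (add_mem (add_mem c1 c2) (Submodule.smul_mem _ _ c0))
    · have : letterMap q 2 (diffVec ⟨0, h0⟩ ⟨1, h1⟩) =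
          (2⁻¹ : ℝ) • (colFun q 1 2 - colFun q 1 1 + (2 : ℝ) • colFun q 1 0) := by
        rw [colFun_one_zero h0 h1, colFun_one_one h0 h1, colFun_one_two h0 h1]
        module
      exact this ▸ Submodule.smul_mem _ _ (add_mem (sub_mem c2 c1) (Submodule.smul_mem _ _ c0))

theorem cycFun_ne_zero {a b c : Fin q} (hab : a ≠ b) (hac : a ≠ c) (hbc : b ≠ c) :
    cycFun a b c ≠ 0 := by
  intro h
  have := congrFun h (a, b)
  simp [cycFun, pairUnit_apply, hab, hac, hbc, hab.symm, hac.symm, hbc.symm] at this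

theorem quadFun_ne_zero {a b c d : Fin q} (hab : a ≠ b) (hac : a ≠ c) (had : a ≠ d) (hbc : b ≠ c)
    (hcd : c ≠ d) : quadFun a b c d ≠ 0 := by
  intro h
  have := congrFun h (a, c)
  simp [quadFun, pairUnit_apply, hab, hac, had, hbc, hcd, hab.symm, hac.symm, had.symm,
    hbc.symm, hcd.symm] at this

theorem li_singleton {V : Type*} [AddCommGroup V] [Module ℝ V] {m : ℕ} (f : ℕ → V)
    (h : m = 0 ∨ m = 1 ∧ f 0 ≠ 0) : LinearIndependent ℝ fun j : Fin m => f j := by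
  rcases h with rfl | ⟨rfl, h⟩
  · exact linearIndependent_empty_type
  · rw [linearIndependent_unique_iff]
    exact h

theorem span_singleton_range {V : Type*} [AddCommGroup V] [Module ℝ V] {m : ℕ} (f : ℕ → V)
    {B : V} (h : m = 0 ∧ B = 0 ∨ m = 1 ∧ f 0 = B) :
    Submodule.span ℝ (Set.range fun j : Fin m => f j) = Submodule.span ℝ {B} := by
  rcases h with ⟨rfl, rfl⟩ | ⟨rfl, rfl⟩
  · simp
  · rw [Set.range_unique]
    rfl

theorem injective_vec_two {α : Type*} {a b : α} (hab : a ≠ b) : Function.Injective ![a, b] := by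
  intro i j h
  fin_cases i <;> fin_cases j <;> simp_all

theorem injective_vec_three {α : Type*} {a b c : α} (hab : a ≠ b) (hac : a ≠ c) (hbc : b ≠ c) :
    Function.Injective ![a, b, c] := by
  intro i j h
  fin_cases i <;> fin_cases j <;> simp_all

theorem injective_vec_four {α : Type*} {a b c d : α} (hab : a ≠ b) (hac : a ≠ c) (had : a ≠ d)
    (hbc : b ≠ c) (hbd : b ≠ d) (hcd : c ≠ d) : Function.Injective ![a, b, c, d] := by
  intro i j h
  fin_cases i <;> fin_cases j <;> simp_all

open Classical in
/-- The function of the third block, zero for small alphabets. -/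
def thirdFun (q : ℕ) : Fin q × Fin q → ℝ :=
  if h : 2 < q then cycFun ⟨0, by omega⟩ ⟨1, by omega⟩ ⟨2, h⟩ else 0

open Classical in
/-- The function of the fourth block, zero for small alphabets. -/
def fourthFun (q : ℕ) : Fin q × Fin q → ℝ :=
  if h : 3 < q then quadFun ⟨0, by omega⟩ ⟨1, by omega⟩ ⟨2, by omega⟩ ⟨3, h⟩ else 0

/-- The defining properties of `thirdFun` and `fourthFun` that yield a block. -/
structure IsSignedFun (B : Fin q × Fin q → ℝ) : Prop where
  line : ∀ v, ∃ c : ℝ,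
    (permRep (Perm (Fin q)) (Fin q × Fin q)).asAlgebraHom (signedStab (Perm (Fin q)) B) v = c • B
  odd : B ≠ 0 → ∃ s : Perm (Fin q), permRep (Perm (Fin q)) (Fin q × Fin q) s B = -B
  odd_fix : B ≠ 0 → ∀ x : Fin q, ∃ s : Perm (Fin q), s x = x ∧
    permRep (Perm (Fin q)) (Fin q × Fin q) s B = -B

theorem isSignedFun_zero : IsSignedFun (0 : Fin q × Fin q → ℝ) where
  line v := ⟨0, by rw [asAlgebraHom_signedStab_zero, zero_smul]⟩
  odd h := absurd rfl h
  odd_fix h := absurd rfl h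

theorem isSignedFun_thirdFun (q : ℕ) : IsSignedFun (thirdFun q) := by
  rw [thirdFun]
  split_ifs with h
  swap
  · exact isSignedFun_zero
  set a : Fin q := ⟨0, by omega⟩
  set b : Fin q := ⟨1, by omega⟩
  set c : Fin q := ⟨2, by omega⟩
  have hab : a ≠ b := by simp [a, b]
  have hac : a ≠ c := by simp [a, c]
  have hbc : b ≠ c := by simp [b, c]
  refine ⟨signedStab_cycFun_eq hab hac hbc, fun _ => ⟨swap a b, permRep_swap_cycFun hac hbc⟩,
    fun _ x => ?_⟩
  by_cases hx : x = a ∨ x = b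
  · by_cases hxa : x = a
    · refine ⟨swap b c, ?_, ?_⟩
      · rw [hxa, swap_apply_of_ne_of_ne hab hac]
      · rw [← cycFun_rotate]; exact permRep_swap_cycFun hab.symm hac.symm
    · have hxb := hx.resolve_left hxa
      refine ⟨swap a c, ?_, ?_⟩
      · rw [hxb, swap_apply_of_ne_of_ne hab.symm hbc]
      · rw [cycFun_rotate c a b, Equiv.swap_comm]; exact permRep_swap_cycFun hbc.symm hab
  · push Not at hx
    exact ⟨swap a b, swap_apply_of_ne_of_ne hx.1 hx.2, permRep_swap_cycFun hac hbc⟩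

theorem isSignedFun_fourthFun (q : ℕ) : IsSignedFun (fourthFun q) := by
  rw [fourthFun]
  split_ifs with h
  swap
  · exact isSignedFun_zero
  set a : Fin q := ⟨0, by omega⟩
  set b : Fin q := ⟨1, by omega⟩
  set c : Fin q := ⟨2, by omega⟩
  set d : Fin q := ⟨3, by omega⟩
  have hab : a ≠ b := by simp [a, b]
  have hac : a ≠ c := by simp [a, c]
  have had : a ≠ d := by simp [a, d]
  have hbc : b ≠ c := by simp [b, c]
  have hbd : b ≠ d := by simp [b, d]
  have hcd : c ≠ d := by simp [c, d]
  refine ⟨signedStab_quadFun_eq hab hac had hbc hbd hcd,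
    fun _ => ⟨swap a b, permRep_swap_quadFun hac hbc had hbd⟩, fun _ x => ?_⟩
  by_cases hx : x = a ∨ x = b
  · refine ⟨swap c d, ?_, permRep_swap_quadFun' hac hbc had hbd⟩
    rcases hx with rfl | rfl
    · exact swap_apply_of_ne_of_ne hac had
    · exact swap_apply_of_ne_of_ne hbc hbd
  · push Not at hx
    exact ⟨swap a b, swap_apply_of_ne_of_ne hx.1 hx.2, permRep_swap_quadFun hac hbc had hbd⟩

theorem thirdFun_skew (p : Fin q × Fin q) : thirdFun q p.swap = -thirdFun q p := by
  rw [thirdFun]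
  split_ifs
  · simp only [cycFun, Pi.add_apply, Pi.sub_apply, Prod.swap, pairUnit_apply]
    obtain ⟨x, y⟩ := p
    simp only [pairUnit_apply, and_comm]
    ring
  · simp

theorem fourthFun_symm (p : Fin q × Fin q) : fourthFun q p.swap = fourthFun q p := by
  rw [fourthFun]
  split_ifs
  · simp only [quadFun, Pi.add_apply, Pi.sub_apply, Prod.swap, pairUnit_apply]
    obtain ⟨x, y⟩ := p
    simp only [pairUnit_apply, and_comm]
    ring
  · simp

theorem asAlgebraHom_comp_swap (x : MonoidAlgebra ℝ (Perm (Fin q))) (v : Fin q × Fin q → ℝ)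
    (p : Fin q × Fin q) :
    (permRep (Perm (Fin q)) (Fin q × Fin q)).asAlgebraHom x v p.swap =
      (permRep (Perm (Fin q)) (Fin q × Fin q)).asAlgebraHom x (fun p => v p.swap) p :=
  congrFun (asAlgebraHom_intertwine (LinearMap.funLeft ℝ ℝ Prod.swap)
    (fun g v => by funext p; rfl) x v) p

/-- The group action commutes with transposition, so the image of a translate of the symmetric
fourth function is symmetric. It is also a multiple of the skew third function, hence zero. -/
theorem signedStab_third_fourth (s : Perm (Fin q)) (v : Fin q × Fin q → ℝ) :
    (permRep (Perm (Fin q)) (Fin q × Fin q)).asAlgebraHom (signedStab _ (thirdFun q))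
      (permRep (Perm (Fin q)) (Fin q × Fin q) s
        ((permRep (Perm (Fin q)) (Fin q × Fin q)).asAlgebraHom
          (signedStab _ (fourthFun q)) v)) = 0 := by
  obtain ⟨c, hc⟩ := (isSignedFun_fourthFun q).line v
  rw [hc, map_smul, map_smul]
  obtain ⟨k, hk⟩ := (isSignedFun_thirdFun q).line
    (permRep (Perm (Fin q)) (Fin q × Fin q) s (fourthFun q))
  suffices H : (permRep (Perm (Fin q)) (Fin q × Fin q)).asAlgebraHom (signedStab _ (thirdFun q))
      (permRep (Perm (Fin q)) (Fin q × Fin q) s (fourthFun q)) = 0 by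
    rw [H, smul_zero]
  funext p
  have h1 := asAlgebraHom_comp_swap (signedStab _ (thirdFun q))
    (permRep (Perm (Fin q)) (Fin q × Fin q) s (fourthFun q)) p
  have h2 : (fun p : Fin q × Fin q => permRep (Perm (Fin q)) (Fin q × Fin q) s (fourthFun q)
      p.swap) = permRep (Perm (Fin q)) (Fin q × Fin q) s (fourthFun q) := by
    funext p
    exact fourthFun_symm (s⁻¹ • p)
  rw [h2, hk, Pi.smul_apply, thirdFun_skew, Pi.smul_apply] at h1
  rw [hk, Pi.smul_apply, Pi.zero_apply]
  simp only [smul_eq_mul] at h1 ⊢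
  linarith

/-- The elements of the group algebra of `S_q` that control the four blocks. -/
def letterElt (h0 : 0 < q) (h1 : 1 < q) : Fin 4 → MonoidAlgebra ℝ (Perm (Fin q)) :=
  ![groupSum _, standardElt ⟨0, h0⟩ ⟨1, h1⟩, signedStab _ (thirdFun q), signedStab _ (fourthFun q)]

theorem coeff_inv_of_rev {G : Type*} [Group G] {x : MonoidAlgebra ℝ G} (hx : rev x = x) (g : G) :
    x.coeff g⁻¹ = x.coeff g := by
  rw [← coeff_rev, hx]

theorem coeff_letterElt_inv (h0 : 0 < q) (h1 : 1 < q) (i : Fin 4) (g : Perm (Fin q)) :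
    (letterElt h0 h1 i).coeff g⁻¹ = (letterElt h0 h1 i).coeff g := by
  fin_cases i
  · exact coeff_inv_of_rev rev_groupSum g
  · exact coeff_inv_of_rev (rev_standardElt _ _) g
  · change (signedStab _ _).coeff _ = (signedStab _ _).coeff _
    rw [coeff_signedStab, coeff_signedStab, stabSign_inv]
  · change (signedStab _ _).coeff _ = (signedStab _ _).coeff _
    rw [coeff_signedStab, coeff_signedStab, stabSign_inv]

theorem li_colFun (h0 : 0 < q) (h1 : 1 < q) (i : Fin 4) :
    LinearIndependent ℝ fun j : Fin (numCols q i) => colFun q i j := by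
  fin_cases i
  · exact li_colFun_zero h1 rfl
  · exact li_colFun_one h1 rfl
  · refine li_singleton (colFun q 2) ?_
    by_cases h2 : q ≤ 2
    · exact Or.inl (if_pos h2)
    · refine Or.inr ⟨if_neg h2, ?_⟩
      rw [colFun_two_zero h0 h1 (by omega)]
      exact cycFun_ne_zero (by simp) (by simp) (by simp)
  · refine li_singleton (colFun q 3) ?_
    by_cases h2 : q ≤ 3
    · exact Or.inl (if_pos h2)
    · refine Or.inr ⟨if_neg h2, ?_⟩
      rw [colFun_three_zero h0 h1 (by omega) (by omega)]
      exact quadFun_ne_zero (by simp) (by simp) (by simp) (by simp) (by simp)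

theorem range_signedStab {B : Fin q × Fin q → ℝ} (hB : IsSignedFun B) :
    LinearMap.range ((permRep (Perm (Fin q)) (Fin q × Fin q)).asAlgebraHom
      (signedStab (Perm (Fin q)) B)) = Submodule.span ℝ {B} := by
  by_cases h : B = 0
  · subst h
    rw [Submodule.span_singleton_eq_bot.2 rfl, LinearMap.range_eq_bot]
    exact LinearMap.ext fun v => asAlgebraHom_signedStab_zero _ v
  · exact range_asAlgebraHom_signedStab h hB.line

theorem span_colFun (h0 : 0 < q) (h1 : 1 < q) (i : Fin 4) :
    Submodule.span ℝ (Set.range fun j : Fin (numCols q i) => colFun q i j) =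
      LinearMap.range ((permRep (Perm (Fin q)) (Fin q × Fin q)).asAlgebraHom
        (letterElt h0 h1 i)) := by
  fin_cases i
  · exact (span_colFun_zero rfl).trans
      (range_groupSum (show (⟨0, h0⟩ : Fin q) ≠ ⟨1, h1⟩ by simp)).symm
  · exact (span_colFun_one h0 h1 rfl).trans (range_standardElt (by simp)).symm
  · refine Eq.trans ?_ (range_signedStab (isSignedFun_thirdFun q)).symm
    refine span_singleton_range (colFun q 2) ?_
    by_cases h2 : q ≤ 2
    · exact Or.inl ⟨if_pos h2, dif_neg (by omega)⟩
    · refine Or.inr ⟨if_neg h2, ?_⟩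
      rw [colFun_two_zero h0 h1 (by omega), thirdFun, dif_pos (by omega)]
  · refine Eq.trans ?_ (range_signedStab (isSignedFun_fourthFun q)).symm
    refine span_singleton_range (colFun q 3) ?_
    by_cases h2 : q ≤ 3
    · exact Or.inl ⟨if_pos h2, dif_neg (by omega)⟩
    · refine Or.inr ⟨if_neg h2, ?_⟩
      rw [colFun_three_zero h0 h1 (by omega) (by omega), fourthFun, dif_pos (by omega)]

theorem controls_letterElt (h0 : 0 < q) (h1 : 1 < q) :
    Controls (permRep (Perm (Fin q)) (Fin q × Fin q)) (letterElt h0 h1) := by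
  have h01 : (⟨0, h0⟩ : Fin q) ≠ ⟨1, h1⟩ := by simp
  have hsymm := coeff_letterElt_inv h0 h1
  have hodd : ∀ {B : Fin q × Fin q → ℝ}, IsSignedFun B → ∀ s v,
      (permRep (Perm (Fin q)) (Fin q × Fin q)).asAlgebraHom (groupSum _)
        (permRep (Perm (Fin q)) (Fin q × Fin q) s
          ((permRep (Perm (Fin q)) (Fin q × Fin q)).asAlgebraHom (signedStab _ B) v)) = 0 := by
    intro B hB s v
    rw [groupSum_apply]
    by_cases h : B = 0
    · subst h; rw [asAlgebraHom_signedStab_zero, map_zero]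
    · obtain ⟨g, hg⟩ := hB.odd h
      exact groupSum_eq_zero _ (apply_asAlgebraHom_signedStab _ hg v)
  have hstd : ∀ {B : Fin q × Fin q → ℝ}, IsSignedFun B → ∀ s v,
      (permRep (Perm (Fin q)) (Fin q × Fin q)).asAlgebraHom (signedStab _ B)
        (permRep (Perm (Fin q)) (Fin q × Fin q) s
          ((permRep (Perm (Fin q)) (Fin q × Fin q)).asAlgebraHom
            (standardElt ⟨0, h0⟩ ⟨1, h1⟩) v)) = 0 := by
    intro B hB s v
    by_cases h : B = 0
    · subst h; rw [asAlgebraHom_signedStab_zero]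
    · exact signedStab_standardElt h01 (hB.odd_fix h) s v
  have c01 : ∀ s v, (permRep (Perm (Fin q)) (Fin q × Fin q)).asAlgebraHom (letterElt h0 h1 0)
      (permRep (Perm (Fin q)) (Fin q × Fin q) s
        ((permRep (Perm (Fin q)) (Fin q × Fin q)).asAlgebraHom (letterElt h0 h1 1) v)) = 0 := by
    intro s v
    change (permRep _ _).asAlgebraHom (groupSum _) _ = 0
    rw [groupSum_apply]
    exact groupSum_eq_zero _ (apply_standardElt _ _ _ v)
  have c02 : ∀ s v, (permRep (Perm (Fin q)) (Fin q × Fin q)).asAlgebraHom (letterElt h0 h1 0)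
      (permRep (Perm (Fin q)) (Fin q × Fin q) s
        ((permRep (Perm (Fin q)) (Fin q × Fin q)).asAlgebraHom (letterElt h0 h1 2) v)) = 0 :=
    hodd (isSignedFun_thirdFun q)
  have c03 : ∀ s v, (permRep (Perm (Fin q)) (Fin q × Fin q)).asAlgebraHom (letterElt h0 h1 0)
      (permRep (Perm (Fin q)) (Fin q × Fin q) s
        ((permRep (Perm (Fin q)) (Fin q × Fin q)).asAlgebraHom (letterElt h0 h1 3) v)) = 0 :=
    hodd (isSignedFun_fourthFun q)
  have c21 : ∀ s v, (permRep (Perm (Fin q)) (Fin q × Fin q)).asAlgebraHom (letterElt h0 h1 2)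
      (permRep (Perm (Fin q)) (Fin q × Fin q) s
        ((permRep (Perm (Fin q)) (Fin q × Fin q)).asAlgebraHom (letterElt h0 h1 1) v)) = 0 :=
    hstd (isSignedFun_thirdFun q)
  have c31 : ∀ s v, (permRep (Perm (Fin q)) (Fin q × Fin q)).asAlgebraHom (letterElt h0 h1 3)
      (permRep (Perm (Fin q)) (Fin q × Fin q) s
        ((permRep (Perm (Fin q)) (Fin q × Fin q)).asAlgebraHom (letterElt h0 h1 1) v)) = 0 :=
    hstd (isSignedFun_fourthFun q)
  have c23 : ∀ s v, (permRep (Perm (Fin q)) (Fin q × Fin q)).asAlgebraHom (letterElt h0 h1 2)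
      (permRep (Perm (Fin q)) (Fin q × Fin q) s
        ((permRep (Perm (Fin q)) (Fin q × Fin q)).asAlgebraHom (letterElt h0 h1 3) v)) = 0 :=
    signedStab_third_fourth
  refine Controls.of_group ?_ ?_ ?_
  · intro i s
    fin_cases i
    · refine ⟨Fintype.card (Perm (Fin q)), fun v => ?_⟩
      change (permRep _ _).asAlgebraHom (groupSum _)
        (permRep _ _ s ((permRep _ _).asAlgebraHom (groupSum _) v)) = _
      rw [apply_groupSum]
      exact groupSum_of_invariant _ fun g => apply_groupSum _ g v
    · exact standardElt_scal h01 s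
    · exact exists_scal_of_range_le (isSignedFun_thirdFun q).line s
    · exact exists_scal_of_range_le (isSignedFun_fourthFun q).line s
  · intro i j hij
    match i, j, hij with
    | 0, 0, h => exact absurd rfl h
    | 0, 1, _ => exact c01
    | 0, 2, _ => exact c02
    | 0, 3, _ => exact c03
    | 1, 0, _ => exact orth_symm (hsymm 0) (hsymm 1) c01
    | 1, 1, h => exact absurd rfl h
    | 1, 2, _ => exact orth_symm (hsymm 2) (hsymm 1) c21
    | 1, 3, _ => exact orth_symm (hsymm 3) (hsymm 1) c31
    | 2, 0, _ => exact orth_symm (hsymm 0) (hsymm 2) c02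
    | 2, 1, _ => exact c21
    | 2, 2, h => exact absurd rfl h
    | 2, 3, _ => exact c23
    | 3, 0, _ => exact orth_symm (hsymm 0) (hsymm 3) c03
    | 3, 1, _ => exact c31
    | 3, 2, _ => exact orth_symm (hsymm 2) (hsymm 3) c23
    | 3, 3, h => exact absurd rfl h
  · intro v hv
    by_contra! hz
    -- By adjointness, a function that no element detects after any translation is orthogonal to all
    -- translates of the four ranges. `eq_zero_of_orthogonal` then applies, as the permutations
    -- reach every choice of distinct letters.
    have hperp : ∀ i w, w ∈ LinearMap.range ((permRep (Perm (Fin q))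
        (Fin q × Fin q)).asAlgebraHom (letterElt h0 h1 i)) → ∀ s,
        v ⬝ᵥ permRep (Perm (Fin q)) (Fin q × Fin q) s w = 0 := by
      rintro i _ ⟨u, rfl⟩ s
      have := dotProduct_permRep s⁻¹ v ((permRep (Perm (Fin q))
        (Fin q × Fin q)).asAlgebraHom (letterElt h0 h1 i) u)
      rw [inv_inv] at this
      rw [← this, ← dotProduct_asAlgebraHom_permRep (hsymm i), hz, zero_dotProduct]
    have hcol : ∀ i j, j < numCols q i → ∀ s,
        v ⬝ᵥ permRep (Perm (Fin q)) (Fin q × Fin q) s (colFun q i j) = 0 := by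
      intro i j hj s
      refine hperp i _ ?_ s
      rw [← span_colFun h0 h1]
      exact Submodule.subset_span ⟨⟨j, hj⟩, rfl⟩
    refine hv (eq_zero_of_orthogonal v ?_ ?_ ?_ ?_)
    · intro k
      have := hcol 0 k k.2 1
      rwa [colFun_zero, permRep_orbitFun] at this
    · intro k a b hab
      obtain ⟨s, hs⟩ := exists_perm_extending (injective_vec_two h01) (injective_vec_two hab)
      have hs0 : s ⟨0, h0⟩ = a := hs 0
      have hs1 : s ⟨1, h1⟩ = b := hs 1
      have := hperp 1 (letterMap q k (diffVec ⟨0, h0⟩ ⟨1, h1⟩)) (by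
        rw [← span_colFun h0 h1]
        exact (span_colFun_one h0 h1 rfl).symm ▸ Submodule.subset_span ⟨k, rfl⟩) s
      rwa [← letterMap_equivariant, permRep_diffVec, hs0, hs1] at this
    · intro a b c hab hac hbc
      have h2 : 2 < q := by
        have := Fintype.card_le_of_injective _ (injective_vec_three hab hac hbc)
        rwa [Fintype.card_fin, Fintype.card_fin] at this
      obtain ⟨s, hs⟩ := exists_perm_extending
        (injective_vec_three (a := (⟨0, h0⟩ : Fin q)) (b := ⟨1, h1⟩) (c := ⟨2, h2⟩) (by simp)
          (by simp) (by simp)) (injective_vec_three hab hac hbc)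
      have hs0 : s ⟨0, h0⟩ = a := hs 0
      have hs1 : s ⟨1, h1⟩ = b := hs 1
      have hs2 : s ⟨2, h2⟩ = c := hs 2
      have := hcol 2 0 (show 0 < if q ≤ 2 then 0 else 1 by rw [if_neg (by omega)]; exact one_pos) s
      rwa [colFun_two_zero h0 h1 h2, permRep_cycFun, hs0, hs1, hs2] at this
    · intro a b c d hab hac had hbc hbd hcd
      have h3 : 3 < q := by
        have := Fintype.card_le_of_injective _ (injective_vec_four hab hac had hbc hbd hcd)
        rwa [Fintype.card_fin, Fintype.card_fin] at this
      have h2 : 2 < q := by omega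
      obtain ⟨s, hs⟩ := exists_perm_extending
        (injective_vec_four (a := (⟨0, h0⟩ : Fin q)) (b := ⟨1, h1⟩) (c := ⟨2, h2⟩) (d := ⟨3, h3⟩)
          (by simp) (by simp) (by simp) (by simp) (by simp) (by simp))
        (injective_vec_four hab hac had hbc hbd hcd)
      have hs0 : s ⟨0, h0⟩ = a := hs 0
      have hs1 : s ⟨1, h1⟩ = b := hs 1
      have hs2 : s ⟨2, h2⟩ = c := hs 2
      have hs3 : s ⟨3, h3⟩ = d := hs 3
      have := hcol 3 0 (show 0 < if q ≤ 3 then 0 else 1 by rw [if_neg (by omega)]; exact one_pos) s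
      rwa [colFun_three_zero h0 h1 h2 h3, permRep_quadFun, hs0, hs1, hs2, hs3] at this

end LetterBlocks

/-! ### Kronecker products of families of matrices -/

section Kron

open Matrix

variable {ι : Type*} [Fintype ι] [DecidableEq ι] {X Y Z J : ι → Type*}
  [∀ i, Fintype (X i)] [∀ i, Fintype (Y i)] [∀ i, Fintype (Z i)] [∀ i, Fintype (J i)]

/-- The Kronecker product of a family of matrices. -/
def kron (A : ∀ i, Matrix (X i) (Y i) ℝ) : Matrix (∀ i, X i) (∀ i, Y i) ℝ :=
  of fun w w' => ∏ i, A i (w i) (w' i)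

/-- The tensor product of a family of vectors. -/
def kronVec (v : ∀ i, X i → ℝ) : (∀ i, X i) → ℝ := fun w => ∏ i, v i (w i)

theorem kron_apply (A : ∀ i, Matrix (X i) (Y i) ℝ) (w : ∀ i, X i) (w' : ∀ i, Y i) :
    kron A w w' = ∏ i, A i (w i) (w' i) := rfl

theorem prod_sum_eq_sum_prod (f : ∀ i, J i → ℝ) :
    ∏ i, ∑ j, f i j = ∑ j : ∀ i, J i, ∏ i, f i (j i) := by
  rw [Finset.prod_univ_sum, Fintype.piFinset_univ]

theorem kron_mul (A : ∀ i, Matrix (X i) (Y i) ℝ) (B : ∀ i, Matrix (Y i) (Z i) ℝ) :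
    kron A * kron B = kron fun i => A i * B i := by
  ext w w'
  simp only [mul_apply, kron_apply, prod_sum_eq_sum_prod, ← Finset.prod_mul_distrib]

theorem kron_sum (A : ∀ i, J i → Matrix (X i) (Y i) ℝ) :
    kron (fun i => ∑ j, A i j) = ∑ j : ∀ i, J i, kron fun i => A i (j i) := by
  ext w w'
  simp only [kron_apply, Matrix.sum_apply, prod_sum_eq_sum_prod]

theorem kron_smul (c : ι → ℝ) (A : ∀ i, Matrix (X i) (Y i) ℝ) :
    kron (fun i => c i • A i) = (∏ i, c i) • kron A := by
  ext w w'
  simp only [kron_apply, Matrix.smul_apply, smul_eq_mul, Finset.prod_mul_distrib]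

theorem kron_one [∀ i, DecidableEq (X i)] :
    kron (fun i => (1 : Matrix (X i) (X i) ℝ)) = 1 := by
  ext w w'
  rw [kron_apply, one_apply]
  split_ifs with h
  · subst h; simp
  · obtain ⟨i, hi⟩ := Function.ne_iff.1 h
    exact Finset.prod_eq_zero (Finset.mem_univ i) (one_apply_ne hi)

theorem kron_transpose (A : ∀ i, Matrix (X i) (Y i) ℝ) :
    (kron A)ᵀ = kron fun i => (A i)ᵀ := rfl

theorem kron_eq_zero {A : ∀ i, Matrix (X i) (Y i) ℝ} (i : ι) (h : A i = 0) : kron A = 0 := by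
  ext w w'
  exact Finset.prod_eq_zero (Finset.mem_univ i) (by rw [h]; rfl)

theorem kron_mulVec (A : ∀ i, Matrix (X i) (Y i) ℝ) (v : ∀ i, Y i → ℝ) :
    kron A *ᵥ kronVec v = kronVec fun i => A i *ᵥ v i := by
  funext w
  simp only [mulVec, dotProduct, kron_apply, kronVec, prod_sum_eq_sum_prod,
    ← Finset.prod_mul_distrib]

theorem dotProduct_kronVec (u v : ∀ i, X i → ℝ) :
    kronVec u ⬝ᵥ kronVec v = ∏ i, u i ⬝ᵥ v i := by
  simp only [dotProduct, kronVec, prod_sum_eq_sum_prod, ← Finset.prod_mul_distrib]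

theorem kronVec_mem_span {u : ∀ i, J i → X i → ℝ} {v : ∀ i, X i → ℝ}
    (h : ∀ i, v i ∈ Submodule.span ℝ (Set.range (u i))) :
    kronVec v ∈ Submodule.span ℝ
      (Set.range fun j : ∀ i, J i => kronVec fun i => u i (j i)) := by
  choose c hc using fun i => (Submodule.mem_span_range_iff_exists_fun ℝ).1 (h i)
  have : kronVec v = ∑ j : ∀ i, J i, (∏ i, c i (j i)) • kronVec fun i => u i (j i) := by
    funext w
    simp only [kronVec, ← hc, Finset.sum_apply, Pi.smul_apply, smul_eq_mul, prod_sum_eq_sum_prod,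
      ← Finset.prod_mul_distrib]
  rw [this]
  exact Submodule.sum_mem _ fun j _ => Submodule.smul_mem _ _ (Submodule.subset_span ⟨j, rfl⟩)

theorem kron_mem_span {B : ∀ i, J i → Matrix (X i) (Y i) ℝ} {A : ∀ i, Matrix (X i) (Y i) ℝ}
    (h : ∀ i, A i ∈ Submodule.span ℝ (Set.range (B i))) :
    kron A ∈ Submodule.span ℝ
      (Set.range fun j : ∀ i, J i => kron fun i => B i (j i)) := by
  choose c hc using fun i => (Submodule.mem_span_range_iff_exists_fun ℝ).1 (h i)
  have : kron A = ∑ j : ∀ i, J i, (∏ i, c i (j i)) • kron fun i => B i (j i) := by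
    rw [show A = fun i => ∑ j, c i j • B i j from funext fun i => (hc i).symm, kron_sum]
    exact Finset.sum_congr rfl fun j _ => kron_smul _ _
  rw [this]
  exact Submodule.sum_mem _ fun j _ => Submodule.smul_mem _ _ (Submodule.subset_span ⟨j, rfl⟩)

theorem span_kronVec {M : ∀ i, Matrix (X i) (Y i) ℝ} {u : ∀ i, J i → X i → ℝ}
    (h : ∀ i, Submodule.span ℝ (Set.range (u i)) = LinearMap.range (M i).mulVecLin) :
    Submodule.span ℝ (Set.range fun j : ∀ i, J i => kronVec fun i => u i (j i)) =
      LinearMap.range (kron M).mulVecLin := by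
  apply le_antisymm
  · rw [Submodule.span_le]
    rintro _ ⟨j, rfl⟩
    have : ∀ i, ∃ x, M i *ᵥ x = u i (j i) := fun i => by
      have : u i (j i) ∈ LinearMap.range (M i).mulVecLin := by
        rw [← h]; exact Submodule.subset_span ⟨_, rfl⟩
      exact this
    choose x hx using this
    exact ⟨kronVec x, by simp only [mulVecLin_apply, kron_mulVec, hx]⟩
  -- The columns of a Kronecker product are the tensor products of columns of its factors.
  · rw [range_mulVecLin, Submodule.span_le]
    rintro _ ⟨w', rfl⟩
    refine kronVec_mem_span (v := fun i => (M i).col (w' i)) fun i => ?_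
    rw [h, range_mulVecLin]
    exact Submodule.subset_span ⟨_, rfl⟩

theorem exists_dual {X J : Type*} [Fintype X] {u : J → X → ℝ} (hu : LinearIndependent ℝ u) :
    ∃ d : J → X → ℝ, (∀ j, d j ⬝ᵥ u j = 1) ∧ ∀ j j', j ≠ j' → d j ⬝ᵥ u j' = 0 := by
  classical
  have : ∀ f : Module.Dual ℝ (X → ℝ), ∃ d : X → ℝ, ∀ v, f v = d ⬝ᵥ v := by
    intro f
    refine ⟨fun x => f (Pi.single x 1), fun v => ?_⟩
    conv_lhs => rw [pi_eq_sum_univ' v]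
    simp [dotProduct, mul_comm]
  let b := Module.Basis.extend hu.linearIndepOn_id
  have hmem : ∀ j, u j ∈ hu.linearIndepOn_id.extend (Set.subset_univ _) := fun j =>
    hu.linearIndepOn_id.subset_extend _ ⟨j, rfl⟩
  choose d hd using fun j => this (b.coord ⟨u j, hmem j⟩)
  have hb : ∀ j, b ⟨u j, hmem j⟩ = u j := fun j => Module.Basis.extend_apply_self _ _
  have key : ∀ j j', d j ⬝ᵥ u j' = b.repr (b ⟨u j', hmem j'⟩) ⟨u j, hmem j⟩ := fun j j' => by
    rw [hb, ← hd, Module.Basis.coord_apply]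
  refine ⟨d, fun j => ?_, fun j j' hj => ?_⟩
  · rw [key, Module.Basis.repr_self, Finsupp.single_eq_same]
  · rw [key, Module.Basis.repr_self, Finsupp.single_apply, if_neg]
    exact fun h => hj (hu.injective (Subtype.mk.inj h).symm)

/-- Pairing a relation with the tensor product of dual vectors isolates one coefficient. -/
theorem linearIndependent_kronVec {u : ∀ i, J i → X i → ℝ}
    (hu : ∀ i, LinearIndependent ℝ (u i)) :
    LinearIndependent ℝ fun j : ∀ i, J i => kronVec fun i => u i (j i) := by
  classical
  choose d hd hd' using fun i => exists_dual (hu i)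
  rw [Fintype.linearIndependent_iff]
  intro g hg j
  have := congrArg (fun v => (kronVec fun i => d i (j i)) ⬝ᵥ v) hg
  simp only [dotProduct_sum, dotProduct_smul, dotProduct_kronVec, dotProduct_zero] at this
  rw [Finset.sum_eq_single j] at this
  · simpa [hd] using this
  · intro j' _ hj'
    obtain ⟨i, hi⟩ := Function.ne_iff.1 hj'
    rw [Finset.prod_eq_zero (Finset.mem_univ i) (hd' i _ _ hi.symm), smul_zero]
  · simp

/-- The Kronecker product of the sums is invertible, and it expands into the sum over all choices of
one summand per factor. Not all choices can therefore kill `v`. -/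
theorem exists_kron_mulVec_ne_zero {A : ∀ i, J i → Matrix (X i) (X i) ℝ}
    [∀ i, DecidableEq (X i)] (h : ∀ i, IsUnit (∑ j, A i j)) {v : (∀ i, X i) → ℝ} (hv : v ≠ 0) :
    ∃ j : ∀ i, J i, kron (fun i => A i (j i)) *ᵥ v ≠ 0 := by
  by_contra! hz
  choose B hB using fun i => (h i).exists_left_inv
  have h1 : kron (fun i => ∑ j, A i j) *ᵥ v = 0 := by
    rw [kron_sum, sum_mulVec, Finset.sum_eq_zero fun j _ => hz j]
  have h2 : kron B *ᵥ (kron (fun i => ∑ j, A i j) *ᵥ v) = v := by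
    rw [mulVec_mulVec, kron_mul, funext hB, kron_one, one_mulVec]
  rw [h1, mulVec_zero] at h2
  exact hv h2.symm

end Kron

/-! ### Kronecker products with permuted positions -/

section PermKron

open Matrix

variable {P : Type*} [Fintype P]
variable {K K' K'' : Type*} [Fintype K] [Fintype K'] [Fintype K''] [DecidableEq K]
  [DecidableEq K'] [DecidableEq K'']

/-- The Kronecker product of matrices, with positions moved by `α`. -/
def permKron (α : K ≃ K') (A : K' → Matrix P P ℝ) : Matrix (K' → P) (K → P) ℝ :=
  of fun w' w => ∏ p, A (α p) (w' (α p)) (w p)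

theorem permKron_apply (α : K ≃ K') (A : K' → Matrix P P ℝ) (w' : K' → P) (w : K → P) :
    permKron α A w' w = ∏ p, A (α p) (w' (α p)) (w p) := rfl

theorem permKron_refl (A : K → Matrix P P ℝ) : permKron (Equiv.refl K) A = kron A := rfl

theorem permKron_mul (α : K' ≃ K'') (β : K ≃ K') (A : K'' → Matrix P P ℝ)
    (B : K' → Matrix P P ℝ) :
    permKron α A * permKron β B = permKron (β.trans α) fun p => A p * B (α.symm p) := by
  ext w'' w
  simp only [mul_apply, permKron_apply, Equiv.trans_apply, Equiv.symm_apply_apply]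
  rw [prod_sum_eq_sum_prod (J := fun _ : K => P)
    (fun p x => A (α (β p)) (w'' (α (β p))) x * B (β p) x (w p))]
  refine Fintype.sum_equiv (β.symm.arrowCongr (Equiv.refl P)) _ _ fun w' => ?_
  rw [Finset.prod_mul_distrib, ← Equiv.prod_comp β]
  refine congrArg₂ (· * ·) (Finset.prod_congr rfl fun p _ => ?_)
    (Finset.prod_congr rfl fun p _ => ?_) <;> simp

theorem permKron_eq_zero (α : K ≃ K') {A : K' → Matrix P P ℝ} (p : K') (h : A p = 0) :
    permKron α A = 0 := by
  ext w' w
  refine Finset.prod_eq_zero (Finset.mem_univ (α.symm p)) ?_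
  rw [Equiv.apply_symm_apply, h]
  rfl

theorem permKron_smul (α : K ≃ K') (c : K' → ℝ) (A : K' → Matrix P P ℝ) :
    permKron α (fun p => c p • A p) = (∏ p, c p) • permKron α A := by
  ext w' w
  simp only [permKron_apply, Matrix.smul_apply, smul_eq_mul, Finset.prod_mul_distrib]
  rw [Equiv.prod_comp α]

theorem permKron_transpose (α : K ≃ K') (A : K' → Matrix P P ℝ) :
    (permKron α A)ᵀ = permKron α.symm fun p => (A (α p))ᵀ := by
  ext w w'
  simp only [transpose_apply, permKron_apply, Equiv.apply_symm_apply]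
  rw [← Equiv.prod_comp α.symm]
  simp

variable {ι : Type*} [Fintype ι] [DecidableEq ι] {C D : ι → Type*} [∀ i, Fintype (C i)]
  [∀ i, Fintype (D i)] [∀ i, DecidableEq (C i)] [∀ i, DecidableEq (D i)]

/-- Words as families of words, one for each block of positions. -/
def blockWords (T : (Σ i, C i) ≃ K) (P : Type*) : (K → P) ≃ (∀ i, C i → P) :=
  (T.symm.arrowCongr (Equiv.refl P)).trans (Equiv.piCurry fun _ _ => P)

theorem permKron_eq_submatrix (T : (Σ i, C i) ≃ K) (T' : (Σ i, D i) ≃ K') (π : K ≃ K')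
    (α : ∀ i, C i ≃ D i) (h : ∀ i y, π (T ⟨i, y⟩) = T' ⟨i, α i y⟩) (A : K' → Matrix P P ℝ) :
    permKron π A = (kron fun i => permKron (α i) fun z => A (T' ⟨i, z⟩)).submatrix
      (blockWords T' P) (blockWords T P) := by
  ext w' w
  rw [permKron_apply, submatrix_apply, kron_apply, ← Equiv.prod_comp T, Fintype.prod_sigma]
  refine Finset.prod_congr rfl fun i _ => Finset.prod_congr rfl fun y _ => ?_
  rw [h]
  rfl

theorem exists_equiv_components (β : (Σ i, C i) ≃ Σ i, D i) (h : ∀ x, (β x).1 = x.1) :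
    ∃ α : ∀ i, C i ≃ D i, ∀ i y, β ⟨i, y⟩ = ⟨i, α i y⟩ := by
  have h1 : ∀ i y, ∃ z, β ⟨i, y⟩ = ⟨i, z⟩ := by
    intro i y
    have := h ⟨i, y⟩
    generalize β ⟨i, y⟩ = x at this
    obtain ⟨j, z⟩ := x
    obtain rfl : j = i := this
    exact ⟨z, rfl⟩
  choose a ha using h1
  refine ⟨fun i => Equiv.ofBijective (a i) ⟨fun y y' hy => ?_, fun z => ?_⟩, fun i y => ha i y⟩
  · have := (ha i y).trans ((congrArg (Sigma.mk i) hy).trans (ha i y').symm)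
    simpa using β.injective this
  · have h2 := h (β.symm ⟨i, z⟩)
    rw [Equiv.apply_symm_apply] at h2
    have h3 : β (β.symm ⟨i, z⟩) = ⟨i, z⟩ := β.apply_symm_apply _
    generalize β.symm ⟨i, z⟩ = x at h2 h3
    obtain ⟨j, y⟩ := x
    obtain rfl : i = j := h2
    rw [ha] at h3
    exact ⟨y, by simpa using h3⟩

end PermKron

/-! ### The action of position permutations on words -/

section PosAct

open Matrix

variable {P : Type*} [Fintype P] [DecidableEq P]
variable {K K' : Type*} [Fintype K] [Fintype K'] [DecidableEq K] [DecidableEq K']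

theorem permKron_one : permKron (1 : Equiv.Perm K) (fun _ => (1 : Matrix P P ℝ)) = 1 :=
  (permKron_refl _).trans kron_one

theorem permKron_mulVec (α : K ≃ K') (A : K' → Matrix P P ℝ) (v : K → P → ℝ) :
    permKron α A *ᵥ kronVec v = kronVec fun p => A p *ᵥ v (α.symm p) := by
  funext w'
  simp only [mulVec, dotProduct, permKron_apply, kronVec, ← Finset.prod_mul_distrib]
  rw [← prod_sum_eq_sum_prod (J := fun _ : K => P)
    (fun p x => A (α p) (w' (α p)) x * v p x), ← Equiv.prod_comp α]
  simp

/-- The action of the group algebra of the position permutations on functions on words. -/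
def posAct (K P : Type*) [Fintype K] [DecidableEq K] [Fintype P] [DecidableEq P] :
    MonoidAlgebra ℝ (Equiv.Perm K) →ₐ[ℝ] Matrix (K → P) (K → P) ℝ :=
  MonoidAlgebra.lift ℝ _ _
    { toFun := fun π => permKron π fun _ => (1 : Matrix P P ℝ)
      map_one' := permKron_one
      map_mul' := fun σ π => by
        rw [permKron_mul]
        simp only [one_mul]
        rfl }

theorem posAct_single (π : Equiv.Perm K) (c : ℝ) :
    posAct K P (MonoidAlgebra.single π c) = c • permKron π fun _ => 1 := by
  rw [posAct, MonoidAlgebra.lift_single]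
  rfl

theorem posAct_rev (x : MonoidAlgebra ℝ (Equiv.Perm K)) :
    posAct K P (rev x) = (posAct K P x)ᵀ := by
  induction x using MonoidAlgebra.induction_on with
  | of π =>
    rw [MonoidAlgebra.of_apply, rev_single, posAct_single, posAct_single, one_smul, one_smul,
      permKron_transpose]
    simp only [transpose_one]
    rfl
  | add x y hx hy => simp only [map_add, hx, hy, transpose_add]
  | smul r x hx => simp only [map_smul, hx, transpose_smul]

theorem posAct_mul_kron (x : MonoidAlgebra ℝ (Equiv.Perm K)) (f : Matrix P P ℝ) :
    posAct K P x * kron (fun _ => f) = kron (fun _ => f) * posAct K P x := by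
  induction x using MonoidAlgebra.induction_on with
  | of π =>
    rw [MonoidAlgebra.of_apply, posAct_single, one_smul, ← permKron_refl, permKron_mul,
      permKron_mul]
    simp only [one_mul, mul_one]
    rfl
  | add x y hx hy => simp only [map_add, Matrix.add_mul, Matrix.mul_add, hx, hy]
  | smul r x hx => simp only [map_smul, Matrix.smul_mul, Matrix.mul_smul, hx]

variable {μ ν : YoungDiagram}

theorem permKron_mul_posAct_single (T : μ.cells ≃ K) (α : K ≃ K') (π : Equiv.Perm μ.cells) (c : ℝ) :
    permKron α (fun _ => (1 : Matrix P P ℝ)) * posAct K P (MonoidAlgebra.single (T.permCongr π) c) =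
      posAct K' P (MonoidAlgebra.single ((T.trans α).permCongr π) c) *
        permKron α (fun _ => (1 : Matrix P P ℝ)) := by
  rw [posAct_single, posAct_single, Matrix.smul_mul, Matrix.mul_smul, permKron_mul, permKron_mul]
  simp only [one_mul]
  congr 2
  ext p
  simp

theorem permKron_mul_posAct_youngElt (T : μ.cells ≃ K) (α : K ≃ K') :
    permKron α (fun _ => (1 : Matrix P P ℝ)) * posAct K P (youngElt T) =
      posAct K' P (youngElt (T.trans α)) * permKron α (fun _ => (1 : Matrix P P ℝ)) := by
  have h1 : permKron α (fun _ => (1 : Matrix P P ℝ)) * posAct K P (rowSym T) =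
      posAct K' P (rowSym (T.trans α)) * permKron α (fun _ => (1 : Matrix P P ℝ)) := by
    simp only [rowSym, map_sum, Matrix.mul_sum, Matrix.sum_mul, permKron_mul_posAct_single]
  have h2 : permKron α (fun _ => (1 : Matrix P P ℝ)) * posAct K P (colAlt T) =
      posAct K' P (colAlt (T.trans α)) * permKron α (fun _ => (1 : Matrix P P ℝ)) := by
    simp only [colAlt, map_sum, Matrix.mul_sum, Matrix.sum_mul, permKron_mul_posAct_single]
  simp only [youngElt, map_mul]
  rw [← Matrix.mul_assoc, ← Matrix.mul_assoc, h2, Matrix.mul_assoc _ (permKron _ _), h1,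
    ← Matrix.mul_assoc, Matrix.mul_assoc _ (permKron _ _), h2, ← Matrix.mul_assoc]

/-- The matrix attached to a tableau and a matrix on letters. -/
def typeMat (T : μ.cells ≃ K) (f : Matrix P P ℝ) : Matrix (K → P) (K → P) ℝ :=
  posAct K P (youngElt T) * kron fun _ => f

theorem typeMat_eq (T : μ.cells ≃ K) (f : Matrix P P ℝ) :
    typeMat T f = (kron fun _ => f) * posAct K P (youngElt T) := posAct_mul_kron _ _

theorem typeMat_transpose (T : μ.cells ≃ K) {f : Matrix P P ℝ} (hf : fᵀ = f) :
    (typeMat T f)ᵀ = typeMat T f := by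
  rw [typeMat, transpose_mul, ← posAct_rev, rev_youngElt, kron_transpose, ← posAct_mul_kron, hf]

theorem permKron_mul_typeMat (T : μ.cells ≃ K) (α : K ≃ K') (f : Matrix P P ℝ) :
    permKron α (fun _ => (1 : Matrix P P ℝ)) * typeMat T f =
      typeMat (T.trans α) f * permKron α (fun _ => (1 : Matrix P P ℝ)) := by
  rw [typeMat, ← Matrix.mul_assoc, permKron_mul_posAct_youngElt, typeMat, Matrix.mul_assoc,
    Matrix.mul_assoc, ← permKron_refl, ← permKron_refl, permKron_mul, permKron_mul]
  simp only [one_mul, mul_one]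
  rfl

/-- Equal letter matrices at all positions commute with position permutations. They can be gathered
around the middle factor, where each position yields a scalar, and only a product of Young elements
is left. -/
theorem typeMat_mul_mul_typeMat (T : ν.cells ≃ K') (S : μ.cells ≃ K) (α : K ≃ K')
    {f : Matrix P P ℝ} {A : K' → Matrix P P ℝ} {c : K' → ℝ} (h : ∀ p, f * A p * f = c p • f) :
    typeMat T f * permKron α A * typeMat S f = (∏ p, c p) •
      ((kron fun _ => f) * (posAct K' P (youngElt T) * posAct K' P (youngElt (S.trans α))) *
        permKron α (fun _ => (1 : Matrix P P ℝ))) := by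
  have h1 : (kron fun _ : K' => f) * permKron α A * (kron fun _ : K => f) =
      (∏ p, c p) • ((kron fun _ : K' => f) * permKron α (fun _ => (1 : Matrix P P ℝ))) := by
    rw [← permKron_refl, ← permKron_refl, permKron_mul, permKron_mul, permKron_mul,
      ← permKron_smul]
    simp only [mul_one]
    congr 1
    funext p
    exact h p
  calc typeMat T f * permKron α A * typeMat S f
      = posAct K' P (youngElt T) * ((kron fun _ : K' => f) * permKron α A * (kron fun _ : K => f)) *
          posAct K P (youngElt S) := by
        rw [typeMat_eq S, typeMat]; simp only [Matrix.mul_assoc]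
    _ = _ := by
        rw [h1, Matrix.mul_smul, Matrix.smul_mul, ← Matrix.mul_assoc (posAct K' P (youngElt T)),
          posAct_mul_kron, Matrix.mul_assoc _ (permKron α _), permKron_mul_posAct_youngElt]
        simp only [Matrix.mul_assoc]

theorem typeMat_orth (T : ν.cells ≃ K') (S : μ.cells ≃ K) (hμ : ν ≠ μ) (α : K ≃ K')
    {f : Matrix P P ℝ} {A : K' → Matrix P P ℝ} {c : K' → ℝ} (h : ∀ p, f * A p * f = c p • f) :
    typeMat T f * permKron α A * typeMat S f = 0 := by
  have := youngElt_mul_mul_youngElt_eq_zero T (S.trans α) hμ 1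
  rw [mul_one] at this
  rw [typeMat_mul_mul_typeMat T S α h, ← map_mul, this, map_zero, Matrix.mul_zero, Matrix.zero_mul,
    smul_zero]

theorem typeMat_scal (T : μ.cells ≃ K) (α : Equiv.Perm K)
    {f : Matrix P P ℝ} {A : K → Matrix P P ℝ} {c : K → ℝ} (h : ∀ p, f * A p * f = c p • f) :
    ∃ k : ℝ, typeMat T f * permKron α A * typeMat T f = k • typeMat T f := by
  obtain ⟨k, hk⟩ := exists_youngElt_mul_mul_youngElt T (MonoidAlgebra.single α 1)
  refine ⟨(∏ p, c p) * k, ?_⟩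
  have h2 := congrArg (posAct K P) hk
  rw [map_mul, map_mul, posAct_single, one_smul, map_smul, Matrix.mul_assoc,
    permKron_mul_posAct_youngElt, ← Matrix.mul_assoc] at h2
  rw [typeMat_mul_mul_typeMat T T α h, Matrix.mul_assoc, h2, Matrix.mul_smul, smul_smul,
    ← typeMat_eq]

/-! ### Tensors selected by tableaux and the range of `typeMat` -/

variable {m : ℕ}

/-- The tensor product of the vectors selected by a tableau. -/
def tens (b : Fin m → P → ℝ) (σ : Tableau μ m) : (μ.cells → P) → ℝ := kronVec fun y => b (σ y)

theorem permKron_mulVec_tens (b : Fin m → P → ℝ) (π : Equiv.Perm μ.cells) (σ : Tableau μ m) :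
    permKron π (fun _ => (1 : Matrix P P ℝ)) *ᵥ tens b σ = tens b (σ ∘ (π⁻¹ : Equiv.Perm μ.cells)) := by
  rw [tens, permKron_mulVec]
  simp only [one_mulVec]
  rfl

theorem permCongr_refl' (π : Equiv.Perm K) : (Equiv.refl K).permCongr π = π := rfl

open Classical in
theorem posAct_colAlt_mulVec_tens (b : Fin m → P → ℝ) (σ : Tableau μ m) :
    posAct μ.cells P (colAlt (Equiv.refl μ.cells)) *ᵥ tens b σ =
      ∑ c : colGroup μ, ((Equiv.Perm.sign c.1 : ℤ) : ℝ) • tens b (σ ∘ c.1) := by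
  rw [colAlt, map_sum, sum_mulVec]
  refine Fintype.sum_equiv (Equiv.inv _) _ _ fun c => ?_
  rw [posAct_single, smul_mulVec, permCongr_refl', permKron_mulVec_tens]
  simp

open Classical in
theorem posAct_rowSym_mulVec_tens (b : Fin m → P → ℝ) (σ : Tableau μ m) :
    posAct μ.cells P (rowSym (Equiv.refl μ.cells)) *ᵥ tens b σ =
      ∑ r : rowGroup μ, tens b (σ ∘ r.1) := by
  rw [rowSym, map_sum, sum_mulVec]
  refine Fintype.sum_equiv (Equiv.inv _) _ _ fun c => ?_
  rw [posAct_single, one_smul, permCongr_refl', permKron_mulVec_tens]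
  simp

theorem posAct_mulVec_tens (b : Fin m → P → ℝ) (σ : Tableau μ m) :
    posAct μ.cells P (colAlt (Equiv.refl μ.cells) * rowSym (Equiv.refl μ.cells)) *ᵥ tens b σ =
      symAlt (tens b) σ := by
  rw [map_mul, ← mulVec_mulVec, posAct_rowSym_mulVec_tens, mulVec_sum, symAlt]
  refine Finset.sum_congr rfl fun r _ => ?_
  rw [posAct_colAlt_mulVec_tens]
  rfl

/-- On the image of the tensor power of `f`, the elements `b a b` and `b a` of the group algebra
have the same range, because `b a b a` is a nonzero multiple of `b a`. The latter sends a tensor of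
columns to its symmetrization, and straightening leaves the semistandard tableaux. -/
theorem range_typeMat {b : Fin m → P → ℝ} {f : Matrix P P ℝ}
    (h : Submodule.span ℝ (Set.range b) = LinearMap.range f.mulVecLin) :
    Submodule.span ℝ (Set.range fun τ : SST μ m => symAltRow (tens b) τ.1) =
      LinearMap.range (typeMat (Equiv.refl μ.cells) f).mulVecLin := by
  have hspan : Submodule.span ℝ (Set.range (tens b : Tableau μ m → _)) =
      LinearMap.range (kron fun _ : μ.cells => f).mulVecLin :=
    span_kronVec (J := fun _ : μ.cells => Fin m) (M := fun _ => f) (u := fun _ => b) fun _ => h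
  obtain ⟨c, hc, hc'⟩ := exists_youngElt_mul_rowSym (Equiv.refl μ.cells)
  rw [span_symAltRow]
  apply le_antisymm
  · rw [Submodule.span_le]
    rintro _ ⟨σ, rfl⟩
    have : tens b σ ∈ LinearMap.range (kron fun _ : μ.cells => f).mulVecLin := by
      rw [← hspan]; exact Submodule.subset_span ⟨_, rfl⟩
    obtain ⟨x, hx⟩ := this
    rw [mulVecLin_apply] at hx
    refine ⟨c⁻¹ • (posAct μ.cells P (rowSym (Equiv.refl μ.cells)) *ᵥ x), ?_⟩
    rw [mulVecLin_apply, mulVec_smul, typeMat, mulVec_mulVec, Matrix.mul_assoc,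
      ← posAct_mul_kron, ← Matrix.mul_assoc, ← map_mul, hc', map_smul, ← mulVec_mulVec, hx,
      smul_mulVec, posAct_mulVec_tens, smul_smul, inv_mul_cancel₀ hc, one_smul]
  · rintro _ ⟨v, rfl⟩
    rw [mulVecLin_apply, typeMat, ← mulVec_mulVec]
    have hv : (kron fun _ : μ.cells => f) *ᵥ v ∈
        Submodule.span ℝ (Set.range (tens b : Tableau μ m → _)) := by
      rw [hspan]; exact ⟨v, rfl⟩
    generalize (kron fun _ : μ.cells => f) *ᵥ v = w at hv
    induction hv using Submodule.span_induction with
    | mem w hw =>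
      obtain ⟨σ, rfl⟩ := hw
      rw [youngElt, map_mul, ← mulVec_mulVec, posAct_colAlt_mulVec_tens, mulVec_sum]
      refine Submodule.sum_mem _ fun c _ => ?_
      rw [mulVec_smul, posAct_mulVec_tens]
      exact Submodule.smul_mem _ _ (Submodule.subset_span ⟨_, rfl⟩)
    | zero => rw [mulVec_zero]; exact zero_mem _
    | add w w' _ _ hw hw' => rw [mulVec_add]; exact add_mem hw hw'
    | smul a w _ hw => rw [mulVec_smul]; exact Submodule.smul_mem _ _ hw

theorem linearIndependent_symAltRow_tens {b : Fin m → P → ℝ} (h : LinearIndependent ℝ b) :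
    LinearIndependent ℝ fun τ : SST μ m => symAltRow (tens b) τ.1 := by
  classical
  have hli : LinearIndependent ℝ (tens b : Tableau μ m → _) :=
    linearIndependent_kronVec (J := fun _ : μ.cells => Fin m) (u := fun _ => b) fun _ => h
  have h1 := (linearIndependent_symAltRow_single (μ := μ) (m := m)).map'
    (Fintype.linearCombination ℝ (tens b : Tableau μ m → _)) (by
      rw [LinearMap.ker_eq_bot]
      exact linearIndependent_iff_injective_fintypeLinearCombination.1 hli)
  have h2 : (fun τ : SST μ m => symAltRow (tens b) τ.1) =
      Fintype.linearCombination ℝ (tens b : Tableau μ m → _) ∘ fun τ : SST μ m =>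
        symAltRow (fun τ => (Pi.single τ 1 : Tableau μ m → ℝ)) τ.1 := by
    funext τ
    rw [Function.comp_apply, map_symAltRow]
    congr 1
    funext σ
    rw [Fintype.linearCombination_apply_single, one_smul]
  rw [h2]
  exact h1

/-- The matrices of type `typeMat` are combinations of group elements. -/
theorem typeMat_mem_span {G : Type*} [Group G] [Fintype G] (pm : G →* Matrix P P ℝ) (T : μ.cells ≃ K)
    {f : Matrix P P ℝ} (hf : f ∈ Submodule.span ℝ (Set.range pm)) :
    typeMat T f ∈ Submodule.span ℝ
      (Set.range fun x : Equiv.Perm K × (K → G) => permKron x.1 fun p => pm (x.2 p)) := by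
  have h1 : (kron fun _ : K => f) ∈ Submodule.span ℝ
      (Set.range fun s : K → G => kron fun p => pm (s p)) :=
    kron_mem_span (J := fun _ : K => G) (B := fun _ => pm) fun _ => hf
  have h2 : ∀ x, posAct K P x ∈ Submodule.span ℝ
      (Set.range fun π : Equiv.Perm K => permKron π fun _ => (1 : Matrix P P ℝ)) := by
    intro x
    induction x using MonoidAlgebra.induction_on with
    | of π =>
      rw [MonoidAlgebra.of_apply, posAct_single, one_smul]
      exact Submodule.subset_span ⟨π, rfl⟩
    | add x y hx hy => rw [map_add]; exact add_mem hx hy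
    | smul r x hx => rw [map_smul]; exact Submodule.smul_mem _ _ hx
  have h3 := Submodule.mul_mem_mul (h2 (youngElt T)) h1
  rw [Submodule.span_mul_span] at h3
  refine Submodule.span_mono ?_ h3
  rintro _ ⟨_, ⟨π, rfl⟩, _, ⟨s, rfl⟩, rfl⟩
  refine ⟨(π, fun p => s (π.symm p)), ?_⟩
  simp only
  rw [← permKron_refl, permKron_mul]
  simp only [one_mul]
  rfl

end PosAct

/-! ### Tensor products over several types of letters -/

section MultiType

open Matrix

/-- Symmetric matrices in the image of the group algebra of `G` that control the representation
`pm` of `G` by matrices. -/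
structure LetterData {G P ι : Type*} [Group G] [Fintype P] [DecidableEq P]
    (pm : G →* Matrix P P ℝ) (f : ι → Matrix P P ℝ) : Prop where
  mem_span : ∀ i, f i ∈ Submodule.span ℝ (Set.range pm)
  symm : ∀ i, (f i)ᵀ = f i
  scal : ∀ i s, ∃ c : ℝ, f i * pm s * f i = c • f i
  orth : ∀ i j, i ≠ j → ∀ s, f i * pm s * f j = 0
  complete : ∀ v : P → ℝ, v ≠ 0 → ∃ i s, f i *ᵥ (pm s *ᵥ v) ≠ 0

variable {G P ι K : Type*} [Group G] [Fintype P] [DecidableEq P] [Fintype K] [DecidableEq K]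
  [Fintype ι] [DecidableEq ι]

/-- The tensor product of the matrices `typeMat` for the shapes `lam i`, with the cells placed in
`K`. -/
def multiMat {lam : ι → YoungDiagram} (T : (Σ i, (lam i).cells) ≃ K) (f : ι → Matrix P P ℝ) :
    Matrix (K → P) (K → P) ℝ :=
  (kron fun i => typeMat (Equiv.refl (lam i).cells) (f i)).submatrix
    (blockWords T P) (blockWords T P)

variable {lam mu : ι → YoungDiagram} (T : (Σ i, (lam i).cells) ≃ K)
  (S : (Σ i, (mu i).cells) ≃ K) {pm : G →* Matrix P P ℝ} {f : ι → Matrix P P ℝ}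

theorem kron_eq_submatrix {C : ι → Type*} [∀ i, Fintype (C i)] [∀ i, DecidableEq (C i)] (T : (Σ i, C i) ≃ K)
    (f : ι → Matrix P P ℝ) :
    kron (fun p => f (T.symm p).1) = (kron fun i => kron fun _ : C i => f i).submatrix
      (blockWords T P) (blockWords T P) := by
  rw [← permKron_refl, permKron_eq_submatrix T T (Equiv.refl K) (fun i => Equiv.refl _)
    (fun _ _ => rfl)]
  simp only [Equiv.symm_apply_apply]
  rfl

theorem multiMat_eq_mul_kron (f : ι → Matrix P P ℝ) :
    multiMat T f = (kron fun i => posAct (lam i).cells P (youngElt (Equiv.refl (lam i).cells))).submatrix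
      (blockWords T P) (blockWords T P) * kron fun p => f (T.symm p).1 := by
  rw [kron_eq_submatrix, submatrix_mul_equiv, kron_mul]
  rfl

theorem multiMat_eq_kron_mul (f : ι → Matrix P P ℝ) :
    multiMat T f = (kron fun p => f (T.symm p).1) *
      (kron fun i => posAct (lam i).cells P (youngElt (Equiv.refl (lam i).cells))).submatrix
      (blockWords T P) (blockWords T P) := by
  rw [kron_eq_submatrix, submatrix_mul_equiv, kron_mul]
  simp only [← typeMat_eq]
  rfl

theorem multiMat_transpose (hf : ∀ i, (f i)ᵀ = f i) : (multiMat T f)ᵀ = multiMat T f := by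
  rw [multiMat, transpose_submatrix, kron_transpose]
  simp only [typeMat_transpose _ (hf _)]

/-- If the permutation preserves types then the product is computed type by type. -/
theorem multiMat_mul_mul_multiMat (π : Equiv.Perm K) (A : K → Matrix P P ℝ)
    (α : ∀ i, (mu i).cells ≃ (lam i).cells) (h : ∀ i y, π (S ⟨i, y⟩) = T ⟨i, α i y⟩) :
    multiMat T f * permKron π A * multiMat S f =
      (kron fun i => typeMat (Equiv.refl (lam i).cells) (f i) *
        permKron (α i) (fun z => A (T ⟨i, z⟩)) *
        typeMat (Equiv.refl (mu i).cells) (f i)).submatrix (blockWords T P) (blockWords S P) := by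
  rw [permKron_eq_submatrix S T π α h, multiMat, multiMat, submatrix_mul_equiv,
    submatrix_mul_equiv, kron_mul, kron_mul]

/-- The letter matrices can be written next to the permuted middle factor. At the position where the
type changes this produces `f i * pm s * f j` with `i ≠ j`, and one vanishing factor suffices. -/
theorem LetterData.multiMat_eq_zero (h : LetterData pm f) (π : Equiv.Perm K) (s : K → G)
    (y : Σ i, (mu i).cells) (hy : (T.symm (π (S y))).1 ≠ y.1) :
    multiMat T f * permKron π (fun p => pm (s p)) * multiMat S f = 0 := by
  have key : (kron fun p => f (T.symm p).1) * permKron π (fun p => pm (s p)) *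
      (kron fun p => f (S.symm p).1) = 0 := by
    rw [← permKron_refl, ← permKron_refl, permKron_mul, permKron_mul]
    refine permKron_eq_zero _ (π (S y)) ?_
    simp only [Equiv.refl_symm, Equiv.refl_apply, Equiv.trans_refl, Equiv.symm_apply_apply]
    exact h.orth _ _ hy _
  rw [multiMat_eq_mul_kron, multiMat_eq_kron_mul S]
  generalize kron (fun p => f (T.symm p).1) = F at key ⊢
  generalize kron (fun p => f (S.symm p).1) = F' at key ⊢
  rw [Matrix.mul_assoc _ F, ← Matrix.mul_assoc _ F', Matrix.mul_assoc _ (F * _) F', key,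
    Matrix.mul_zero, Matrix.zero_mul]

theorem exists_components_of_symm (π : Equiv.Perm K)
    (h : ∀ y : Σ i, (mu i).cells, (T.symm (π (S y))).1 = y.1) :
    ∃ α : ∀ i, (mu i).cells ≃ (lam i).cells, ∀ i y, π (S ⟨i, y⟩) = T ⟨i, α i y⟩ := by
  obtain ⟨α, hα⟩ := exists_equiv_components (S.trans (π.trans T.symm)) h
  refine ⟨α, fun i y => ?_⟩
  rw [← hα]
  simp

theorem LetterData.multiMat_orth (h : LetterData pm f) (hlm : lam ≠ mu) (π : Equiv.Perm K)
    (s : K → G) :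
    multiMat T f * permKron π (fun p => pm (s p)) * multiMat S f = 0 := by
  by_cases hy : ∀ y : Σ i, (mu i).cells, (T.symm (π (S y))).1 = y.1
  · obtain ⟨α, hα⟩ := exists_components_of_symm T S π hy
    rw [multiMat_mul_mul_multiMat T S π _ α hα]
    obtain ⟨i, hi⟩ := Function.ne_iff.1 hlm
    choose c hc using h.scal i
    rw [kron_eq_zero i (typeMat_orth _ _ hi (α i) fun z => hc (s (T ⟨i, z⟩)))]
    rfl
  · push Not at hy
    obtain ⟨y, hy⟩ := hy
    exact h.multiMat_eq_zero T S π s y hy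

theorem LetterData.multiMat_scal (h : LetterData pm f) (π : Equiv.Perm K) (s : K → G) :
    ∃ c : ℝ, multiMat T f * permKron π (fun p => pm (s p)) * multiMat T f = c • multiMat T f := by
  by_cases hy : ∀ y : Σ i, (lam i).cells, (T.symm (π (T y))).1 = y.1
  · obtain ⟨α, hα⟩ := exists_components_of_symm T T π hy
    rw [multiMat_mul_mul_multiMat T T π _ α hα]
    choose c hc using h.scal
    choose k hk using fun i => typeMat_scal (Equiv.refl (lam i).cells) (α i)
      (A := fun z => pm (s (T ⟨i, z⟩))) fun z => hc i (s (T ⟨i, z⟩))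
    refine ⟨∏ i, k i, ?_⟩
    simp only [hk, kron_smul]
    rfl
  · push Not at hy
    obtain ⟨y, hy⟩ := hy
    exact ⟨0, by rw [h.multiMat_eq_zero T T π s y hy, zero_smul]⟩

/-- The associated quadratic form is the sum of the squared lengths of all `f i * pm s` applied to
`v`, positive by completeness. Invertibility, unlike completeness itself, passes to Kronecker
products. -/
theorem LetterData.isUnit_sum [Fintype G] (h : LetterData pm f) :
    IsUnit (∑ x : ι × G, (f x.1 * pm x.2)ᵀ * (f x.1 * pm x.2)) := by
  rw [← mulVec_injective_iff_isUnit]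
  refine (injective_iff_map_eq_zero (mulVecLin _)).2 fun v hv => ?_
  by_contra hne
  obtain ⟨i, s, his⟩ := h.complete v hne
  rw [mulVecLin_apply] at hv
  have h0 : ∑ x : ι × G, ((f x.1 * pm x.2) *ᵥ v) ⬝ᵥ ((f x.1 * pm x.2) *ᵥ v) = 0 := by
    have := congrArg (fun w => v ⬝ᵥ w) hv
    simp only [sum_mulVec, dotProduct_sum, dotProduct_zero, ← mulVec_mulVec] at this
    rw [← this]
    refine Finset.sum_congr rfl fun x _ => ?_
    rw [dotProduct_mulVec v, vecMul_transpose, mulVec_mulVec]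
  rw [Finset.sum_eq_zero_iff_of_nonneg fun x _ => by
    exact Finset.sum_nonneg fun _ _ => mul_self_nonneg _] at h0
  have := dotProduct_self_eq_zero.1 (h0 (i, s) (Finset.mem_univ _))
  rw [mulVec_mulVec] at his
  exact his this

theorem exists_kron_posAct_ne_zero {C : ι → Type} [∀ i, Fintype (C i)] [∀ i, DecidableEq (C i)]
    {v : (∀ i, C i → P) → ℝ} (hv : v ≠ 0) :
    ∃ (mu : ι → YoungDiagram) (T : ∀ i, (mu i).cells ≃ C i),
      kron (fun i => posAct (C i) P (youngElt (T i))) *ᵥ v ≠ 0 := by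
  choose J hJ c μ T h1 using fun i => exists_one_eq_sum_youngElt (C i)
  obtain ⟨j, hj⟩ := exists_kron_mulVec_ne_zero
    (A := fun i j => c i j • posAct (C i) P (youngElt (T i j))) (fun i => by
      have := congrArg (posAct (C i) P) (h1 i)
      rw [map_one, map_sum] at this
      simp only [map_smul] at this
      rw [← this]
      exact isUnit_one) hv
  refine ⟨fun i => μ i (j i), fun i => T i (j i), fun h0 => hj ?_⟩
  rw [kron_smul, smul_mulVec, h0, smul_zero]

/-- Every nonzero vector can be moved by the group so that it is not annihilated by the matrix for
some tuple of shapes. -/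
theorem LetterData.exists_multiMat_ne_zero {K : Type} [Fintype K] [DecidableEq K] {ι : Type}
    [Fintype ι] [DecidableEq ι] {f : ι → Matrix P P ℝ} [Fintype G]
    (h : LetterData pm f) {v : (K → P) → ℝ} (hv : v ≠ 0) :
    ∃ (mu : ι → YoungDiagram), Nonempty ((Σ i, (mu i).cells) ≃ K) ∧
      ∀ S : (Σ i, (mu i).cells) ≃ K, ∃ (π : Equiv.Perm K) (s : K → G),
        multiMat S f *ᵥ (permKron π (fun p => pm (s p)) *ᵥ v) ≠ 0 := by
  -- This selects a type and a group element for every position. The positions are next grouped by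
  -- type, and in each group a Young element is chosen that does not kill the vector.
  obtain ⟨ts, hts⟩ := exists_kron_mulVec_ne_zero (fun _ : K => h.isUnit_sum) hv
  have hts1 : kron (fun p => f (ts p).1) *ᵥ (kron (fun p => pm (ts p).2) *ᵥ v) ≠ 0 := by
    intro h0
    refine hts ?_
    rw [mulVec_mulVec, kron_mul] at h0
    rw [← kron_mul, ← mulVec_mulVec, h0, mulVec_zero]
  let T0 : (Σ i, {p // (ts p).1 = i}) ≃ K := Equiv.sigmaFiberEquiv fun p => (ts p).1
  have hT0 : ∀ p, (T0.symm p).1 = (ts p).1 := fun p => rfl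
  generalize hw : kron (fun p => pm (ts p).2) *ᵥ v = w at hts1
  have h1 : (kron fun i => kron fun _ : {p // (ts p).1 = i} => f i) *ᵥ
      (w ∘ (blockWords T0 P).symm) ≠ 0 := by
    intro h0
    refine hts1 ?_
    have := kron_eq_submatrix T0 f
    simp only [hT0] at this
    rw [this, submatrix_mulVec_equiv, h0]
    rfl
  obtain ⟨mu, T, hT⟩ := exists_kron_posAct_ne_zero h1
  rw [mulVec_mulVec, kron_mul] at hT
  refine ⟨mu, ⟨(Equiv.sigmaCongrRight T).trans T0⟩, fun S => ?_⟩
  -- The permutation carries the numbering found by the detection argument to the prescribed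
  -- numbering `S`.
  let π : Equiv.Perm K := (T0.symm.trans (Equiv.sigmaCongrRight fun i => (T i).symm)).trans S
  have hπ : ∀ i y, π (T0 ⟨i, y⟩) = S ⟨i, (T i).symm y⟩ := fun i y => by
    simp [π]
  refine ⟨π, fun p => (ts (π.symm p)).2, fun h0 => hT ?_⟩
  have e1 : permKron π (fun p => pm (ts (π.symm p)).2) =
      permKron π (fun _ => (1 : Matrix P P ℝ)) * kron fun p => pm (ts p).2 := by
    rw [← permKron_refl, permKron_mul]
    simp
  rw [e1, ← mulVec_mulVec, hw, mulVec_mulVec, permKron_eq_submatrix T0 S π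
    (fun i => (T i).symm) hπ, multiMat, submatrix_mul_equiv, kron_mul,
    submatrix_mulVec_equiv] at h0
  have h2 : (kron fun i => typeMat (Equiv.refl (mu i).cells) (f i) *
      permKron (T i).symm fun _ => (1 : Matrix P P ℝ)) *ᵥ (w ∘ (blockWords T0 P).symm) = 0 := by
    funext x
    have := congrFun h0 ((blockWords S P).symm x)
    simpa using this
  have h3 : ∀ i, posAct {p // (ts p).1 = i} P (youngElt (T i)) * (kron fun _ => f i) =
      permKron (T i) (fun _ => (1 : Matrix P P ℝ)) *
        (typeMat (Equiv.refl (mu i).cells) (f i) *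
          permKron (T i).symm fun _ => (1 : Matrix P P ℝ)) := by
    intro i
    rw [← Matrix.mul_assoc, permKron_mul_typeMat, Matrix.mul_assoc, permKron_mul]
    simp only [mul_one, Equiv.symm_trans_self, permKron_refl, Equiv.refl_trans]
    rw [kron_one, Matrix.mul_one]
    rfl
  simp only [h3]
  rw [← kron_mul, ← mulVec_mulVec, h2, mulVec_zero]

theorem LetterData.multiMat_mem_span [Fintype G] (h : LetterData pm f) :
    multiMat T f ∈ Submodule.span ℝ
      (Set.range fun x : Equiv.Perm K × (K → G) => permKron x.1 fun p => pm (x.2 p)) := by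
  have h1 := kron_mem_span
    (A := fun i => typeMat (Equiv.refl (lam i).cells) (f i))
    (fun i => typeMat_mem_span pm (Equiv.refl (lam i).cells) (h.mem_span i))
  have h2 := Submodule.mem_map_of_mem (f := (reindexLinearEquiv ℝ ℝ (blockWords T P).symm
    (blockWords T P).symm).toLinearMap) h1
  rw [Submodule.map_span, ← Set.range_comp] at h2
  refine Submodule.span_mono ?_ h2
  rintro _ ⟨x, rfl⟩
  let π : Equiv.Perm K := T.symm.trans ((Equiv.sigmaCongrRight fun i => (x i).1).trans T)
  let s : K → G := fun p => (x (T.symm p).1).2 (T.symm p).2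
  refine ⟨(π, s), ?_⟩
  simp only
  rw [permKron_eq_submatrix T T π (fun i => (x i).1) (fun i y => by simp [π])]
  have : ∀ i z, pm (s (T ⟨i, z⟩)) = pm ((x i).2 z) := fun i z => by
    simp only [s]
    rw [T.symm_apply_apply]
  simp only [this]
  rfl

/-- The tensor product of the vectors of the tableaux. -/
def multiVec (T : (Σ i, (lam i).cells) ≃ K) {m : ι → ℕ} (b : ∀ i, Fin (m i) → P → ℝ)
    (τ : ∀ i, SST (lam i) (m i)) : (K → P) → ℝ :=
  (kronVec fun i => symAltRow (tens (b i)) (τ i).1) ∘ blockWords T P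

variable {m : ι → ℕ} {b : ∀ i, Fin (m i) → P → ℝ}

theorem span_multiVec
    (h : ∀ i, Submodule.span ℝ (Set.range (b i)) = LinearMap.range (f i).mulVecLin) :
    Submodule.span ℝ (Set.range (multiVec T b)) = LinearMap.range (multiMat T f).mulVecLin := by
  classical
  have h1 := span_kronVec fun i => range_typeMat (μ := lam i) (h i)
  let e : ((∀ i, (lam i).cells → P) → ℝ) ≃ₗ[ℝ] ((K → P) → ℝ) :=
    LinearEquiv.funCongrLeft ℝ ℝ (blockWords T P)
  have h2 := congrArg (Submodule.map e.toLinearMap) h1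
  rw [Submodule.map_span, ← Set.range_comp] at h2
  refine Eq.trans ?_ (h2.trans ?_)
  · rfl
  · ext w
    simp only [Submodule.mem_map, LinearMap.mem_range, mulVecLin_apply, multiMat,
      submatrix_mulVec_equiv, LinearEquiv.coe_coe]
    constructor
    · rintro ⟨_, ⟨v, rfl⟩, rfl⟩
      refine ⟨e v, ?_⟩
      have : e v ∘ (blockWords T P).symm = v := by
        funext x
        simp [e, LinearEquiv.funCongrLeft_apply, LinearMap.funLeft_apply]
      rw [this]
      rfl
    · rintro ⟨v, rfl⟩
      exact ⟨_, ⟨_, rfl⟩, rfl⟩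

theorem linearIndependent_multiVec (h : ∀ i, LinearIndependent ℝ (b i)) :
    LinearIndependent ℝ (multiVec T b) := by
  classical
  have h1 := linearIndependent_kronVec fun i =>
    linearIndependent_symAltRow_tens (μ := lam i) (h i)
  exact h1.map' (LinearEquiv.funCongrLeft ℝ ℝ (blockWords T P)).toLinearMap
    (LinearEquiv.ker _)

end MultiType

/-! ### The matrices of the letters -/

section LetterMatrices

open Matrix

variable {G P : Type*} [Group G] [Fintype P] [DecidableEq P] [MulAction G P]

/-- The matrices of a permutation representation. -/
def permMat (G P : Type*) [Group G] [Fintype P] [DecidableEq P] [MulAction G P] :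
    G →* Matrix P P ℝ :=
  (LinearMap.toMatrixAlgEquiv' : ((P → ℝ) →ₗ[ℝ] (P → ℝ)) ≃ₐ[ℝ] Matrix P P ℝ).toMonoidHom.comp
    (permRep G P)

theorem permMat_mulVec (g : G) (v : P → ℝ) : permMat G P g *ᵥ v = permRep G P g v :=
  LinearMap.toMatrix'_mulVec (permRep G P g) v

theorem permMat_apply (g : G) (x y : P) : permMat G P g x y = if g⁻¹ • x = y then 1 else 0 := by
  change LinearMap.toMatrix' (permRep G P g) x y = _
  rw [LinearMap.toMatrix'_apply, permRep_apply, Pi.single_apply]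

theorem eq_of_mulVec {A B : Matrix P P ℝ} (h : ∀ v, A *ᵥ v = B *ᵥ v) : A = B :=
  ext_of_mulVec_single fun _ => h _

theorem transpose_eq_self {A : Matrix P P ℝ} (h : ∀ u v, (A *ᵥ u) ⬝ᵥ v = u ⬝ᵥ (A *ᵥ v)) :
    Aᵀ = A := by
  ext i j
  have := h (Pi.single i 1) (Pi.single j 1)
  simpa using this

/-- The matrix of an element of the group algebra. -/
def algMat (x : MonoidAlgebra ℝ G) : Matrix P P ℝ :=
  LinearMap.toMatrix' ((permRep G P).asAlgebraHom x)

theorem algMat_mulVec (x : MonoidAlgebra ℝ G) (v : P → ℝ) :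
    algMat x *ᵥ v = (permRep G P).asAlgebraHom x v :=
  LinearMap.toMatrix'_mulVec _ _

variable {ι : Type*} {e : ι → MonoidAlgebra ℝ G}

theorem Controls.letterData [Fintype G] (h : Controls (permRep G P) e)
    (hs : ∀ i g, (e i).coeff g⁻¹ = (e i).coeff g) :
    LetterData (permMat G P) fun i => algMat (P := P) (e i) where
  mem_span i := by
    have : algMat (P := P) (e i) = ∑ g, (e i).coeff g • permMat G P g := by
      refine eq_of_mulVec fun v => ?_
      rw [algMat_mulVec, asAlgebraHom_eq_sum, sum_mulVec]
      simp only [smul_mulVec, permMat_mulVec]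
    rw [this]
    exact Submodule.sum_mem _ fun g _ => Submodule.smul_mem _ _ (Submodule.subset_span ⟨g, rfl⟩)
  symm i := by
    refine transpose_eq_self fun u v => ?_
    rw [algMat_mulVec, algMat_mulVec, dotProduct_asAlgebraHom_permRep (hs i)]
  scal i s := by
    obtain ⟨c, hc⟩ := h.scal i (MonoidAlgebra.of ℝ G s)
    simp only [Representation.asAlgebraHom_of] at hc
    refine ⟨c, eq_of_mulVec fun v => ?_⟩
    rw [← mulVec_mulVec, ← mulVec_mulVec, smul_mulVec]
    simp only [algMat_mulVec, permMat_mulVec, hc]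
  orth i j hij s := by
    refine eq_of_mulVec fun v => ?_
    have := h.orth i j hij (MonoidAlgebra.of ℝ G s) v
    rw [Representation.asAlgebraHom_of] at this
    rw [← mulVec_mulVec, ← mulVec_mulVec, algMat_mulVec, algMat_mulVec, permMat_mulVec, this,
      zero_mulVec]
  complete v hv := by
    obtain ⟨i, x, hx⟩ := h.complete v hv
    by_contra! h0
    refine hx ?_
    rw [asAlgebraHom_eq_sum _ x, map_sum]
    refine Finset.sum_eq_zero fun s _ => ?_
    have := h0 i s
    rw [algMat_mulVec, permMat_mulVec] at this
    rw [map_smul, this, smul_zero]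

end LetterMatrices

/-! ### The wreath product -/

section WreathProduct

open Matrix

variable {q n : ℕ}

instance instFintypeWreath (q n : ℕ) : Fintype (Wreath q n) :=
  Fintype.ofEquiv _ SemidirectProduct.equivProd.symm

/-- A pair of words as a word of pairs. -/
def zipWords (q n : ℕ) : Word q n × Word q n ≃ (Fin n → Fin q × Fin q) :=
  (Equiv.arrowProdEquivProdArrow (Fin n) (fun _ => Fin q) (fun _ => Fin q)).symm

theorem zipWords_apply (p : Word q n × Word q n) (i : Fin n) :
    zipWords q n p i = (p.1 i, p.2 i) := rfl

theorem inv_smul_word_apply (g : Wreath q n) (w : Word q n) (i : Fin n) :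
    (g⁻¹ • w) i = (g.left (g.right i))⁻¹ (w (g.right i)) := by
  rw [smul_word_apply, SemidirectProduct.inv_left, SemidirectProduct.inv_right, inv_inv]
  rfl

/-- The matrix of an element of the wreath product on words of pairs. -/
def wreathMat (g : Wreath q n) : Matrix (Fin n → Fin q × Fin q) (Fin n → Fin q × Fin q) ℝ :=
  permKron g.right fun p => permMat (Equiv.Perm (Fin q)) (Fin q × Fin q) (g.left p)

theorem wreathMat_mulVec (g : Wreath q n) (v : Word q n × Word q n → ℝ) :
    (wreathMat g).submatrix (zipWords q n) (zipWords q n) *ᵥ v =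
      permRep (Wreath q n) (Word q n × Word q n) g v := by
  funext p
  have h : ∀ p' : Word q n × Word q n, wreathMat g (zipWords q n p) (zipWords q n p') =
      if g⁻¹ • p = p' then 1 else 0 := by
    intro p'
    rw [wreathMat, permKron_apply]
    simp only [permMat_apply]
    rw [Finset.prod_boole]
    have : (∀ i ∈ Finset.univ, (g.left (g.right i))⁻¹ • zipWords q n p (g.right i) =
        zipWords q n p' i) ↔ g⁻¹ • p = p' := by
      simp only [zipWords_apply, Prod.ext_iff, funext_iff, Prod.smul_fst, Prod.smul_snd,
        inv_smul_word_apply, ← forall_and, Equiv.Perm.smul_def, Finset.mem_univ, true_imp_iff]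
    by_cases hp : g⁻¹ • p = p'
    · rw [if_pos hp, if_pos (this.2 hp)]
    · rw [if_neg hp, if_neg (mt this.1 hp)]
  simp only [mulVec, dotProduct, submatrix_apply, h, ite_mul, one_mul, zero_mul,
    Finset.sum_ite_eq, Finset.mem_univ, if_true]
  rfl

/-- A family indexed by `Fin 4` as a disjoint union. -/
def sigmaFinFour (C : Fin 4 → Type*) : (Σ i, C i) ≃ C 0 ⊕ C 1 ⊕ C 2 ⊕ C 3 where
  toFun
    | ⟨0, y⟩ => .inl y
    | ⟨1, y⟩ => .inr (.inl y)
    | ⟨2, y⟩ => .inr (.inr (.inl y))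
    | ⟨3, y⟩ => .inr (.inr (.inr y))
  invFun
    | .inl y => ⟨0, y⟩
    | .inr (.inl y) => ⟨1, y⟩
    | .inr (.inr (.inl y)) => ⟨2, y⟩
    | .inr (.inr (.inr y)) => ⟨3, y⟩
  left_inv := by
    rintro ⟨i, y⟩
    fin_cases i <;> rfl
  right_inv := by
    rintro (y | y | y | y) <;> rfl

/-- The order of the cells of a tuple of shapes. -/
def MultiShape.place (lam : MultiShape n) : (Σ i, (lam.shape i).cells) ≃ Fin n :=
  (sigmaFinFour fun i => (lam.shape i).cells).trans lam.cellOrder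

theorem MultiShape.shape_injective :
    Function.Injective (MultiShape.shape : MultiShape n → Fin 4 → YoungDiagram) := by
  rintro ⟨s, hs⟩ ⟨t, ht⟩ h
  simp only at h
  subst h
  rfl

variable (h0 : 0 < q) (h1 : 1 < q)

/-- The matrices of the letters. -/
def letterMat (i : Fin 4) : Matrix (Fin q × Fin q) (Fin q × Fin q) ℝ :=
  algMat (letterElt h0 h1 i)

theorem letterData_letterMat :
    LetterData (permMat (Equiv.Perm (Fin q)) (Fin q × Fin q)) (letterMat h0 h1) :=
  (controls_letterElt h0 h1).letterData (coeff_letterElt_inv h0 h1)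

/-- The matrix attached to a tuple of shapes. -/
def shapeMat (lam : MultiShape n) : Matrix (Word q n × Word q n) (Word q n × Word q n) ℝ :=
  (multiMat lam.place (letterMat h0 h1)).submatrix (zipWords q n) (zipWords q n)

theorem dotProduct_asAlgebraHom_rev {G X : Type*} [Group G] [Fintype G] [MulAction G X] [Fintype X]
    (x : MonoidAlgebra ℝ G) (f f' : X → ℝ) :
    (permRep G X).asAlgebraHom x f ⬝ᵥ f' = f ⬝ᵥ (permRep G X).asAlgebraHom (rev x) f' := by
  rw [asAlgebraHom_eq_sum, asAlgebraHom_eq_sum, sum_dotProduct, dotProduct_sum]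
  refine Fintype.sum_equiv (Equiv.inv G) _ _ fun g => ?_
  simp only [Equiv.inv_apply, smul_dotProduct, dotProduct_smul, dotProduct_permRep, coeff_rev,
    inv_inv]

/-- A symmetric matrix in the span of the group acts as an element of the group algebra that is
fixed by inversion. -/
theorem exists_shapeElt (lam : MultiShape n) :
    ∃ x : MonoidAlgebra ℝ (Wreath q n), (∀ g, x.coeff g⁻¹ = x.coeff g) ∧
      ∀ v, (permRep (Wreath q n) (Word q n × Word q n)).asAlgebraHom x v =
        shapeMat h0 h1 lam *ᵥ v := by
  have hd := letterData_letterMat h0 h1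
  have key : ∀ M ∈ Submodule.span ℝ (Set.range fun x : Equiv.Perm (Fin n) ×
      (Fin n → Equiv.Perm (Fin q)) => permKron x.1 fun p =>
        permMat (Equiv.Perm (Fin q)) (Fin q × Fin q) (x.2 p)),
      ∃ x : MonoidAlgebra ℝ (Wreath q n), ∀ v,
        (permRep (Wreath q n) (Word q n × Word q n)).asAlgebraHom x v =
          M.submatrix (zipWords q n) (zipWords q n) *ᵥ v := by
    intro M hM
    induction hM using Submodule.span_induction with
    | mem M hM =>
      obtain ⟨⟨π, s⟩, rfl⟩ := hM
      refine ⟨MonoidAlgebra.of ℝ _ ⟨s, π⟩, fun v => ?_⟩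
      rw [Representation.asAlgebraHom_of, ← wreathMat_mulVec]
      rfl
    | zero => exact ⟨0, fun v => by simp⟩
    | add M N _ _ hM hN =>
      obtain ⟨x, hx⟩ := hM
      obtain ⟨y, hy⟩ := hN
      exact ⟨x + y, fun v => by
        rw [map_add, LinearMap.add_apply, hx, hy, submatrix_add, Pi.add_apply, Pi.add_apply,
          add_mulVec]⟩
    | smul a M _ hM =>
      obtain ⟨x, hx⟩ := hM
      exact ⟨a • x, fun v => by
        rw [map_smul, LinearMap.smul_apply, hx, submatrix_smul, Pi.smul_apply, Pi.smul_apply,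
          smul_mulVec]⟩
  obtain ⟨x, hx⟩ := key _ (hd.multiMat_mem_span lam.place)
  have hT : (shapeMat h0 h1 lam)ᵀ = shapeMat h0 h1 lam := by
    rw [shapeMat, transpose_submatrix, multiMat_transpose _ hd.symm]
  have hrev : ∀ v, (permRep (Wreath q n) (Word q n × Word q n)).asAlgebraHom (rev x) v =
      shapeMat h0 h1 lam *ᵥ v := by
    intro v
    refine dotProduct_eq _ _ fun u => ?_
    rw [dotProduct_comm, ← dotProduct_asAlgebraHom_rev, hx, dotProduct_comm (shapeMat h0 h1 lam *ᵥ v),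
      dotProduct_mulVec u, ← mulVec_transpose, hT]
    rfl
  -- Reversal acts as the transpose, and the matrix is symmetric. So the average of `x` and `rev x`
  -- acts in the same way and is in addition fixed by inversion.
  refine ⟨(2⁻¹ : ℝ) • (x + rev x), fun g => coeff_inv_of_rev ?_ g, fun v => ?_⟩
  · rw [map_smul, map_add, rev_rev, add_comm]
  · rw [map_smul, map_add, LinearMap.smul_apply, LinearMap.add_apply, hrev, hx, shapeMat, ← two_smul ℝ,
      smul_smul, inv_mul_cancel₀ two_ne_zero, one_smul]

/-- The element of the group algebra attached to a tuple of shapes. -/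
def shapeElt (lam : MultiShape n) : MonoidAlgebra ℝ (Wreath q n) :=
  (exists_shapeElt h0 h1 lam).choose

theorem coeff_shapeElt_inv (lam : MultiShape n) (g : Wreath q n) :
    (shapeElt h0 h1 lam).coeff g⁻¹ = (shapeElt h0 h1 lam).coeff g :=
  (exists_shapeElt h0 h1 lam).choose_spec.1 g

theorem asAlgebraHom_shapeElt (lam : MultiShape n) (v : Word q n × Word q n → ℝ) :
    (permRep (Wreath q n) (Word q n × Word q n)).asAlgebraHom (shapeElt h0 h1 lam) v =
      shapeMat h0 h1 lam *ᵥ v :=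
  (exists_shapeElt h0 h1 lam).choose_spec.2 v

theorem controls_shapeElt :
    Controls (permRep (Wreath q n) (Word q n × Word q n)) (shapeElt h0 h1) := by
  have hd := letterData_letterMat h0 h1
  refine Controls.of_group (fun lam g => ?_) (fun lam mu hlm g v => ?_) fun v hv => ?_
  · obtain ⟨c, hc⟩ := hd.multiMat_scal lam.place g.right g.left
    refine ⟨c, fun v => ?_⟩
    rw [asAlgebraHom_shapeElt, asAlgebraHom_shapeElt, ← wreathMat_mulVec, mulVec_mulVec,
      mulVec_mulVec, shapeMat, submatrix_mul_equiv, submatrix_mul_equiv, wreathMat, hc, submatrix_smul, Pi.smul_apply, Pi.smul_apply, smul_mulVec]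
  · have hc := hd.multiMat_orth lam.place mu.place (MultiShape.shape_injective.ne hlm)
      g.right g.left
    rw [asAlgebraHom_shapeElt, asAlgebraHom_shapeElt, ← wreathMat_mulVec, mulVec_mulVec,
      mulVec_mulVec, shapeMat, shapeMat, submatrix_mul_equiv, submatrix_mul_equiv, wreathMat,
      hc]
    exact zero_mulVec _
  · have hv' : v ∘ (zipWords q n).symm ≠ 0 := fun h => hv (by
      funext p
      have := congrFun h (zipWords q n p)
      simpa using this)
    obtain ⟨mu, ⟨S⟩, h⟩ := hd.exists_multiMat_ne_zero hv'
    let lam : MultiShape n := ⟨mu, by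
      have := Fintype.card_congr S
      simpa [Fintype.card_sigma] using this⟩
    obtain ⟨π, s, hs⟩ := h lam.place
    refine ⟨lam, ⟨s, π⟩, fun h0' => hs ?_⟩
    rw [asAlgebraHom_shapeElt, ← wreathMat_mulVec, shapeMat, submatrix_mulVec_equiv,
      submatrix_mulVec_equiv, Function.comp_assoc, Equiv.self_comp_symm, Function.comp_id] at h0'
    funext p
    have := congrFun h0' ((zipWords q n).symm p)
    rwa [Function.comp_apply, Equiv.apply_symm_apply] at this

end WreathProduct

/-! ### The vectors of the tableaux as functions on pairs of words -/

section Evaluation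

variable {q n : ℕ} {K L : Type*} [Fintype K] [Fintype L]

/-- Evaluation of a tensor at a word of pairs. -/
def evalTensor (z : K → Fin q × Fin q) : (⨂[ℝ] _ : K, Matrix (Fin q) (Fin q) ℝ) →ₗ[ℝ] ℝ :=
  PiTensorProduct.lift ((MultilinearMap.mkPiAlgebra ℝ K ℝ).compLinearMap fun i =>
    Matrix.entryLinearMap ℝ ℝ (z i).1 (z i).2)

theorem evalTensor_tprod (z : K → Fin q × Fin q) (A : K → Matrix (Fin q) (Fin q) ℝ) :
    evalTensor z (PiTensorProduct.tprod ℝ A) = ∏ i, A i (z i).1 (z i).2 := by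
  simp [evalTensor]

theorem toPairs_tprod (A : Fin n → Matrix (Fin q) (Fin q) ℝ) (p : Word q n × Word q n) :
    toPairs q n (PiTensorProduct.tprod ℝ A) p = ∏ i, A i (p.1 i) (p.2 i) := by
  simp [toPairs]

theorem toPairs_apply (t : TensorSpace q n) (p : Word q n × Word q n) :
    toPairs q n t p = evalTensor (zipWords q n p) t := by
  have : (LinearMap.proj p).comp (toPairs q n) = evalTensor (zipWords q n p) := by
    refine PiTensorProduct.ext (MultilinearMap.ext fun A => ?_)
    simp only [LinearMap.compMultilinearMap_apply, LinearMap.comp_apply, LinearMap.proj_apply,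
      toPairs_tprod, evalTensor_tprod]
    rfl
  exact LinearMap.congr_fun this t

theorem evalTensor_reindex (e : K ≃ L) (z : L → Fin q × Fin q)
    (t : ⨂[ℝ] _ : K, Matrix (Fin q) (Fin q) ℝ) :
    evalTensor z (PiTensorProduct.reindex ℝ (fun _ => Matrix (Fin q) (Fin q) ℝ) e t) =
      evalTensor (z ∘ e) t := by
  have : (evalTensor z).comp
      (PiTensorProduct.reindex ℝ (fun _ => Matrix (Fin q) (Fin q) ℝ) e).toLinearMap =
      evalTensor (z ∘ e) := by
    refine PiTensorProduct.ext (MultilinearMap.ext fun A => ?_)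
    simp only [LinearMap.compMultilinearMap_apply, LinearMap.comp_apply, LinearEquiv.coe_coe,
      PiTensorProduct.reindex_tprod, evalTensor_tprod]
    rw [← Equiv.prod_comp e]
    simp
  exact LinearMap.congr_fun this t

theorem evalTensor_tmulEquiv (z : K ⊕ L → Fin q × Fin q)
    (s : ⨂[ℝ] _ : K, Matrix (Fin q) (Fin q) ℝ) (t : ⨂[ℝ] _ : L, Matrix (Fin q) (Fin q) ℝ) :
    evalTensor z (PiTensorProduct.tmulEquiv ℝ _ (s ⊗ₜ[ℝ] t)) =
      evalTensor (z ∘ Sum.inl) s * evalTensor (z ∘ Sum.inr) t := by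
  induction s using PiTensorProduct.induction_on with
  | smul_tprod a A =>
    induction t using PiTensorProduct.induction_on with
    | smul_tprod b B =>
      simp only [TensorProduct.tmul_smul, ← TensorProduct.smul_tmul', map_smul, PiTensorProduct.tmulEquiv_apply, evalTensor_tprod, Fintype.prod_sum_type,
        Sum.elim_inl, Sum.elim_inr, Function.comp_apply, smul_eq_mul]
      ring
    | add t t' ht ht' => rw [TensorProduct.tmul_add, map_add, map_add, ht, ht', map_add, mul_add]
  | add s s' hs hs' => rw [TensorProduct.add_tmul, map_add, map_add, hs, hs', map_add, add_mul]

theorem evalTensor_youngTensor {μ : YoungDiagram} {i : Fin 4} (τ : Tableau μ (numCols q i))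
    (z : μ.cells → Fin q × Fin q) :
    evalTensor z (youngTensor (colFamily q i) τ) =
      symAltRow (tens fun j : Fin (numCols q i) => colFun q i j) τ z := by
  have h1 := map_symAltRow (evalTensor z) (fun σ : Tableau μ (numCols q i) =>
    PiTensorProduct.tprod ℝ fun y => colFamily q i (σ y)) τ
  have h2 := map_symAltRow (LinearMap.proj (R := ℝ) (φ := fun _ => ℝ) z)
    (tens fun j : Fin (numCols q i) => colFun q i j) τ
  simp only [LinearMap.proj_apply] at h2
  rw [h2]
  refine Eq.trans h1 ?_
  congr 1
  funext σ
  rw [evalTensor_tprod]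
  rfl

theorem pairVec_eq {lam : MultiShape n} (τ : W q lam) :
    pairVec τ = multiVec lam.place (fun i (j : Fin (numCols q i)) => colFun q i j) τ ∘
      zipWords q n := by
  funext p
  rw [pairVec, toPairs_apply, tableauVec, evalTensor_reindex, evalTensor_tmulEquiv,
    evalTensor_tmulEquiv, evalTensor_tmulEquiv]
  simp only [evalTensor_youngTensor]
  rw [Function.comp_apply, multiVec, Function.comp_apply, kronVec, Fin.prod_univ_four, mul_assoc,
    mul_assoc]
  rfl

theorem linearIndependent_pairVec (h0 : 0 < q) (h1 : 1 < q) (lam : MultiShape n) :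
    LinearIndependent ℝ fun τ : W q lam => pairVec τ := by
  simp only [pairVec_eq]
  exact (linearIndependent_multiVec lam.place (li_colFun h0 h1)).map'
    (LinearEquiv.funCongrLeft ℝ ℝ (zipWords q n)).toLinearMap (LinearEquiv.ker _)

theorem span_pairVec (h0 : 0 < q) (h1 : 1 < q) (lam : MultiShape n) :
    Submodule.span ℝ (Set.range fun τ : W q lam => pairVec τ) =
      LinearMap.range ((permRep (Wreath q n) (Word q n × Word q n)).asAlgebraHom
        (shapeElt h0 h1 lam)) := by
  simp only [pairVec_eq]
  have hspan := span_multiVec lam.place (f := letterMat h0 h1)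
    (b := fun i (j : Fin (numCols q i)) => colFun q i j) (fun i => by
      rw [span_colFun h0 h1]
      ext w
      simp only [LinearMap.mem_range, Matrix.mulVecLin_apply, letterMat, algMat_mulVec])
  let e : ((Fin n → Fin q × Fin q) → ℝ) ≃ₗ[ℝ] (Word q n × Word q n → ℝ) :=
    LinearEquiv.funCongrLeft ℝ ℝ (zipWords q n)
  have h2 := congrArg (Submodule.map e.toLinearMap) hspan
  rw [Submodule.map_span, ← Set.range_comp] at h2
  refine Eq.trans ?_ (h2.trans ?_)
  · rfl
  · ext w
    simp only [Submodule.mem_map, LinearMap.mem_range, Matrix.mulVecLin_apply, shapeMat,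
      asAlgebraHom_shapeElt, Matrix.submatrix_mulVec_equiv, LinearEquiv.coe_coe]
    constructor
    · rintro ⟨_, ⟨v, rfl⟩, rfl⟩
      refine ⟨e v, ?_⟩
      have : e v ∘ (zipWords q n).symm = v := by
        funext x
        simp [e, LinearEquiv.funCongrLeft_apply, LinearMap.funLeft_apply]
      rw [this]
      rfl
    · rintro ⟨v, rfl⟩
      exact ⟨_, ⟨_, rfl⟩, rfl⟩

end Evaluation

/-! ### Tensors as functions on pairs of words -/

section ToPairs

variable {q n : ℕ}

theorem tensorRep_tprod (g : Wreath q n) (A : Fin n → Matrix (Fin q) (Fin q) ℝ) :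
    tensorRep q n g (PiTensorProduct.tprod ℝ A) =
      PiTensorProduct.tprod ℝ fun i => matrixRep q (g.left i) (A (g.right.symm i)) := by
  simp [tensorRep]

theorem toPairs_tensorRep (g : Wreath q n) (t : TensorSpace q n) :
    toPairs q n (tensorRep q n g t) =
      permRep (Wreath q n) (Word q n × Word q n) g (toPairs q n t) := by
  have : (toPairs q n).comp (tensorRep q n g) =
      (permRep (Wreath q n) (Word q n × Word q n) g).comp (toPairs q n) := by
    refine PiTensorProduct.ext (MultilinearMap.ext fun A => funext fun p => ?_)
    simp only [LinearMap.compMultilinearMap_apply, LinearMap.comp_apply, tensorRep_tprod,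
      toPairs_tprod, permRep_apply, Prod.smul_fst, Prod.smul_snd, inv_smul_word_apply]
    rw [← Equiv.prod_comp g.right]
    simp only [Equiv.symm_apply_apply]
    rfl
  exact LinearMap.congr_fun this t

/-- The inverse of `toPairs`. -/
def fromPairs (q n : ℕ) : (Word q n × Word q n → ℝ) →ₗ[ℝ] TensorSpace q n :=
  Fintype.linearCombination ℝ fun p : Word q n × Word q n =>
    PiTensorProduct.tprod ℝ fun i => Matrix.single (p.1 i) (p.2 i) (1 : ℝ)

theorem toPairs_fromPairs (v : Word q n × Word q n → ℝ) : toPairs q n (fromPairs q n v) = v := by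
  have : (toPairs q n).comp (fromPairs q n) = LinearMap.id := by
    refine LinearMap.pi_ext' fun p => LinearMap.ext_ring (funext fun p' => ?_)
    simp only [LinearMap.comp_apply, LinearMap.coe_single, fromPairs,
      Fintype.linearCombination_apply_single, one_smul, toPairs_tprod, LinearMap.id_apply,
      Matrix.single_apply, Finset.prod_boole, Pi.single_apply]
    have : (∀ i ∈ Finset.univ, p.1 i = p'.1 i ∧ p.2 i = p'.2 i) ↔ p' = p := by
      simp only [Finset.mem_univ, true_imp_iff, Prod.ext_iff, funext_iff, forall_and, eq_comm]
    by_cases hp : p' = p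
    · rw [if_pos hp, if_pos (this.2 hp)]
    · rw [if_neg hp, if_neg (mt this.1 hp)]
  exact LinearMap.congr_fun this v

theorem fromPairs_toPairs (t : TensorSpace q n) : fromPairs q n (toPairs q n t) = t := by
  have : (fromPairs q n).comp (toPairs q n) = LinearMap.id := by
    refine PiTensorProduct.ext (MultilinearMap.ext fun A => ?_)
    simp only [LinearMap.compMultilinearMap_apply, LinearMap.comp_apply, LinearMap.id_apply]
    have hA : A = fun i => ∑ x : Fin q × Fin q, A i x.1 x.2 • Matrix.single x.1 x.2 (1 : ℝ) := by
      funext i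
      conv_lhs => rw [Matrix.matrix_eq_sum_single (A i)]
      rw [Fintype.sum_prod_type]
      simp [Matrix.smul_single]
    conv_rhs => rw [hA, MultilinearMap.map_sum]
    rw [fromPairs, Fintype.linearCombination_apply]
    refine Fintype.sum_equiv (zipWords q n) _ _ fun p => ?_
    rw [toPairs_tprod, MultilinearMap.map_smul_univ]
    rfl
  exact LinearMap.congr_fun this t

/-- `toPairs` as an equivalence. -/
def toPairsEquiv (q n : ℕ) : TensorSpace q n ≃ₗ[ℝ] (Word q n × Word q n → ℝ) :=
  { toPairs q n with
    invFun := fromPairs q n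
    left_inv := fromPairs_toPairs
    right_inv := toPairs_fromPairs }

theorem isRepresentative_tableauVec (hq : 2 ≤ q) :
    IsRepresentative (tensorRep q n)
      (fun (lam : {lam : MultiShape n // Nonempty (W q lam)})
        (τ : W q lam.1) => tableauVec τ) := by
  have h0 : 0 < q := by omega
  have h1 : 1 < q := by omega
  have hsymm : ∀ lam (τ : W q lam), (toPairsEquiv q n).symm (pairVec τ) = tableauVec τ :=
    fun lam τ => fromPairs_toPairs _
  have hc : Controls (tensorRep q n) (shapeElt h0 h1) :=
    (controls_shapeElt h0 h1).of_separating (fun _ : Unit => toPairs q n)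
      (fun _ g v => toPairs_tensorRep g v)
      (fun v hv => (toPairsEquiv q n).map_eq_zero_iff.1 (hv ()))
  refine hc.isRepresentative (u := fun lam (τ : W q lam) => tableauVec τ) (fun lam => ?_)
    (fun lam => ?_) fun lam => Iff.rfl
  · rw [range_asAlgebraHom_of_surjective (ρ := permRep (Wreath q n) (Word q n × Word q n))
      (toPairsEquiv q n).symm.toLinearMap (fun g v => ?_) (toPairsEquiv q n).symm.surjective,
      ← span_pairVec h0 h1, Submodule.map_span, ← Set.range_comp]
    · congr 2
      funext τ
      exact (hsymm lam τ).symm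
    · refine (toPairsEquiv q n).injective ?_
      change _ = toPairs q n _
      rw [toPairs_tensorRep]
      change (toPairsEquiv q n) ((toPairsEquiv q n).symm _) =
        permRep _ _ g ((toPairsEquiv q n) ((toPairsEquiv q n).symm _))
      rw [LinearEquiv.apply_symm_apply, LinearEquiv.apply_symm_apply]
  · have := (linearIndependent_pairVec h0 h1 lam).map' (toPairsEquiv q n).symm.toLinearMap
      (LinearEquiv.ker _)
    have h : ((toPairsEquiv q n).symm.toLinearMap ∘ fun τ : W q lam => pairVec τ) =
        fun τ => tableauVec τ := funext fun τ => hsymm lam τ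
    rwa [h] at this

end ToPairs

/-! ### Behaviour under transposition and support -/

section Weights

variable {P : Type*}

/-- The product of the weights over the cells depends only on the multiset of entries, which row and
column permutations preserve. -/
theorem symAltRow_of_weights {N : Type*} [AddCommGroup N] [Module ℝ N] {μ : YoungDiagram} {m : ℕ}
    {ε : Fin m → ℝ} {t t' : Tableau μ m → N}
    (h : ∀ σ, t' σ = (∏ y, ε (σ y)) • t σ) (τ : Tableau μ m) :
    symAltRow t' τ = (∏ y, ε (τ y)) • symAltRow t τ := by
  classical
  rw [symAltRow, symAltRow, Finset.smul_sum]
  refine Finset.sum_congr rfl fun τ' _ => ?_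
  rw [Finset.smul_sum]
  refine Finset.sum_congr rfl fun c _ => ?_
  obtain ⟨r, -, hr⟩ := τ'.2
  have : ∏ y, ε ((τ'.1 ∘ c.1) y) = ∏ y, ε (τ y) := by
    rw [hr]
    exact Equiv.prod_comp (c.1.trans r) fun y => ε (τ y)
  rw [h, this, smul_comm]

/-- One statement for two uses: `g` is the transposition with `χ = 1` for the parity, and `g` is the
identity with `χ = 2` on the diagonal for the support. -/
theorem multiVec_of_weights {ι K : Type*} [Fintype ι] [Fintype K] {lam : ι → YoungDiagram}
    (T : (Σ i, (lam i).cells) ≃ K) {m : ι → ℕ} {b : ∀ i, Fin (m i) → P → ℝ} {g : P → P}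
    {χ : P → ℝ} {ε : ∀ i, Fin (m i) → ℝ}
    (h : ∀ i j p, χ p * b i j (g p) = ε i j * b i j p)
    (τ : ∀ i, SST (lam i) (m i)) (z : K → P) :
    (∏ k, χ (z k)) * multiVec T b τ (g ∘ z) =
      (∏ i, ∏ y, ε i ((τ i).1 y)) * multiVec T b τ z := by
  have h1 : ∀ i (w : (lam i).cells → P), (∏ y, χ (w y)) * symAltRow (tens (b i)) (τ i).1 (g ∘ w) =
      (∏ y, ε i ((τ i).1 y)) * symAltRow (tens (b i)) (τ i).1 w := by
    intro i w
    let L : (((lam i).cells → P) → ℝ) →ₗ[ℝ] (((lam i).cells → P) → ℝ) :=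
      { toFun := fun v w => (∏ y, χ (w y)) * v (g ∘ w)
        map_add' := fun u v => funext fun w => mul_add _ _ _
        map_smul' := fun c v => funext fun w => by
          simp only [Pi.smul_apply, smul_eq_mul, RingHom.id_apply]; ring }
    have h2 := map_symAltRow L (tens (b i)) (τ i).1
    have h3 := symAltRow_of_weights (ε := ε i) (t := tens (b i)) (t' := fun σ => L (tens (b i) σ))
      (fun σ => funext fun w => by
        simp only [L, LinearMap.coe_mk, AddHom.coe_mk, tens, kronVec, Pi.smul_apply, smul_eq_mul,
          ← Finset.prod_mul_distrib, Function.comp_apply, h]) (τ i).1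
    exact congrFun (h2.trans h3) w
  rw [← Equiv.prod_comp T, Fintype.prod_sigma]
  simp only [multiVec, Function.comp_apply, kronVec]
  rw [← Finset.prod_mul_distrib, ← Finset.prod_mul_distrib]
  exact Finset.prod_congr rfl fun i _ => h1 i (blockWords T P z i)

variable {q n : ℕ} {lam : MultiShape n}

theorem pairVec_of_weights {g : Fin q × Fin q → Fin q × Fin q} {χ : Fin q × Fin q → ℝ}
    {ε : ∀ i, Fin (numCols q i) → ℝ}
    (h : ∀ i (j : Fin (numCols q i)) p, χ p * colFun q i j (g p) = ε i j * colFun q i j p)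
    (τ : W q lam) (p p' : Word q n × Word q n) (hp : zipWords q n p' = g ∘ zipWords q n p) :
    (∏ k, χ (p.1 k, p.2 k)) * pairVec τ p' =
      (∏ i, ∏ y, ε i ((τ i).1 y)) * pairVec τ p := by
  have := multiVec_of_weights lam.place h τ (zipWords q n p)
  rw [pairVec_eq, Function.comp_apply, Function.comp_apply, hp]
  exact this

theorem prod_ite_eq_pow {μ : YoungDiagram} {m : ℕ} (τ : Tableau μ m) (j : ℕ) (c : ℝ) :
    ∏ y, (if (τ y : ℕ) = j then c else 1) = c ^ entryCount τ j := by
  rw [Finset.prod_ite, Finset.prod_const_one, mul_one, Finset.prod_const, entryCount]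

theorem unitVec_mul_self (a : ℕ) (x : Fin q) : unitVec q a x * unitVec q a x = unitVec q a x := by
  simp [unitVec]

theorem unitVec_mul_unitVec_of_ne (a : ℕ) {x y : Fin q} (h : x ≠ y) :
    unitVec q a x * unitVec q a y = 0 := by
  simp only [unitVec, ite_mul, one_mul, zero_mul]
  split_ifs with h1 h2
  · exact absurd (Fin.ext (by omega)) h
  · rfl
  · rfl

theorem unitVec_mul_unitVec_self {a b : ℕ} (h : a ≠ b) (x : Fin q) :
    unitVec q a x * unitVec q b x = 0 := by
  simp only [unitVec, ite_mul, one_mul, zero_mul]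
  split_ifs with h1 h2
  · exact absurd (h1.symm.trans h2) h
  · rfl
  · rfl

theorem colFun_swap (i : Fin 4) (j : ℕ) (p : Fin q × Fin q) :
    colFun q i j p.swap = ((if i = 1 ∧ j = 1 then -1 else 1) *
      (if i = 2 ∧ j = 0 then -1 else 1) : ℝ) * colFun q i j p := by
  obtain ⟨x, y⟩ := p
  match i, j with
  | 0, 0 => simp [colFun, basisMat, Matrix.one_apply, eq_comm]
  | 0, 1 => simp [colFun, basisMat, Matrix.one_apply, allOne, eq_comm]
  | 1, 0 | 1, 1 | 1, 2 | 2, 0 | 3, 0 =>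
    simp [colFun, basisMat, unitMat, diffMat, Matrix.vecMulVec_apply] <;> ring
  | 0, j + 2 | 1, j + 3 | 2, j + 1 | 3, j + 1 => simp [colFun, basisMat]

/-- Being supported on or off the diagonal is expressed by a multiplicative weight, `2` on the
diagonal and `1` elsewhere, so that it passes through tensor products and symmetrization. -/
theorem colFun_diag (i : Fin 4) (j : ℕ) (p : Fin q × Fin q) :
    (if p.1 = p.2 then 2 else 1) * colFun q i j p = ((if i = 0 ∧ j = 0 then 2 else 1) *
      (if i = 1 ∧ j = 0 then 2 else 1) : ℝ) * colFun q i j p := by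
  obtain ⟨x, y⟩ := p
  by_cases hxy : x = y
  · subst hxy
    have h1 := unitVec_mul_self 1 x
    have h2 := unitVec_mul_self 2 x
    match i, j with
    | 0, 0 | 0, 1 => simp [colFun, basisMat, allOne]
    | 1, 0 => simp
    | 1, 1 | 1, 2 | 2, 0 =>
      simp [colFun, basisMat, unitMat, diffMat, Matrix.vecMulVec_apply, h1, h2] <;> ring
    | 3, 0 => simp [colFun, basisMat, unitMat, Matrix.vecMulVec_apply, unitVec_mul_unitVec_self]
    | 0, j + 2 | 1, j + 3 | 2, j + 1 | 3, j + 1 => simp [colFun, basisMat]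
  · have h1 := unitVec_mul_unitVec_of_ne 1 hxy
    have h2 := unitVec_mul_unitVec_of_ne 2 hxy
    match i, j with
    | 0, 0 | 0, 1 => simp [colFun, basisMat, hxy]
    | 1, 0 => simp [colFun, basisMat, unitMat, Matrix.vecMulVec_apply, h1, h2]
    | 1, 1 | 1, 2 | 2, 0 | 3, 0 => simp [hxy]
    | 0, j + 2 | 1, j + 3 | 2, j + 1 | 3, j + 1 => simp [colFun, basisMat]

theorem pairVec_swap (τ : W q lam) (p : Word q n × Word q n) :
    pairVec τ p.swap = (-1) ^ skewCount τ * pairVec τ p := by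
  have := pairVec_of_weights (χ := fun _ => 1) (g := Prod.swap)
    (fun i j p => (one_mul _).trans (colFun_swap i j p)) τ p p.swap rfl
  rw [Finset.prod_const_one, one_mul] at this
  rw [this, Fin.prod_univ_four]
  simp [-Finset.univ_eq_attach, prod_ite_eq_pow, skewCount, pow_add]

/-- At a point of the support, `2` to the number of agreeing positions equals `2` to the number of
entries that select a diagonal column. Comparing exponents gives the distance. -/
theorem hammingDist_of_pairVec_ne_zero (τ : W q lam) (p : Word q n × Word q n)
    (hp : pairVec τ p ≠ 0) : hammingDist p.1 p.2 = distCount τ := by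
  have := pairVec_of_weights (g := id) (fun i j p => colFun_diag i j p) τ p p rfl
  have := mul_right_cancel₀ hp this
  rw [Fin.prod_univ_four, Finset.prod_ite, Finset.prod_const_one, mul_one,
    Finset.prod_const] at this
  simp [-Finset.univ_eq_attach, prod_ite_eq_pow, ← pow_add] at this
  have h2 := Finset.card_filter_add_card_filter_not (s := (Finset.univ : Finset (Fin n)))
    (fun k => p.1 k = p.2 k)
  rw [Finset.card_univ, Fintype.card_fin] at h2
  rw [distCount, hammingDist]
  simp only [ne_eq]
  omega

end Weights

/-! ### Transfer to symmetric functions and to codes -/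

section Transfer

open Matrix

variable {q n : ℕ}

theorem span_range_comp_of_zero {V V' J K : Type*} [AddCommGroup V] [Module ℝ V] [AddCommGroup V']
    [Module ℝ V'] (Φ : V →ₗ[ℝ] V') (u : K → V) (f : J → K)
    (h : ∀ k, k ∉ Set.range f → Φ (u k) = 0) :
    Submodule.span ℝ (Set.range fun j => Φ (u (f j))) =
      (Submodule.span ℝ (Set.range u)).map Φ := by
  rw [Submodule.map_span, ← Set.range_comp]
  apply le_antisymm
  · exact Submodule.span_mono (by rintro _ ⟨j, rfl⟩; exact ⟨f j, rfl⟩)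
  · rw [Submodule.span_le]
    rintro _ ⟨k, rfl⟩
    by_cases hk : k ∈ Set.range f
    · obtain ⟨j, rfl⟩ := hk
      exact Submodule.subset_span ⟨j, rfl⟩
    · rw [Function.comp_apply, h k hk]
      exact zero_mem _

/-- Transfer along an intertwiner of the representation on functions on pairs of words. -/
theorem isRepresentative_transfer {V : Type*} [AddCommGroup V] [Module ℝ V]
    {ρ : Representation ℝ (Wreath q n) V} (h0 : 0 < q) (h1 : 1 < q)
    (hc : Controls ρ (shapeElt h0 h1))
    (Φ : (Word q n × Word q n → ℝ) →ₗ[ℝ] V)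
    (hΦ : ∀ g v, Φ (permRep (Wreath q n) (Word q n × Word q n) g v) = ρ g (Φ v))
    (hs : Function.Surjective Φ) {J : MultiShape n → Type*} (f : ∀ lam, J lam → W q lam)
    (hz : ∀ lam τ, τ ∉ Set.range (f lam) → Φ (pairVec τ) = 0)
    (hli : ∀ lam, LinearIndependent ℝ fun j => Φ (pairVec (f lam j))) :
    IsRepresentative ρ (fun (lam : {lam : MultiShape n // Nonempty (J lam)})
      (j : J lam.1) => Φ (pairVec (f lam.1 j))) := by
  refine hc.isRepresentative (u := fun lam (j : J lam) => Φ (pairVec (f lam j))) (fun lam => ?_)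
    hli fun lam => Iff.rfl
  rw [range_asAlgebraHom_of_surjective Φ hΦ hs, ← span_pairVec h0 h1]
  exact span_range_comp_of_zero Φ (fun τ : W q lam => pairVec τ) (f lam) (hz lam)

theorem pairVec_swap_of_even {lam : MultiShape n} (τ : W' q lam) (p : Word q n × Word q n) :
    pairVec τ.1 p.swap = pairVec τ.1 p := by
  rw [pairVec_swap, τ.2.neg_one_pow, one_mul]

theorem pairVec_mem_symmetricPairs (lam : MultiShape n) (τ : W' q lam) :
    pairVec τ.1 ∈ (symmetricPairs q n).toSubmodule :=
  fun a b => pairVec_swap_of_even τ (a, b)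

/-- Symmetrization. -/
def symmetrize (q n : ℕ) :
    (Word q n × Word q n → ℝ) →ₗ[ℝ] (symmetricPairs q n).toSubmodule where
  toFun v := ⟨fun p => 2⁻¹ * (v p + v p.swap), fun a b => by
    simp only [Prod.swap_prod_mk]
    rw [add_comm]⟩
  map_add' u v := Subtype.ext (funext fun p => by
    simp only [Pi.add_apply, Submodule.coe_add]; ring)
  map_smul' c v := Subtype.ext (funext fun p => by
    simp only [Pi.smul_apply, Submodule.coe_smul, smul_eq_mul, RingHom.id_apply]; ring)

theorem symmetrize_apply (v : Word q n × Word q n → ℝ) (p : Word q n × Word q n) :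
    (symmetrize q n v).1 p = 2⁻¹ * (v p + v p.swap) := rfl

theorem symmetrize_coe (v : (symmetricPairs q n).toSubmodule) : symmetrize q n v.1 = v := by
  refine Subtype.ext (funext fun p => ?_)
  have : v.1 p.swap = v.1 p := v.2 p.1 p.2
  rw [symmetrize_apply, this, ← two_mul, inv_mul_cancel_left₀ two_ne_zero]

theorem isRepresentative_symmetricPairs (hq : 2 ≤ q) :
    IsRepresentative (symmetricPairs q n).toRepresentation
      (fun (lam : {lam : MultiShape n // Nonempty (W' q lam)}) (τ : W' q lam.1) =>
        (⟨pairVec τ.1, pairVec_mem_symmetricPairs lam.1 τ⟩ :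
          (symmetricPairs q n).toSubmodule)) := by
  have h0 : 0 < q := by omega
  have h1 : 1 < q := by omega
  have hc : Controls (symmetricPairs q n).toRepresentation (shapeElt h0 h1) :=
    (controls_shapeElt h0 h1).of_separating
      (fun _ : Unit => (symmetricPairs q n).toSubmodule.subtype)
      (fun _ g v => rfl) (fun v hv => Subtype.ext (hv ()))
  have heq : ∀ (lam : MultiShape n) (τ : W' q lam), symmetrize q n (pairVec τ.1) =
      ⟨pairVec τ.1, pairVec_mem_symmetricPairs lam τ⟩ :=
    fun lam τ => symmetrize_coe ⟨pairVec τ.1, pairVec_mem_symmetricPairs lam τ⟩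
  have := isRepresentative_transfer h0 h1 hc (symmetrize q n) (fun g v => rfl)
    (fun v => ⟨v.1, symmetrize_coe v⟩) (fun lam (τ : W' q lam) => τ.1) (fun lam τ hτ => ?_)
    (fun lam => ?_)
  · simpa only [heq] using this
  -- Skew vectors vanish under symmetrization, so that exactly the even tableaux survive.
  · have hodd : Odd (skewCount τ) := by
      rw [← Nat.not_even_iff_odd]
      exact fun h => hτ ⟨⟨τ, h⟩, rfl⟩
    refine Subtype.ext (funext fun p => ?_)
    rw [symmetrize_apply, pairVec_swap, hodd.neg_one_pow]
    simp
  · simp only [heq]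
    refine LinearIndependent.of_comp (symmetricPairs q n).toSubmodule.subtype ?_
    exact (linearIndependent_pairVec h0 h1 lam).comp (fun τ : W' q lam => τ.1)
      Subtype.val_injective

/-- Multiplication by an invariant rectangular matrix is equivariant. -/
theorem mulVec_permRep_of_invariant {G X Y : Type*} [Group G] [MulAction G X] [MulAction G Y]
    [Fintype Y] {A : Matrix X Y ℝ} (hA : ∀ (g : G) x y, A (g • x) (g • y) = A x y) (g : G)
    (f : Y → ℝ) : A *ᵥ permRep G Y g f = permRep G X g (A *ᵥ f) := by
  funext x
  simp only [mulVec, dotProduct, permRep_apply]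
  refine Fintype.sum_equiv (MulAction.toPerm g⁻¹) _ _ fun y => ?_
  simp [hA g⁻¹ x y]

variable (S : SubMulAction (Wreath q n) (Finset (Word q n)))

theorem smul_pair (g : Wreath q n) (p : Word q n × Word q n) :
    ({(g • p).1, (g • p).2} : Finset (Word q n)) = g • {p.1, p.2} := by
  rw [Finset.smul_finset_insert, Finset.smul_finset_singleton]
  rfl

theorem pairMatrix_smul (g : Wreath q n) (C : S) (p : Word q n × Word q n) :
    pairMatrix S (g • C) (g • p) = pairMatrix S C p := by
  simp only [pairMatrix, of_apply, smul_pair, SubMulAction.val_smul, smul_left_cancel_iff]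

theorem pairMatrix_mulVec (v : Word q n × Word q n → ℝ) (C : S) :
    (pairMatrix S *ᵥ v) C = ∑ p with C.1 = {p.1, p.2}, v p := by
  simp only [mulVec, dotProduct, pairMatrix, of_apply, ite_mul, one_mul, zero_mul,
    Finset.sum_filter]

theorem pairMatrix_transpose_mulVec (f : S → ℝ) (C : S) {p : Word q n × Word q n}
    (hp : C.1 = {p.1, p.2}) : ((pairMatrix S)ᵀ *ᵥ f) p = f C := by
  simp only [mulVec, dotProduct, pairMatrix, of_apply, ite_mul, one_mul, zero_mul,
    transpose_apply]
  rw [Finset.sum_eq_single C, if_pos hp]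
  · intro C' _ hC'
    rw [if_neg fun h => hC' (Subtype.ext (h.trans hp.symm))]
  · exact fun h => absurd (Finset.mem_univ _) h

theorem pairMatrix_mulVec_single (C : S) {p : Word q n × Word q n} (hp : C.1 = {p.1, p.2}) :
    pairMatrix S *ᵥ Pi.single p 1 = Pi.single C 1 := by
  funext C'
  simp only [mulVec_single_one, col_apply, pairMatrix, of_apply, Pi.single_apply, ← hp,
    Subtype.ext_iff]

theorem pairMatrix_mulVec_of_odd {lam : MultiShape n} (τ : W q lam) (h : ¬ Even (skewCount τ)) :
    pairMatrix S *ᵥ pairVec τ = 0 := by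
  funext C
  have key : ∑ p with C.1 = {p.1, p.2}, pairVec τ p = ∑ p with C.1 = {p.1, p.2}, - pairVec τ p := by
    refine Finset.sum_equiv (Equiv.prodComm _ _) (fun p => ?_) fun p _ => ?_
    · simp only [Finset.mem_filter, Finset.mem_univ, true_and, Equiv.prodComm_apply, Prod.fst_swap,
        Prod.snd_swap, Finset.pair_comm]
    · rw [Equiv.prodComm_apply, pairVec_swap, (Nat.not_even_iff_odd.1 h).neg_one_pow]
      ring
  rw [Finset.sum_neg_distrib] at key
  rw [pairMatrix_mulVec, Pi.zero_apply]
  linarith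

theorem pairMatrix_mulVec_eq_zero {v : Word q n × Word q n → ℝ} {C : S}
    (h : ∀ p : Word q n × Word q n, C.1 = {p.1, p.2} → v p = 0) : (pairMatrix S *ᵥ v) C = 0 := by
  rw [pairMatrix_mulVec]
  exact Finset.sum_eq_zero fun p hp => h p (Finset.mem_filter.1 hp).2

theorem pair_eq_pair {a b c d : Word q n} (h : ({a, b} : Finset (Word q n)) = {c, d}) :
    (c, d) = (a, b) ∨ (c, d) = (b, a) := by
  have h' := congrArg (fun s : Finset (Word q n) => (s : Set (Word q n))) h
  simp only [Finset.coe_insert, Finset.coe_singleton, Set.pair_eq_pair_iff] at h'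
  rcases h' with ⟨rfl, rfl⟩ | ⟨rfl, rfl⟩
  · exact Or.inl rfl
  · exact Or.inr rfl

/-- The symmetric functions that vanish on pairs outside `S`. -/
def supportedPairs : Submodule ℝ (Word q n × Word q n → ℝ) where
  carrier := {v | (∀ p, v p.swap = v p) ∧ ∀ p : Word q n × Word q n, {p.1, p.2} ∉ S → v p = 0}
  add_mem' := fun hu hv => ⟨fun p => congrArg₂ (· + ·) (hu.1 p) (hv.1 p), fun p hp => by
    rw [Pi.add_apply, hu.2 p hp, hv.2 p hp, add_zero]⟩
  zero_mem' := ⟨fun _ => rfl, fun _ _ => rfl⟩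
  smul_mem' := fun c _ hv => ⟨fun p => congrArg (c * ·) (hv.1 p), fun p hp => by
    rw [Pi.smul_apply, hv.2 p hp, smul_zero]⟩

/-- The value of `F v` at a code sums `v` over the orderings of its elements. For symmetric `v`
these values agree, so the sum is a nonzero multiple of one of them. -/
theorem disjoint_supportedPairs :
    Disjoint (supportedPairs S) (LinearMap.ker (pairMatrix S).mulVecLin) := by
  rw [Submodule.disjoint_def]
  intro v hv hv0
  rw [LinearMap.mem_ker, mulVecLin_apply] at hv0
  funext p
  by_cases hp : {p.1, p.2} ∈ S
  swap
  · exact hv.2 p hp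
  have h := congrFun hv0 ⟨_, hp⟩
  rw [pairMatrix_mulVec] at h
  have h2 : ∀ p' ∈ Finset.univ.filter fun p' : Word q n × Word q n =>
      ({p.1, p.2} : Finset (Word q n)) = {p'.1, p'.2}, v p' = v p := by
    intro p' hp'
    rcases pair_eq_pair (Finset.mem_filter.1 hp').2 with h' | h'
    · exact congrArg v h'
    · exact (congrArg v h').trans (hv.1 p)
  rw [Finset.sum_congr rfl h2, Finset.sum_const, Pi.zero_apply, smul_eq_zero] at h
  refine h.resolve_left fun h3 => ?_
  rw [Finset.card_eq_zero] at h3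
  exact Finset.notMem_empty p (h3 ▸ by simp)

theorem linearIndependent_pairMatrix (h0 : 0 < q) (h1 : 1 < q) {lam : MultiShape n} {J : Type*}
    {f : J → W q lam} (hf : Function.Injective f)
    (hs : ∀ j, pairVec (f j) ∈ supportedPairs S) :
    LinearIndependent ℝ fun j => pairMatrix S *ᵥ pairVec (f j) := by
  have h := (linearIndependent_pairVec h0 h1 lam).comp f hf
  refine h.map (f := (pairMatrix S).mulVecLin) ((disjoint_supportedPairs S).mono_left ?_)
  rw [Submodule.span_le]
  rintro _ ⟨j, rfl⟩
  exact hs j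

/-- If every code in `S` is a pair, possibly with equal members, the transpose of `F` is injective
and pulls back the control. Moreover `F` is onto, as it sends unit vectors of pairs to unit vectors
of codes. -/
theorem isRepresentative_pairMatrix (hq : 2 ≤ q) (hS : ∀ C ∈ S, ∃ p : Word q n × Word q n,
      C = {p.1, p.2}) {J : MultiShape n → Type*} (f : ∀ lam, J lam → W q lam)
    (hf : ∀ lam, Function.Injective (f lam))
    (hz : ∀ lam τ, τ ∉ Set.range (f lam) → pairMatrix S *ᵥ pairVec τ = 0)
    (hs : ∀ lam j, pairVec (f lam j) ∈ supportedPairs S) :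
    IsRepresentative (permRep (Wreath q n) S) (fun (lam : {lam : MultiShape n // Nonempty (J lam)})
      (j : J lam.1) => pairMatrix S *ᵥ pairVec (f lam.1 j)) := by
  have h0 : 0 < q := by omega
  have h1 : 1 < q := by omega
  have hc : Controls (permRep (Wreath q n) S) (shapeElt h0 h1) := by
    refine (controls_shapeElt h0 h1).of_separating (fun _ : Unit => (pairMatrix S)ᵀ.mulVecLin)
      (fun _ g v => mulVec_permRep_of_invariant (fun g p C => pairMatrix_smul S g C p) g v)
      fun v hv => funext fun C => ?_
    obtain ⟨p, hp⟩ := hS C.1 C.2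
    rw [← pairMatrix_transpose_mulVec S v C hp]
    exact congrFun (hv ()) p
  refine isRepresentative_transfer h0 h1 hc (pairMatrix S).mulVecLin
    (fun g v => mulVec_permRep_of_invariant (pairMatrix_smul S) g v) (fun v => ?_) f hz
    fun lam => linearIndependent_pairMatrix S h0 h1 (hf lam) (hs lam)
  choose p hp using fun C : S => hS C.1 C.2
  refine ⟨∑ C, v C • Pi.single (p C) 1, ?_⟩
  simp only [map_sum, map_smul, mulVecLin_apply, pairMatrix_mulVec_single S _ (hp _)]
  funext C
  simp [Finset.sum_apply, Pi.single_apply]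

theorem exists_eq_pair {α : Type*} [DecidableEq α] {C : Finset α} (hC : C.card ≤ 2) (h : C ≠ ∅) :
    ∃ p : α × α, C = {p.1, p.2} := by
  have h3 : C.card = 1 ∨ C.card = 2 := by
    have := Finset.card_pos.2 (Finset.nonempty_iff_ne_empty.2 h)
    omega
  rcases h3 with h3 | h3
  · obtain ⟨a, rfl⟩ := Finset.card_eq_one.1 h3
    exact ⟨(a, a), by simp⟩
  · obtain ⟨a, b, -, rfl⟩ := Finset.card_eq_two.1 h3
    exact ⟨(a, b), rfl⟩

theorem isRepresentative_pairs (hq : 2 ≤ q) :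
    IsRepresentative (permRep (Wreath q n) (pairs q n))
      (fun (lam : {lam : MultiShape n // Nonempty (W' q lam)}) (τ : W' q lam.1) =>
        (pairMatrix (pairs q n)).mulVec (pairVec τ.1)) := by
  refine isRepresentative_pairMatrix (pairs q n) hq (fun C hC => exists_eq_pair hC.1 hC.2)
    (fun lam (τ : W' q lam) => τ.1) (fun lam => Subtype.val_injective) (fun lam τ hτ => ?_)
    fun lam τ => ⟨pairVec_swap_of_even τ, fun p hp => ?_⟩
  · exact pairMatrix_mulVec_of_odd _ τ fun h => hτ ⟨⟨τ, h⟩, rfl⟩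
  · exact absurd ⟨Finset.card_le_two, by simp⟩ hp

theorem minDistGE_pair {d : ℕ} {a b : Word q n} :
    MinDistGE d {a, b} ↔ hammingDist a b = 0 ∨ d ≤ hammingDist a b := by
  constructor
  · intro h
    by_cases hab : a = b
    · exact Or.inl (by rw [hab, hammingDist_self])
    · exact Or.inr (h a (by simp) b (by simp) hab)
  · rintro h v hv w hw hvw
    rw [hammingDist_eq_zero] at h
    simp only [Finset.mem_insert, Finset.mem_singleton] at hv hw
    rcases hv with rfl | rfl <;> rcases hw with rfl | rfl
    · exact absurd rfl hvw
    · exact h.resolve_left hvw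
    · rw [hammingDist_comm]
      exact h.resolve_left hvw.symm
    · exact absurd rfl hvw

theorem minDistGE_of_pairVec_ne_zero {d : ℕ} {lam : MultiShape n} (τ : W'' q d lam)
    {p : Word q n × Word q n} (hp : pairVec τ.1.1 p ≠ 0) : MinDistGE d {p.1, p.2} := by
  rw [minDistGE_pair, hammingDist_of_pairVec_ne_zero _ _ hp]
  exact τ.2.imp_right And.left

theorem distCount_of_minDistGE {d : ℕ} {lam : MultiShape n} {τ : W q lam}
    {p : Word q n × Word q n} (hp : pairVec τ p ≠ 0) (h : MinDistGE d {p.1, p.2}) :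
    distCount τ = 0 ∨ d ≤ distCount τ ∧ distCount τ ≤ n := by
  rw [minDistGE_pair, hammingDist_of_pairVec_ne_zero _ _ hp] at h
  refine h.imp_right fun h => ⟨h, ?_⟩
  rw [distCount]
  omega

theorem pairMatrix_mulVec_of_not_minDistGE {d : ℕ} (lam : MultiShape n) (τ : W'' q d lam) (C : S)
    (hC : ¬ MinDistGE d C.1) : (pairMatrix S).mulVec (pairVec τ.1.1) C = 0 := by
  refine pairMatrix_mulVec_eq_zero S fun p hp => ?_
  by_contra h
  exact hC (hp ▸ minDistGE_of_pairVec_ne_zero τ h)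

/-- On codes with minimum distance at least `d` only the tableaux in `W''` contribute. -/
theorem pairMatrix_mulVec_of_notMem_range {d : ℕ} (hS : ∀ C ∈ S, MinDistGE d C)
    {lam : MultiShape n} (τ : W q lam) (hτ : τ ∉ Set.range fun τ : W'' q d lam => τ.1.1) :
    pairMatrix S *ᵥ pairVec τ = 0 := by
  by_cases he : Even (skewCount τ)
  swap
  · exact pairMatrix_mulVec_of_odd S τ he
  funext C
  refine pairMatrix_mulVec_eq_zero S fun p hp => ?_
  by_contra h
  exact hτ ⟨⟨⟨τ, he⟩, distCount_of_minDistGE h (hp ▸ hS C.1 C.2)⟩, rfl⟩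

theorem pairVec_mem_supportedPairs {d : ℕ} (hS : ∀ p : Word q n × Word q n,
      MinDistGE d {p.1, p.2} → {p.1, p.2} ∈ S) {lam : MultiShape n} (τ : W'' q d lam) :
    pairVec τ.1.1 ∈ supportedPairs S := by
  refine ⟨pairVec_swap_of_even τ.1, fun p hp => ?_⟩
  by_contra h
  exact hp (hS p (minDistGE_of_pairVec_ne_zero τ h))

theorem val_val_injective {d : ℕ} {lam : MultiShape n} :
    Function.Injective fun τ : W'' q d lam => τ.1.1 :=
  Subtype.val_injective.comp Subtype.val_injective

theorem isRepresentative_pairsD (hq : 2 ≤ q) (d : ℕ) :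
    IsRepresentative (permRep (Wreath q n) (pairsD q n d))
      (fun (lam : {lam : MultiShape n // Nonempty (W'' q d lam)}) (τ : W'' q d lam.1) =>
        (pairMatrix (pairsD q n d)).mulVec (pairVec τ.1.1)) :=
  isRepresentative_pairMatrix (pairsD q n d) hq (fun _ hC => exists_eq_pair hC.1 hC.2.2)
    (fun lam (τ : W'' q d lam) => τ.1.1) (fun _ => val_val_injective)
    (fun _ τ hτ => pairMatrix_mulVec_of_notMem_range (pairsD q n d)
      (fun _ hC => hC.2.1) τ hτ)
    fun _ τ => pairVec_mem_supportedPairs (pairsD q n d)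
      (fun _ hp => ⟨Finset.card_le_two, hp, by simp⟩) τ

end Transfer

/-! ### The constant functions -/

section Trivial

open Matrix

variable {q n : ℕ}

theorem asAlgebraHom_of_invariant {G V : Type*} [Group G] [Fintype G] [AddCommGroup V] [Module ℝ V]
    {ρ : Representation ℝ G V} {v : V} (h : ∀ g, ρ g v = v) (x : MonoidAlgebra ℝ G) :
    ρ.asAlgebraHom x v = (∑ g, x.coeff g) • v := by
  rw [asAlgebraHom_eq_sum, Finset.sum_smul]
  simp only [h]

theorem sum_symAlt {μ : YoungDiagram} {m : ℕ} {N : Type*} [AddCommGroup N] [Module ℝ N]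
    (hμ : ∀ c ∈ colGroup μ, c = 1) (t : Tableau μ m → N) :
    ∑ σ, symAlt t σ = (Nat.card (rowGroup μ) : ℝ) • ∑ σ, t σ := by
  classical
  have : Subsingleton (colGroup μ) :=
    ⟨fun c c' => Subtype.ext ((hμ c.1 c.2).trans (hμ c'.1 c'.2).symm)⟩
  have : Unique (colGroup μ) := ⟨⟨1⟩, fun c => Subsingleton.elim _ _⟩
  simp only [symAlt, Fintype.sum_unique]
  rw [Finset.sum_comm]
  have h : ∀ r : rowGroup μ, ∑ σ, ((Equiv.Perm.sign (default : colGroup μ).1 : ℤ) : ℝ) •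
      t (σ ∘ r.1 ∘ (default : colGroup μ).1) = ∑ σ, t σ := by
    intro r
    have h1 : (default : colGroup μ).1 = 1 := hμ _ (default : colGroup μ).2
    rw [h1]
    simp only [Equiv.Perm.sign_one, Units.val_one, Int.cast_one, one_smul]
    exact Fintype.sum_equiv (Equiv.arrowCongr r.1.symm (Equiv.refl (Fin m))) _ _ fun σ => rfl
  rw [Finset.sum_congr rfl fun r _ => h r, Finset.sum_const, Finset.card_univ,
    Nat.card_eq_fintype_card, Nat.cast_smul_eq_nsmul]

theorem one_mem_span_symAltRow {P : Type*} {μ : YoungDiagram} {m : ℕ}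
    (hμ : ∀ c ∈ colGroup μ, c = 1) {b : Fin m → P → ℝ}
    (hb : ∀ w : μ.cells → P, ∏ y, ∑ j, b j (w y) = 1) :
    (1 : (μ.cells → P) → ℝ) ∈
      Submodule.span ℝ (Set.range fun τ : SST μ m => symAltRow (tens b) τ.1) := by
  rw [span_symAltRow]
  have h : (∑ σ : Tableau μ m, tens b σ) = 1 := by
    funext w
    rw [Finset.sum_apply, Pi.one_apply, ← hb w, prod_sum_eq_sum_prod]
    rfl
  have h1 := sum_symAlt hμ (tens b)
  rw [h] at h1
  have hc : (Nat.card (rowGroup μ) : ℝ) ≠ 0 := Nat.cast_ne_zero.2 Nat.card_pos.ne'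
  rw [← inv_smul_smul₀ hc (1 : (μ.cells → P) → ℝ), ← h1]
  exact Submodule.smul_mem _ _ (Submodule.sum_mem _ fun σ _ => Submodule.subset_span ⟨σ, rfl⟩)

theorem colGroup_rowShape (c : Equiv.Perm (rowShape n).cells) (hc : c ∈ colGroup (rowShape n)) :
    c = 1 := by
  refine Equiv.ext fun y => Subtype.ext (Prod.ext ?_ (hc y))
  have h : ∀ z : (rowShape n).cells, z.1.1 = 0 := fun z => by
    have h2 : z.1 ∈ ({0} ×ˢ Finset.range n : Finset (ℕ × ℕ)) := z.2
    exact Finset.mem_singleton.1 (Finset.mem_product.1 h2).1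
  rw [h, h]

theorem isEmpty_cells_trivialShape (i : Fin 4) (hi : i ≠ 0) :
    IsEmpty ((trivialShape n).shape i).cells := by
  have h : (trivialShape n).shape i = ⊥ := by
    fin_cases i
    · exact absurd rfl hi
    all_goals rfl
  rw [h]
  exact ⟨fun y => Finset.notMem_empty _ y.2⟩

/-- The constant function is the tensor power of `J`, which is the sum of the two columns of `B₁`. A
one-row shape has trivial column group, so summing the symmetrizations over all tableaux yields a
multiple of that tensor power. -/
theorem one_mem_span_pairVec :
    (1 : Word q n × Word q n → ℝ) ∈
      Submodule.span ℝ (Set.range fun τ : W q (trivialShape n) => pairVec τ) := by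
  classical
  have h1 : ∀ i, (1 : (((trivialShape n).shape i).cells → Fin q × Fin q) → ℝ) ∈
      Submodule.span ℝ (Set.range fun τ : SST ((trivialShape n).shape i) (numCols q i) =>
        symAltRow (tens fun j : Fin (numCols q i) => colFun q i j) τ.1) := by
    intro i
    by_cases hi : i = 0
    · subst hi
      refine one_mem_span_symAltRow colGroup_rowShape fun w => Finset.prod_eq_one fun y _ => ?_
      change ∑ j : Fin 2, colFun q 0 j (w y) = 1
      simp [Fin.sum_univ_two, colFun, basisMat, allOne]
    · have := isEmpty_cells_trivialShape (n := n) i hi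
      exact one_mem_span_symAltRow (fun c _ => Subsingleton.elim _ _) fun w => by simp
  have h2 := kronVec_mem_span h1
  let e : ((∀ i, ((trivialShape n).shape i).cells → Fin q × Fin q) → ℝ) ≃ₗ[ℝ]
      (Word q n × Word q n → ℝ) :=
    LinearEquiv.funCongrLeft ℝ ℝ ((zipWords q n).trans (blockWords (trivialShape n).place _))
  have h3 := Submodule.mem_map_of_mem (f := e.toLinearMap) h2
  rw [Submodule.map_span, ← Set.range_comp] at h3
  have h4 : e.toLinearMap (kronVec fun i => (1 : (((trivialShape n).shape i).cells → Fin q × Fin q) → ℝ)) = 1 := by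
    funext p
    change (∏ _i : Fin 4, (1 : ℝ)) = 1
    exact Finset.prod_const_one
  rw [h4] at h3
  simp only [pairVec_eq]
  exact h3

theorem permRep_one (G X : Type*) [Group G] [MulAction G X] (g : G) :
    permRep G X g 1 = 1 := rfl

variable (h0 : 0 < q) (h1 : 1 < q)

theorem exists_shapeElt_one : ∃ v, (permRep (Wreath q n) (Word q n × Word q n)).asAlgebraHom
    (shapeElt h0 h1 (trivialShape n)) v = 1 := by
  have := one_mem_span_pairVec (q := q) (n := n)
  rw [span_pairVec h0 h1] at this
  exact this

theorem one_ne_zero_of_pos (h0 : 0 < q) : (1 : Word q n × Word q n → ℝ) ≠ 0 := fun h => by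
  have := congrFun h (fun _ => ⟨0, h0⟩, fun _ => ⟨0, h0⟩)
  exact one_ne_zero this

/-- The constant function lies in the range belonging to the trivial shape, so orthogonality makes
the other elements kill it. On it they act by the sum of their coefficients. -/
theorem sum_coeff_shapeElt_of_ne {lam : MultiShape n} (h : lam ≠ trivialShape n) :
    ∑ g, (shapeElt h0 h1 lam).coeff g = 0 := by
  obtain ⟨v, hv⟩ := exists_shapeElt_one (n := n) h0 h1
  have := (controls_shapeElt h0 h1).orth _ _ h 1 v
  rw [map_one, Module.End.one_apply, hv,
    asAlgebraHom_of_invariant (permRep_one (Wreath q n) _)] at this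
  exact (smul_eq_zero.1 this).resolve_right (one_ne_zero_of_pos h0)

/-- Otherwise the element would kill the constant function. By symmetry that function would be
orthogonal to the range of the element, to which it belongs. -/
theorem sum_coeff_shapeElt_trivialShape :
    ∑ g, (shapeElt h0 h1 (trivialShape n)).coeff g ≠ 0 := by
  obtain ⟨v, hv⟩ := exists_shapeElt_one (n := n) h0 h1
  intro hc
  have h := asAlgebraHom_of_invariant (permRep_one (Wreath q n) (Word q n × Word q n))
    (shapeElt h0 h1 (trivialShape n))
  have h2 := dotProduct_asAlgebraHom_permRep (coeff_shapeElt_inv h0 h1 (trivialShape n)) v 1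
  rw [h, hv, hc, zero_smul, dotProduct_zero] at h2
  exact one_ne_zero_of_pos (n := n) h0 (dotProduct_self_eq_zero.1 h2)

end Trivial

/-! ### Codes with at most two words -/

section CodesD

open Matrix

variable {q n d : ℕ}

/-- The empty code. -/
def emptyCode (q n d : ℕ) : codesD q n d :=
  ⟨∅, Nat.zero_le _, fun _ h => absurd h (Finset.notMem_empty _)⟩

theorem smul_emptyCode (g : Wreath q n) : g • emptyCode q n d = emptyCode q n d :=
  Subtype.ext (Finset.smul_finset_empty g)

theorem val_eq_empty_iff {C : codesD q n d} : C.1 = ∅ ↔ C = emptyCode q n d := by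
  rw [Subtype.ext_iff]
  rfl

theorem fullVec_inr {lam : MultiShape n} (u : {_u : Unit // lam = trivialShape n}) :
    fullVec (q := q) (d := d) (.inr u) = Pi.single (emptyCode q n d) 1 := by
  funext C
  simp only [fullVec, Pi.single_apply, val_eq_empty_iff]

theorem pairMatrix_mulVec_emptyCode (v : Word q n × Word q n → ℝ) :
    (pairMatrix (codesD q n d) *ᵥ v) (emptyCode q n d) = 0 :=
  pairMatrix_mulVec_eq_zero _ fun p hp => by
    have : p.1 ∈ (emptyCode q n d).1 := by rw [hp]; simp
    exact absurd this (Finset.notMem_empty _)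

theorem permRep_emptyCode (g : Wreath q n) :
    permRep (Wreath q n) (codesD q n d) g (Pi.single (emptyCode q n d) 1) =
      Pi.single (emptyCode q n d) 1 := by
  funext C
  simp only [permRep_apply, Pi.single_apply, inv_smul_eq_iff, smul_emptyCode]

/-- Two intertwiners to functions on pairs of words separate points: the transpose of `F` sees the
nonempty codes, and the value at the empty code, times the constant function, sees the rest. -/
theorem controls_codesD (h0 : 0 < q) (h1 : 1 < q) :
    Controls (permRep (Wreath q n) (codesD q n d)) (shapeElt h0 h1) := by
  refine (controls_shapeElt h0 h1).of_separating
    (fun b : Bool => if b then (pairMatrix (codesD q n d))ᵀ.mulVecLin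
      else (LinearMap.proj (emptyCode q n d)).smulRight 1) (fun b g v => ?_)
    fun v hv => funext fun C => ?_
  · cases b
    · simp only [Bool.false_eq_true, if_false, LinearMap.smulRight_apply, LinearMap.proj_apply,
        map_smul, permRep_one, permRep_apply, smul_emptyCode]
    · exact mulVec_permRep_of_invariant (fun g p C => pairMatrix_smul (codesD q n d) g C p) g v
  · by_cases hC : C.1 = ∅
    · have := congrFun (hv false) (fun _ => ⟨0, h0⟩, fun _ => ⟨0, h0⟩)
      rw [val_eq_empty_iff.1 hC]
      simpa using this
    · obtain ⟨p, hp⟩ := exists_eq_pair C.2.1 hC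
      rw [← pairMatrix_transpose_mulVec _ v C hp]
      exact congrFun (hv true) p

theorem exists_eq_mulVec_add (h0 : 0 < q) (f : codesD q n d → ℝ) :
    ∃ v, f = pairMatrix (codesD q n d) *ᵥ v + f (emptyCode q n d) • Pi.single (emptyCode q n d) 1 := by
  have h : ∀ C : codesD q n d, C ≠ emptyCode q n d → ∃ p : Word q n × Word q n, C.1 = {p.1, p.2} :=
    fun C hC => exists_eq_pair C.2.1 fun h => hC (val_eq_empty_iff.1 h)
  have : Nonempty (Word q n × Word q n) := ⟨fun _ => ⟨0, h0⟩, fun _ => ⟨0, h0⟩⟩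
  choose! p hp using h
  refine ⟨∑ C, if C = emptyCode q n d then 0 else f C • Pi.single (p C) 1, ?_⟩
  rw [mulVec_sum]
  funext C
  rw [Pi.add_apply, Finset.sum_apply, Finset.sum_eq_single C]
  · split_ifs with hC
    · simp [hC]
    · rw [mulVec_smul, pairMatrix_mulVec_single _ C (hp C hC)]
      simp [hC]
  · intro C' _ hC'
    split_ifs with h
    · simp
    · rw [mulVec_smul, pairMatrix_mulVec_single _ C' (hp C' h)]
      simp [hC'.symm]
  · exact fun h => absurd (Finset.mem_univ _) h

theorem asAlgebraHom_codesD (x : MonoidAlgebra ℝ (Wreath q n)) (v : Word q n × Word q n → ℝ)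
    (c : ℝ) :
    (permRep (Wreath q n) (codesD q n d)).asAlgebraHom x
      (pairMatrix (codesD q n d) *ᵥ v + c • Pi.single (emptyCode q n d) 1) =
    pairMatrix (codesD q n d) *ᵥ ((permRep (Wreath q n) (Word q n × Word q n)).asAlgebraHom x v) +
      (c * ∑ g, x.coeff g) • Pi.single (emptyCode q n d) 1 := by
  rw [map_add, map_smul, asAlgebraHom_of_invariant permRep_emptyCode, smul_smul]
  congr 1
  exact (asAlgebraHom_intertwine (pairMatrix (codesD q n d)).mulVecLin
    (fun g v => mulVec_permRep_of_invariant (pairMatrix_smul _) g v) x v).symm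

theorem span_pairMatrix_codesD (h0 : 0 < q) (h1 : 1 < q) (lam : MultiShape n) :
    Submodule.span ℝ (Set.range fun τ : W'' q d lam =>
      pairMatrix (codesD q n d) *ᵥ pairVec τ.1.1) =
    (LinearMap.range ((permRep (Wreath q n) (Word q n × Word q n)).asAlgebraHom
        (shapeElt h0 h1 lam))).map (pairMatrix (codesD q n d)).mulVecLin := by
  rw [← span_pairVec h0 h1]
  exact span_range_comp_of_zero (pairMatrix (codesD q n d)).mulVecLin
    (fun τ : W q lam => pairVec τ) (fun τ : W'' q d lam => τ.1.1)
    (pairMatrix_mulVec_of_notMem_range (codesD q n d) fun _ hC => hC.2)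

/-- The space is the sum of the image of `F` and the invariant line of the empty code. On this line
the element of `lam` acts by its coefficient sum, which is nonzero only for the trivial shape. -/
theorem span_fullVec (h0 : 0 < q) (h1 : 1 < q) (lam : MultiShape n) :
    Submodule.span ℝ (Set.range fun c : FullCols q d lam => fullVec c) =
      LinearMap.range ((permRep (Wreath q n) (codesD q n d)).asAlgebraHom
        (shapeElt h0 h1 lam)) := by
  have hinl := span_pairMatrix_codesD (d := d) h0 h1 lam
  have hle : Submodule.span ℝ (Set.range fun τ : W'' q d lam =>
      pairMatrix (codesD q n d) *ᵥ pairVec τ.1.1) ≤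
      Submodule.span ℝ (Set.range fun c : FullCols q d lam => fullVec c) :=
    Submodule.span_mono (by rintro _ ⟨τ, rfl⟩; exact ⟨.inl τ, rfl⟩)
  apply le_antisymm
  · rw [Submodule.span_le]
    rintro _ ⟨τ | u, rfl⟩
    · have : pairMatrix (codesD q n d) *ᵥ pairVec τ.1.1 ∈
          Submodule.span ℝ (Set.range fun τ : W'' q d lam =>
            pairMatrix (codesD q n d) *ᵥ pairVec τ.1.1) := Submodule.subset_span ⟨τ, rfl⟩
      rw [hinl] at this
      obtain ⟨_, ⟨v, rfl⟩, hv⟩ := this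
      refine ⟨pairMatrix (codesD q n d) *ᵥ v + (0 : ℝ) • Pi.single (emptyCode q n d) 1, ?_⟩
      rw [asAlgebraHom_codesD, zero_mul, zero_smul, add_zero]
      exact hv
    · simp only [fullVec_inr]
      obtain rfl := u.2
      refine ⟨pairMatrix (codesD q n d) *ᵥ 0 +
        (∑ g, (shapeElt h0 h1 (trivialShape n)).coeff g)⁻¹ • Pi.single (emptyCode q n d) 1, ?_⟩
      rw [asAlgebraHom_codesD, map_zero, mulVec_zero, zero_add,
        inv_mul_cancel₀ (sum_coeff_shapeElt_trivialShape h0 h1), one_smul]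
  · rintro _ ⟨f, rfl⟩
    obtain ⟨v, hv⟩ := exists_eq_mulVec_add h0 f
    rw [hv, asAlgebraHom_codesD]
    refine add_mem (hle ?_) ?_
    · rw [hinl]
      exact ⟨_, ⟨v, rfl⟩, rfl⟩
    · by_cases hlam : lam = trivialShape n
      · refine Submodule.smul_mem _ _ (Submodule.subset_span ⟨.inr ⟨(), hlam⟩, ?_⟩)
        exact fullVec_inr _
      · rw [sum_coeff_shapeElt_of_ne h0 h1 hlam, mul_zero, zero_smul]
        exact zero_mem _

theorem linearIndependent_fullVec (h0 : 0 < q) (h1 : 1 < q) (lam : MultiShape n) :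
    LinearIndependent ℝ fun c : FullCols q d lam => fullVec c := by
  rw [linearIndependent_sum]
  refine ⟨?_, ?_, ?_⟩
  · exact linearIndependent_pairMatrix (codesD q n d) h0 h1 val_val_injective
      (pairVec_mem_supportedPairs (codesD q n d) fun p hp => ⟨Finset.card_le_two, hp⟩)
  · by_cases hlam : lam = trivialShape n
    · have : Unique {_u : Unit // lam = trivialShape n} := 
        ⟨⟨⟨(), hlam⟩⟩, fun _ => Subtype.ext rfl⟩
      refine linearIndependent_unique_iff.2 ?_
      rw [Function.comp_apply, fullVec_inr]
      exact fun h => one_ne_zero ((Pi.single_eq_same _ _).symm.trans (congrFun h _))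
    · have : IsEmpty {_u : Unit // lam = trivialShape n} := ⟨fun u => hlam u.2⟩
      exact linearIndependent_empty_type
  · rw [Submodule.disjoint_def]
    intro f hf hf'
    -- The vectors in the image of `F` vanish at the empty code, whereas its unit vector does not.
    have h2 : f (emptyCode q n d) = 0 := by
      have : Submodule.span ℝ (Set.range ((fun c : FullCols q d lam => fullVec c) ∘ Sum.inl)) ≤
          LinearMap.ker (LinearMap.proj (R := ℝ) (φ := fun _ => ℝ) (emptyCode q n d)) := by
        rw [Submodule.span_le]
        rintro _ ⟨τ, rfl⟩
        exact pairMatrix_mulVec_emptyCode _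
      exact this hf
    have h3 : Submodule.span ℝ (Set.range ((fun c : FullCols q d lam => fullVec c) ∘ Sum.inr)) ≤
        Submodule.span ℝ {Pi.single (emptyCode q n d) 1} := by
      refine Submodule.span_mono ?_
      rintro _ ⟨u, rfl⟩
      exact fullVec_inr u
    obtain ⟨c, rfl⟩ := Submodule.mem_span_singleton.1 (h3 hf')
    simp only [Pi.smul_apply, Pi.single_eq_same, smul_eq_mul, mul_one] at h2
    rw [h2, zero_smul]

/-- The tableau with all entries `1` gives the tensor power of `I`, supported at distance `0`, which
is allowed for every `d`. So the unit vector of the empty code joins a list that is already present.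
-/
theorem nonempty_W''_trivialShape : Nonempty (W'' q d (trivialShape n)) := by
  have h : ∀ i, ∃ τ : SST ((trivialShape n).shape i) (numCols q i), ∀ y, (τ.1 y : ℕ) = 0 := by
    intro i
    by_cases hi : i = 0
    · subst hi
      have hrow : ∀ y : (rowShape n).cells, y.1.1 = 0 := fun y => by
        have h2 : y.1 ∈ ({0} ×ˢ Finset.range n : Finset (ℕ × ℕ)) := y.2
        exact Finset.mem_singleton.1 (Finset.mem_product.1 h2).1
      refine ⟨⟨fun _ => (0 : Fin 2), fun _ _ _ _ => le_rfl, fun y z _ hyz => ?_⟩, fun _ => rfl⟩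
      have hy := hrow y
      have hz := hrow z
      omega
    · have := isEmpty_cells_trivialShape (n := n) i hi
      exact ⟨⟨fun y => isEmptyElim y, fun y => isEmptyElim y, fun y => isEmptyElim y⟩,
        fun y => isEmptyElim y⟩
  choose τ hτ using h
  have hempty : ∀ i, i ≠ 0 → ∀ j, entryCount (τ i).1 j = 0 := fun i hi j => by
    have := isEmpty_cells_trivialShape (n := n) i hi
    rw [entryCount, Finset.univ_eq_empty, Finset.filter_empty, Finset.card_empty]
  have hzero : entryCount (τ 0).1 0 = n := by
    rw [entryCount, Finset.filter_true_of_mem fun y _ => hτ 0 y, Finset.card_univ,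
      Fintype.card_coe]
    change (({0} : Finset ℕ) ×ˢ Finset.range n).card = n
    simp
  refine ⟨⟨⟨τ, ?_⟩, Or.inl ?_⟩⟩
  · rw [skewCount, hempty 1 (by decide), hempty 2 (by decide)]
    exact Even.zero
  · simp only [distCount]
    rw [hzero, hempty 1 (by decide), Nat.sub_self]

theorem nonempty_W''_iff (lam : MultiShape n) :
    Nonempty (W'' q d lam) ↔ Nonempty (FullCols q d lam) := by
  constructor
  · rintro ⟨τ⟩
    exact ⟨.inl τ⟩
  · rintro ⟨τ | u⟩
    · exact ⟨τ⟩
    · obtain rfl := u.2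
      exact nonempty_W''_trivialShape

theorem isRepresentative_codesD (hq : 2 ≤ q) (d : ℕ) :
    IsRepresentative (permRep (Wreath q n) (codesD q n d))
      (fun (lam : {lam : MultiShape n // Nonempty (W'' q d lam)})
        (c : FullCols q d lam.1) => fullVec c) :=
  (controls_codesD (by omega) hq).isRepresentative
    (u := fun lam (c : FullCols q d lam) => fullVec c) (span_fullVec (by omega) hq)
    (linearIndependent_fullVec (by omega) hq) nonempty_W''_iff

theorem blockData_fullMatrix (h0 : 0 < q) (h1 : 1 < q) (d : ℕ) :
    BlockData (G := Wreath q n) (X := codesD q n d) (shapeElt h0 h1)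
      (fun lam => fullMatrix q d lam) where
  controls := controls_codesD h0 h1
  symm := coeff_shapeElt_inv h0 h1
  span := span_fullVec h0 h1
  li := linearIndependent_fullVec h0 h1

theorem isInvariantMatrix_momentMatrixD {x : codes q n 4 → ℝ}
    (hx : ∀ (g : Wreath q n) (C : codes q n 4), x (g • C) = x C) :
    IsInvariantMatrix (Wreath q n) (momentMatrixD d x) := by
  intro g C C'
  simp only [momentMatrixD, submatrix_apply, momentMatrix, of_apply]
  refine Eq.trans (congrArg x (Subtype.ext ?_)) (hx g _)
  simp only [SubMulAction.val_smul, Finset.smul_finset_union]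

/-- A union containing a code of too small distance has too small distance itself. Hence the full
matrix is the extension by zero of the submatrix, written as a congruence with a `0,1` matrix. -/
theorem posSemidef_momentMatrix_iff {x : codes q n 4 → ℝ}
    (hx : ∀ C : codes q n 4, ¬ MinDistGE d C.1 → x C = 0) :
    (momentMatrix x).PosSemidef ↔ (momentMatrixD d x).PosSemidef := by
  refine ⟨fun h => h.submatrix _, fun h => ?_⟩
  let E : Matrix (codesD q n d) (codes q n 2) ℝ := of fun C C' => if C.1 = C'.1 then 1 else 0
  have h2 : momentMatrix x = Eᴴ * momentMatrixD d x * E := by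
    have hmem : ∀ (C : codes q n 2) (h : C.1 ∈ codesD q n d),
        (fun D => E D C) = Pi.single ⟨C.1, h⟩ 1 := fun C h => by
      funext D
      simp only [E, of_apply, Pi.single_apply, Subtype.ext_iff]
    have hnotMem : ∀ C : codes q n 2, C.1 ∉ codesD q n d → (fun D => E D C) = 0 := fun C h => by
      funext D
      refine if_neg fun h' => h ?_
      rw [← h']
      exact D.2
    ext C C'
    have h3 : (Eᴴ * momentMatrixD d x * E) C C' =
        (fun D => E D C) ⬝ᵥ (momentMatrixD d x *ᵥ fun D => E D C') := by
      rw [Matrix.mul_assoc]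
      simp only [mul_apply, dotProduct, mulVec, conjTranspose_apply, star_trivial]
    rw [h3]
    by_cases hC : C.1 ∈ codesD q n d
    · by_cases hC' : C'.1 ∈ codesD q n d
      · rw [hmem C hC, hmem C' hC', mulVec_single_one, single_one_dotProduct]
        rfl
      · rw [hnotMem C' hC', mulVec_zero, dotProduct_zero]
        exact hx _ fun h => hC' ⟨C'.2, fun v hv w hw =>
          h v (Finset.mem_union_right _ hv) w (Finset.mem_union_right _ hw)⟩
    · rw [hnotMem C hC, zero_dotProduct]
      exact hx _ fun h => hC ⟨C.2, fun v hv w hw =>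
        h v (Finset.mem_union_left _ hv) w (Finset.mem_union_left _ hw)⟩
  rw [h2]
  exact h.conjTranspose_mul_mul_same E

end CodesD

/-! ### Counting -/

section Counting

variable {q n : ℕ} {lam : MultiShape n}

theorem numCols_le (q : ℕ) (i : Fin 4) : numCols q i ≤ 3 := by
  fin_cases i <;> simp [numCols] <;> split_ifs <;> norm_num

/-- In a semistandard tableau the entry of a cell is at least its row. -/
theorem row_le_of_isSemistandard {μ : YoungDiagram} {m : ℕ} {τ : Tableau μ m}
    (hτ : IsSemistandard τ) (r c : ℕ) (h : (r, c) ∈ μ.cells) : r ≤ (τ ⟨(r, c), h⟩ : ℕ) := by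
  induction r with
  | zero => exact Nat.zero_le _
  | succ r ih =>
    have h' : (r, c) ∈ μ.cells := μ.up_left_mem (Nat.le_succ r) le_rfl h
    have h2 := hτ.2 ⟨(r, c), h'⟩ ⟨(r + 1, c), h⟩ rfl (Nat.lt_succ_self r)
    exact Nat.succ_le_of_lt ((ih h').trans_lt h2)

theorem row_lt_three (τ : W q lam) (i : Fin 4) (y : (lam.shape i).cells) : y.1.1 < 3 :=
  (row_le_of_isSemistandard (τ i).2 y.1.1 y.1.2 y.2).trans_lt
    (((τ i).1 y).2.trans_le (numCols_le q i))

theorem card_filter_lt (i : Fin 4) (p : (lam.shape i).cells → Prop) [DecidablePred p] :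
    (Finset.univ.filter p).card < n + 1 := by
  have h1 : (Finset.univ.filter p).card ≤ (lam.shape i).card :=
    (Finset.card_le_univ _).trans_eq (Fintype.card_coe _)
  have h2 : (lam.shape i).card ≤ ∑ i, (lam.shape i).card :=
    Finset.single_le_sum (f := fun i => (lam.shape i).card) (fun _ _ => Nat.zero_le _)
      (Finset.mem_univ i)
  rw [lam.sum_card] at h2
  omega

/-- The lengths of the first three rows of the shapes. -/
def rowLengths (lam : MultiShape n) : Fin 4 → Fin 3 → Fin (n + 1) := fun i r =>
  ⟨(lam.shape i).rowLen r, by rw [rowLen_eq_card_filter]; exact card_filter_lt i _⟩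

theorem rowLengths_injective :
    Function.Injective fun lam : {lam : MultiShape n // Nonempty (W q lam)} =>
      rowLengths lam.1 := by
  rintro ⟨lam, ⟨τ⟩⟩ ⟨mu, ⟨σ⟩⟩ h
  refine Subtype.ext (MultiShape.shape_injective (funext fun i => ?_))
  have hz : ∀ {lam : MultiShape n} (τ : W q lam) (r : ℕ), ¬ r < 3 → (lam.shape i).rowLen r = 0 := by
    intro lam τ r hr
    rw [rowLen_eq_card_filter, Finset.card_eq_zero, Finset.filter_eq_empty_iff]
    intro y _ hy
    exact hr (hy ▸ row_lt_three τ i y)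
  refine youngDiagram_ext_rowLen fun r => ?_
  by_cases hr : r < 3
  · exact congrArg Fin.val (congrFun (congrFun h i) ⟨r, hr⟩)
  · rw [hz τ r hr, hz σ r hr]

/-- The numbers of entries `a` in the rows of the tableaux. -/
def rowContents (τ : W q lam) : Fin 4 → Fin 3 → Fin 3 → Fin (n + 1) := fun i r a =>
  ⟨(Finset.univ.filter fun y : (lam.shape i).cells => y.1.1 = r ∧ ((τ i).1 y : ℕ) = a).card,
    card_filter_lt i _⟩

/-- Rows are nondecreasing, so their contents determine them. For four tableaux with three rows and
three values this makes 36 numbers between `0` and `n`. -/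
theorem rowContents_injective : Function.Injective (rowContents : W q lam → _) := by
  intro τ σ h
  funext i
  refine Subtype.ext (RowWeak.eq_of_rowEquiv (σ i).2.1 (τ i).2.1 (rowEquiv_iff_card.2 ?_))
  intro r a
  by_cases hr : r < 3
  · have := congrArg Fin.val
      (congrFun (congrFun (congrFun h i) ⟨r, hr⟩) ⟨a, a.2.trans_le (numCols_le q i)⟩)
    simpa only [rowContents, ← Fin.ext_iff] using this
  · have hz : ∀ τ : W q lam, (Finset.univ.filter fun y : (lam.shape i).cells =>
        y.1.1 = r ∧ (τ i).1 y = a).card = 0 := by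
      intro τ
      rw [Finset.card_eq_zero, Finset.filter_eq_empty_iff]
      intro y _ hy
      exact hr (hy.1 ▸ row_lt_three τ i y)
    rw [hz, hz]

theorem natCast_card_le {α : Type*} [Fintype α] {k : ℕ} (h : Fintype.card α ≤ k) :
    ENat.card α ≤ k := by
  rw [ENat.card_eq_coe_fintype_card]
  exact_mod_cast h

theorem card_nonempty_W_le (q n : ℕ) :
    ENat.card {lam : MultiShape n // Nonempty (W q lam)} ≤ ((n + 1) ^ 36 + 1 : ℕ) := by
  refine (ENat.card_le_card_of_injective rowLengths_injective).trans (natCast_card_le ?_)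
  simp only [Fintype.card_fun, Fintype.card_fin, ← pow_mul]
  exact (Nat.pow_le_pow_right (Nat.succ_pos n) (by norm_num)).trans (Nat.le_succ _)

theorem card_W_le (lam : MultiShape n) : ENat.card (W q lam) ≤ ((n + 1) ^ 36 + 1 : ℕ) := by
  refine (ENat.card_le_card_of_injective rowContents_injective).trans (natCast_card_le ?_)
  simp only [Fintype.card_fun, Fintype.card_fin, ← pow_mul]
  exact (Nat.pow_le_pow_right (Nat.succ_pos n) (by norm_num)).trans (Nat.le_succ _)

theorem card_nonempty_W''_le (q n d : ℕ) :
    ENat.card {lam : MultiShape n // Nonempty (W'' q d lam)} ≤ ((n + 1) ^ 36 + 1 : ℕ) := by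
  refine (ENat.card_le_card_of_injective (f := fun lam : {lam : MultiShape n //
    Nonempty (W'' q d lam)} => (⟨lam.1, lam.2.map fun τ => τ.1.1⟩ :
      {lam : MultiShape n // Nonempty (W q lam)})) fun lam mu h => ?_).trans
    (card_nonempty_W_le q n)
  simp only [Subtype.mk.injEq] at h
  exact Subtype.ext h

theorem card_fullCols_le (d : ℕ) (lam : MultiShape n) :
    ENat.card (FullCols q d lam) ≤ ((n + 1) ^ 36 + 1 : ℕ) := by
  refine (ENat.card_le_card_of_injective (f := Sum.map
    (fun τ : W'' q d lam => rowContents τ.1.1) (fun u : {_u : Unit // lam = trivialShape n} => u.1))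
    (Sum.map_injective.2 ⟨rowContents_injective.comp val_val_injective,
      Subtype.val_injective⟩)).trans (natCast_card_le ?_)
  simp only [Fintype.card_sum, Fintype.card_unit, Fintype.card_fun, Fintype.card_fin, ← pow_mul]
  exact le_rfl

theorem finite_nonempty_W'' (q n d : ℕ) :
    Finite {lam : MultiShape n // Nonempty (W'' q d lam)} :=
  ENat.card_lt_top.1 ((card_nonempty_W''_le q n d).trans_lt (ENat.natCast_lt_top _))

end Counting

end WreathCodes

end

/-! ### The main theorem -/

theorem mainTheorem2 :
    (∀ q n : ℕ, 2 ≤ q →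
      -- ordered pairs of words
      IsRepresentative (tensorRep q n)
        (fun (lam : {lam : MultiShape n // Nonempty (W q lam)})
          (τ : W q lam.1) => tableauVec τ) ∧
      -- symmetric functions on ordered pairs
      (∃ h : ∀ (lam : MultiShape n) (τ : W' q lam),
          pairVec τ.1 ∈ (symmetricPairs q n).toSubmodule,
        IsRepresentative (symmetricPairs q n).toRepresentation
          (fun (lam : {lam : MultiShape n // Nonempty (W' q lam)})
            (τ : W' q lam.1) => ⟨pairVec τ.1, h lam.1 τ⟩)) ∧
      -- unordered pairs
      IsRepresentative
        (permRep (Wreath q n) (pairs q n))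
        (fun (lam : {lam : MultiShape n // Nonempty (W' q lam)})
          (τ : W' q lam.1) =>
            (pairMatrix (pairs q n)).mulVec (pairVec τ.1)) ∧
      ∀ d : ℕ,
        -- unordered pairs at distance at least `d`
        (∀ (lam : MultiShape n) (τ : W'' q d lam) (C : pairs q n), ¬ MinDistGE d C.1 →
          (pairMatrix (pairs q n)).mulVec (pairVec τ.1.1) C = 0) ∧
        IsRepresentative
          (permRep (Wreath q n) (pairsD q n d))
          (fun (lam : {lam : MultiShape n // Nonempty (W'' q d lam)})
            (τ : W'' q d lam.1) =>
              (pairMatrix (pairsD q n d)).mulVec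
                (pairVec τ.1.1)) ∧
        -- with the empty code added
        IsRepresentative
          (permRep (Wreath q n) (codesD q n d))
          (fun (lam : {lam : MultiShape n // Nonempty (W'' q d lam)})
            (c : FullCols q d lam.1) => fullVec c) ∧
        -- block diagonalization of invariant matrices
        Function.Bijective
          (fun (A : {A : Matrix (codesD q n d) (codesD q n d) ℝ //
              IsInvariantMatrix (Wreath q n) A}) =>
            blocks
              (fun lam : {lam : MultiShape n // Nonempty (W'' q d lam)} =>
                fullMatrix q d lam.1) A.1) ∧
        (∀ A : Matrix (codesD q n d) (codesD q n d) ℝ,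
          IsInvariantMatrix (Wreath q n) A →
          (A.PosSemidef ↔
            ∀ lam : {lam : MultiShape n // Nonempty (W'' q d lam)},
              ((fullMatrix q d lam.1).transpose * A *
                fullMatrix q d lam.1).PosSemidef)) ∧
        -- block diagonalization of the constraint that `M(x)` is positive semidefinite
        (∀ x : codes q n 4 → ℝ,
          (∀ (g : Wreath q n) (C : codes q n 4), x (g • C) = x C) →
          (∀ C : codes q n 4, ¬ MinDistGE d C.1 → x C = 0) →
          ((momentMatrix x).PosSemidef ↔
            ∀ lam : {lam : MultiShape n // Nonempty (W'' q d lam)},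
              ((fullMatrix q d lam.1).transpose * momentMatrixD d x *
                fullMatrix q d lam.1).PosSemidef))) ∧
    -- the number and the orders of the blocks are polynomially bounded
    (∃ p : Polynomial ℕ, ∀ q n : ℕ, 2 ≤ q →
      ENat.card {lam : MultiShape n // Nonempty (W q lam)} ≤ p.eval n ∧
      (∀ lam : MultiShape n, ENat.card (W q lam) ≤ p.eval n) ∧
      ∀ d : ℕ,
        ENat.card {lam : MultiShape n // Nonempty (W'' q d lam)}
          ≤ p.eval n ∧
        ∀ lam : MultiShape n,
          ENat.card (FullCols q d lam) ≤ p.eval n) := by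
  -- The exponent `36 = 4 * 3 * 3` counts the row contents of four tableaux and covers the `12` row
  -- lengths of the shapes as well. The summand `1` is for the column of the empty code.
  refine ⟨fun q n hq => ⟨isRepresentative_tableauVec hq,
    ⟨pairVec_mem_symmetricPairs, isRepresentative_symmetricPairs hq⟩,
    isRepresentative_pairs hq, fun d => ?_⟩, (Polynomial.X + 1) ^ 36 + 1, fun q n _ => ?_⟩
  · have h0 : 0 < q := by omega
    have hfin := finite_nonempty_W'' q n d
    have hb := blockData_fullMatrix (n := n) h0 hq d
    have hp : ∀ lam : MultiShape n, Nonempty (W'' q d lam) ↔ Nonempty (FullCols q d lam) :=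
      nonempty_W''_iff
    refine ⟨pairMatrix_mulVec_of_not_minDistGE (pairs q n), isRepresentative_pairsD hq d,
      isRepresentative_codesD hq d, hb.bijective_blocks hp,
      fun A hA => hb.posSemidef_iff hp hA, fun x hx hx0 => ?_⟩
    rw [posSemidef_momentMatrix_iff hx0]
    exact hb.posSemidef_iff hp (isInvariantMatrix_momentMatrixD hx)
  · have heval : ((Polynomial.X + 1) ^ 36 + 1 : Polynomial ℕ).eval n = (n + 1) ^ 36 + 1 := by
      simp
    rw [heval]
    exact ⟨card_nonempty_W_le q n, card_W_le, fun d =>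
      ⟨card_nonempty_W''_le q n d, card_fullCols_le d⟩⟩
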